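/- Let $k$ be a field and $B$ a bialgebra over $k$, with comultiplication $\Delta(b)=b_{(1)}\otimes b_{(2)}$ and counit $\varepsilon$. All tensor products are over $k$. A *twisted antipode* of $B$ is an antipode for $B^{\mathrm{cop}}$, i.e. a $k$-linear map $S\colon B\to B$ with $S(b_{(2)})\,b_{(1)}=\varepsilon(b)1=b_{(2)}\,S(b_{(1)})$ for all $b\in B$. Let ${}^B\mathrm{Vec}$ be the monoidal category of left $B$-comodules (with the diagonal coaction $m\otimes n\mapsto m_{(-1)}n_{(-1)}\otimes m_{(0)}\otimes n_{(0)}$ on tensor products) and ${}^B\mathrm{vecfd}$ its full monoidal subcategory of finite-dimensional comodules. A *Hopf trimodule* is a $B$-$B$-bicomodule $X$ together with a left $B$-action that is a morphism of bicomodules, i.e. $(bx)_{(-1)}\otimes (bx)_{(0)}=b_{(1)}x_{(-1)}\otimes b_{(2)}x_{(0)}$ and $(bx)_{(0)}\otimes (bx)_{(1)}=b_{(1)}x_{(0)}\otimes b_{(2)}x_{(1)}$. Morphisms are the linear maps compatible with both coactions and the action. Hopf trimodules form a monoidal category ${}^B_B\mathrm{Vec}^B$ under the cotensor product $X\mathbin{\square}Y$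 (the left coaction is that of $X$, the right coaction is that of $Y$, the action is diagonal), with unit $B$. Let $$B\otimes -\colon {}^B\mathrm{Vec}\to {}^B_B\mathrm{Vec}^B$$ be the functor that sends $M$ to $B\otimes M$ with left coaction $b\otimes m\mapsto b_{(1)}m_{(-1)}\otimes (b_{(2)}\otimes m_{(0)})$, right coaction $b\otimes m\mapsto (b_{(1)}\otimes m)\otimes b_{(2)}$ and action $a(b\otimes m)=ab\otimes m$. Regard ${}^B\mathrm{Vec}$ as a left module category over itself. A *lax module endofunctor* is a functor $F\colon{}^B\mathrm{Vec}\to{}^B\mathrm{Vec}$ with a coherent natural family $V\otimes F(M)\to F(V\otimes M)$. It is *strong* if these maps are all invertible, *left exact* if it preserves finite limits, and *finitary* if it preserves filtered colimits. With module transformations as morphisms and composition as tensor product, these functors form a monoidal category. Let $\mathrm{Str}$ and $\mathrm{LexLax}$ be its full monoidal subcategories of strong, respectively left exact finitary lax, module endofunctors. For a Hopf trimodule $X$ let $\Sigma(X)$ be the functor $X\mathbin{\square}-$ with the lax structure $$\chi\colon M\otimes (X\mathbin{\square}N)\to X\mathbin{\square}(M\otimes N),\qquad m\otimes (x\otimes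 n)\mapsto m_{(-1)}x\otimes (m_{(0)}\otimes n).$$ **Theorem.** 1. $B$ admits a twisted antipode if and only if the functor $B\otimes -\colon {}^B\mathrm{Vec}\to {}^B_B\mathrm{Vec}^B$ is an equivalence of categories. 2. Each $\Sigma(X)$ is left exact and finitary, and every strong module endofunctor is left exact and finitary; let $\iota\colon\mathrm{Str}\to\mathrm{LexLax}$ be the resulting inclusion. The functor $\Sigma\colon {}^B_B\mathrm{Vec}^B\to\mathrm{LexLax}$ and the evaluation functor $\mathrm{ev}\colon\mathrm{Str}\to({}^B\mathrm{Vec})^{\otimes\mathrm{rev}}$, $F\mapsto F(k)$, are equivalences and carry monoidal structures, and $B\otimes-\colon({}^B\mathrm{Vec})^{\otimes\mathrm{rev}}\to{}^B_B\mathrm{Vec}^B$ carries a monoidal structure, such that $\iota\cong\Sigma\circ(B\otimes-)\circ\mathrm{ev}$ by a monoidal natural isomorphism. (Here $\otimes\mathrm{rev}$ denotes the reversed tensor product.) 3. The inclusion $\iota$ of strong into left exact finitary lax module endofunctors is an equivalence if and only if ${}^B\mathrm{vecfd}$ is left rigid, and this holds if and only if $B$ admits a twisted antipode. Here left rigid means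 that every object $W$ has a left dual: an object $V$ with morphisms $V\otimes W\to\mathbf 1$ and $\mathbf 1\to W\otimes V$ satisfying the two snake identities. -/

import Mathlib

open CategoryTheory MonoidalCategory
open scoped TensorProduct

universe u

namespace HopfTrimod

noncomputable section


/-! ### Lax module endofunctors of a monoidal category -/

section LaxModule

open MonoidalLeftAction Functor Limits

universe v w

variable (C : Type w) [Category.{v} C] [MonoidalCategory C]

/-- Lax `C`-module endofunctors of the regular left `C`-module category `C`. -/
structure LaxModuleEnd where
  functor : C ⥤ C
  [lax : functor.LaxLeftLinear C]

attribute [instance] LaxModuleEnd.lax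

variable {C}

namespace LaxModuleEnd

/-- The structure morphism `V ⊗ F(M) ⟶ F(V ⊗ M)` of a lax module endofunctor. -/
abbrev str (F : LaxModuleEnd C) (V M : C) : V ⊙ₗ F.functor.obj M ⟶ F.functor.obj (V ⊙ₗ M) :=
  LaxLeftLinear.μₗ F.functor V M

/-- Module transformations between lax module endofunctors. -/
@[ext]
structure Hom (F G : LaxModuleEnd C) where
  nat : F.functor ⟶ G.functor
  comm : ∀ V M : C, V ⊴ₗ nat.app M ≫ G.str V M = F.str V M ≫ nat.app (V ⊙ₗ M)

/-- The category of lax `C`-module endofunctors of `C` and module transformations. -/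
instance : Category (LaxModuleEnd C) where
  Hom F G := Hom F G
  id F := ⟨𝟙 _, fun V M => by simp⟩
  comp f g := ⟨f.nat ≫ g.nat, fun V M => by
    rw [NatTrans.comp_app, NatTrans.comp_app, MonoidalLeftAction.actionHomRight_comp,
      Category.assoc, g.comm, ← Category.assoc, f.comm, Category.assoc]⟩

@[ext] lemma hom_ext {F G : LaxModuleEnd C} {f g : F ⟶ G} (h : f.nat = g.nat) : f = g :=
  Hom.ext h

@[simp] lemma id_nat (F : LaxModuleEnd C) : (𝟙 F : F ⟶ F).nat = 𝟙 _ := rfl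

@[simp] lemma comp_nat {F G H : LaxModuleEnd C} (f : F ⟶ G) (g : G ⟶ H) :
    (f ≫ g).nat = f.nat ≫ g.nat := rfl

/-- The identity, as a lax module endofunctor. -/
@[simps] def unit (C : Type w) [Category.{v} C] [MonoidalCategory C] : LaxModuleEnd C where
  functor := 𝟭 C
  lax :=
    { μₗ := fun V M => 𝟙 (V ⊙ₗ M)
      μₗ_naturality_left := fun f d =>
        (Category.comp_id _).trans (Category.id_comp _).symm
      μₗ_naturality_right := fun c _ _ f =>
        (Category.comp_id _).trans (Category.id_comp _).symm
      μₗ_associativity := fun c c' d => by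
        simp only [Functor.id_obj, Functor.id_map, Category.id_comp,
          MonoidalLeftAction.actionHomRight_id, Category.comp_id]
      μₗ_unitality := fun d => by simp only [Functor.id_map, Category.id_comp, Functor.id_obj] }

/-- The composite `F ∘ G` of two lax module endofunctors, with structure morphism
`V ⊗ F(G(M)) ⟶ F(V ⊗ G(M)) ⟶ F(G(V ⊗ M))`. -/
@[simps] def comp (F G : LaxModuleEnd C) : LaxModuleEnd C where
  functor := G.functor ⋙ F.functor
  lax :=
    { μₗ := fun V M => F.str V (G.functor.obj M) ≫ F.functor.map (G.str V M)
      μₗ_naturality_left := fun f d => by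
        simp only [Functor.comp_obj, Functor.comp_map]
        rw [← Category.assoc, LaxLeftLinear.μₗ_naturality_left, Category.assoc,
          ← Functor.map_comp, LaxLeftLinear.μₗ_naturality_left, Functor.map_comp, Category.assoc]
      μₗ_naturality_right := fun c _ _ f => by
        simp only [Functor.comp_obj, Functor.comp_map]
        rw [← Category.assoc, LaxLeftLinear.μₗ_naturality_right, Category.assoc,
          ← Functor.map_comp, LaxLeftLinear.μₗ_naturality_right, Functor.map_comp, Category.assoc]
      μₗ_associativity := fun c c' d => by
        simp only [Functor.comp_obj, Functor.comp_map]
        rw [Category.assoc, ← Functor.map_comp, LaxLeftLinear.μₗ_associativity,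
          Functor.map_comp, Functor.map_comp, ← Category.assoc,
          LaxLeftLinear.μₗ_associativity, MonoidalLeftAction.actionHomRight_comp]
        simp only [Category.assoc]
        rw [← Category.assoc (LaxLeftLinear.μₗ F.functor c _), ←
          LaxLeftLinear.μₗ_naturality_right]
        simp only [Category.assoc]
      μₗ_unitality := fun d => by
        simp only [Functor.comp_obj, Functor.comp_map]
        rw [Category.assoc, ← Functor.map_comp, ← LaxLeftLinear.μₗ_unitality,
          ← LaxLeftLinear.μₗ_unitality] }

lemma str_comp (F G : LaxModuleEnd C) (V M : C) :
    (comp F G).str V M = F.str V (G.functor.obj M) ≫ F.functor.map (G.str V M) := rfl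

lemma str_unit (V M : C) : (unit C).str V M = 𝟙 (V ⊙ₗ M) := rfl

/-- Horizontal composition of module transformations. -/
@[simps] def compMap {F F' G G' : LaxModuleEnd C} (f : F ⟶ F') (g : G ⟶ G') :
    comp F G ⟶ comp F' G' where
  nat := g.nat ◫ f.nat
  comm V M := by
    change V ⊴ₗ (f.nat.app (G.functor.obj M) ≫ F'.functor.map (g.nat.app M)) ≫
        F'.str V (G'.functor.obj M) ≫ F'.functor.map (G'.str V M) =
      (F.str V (G.functor.obj M) ≫ F.functor.map (G.str V M)) ≫
        f.nat.app (G.functor.obj (V ⊙ₗ M)) ≫ F'.functor.map (g.nat.app (V ⊙ₗ M))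
    rw [MonoidalLeftAction.actionHomRight_comp, Category.assoc,
      ← Category.assoc (V ⊴ₗ F'.functor.map _), LaxLeftLinear.μₗ_naturality_right,
      Category.assoc, ← Functor.map_comp, g.comm, Functor.map_comp, ← Category.assoc, f.comm,
      Category.assoc, Category.assoc, f.nat.naturality_assoc]

/-- A natural isomorphism of the underlying functors compatible with the structure morphisms is an
isomorphism of lax module endofunctors. -/
@[simps] def isoMk {F G : LaxModuleEnd C} (e : F.functor ≅ G.functor)
    (h : ∀ V M : C, V ⊴ₗ e.hom.app M ≫ G.str V M = F.str V M ≫ e.hom.app (V ⊙ₗ M)) : F ≅ G where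
  hom := ⟨e.hom, h⟩
  inv := ⟨e.inv, fun V M => by
    rw [← cancel_epi (V ⊴ₗ e.hom.app M), ← Category.assoc,
      ← MonoidalLeftAction.actionHomRight_comp, Iso.hom_inv_id_app,
      MonoidalLeftAction.actionHomRight_id, Category.id_comp, ← Category.assoc, h,
      Category.assoc, Iso.hom_inv_id_app, Category.comp_id]⟩
  hom_inv_id := by ext : 1; exact e.hom_inv_id
  inv_hom_id := by ext : 1; exact e.inv_hom_id

/-- The associator of composition. -/
def assocIso (F G H : LaxModuleEnd C) : comp (comp F G) H ≅ comp F (comp G H) :=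
  isoMk (Functor.associator H.functor G.functor F.functor).symm fun V M => by
    change V ⊴ₗ 𝟙 (F.functor.obj (G.functor.obj (H.functor.obj M))) ≫
      F.str V (G.functor.obj (H.functor.obj M)) ≫
        F.functor.map (G.str V (H.functor.obj M) ≫ G.functor.map (H.str V M)) =
      ((F.str V (G.functor.obj (H.functor.obj M)) ≫ F.functor.map (G.str V (H.functor.obj M))) ≫
        F.functor.map (G.functor.map (H.str V M))) ≫ 𝟙 _
    rw [MonoidalLeftAction.actionHomRight_id, Category.id_comp, Category.comp_id,
      Functor.map_comp, Category.assoc]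

/-- The left unitor of composition. -/
def leftUnitorIso (F : LaxModuleEnd C) : comp (unit C) F ≅ F :=
  isoMk (Functor.rightUnitor F.functor) fun V M => by
    change V ⊴ₗ 𝟙 (F.functor.obj M) ≫ F.str V M = (𝟙 _ ≫ F.str V M) ≫ 𝟙 _
    rw [MonoidalLeftAction.actionHomRight_id, Category.id_comp, Category.comp_id]

/-- The right unitor of composition. -/
def rightUnitorIso (F : LaxModuleEnd C) : comp F (unit C) ≅ F :=
  isoMk (Functor.leftUnitor F.functor) fun V M => by
    change V ⊴ₗ 𝟙 (F.functor.obj M) ≫ F.str V M = (F.str V M ≫ F.functor.map (𝟙 _)) ≫ 𝟙 _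
    rw [MonoidalLeftAction.actionHomRight_id, Category.id_comp, Category.comp_id,
      CategoryTheory.Functor.map_id, Category.comp_id]

instance : MonoidalCategoryStruct (LaxModuleEnd C) where
  tensorObj F G := comp F G
  whiskerLeft F _ _ g := compMap (𝟙 F) g
  whiskerRight f G := compMap f (𝟙 G)
  tensorHom f g := compMap f g
  tensorUnit := unit C
  associator F G H := assocIso F G H
  leftUnitor F := leftUnitorIso F
  rightUnitor F := rightUnitorIso F

/-- Lax module endofunctors form a monoidal category under composition, `F ⊗ G = F ∘ G`. -/
instance : MonoidalCategory (LaxModuleEnd C) :=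
  MonoidalCategory.ofTensorHom
    (id_tensorHom_id := fun F G => hom_ext <| by
      change 𝟙 G.functor ◫ 𝟙 F.functor = 𝟙 (G.functor ⋙ F.functor)
      simp)
    (id_tensorHom := fun F _ _ g => rfl)
    (tensorHom_id := fun f G => rfl)
    (tensorHom_comp_tensorHom := fun f g h i => hom_ext <| by
      change (g.nat ◫ f.nat) ≫ (i.nat ◫ h.nat) = (g.nat ≫ i.nat) ◫ (f.nat ≫ h.nat)
      ext; simp)
    (associator_naturality := fun {F₁ F₂ F₃ G₁ G₂ G₃} f g h => hom_ext <| by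
      change (h.nat ◫ (g.nat ◫ f.nat)) ≫
          (Functor.associator G₃.functor G₂.functor G₁.functor).inv =
        (Functor.associator F₃.functor F₂.functor F₁.functor).inv ≫ ((h.nat ◫ g.nat) ◫ f.nat)
      ext; simp)
    (leftUnitor_naturality := fun {F G} f => hom_ext <| by
      change (f.nat ◫ 𝟙 (𝟭 C)) ≫ (Functor.rightUnitor G.functor).hom =
        (Functor.rightUnitor F.functor).hom ≫ f.nat
      ext; simp)
    (rightUnitor_naturality := fun {F G} f => hom_ext <| by
      change (𝟙 (𝟭 C) ◫ f.nat) ≫ (Functor.leftUnitor G.functor).hom =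
        (Functor.leftUnitor F.functor).hom ≫ f.nat
      ext; simp)
    (pentagon := fun F G H K => hom_ext <| by
      change (𝟙 K.functor ◫ (Functor.associator H.functor G.functor F.functor).inv) ≫
          (Functor.associator K.functor (H.functor ⋙ G.functor) F.functor).inv ≫
          ((Functor.associator K.functor H.functor G.functor).inv ◫ 𝟙 F.functor) =
        (Functor.associator K.functor H.functor (G.functor ⋙ F.functor)).inv ≫
          (Functor.associator (K.functor ⋙ H.functor) G.functor F.functor).inv
      ext; simp)
    (triangle := fun F G => hom_ext <| by
      change (Functor.associator G.functor (𝟭 C) F.functor).inv ≫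
          ((Functor.rightUnitor G.functor).hom ◫ 𝟙 F.functor) =
        (𝟙 G.functor ◫ (Functor.leftUnitor F.functor).hom)
      ext; simp)

/-- A lax module endofunctor is strong if its structure morphisms are invertible. -/
def IsStrong (C : Type w) [Category.{v} C] [MonoidalCategory C] :
    ObjectProperty (LaxModuleEnd C) :=
  fun F => ∀ V M : C, IsIso (F.str V M)

/-- A lax module endofunctor is left exact (it preserves finite limits) and finitary (it preserves
filtered colimits). -/
def IsLexFinitary (C : Type w) [Category.{v} C] [MonoidalCategory C] :
    ObjectProperty (LaxModuleEnd C) :=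
  fun F => PreservesFiniteLimits F.functor ∧ PreservesFilteredColimits F.functor

instance : (IsStrong C).IsMonoidal where
  prop_unit := fun V M => by
    change IsIso (𝟙 (V ⊙ₗ M)); infer_instance
  prop_tensor F G hF hG := fun V M => by
    have := hF V (G.functor.obj M)
    have := hG V M
    change IsIso (F.str V (G.functor.obj M) ≫ F.functor.map (G.str V M))
    infer_instance

instance : (IsLexFinitary C).IsMonoidal where
  prop_unit := by
    constructor
    · change PreservesFiniteLimits (𝟭 C); infer_instance
    · change PreservesFilteredColimits (𝟭 C); infer_instance
  prop_tensor F G hF hG := by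
    obtain ⟨hF₁, hF₂⟩ := hF
    obtain ⟨hG₁, hG₂⟩ := hG
    constructor
    · change PreservesFiniteLimits (G.functor ⋙ F.functor)
      exact comp_preservesFiniteLimits _ _
    · change PreservesFilteredColimits (G.functor ⋙ F.functor)
      exact comp_preservesFilteredColimits _ _

end LaxModuleEnd

open LaxModuleEnd

variable (C)

/-- The monoidal category of strong `C`-module endofunctors of `C`. -/
abbrev StrongModuleEnd := (IsStrong C).FullSubcategory

/-- The monoidal category of left exact, finitary, lax `C`-module endofunctors of `C`. -/
abbrev LexLaxModuleEnd := (IsLexFinitary C).FullSubcategory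

/-- Evaluation `F ↦ F(𝟙)` of strong module endofunctors at the unit object, as a functor to `C` with
the reversed tensor product. -/
@[simps!] def evalUnit : StrongModuleEnd C ⥤ Cᴹᵒᵖ where
  obj F := .mop (F.obj.functor.obj (𝟙_ C))
  map f := (f.hom.nat.app (𝟙_ C)).mop

/-- Every object `W` has a left dual `V`: there are morphisms `V ⊗ W ⟶ 𝟙` and `𝟙 ⟶ W ⊗ V`
satisfying the snake equations. -/
def IsLeftRigid : Prop := ∀ W : C, ∃ V : C, Nonempty (ExactPairing W V)

end LaxModule

section Coactions

variable {k : Type u} [Field k] {B : Type u} [Ring B] [Bialgebra k B]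
variable {V W M N : Type u} [AddCommGroup V] [Module k V] [AddCommGroup W] [Module k W]
  [AddCommGroup M] [Module k M] [AddCommGroup N] [Module k N]

/-- `c : V → B ⊗ V` is a (coassociative, counital) left `B`-coaction. -/
structure IsLeftCoaction (c : V →ₗ[k] B ⊗[k] V) : Prop where
  coassoc : (TensorProduct.assoc k B B V).toLinearMap ∘ₗ
    (Coalgebra.comul (R := k) (A := B)).rTensor V ∘ₗ c = c.lTensor B ∘ₗ c
  counit : (TensorProduct.lid k V).toLinearMap ∘ₗ
    (Coalgebra.counit (R := k) (A := B)).rTensor V ∘ₗ c = LinearMap.id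

/-- `r : V → V ⊗ B` is a (coassociative, counital) right `B`-coaction. -/
structure IsRightCoaction (r : V →ₗ[k] V ⊗[k] B) : Prop where
  coassoc : (TensorProduct.assoc k V B B).toLinearMap ∘ₗ r.rTensor B ∘ₗ r =
    (Coalgebra.comul (R := k) (A := B)).lTensor V ∘ₗ r
  counit : (TensorProduct.rid k V).toLinearMap ∘ₗ
    (Coalgebra.counit (R := k) (A := B)).lTensor V ∘ₗ r = LinearMap.id

lemma IsLeftCoaction.coassoc_apply {c : V →ₗ[k] B ⊗[k] V} (h : IsLeftCoaction c) (v : V) :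
    TensorProduct.assoc k B B V ((Coalgebra.comul (R := k) (A := B)).rTensor V (c v)) =
      c.lTensor B (c v) :=
  LinearMap.congr_fun h.coassoc v

lemma IsLeftCoaction.counit_apply {c : V →ₗ[k] B ⊗[k] V} (h : IsLeftCoaction c) (v : V) :
    TensorProduct.lid k V ((Coalgebra.counit (R := k) (A := B)).rTensor V (c v)) = v :=
  LinearMap.congr_fun h.counit v

lemma IsRightCoaction.coassoc_apply {r : V →ₗ[k] V ⊗[k] B} (h : IsRightCoaction r) (v : V) :
    TensorProduct.assoc k V B B (r.rTensor B (r v)) =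
      (Coalgebra.comul (R := k) (A := B)).lTensor V (r v) :=
  LinearMap.congr_fun h.coassoc v

lemma IsRightCoaction.counit_apply {r : V →ₗ[k] V ⊗[k] B} (h : IsRightCoaction r) (v : V) :
    TensorProduct.rid k V ((Coalgebra.counit (R := k) (A := B)).lTensor V (r v)) = v :=
  LinearMap.congr_fun h.counit v

variable (k B) in
lemma isLeftCoaction_comul : IsLeftCoaction (Coalgebra.comul (R := k) (A := B)) where
  coassoc := Coalgebra.coassoc
  counit := by ext b; simp

variable (k B) in
lemma isRightCoaction_comul : IsRightCoaction (Coalgebra.comul (R := k) (A := B)) where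
  coassoc := Coalgebra.coassoc
  counit := by ext b; simp

/-- The trivial left coaction `v ↦ 1 ⊗ v`. -/
def trivialCoaction (k B V : Type u) [Field k] [Ring B] [Bialgebra k B] [AddCommGroup V]
    [Module k V] : V →ₗ[k] B ⊗[k] V :=
  TensorProduct.mk k B V 1

lemma isLeftCoaction_trivial : IsLeftCoaction (trivialCoaction k B V) where
  coassoc := by ext v; simp [trivialCoaction, Algebra.TensorProduct.one_def]
  counit := by ext v; simp [trivialCoaction]

/-- The diagonal left coaction `m ⊗ n ↦ m₍₋₁₎ n₍₋₁₎ ⊗ (m₍₀₎ ⊗ n₍₀₎)` on a tensor product. -/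
def diagCoaction (c : M →ₗ[k] B ⊗[k] M) (d : N →ₗ[k] B ⊗[k] N) :
    M ⊗[k] N →ₗ[k] B ⊗[k] (M ⊗[k] N) :=
  (LinearMap.mul' k B).rTensor (M ⊗[k] N) ∘ₗ
    (TensorProduct.tensorTensorTensorComm k B M B N).toLinearMap ∘ₗ TensorProduct.map c d

/-- `(b ⊗ b' ⊗ m) ⊗ (c ⊗ c' ⊗ n) ↦ b c ⊗ b' c' ⊗ m ⊗ n`. -/
def mulMul (k B M N : Type u) [Field k] [Ring B] [Bialgebra k B] [AddCommGroup M] [Module k M]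
    [AddCommGroup N] [Module k N] :
    (B ⊗[k] (B ⊗[k] M)) ⊗[k] (B ⊗[k] (B ⊗[k] N)) →ₗ[k] B ⊗[k] (B ⊗[k] (M ⊗[k] N)) :=
  TensorProduct.map (LinearMap.mul' k B)
    ((LinearMap.mul' k B).rTensor (M ⊗[k] N) ∘ₗ
      (TensorProduct.tensorTensorTensorComm k B M B N).toLinearMap) ∘ₗ
    (TensorProduct.tensorTensorTensorComm k B (B ⊗[k] M) B (B ⊗[k] N)).toLinearMap

@[simp] lemma mulMul_tmul (b b' c c' : B) (m : M) (n : N) :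
    mulMul k B M N ((b ⊗ₜ (b' ⊗ₜ m)) ⊗ₜ (c ⊗ₜ (c' ⊗ₜ n))) =
      (b * c) ⊗ₜ ((b' * c') ⊗ₜ (m ⊗ₜ n)) := by
  simp [mulMul]

lemma IsLeftCoaction.diag {c : M →ₗ[k] B ⊗[k] M} {d : N →ₗ[k] B ⊗[k] N}
    (hc : IsLeftCoaction c) (hd : IsLeftCoaction d) : IsLeftCoaction (diagCoaction c d) where
  coassoc := by
    have h1 : ∀ (x : B ⊗[k] M) (y : B ⊗[k] N),
        TensorProduct.assoc k B B (M ⊗[k] N)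
          ((Coalgebra.comul (R := k) (A := B)).rTensor (M ⊗[k] N)
            ((LinearMap.mul' k B).rTensor (M ⊗[k] N)
              (TensorProduct.tensorTensorTensorComm k B M B N (x ⊗ₜ y)))) =
        mulMul k B M N
          (TensorProduct.assoc k B B M ((Coalgebra.comul (R := k) (A := B)).rTensor M x) ⊗ₜ
          TensorProduct.assoc k B B N ((Coalgebra.comul (R := k) (A := B)).rTensor N y)) := by
      intro x y
      induction x with
      | zero => simp
      | add x₁ x₂ h₁ h₂ => simp only [TensorProduct.add_tmul, map_add, h₁, h₂]
      | tmul b m =>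
        induction y with
        | zero => simp
        | add x₁ x₂ h₁ h₂ => simp only [TensorProduct.tmul_add, map_add, h₁, h₂]
        | tmul b' n =>
          simp only [TensorProduct.tensorTensorTensorComm_tmul, LinearMap.rTensor_tmul,
            LinearMap.mul'_apply, Bialgebra.comul_mul]
          generalize Coalgebra.comul (R := k) b = p
          generalize Coalgebra.comul (R := k) b' = q
          induction p with
          | zero => simp
          | add x₁ x₂ h₁ h₂ => simp only [add_mul, TensorProduct.add_tmul, map_add, h₁, h₂]
          | tmul b₁ b₂ =>
            induction q with
            | add x₁ x₂ h₁ h₂ =>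
              simp only [mul_add, TensorProduct.add_tmul, TensorProduct.tmul_add, map_add, h₁, h₂]
            | _ => simp
    have h2 : ∀ (x : B ⊗[k] M) (y : B ⊗[k] N),
        (diagCoaction c d).lTensor B ((LinearMap.mul' k B).rTensor (M ⊗[k] N)
              (TensorProduct.tensorTensorTensorComm k B M B N (x ⊗ₜ y))) =
        mulMul k B M N (c.lTensor B x ⊗ₜ d.lTensor B y) := by
      intro x y
      induction x with
      | zero => simp
      | add x₁ x₂ h₁ h₂ => simp only [TensorProduct.add_tmul, map_add, h₁, h₂]
      | tmul b m =>
        induction y with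
        | add x₁ x₂ h₁ h₂ => simp only [TensorProduct.tmul_add, map_add, h₁, h₂]
        | _ => simp [mulMul, diagCoaction]
    ext m n
    have := h1 (c m) (d n)
    rw [hc.coassoc_apply, hd.coassoc_apply, ← h2] at this
    simpa [diagCoaction] using this
  counit := by
    have h1 : ∀ (x : B ⊗[k] M) (y : B ⊗[k] N),
        TensorProduct.lid k (M ⊗[k] N)
          ((Coalgebra.counit (R := k) (A := B)).rTensor (M ⊗[k] N)
            ((LinearMap.mul' k B).rTensor (M ⊗[k] N)
              (TensorProduct.tensorTensorTensorComm k B M B N (x ⊗ₜ y)))) =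
        TensorProduct.lid k M ((Coalgebra.counit (R := k) (A := B)).rTensor M x) ⊗ₜ
          TensorProduct.lid k N ((Coalgebra.counit (R := k) (A := B)).rTensor N y) := by
      intro x y
      induction x with
      | zero => simp
      | add x₁ x₂ h₁ h₂ => simp only [TensorProduct.add_tmul, map_add, h₁, h₂]
      | tmul b m =>
        induction y with
        | zero => simp
        | add x₁ x₂ h₁ h₂ => simp only [TensorProduct.tmul_add, map_add, h₁, h₂]
        | tmul b' n => 
          simp only [TensorProduct.tensorTensorTensorComm_tmul, LinearMap.rTensor_tmul,
            LinearMap.mul'_apply, Bialgebra.counit_mul, TensorProduct.lid_tmul,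
            TensorProduct.smul_tmul_smul]
    ext m n
    have := h1 (c m) (d n)
    rw [hc.counit_apply, hd.counit_apply] at this
    simpa [diagCoaction] using this

end Coactions

variable (k : Type u) [Field k] (B : Type u) [Ring B] [Bialgebra k B]

/-- A left `B`-comodule (of arbitrary dimension). -/
structure LeftComod where
  carrier : Type u
  [addCommGroup : AddCommGroup carrier]
  [module : Module k carrier]
  coact : carrier →ₗ[k] B ⊗[k] carrier
  isCoaction : IsLeftCoaction coact

attribute [instance] LeftComod.addCommGroup LeftComod.module

variable {k B}

namespace LeftComod

/-- Morphisms of left comodules: linear maps commuting with the coactions. -/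
@[ext]
structure Hom (M N : LeftComod k B) where
  lin : M.carrier →ₗ[k] N.carrier
  comm : N.coact ∘ₗ lin = lin.lTensor B ∘ₗ M.coact

lemma Hom.comm_apply {M N : LeftComod k B} (f : Hom M N) (m : M.carrier) :
    N.coact (f.lin m) = f.lin.lTensor B (M.coact m) :=
  LinearMap.congr_fun f.comm m

/-- The category `ᴮVec` of left `B`-comodules. -/
instance : Category (LeftComod k B) where
  Hom M N := Hom M N
  id M := ⟨LinearMap.id, by ext; simp⟩
  comp f g := ⟨g.lin ∘ₗ f.lin, by
    ext m; simp [g.comm_apply, f.comm_apply, LinearMap.lTensor_comp_apply]⟩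

@[ext] lemma hom_ext {M N : LeftComod k B} {f g : M ⟶ N} (h : f.lin = g.lin) : f = g :=
  Hom.ext h

@[simp] lemma id_lin (M : LeftComod k B) : (𝟙 M : M ⟶ M).lin = LinearMap.id := rfl

@[simp] lemma comp_lin {M N P : LeftComod k B} (f : M ⟶ N) (g : N ⟶ P) :
    (f ≫ g).lin = g.lin ∘ₗ f.lin := rfl

/-- A linear isomorphism commuting with the coactions is an isomorphism of comodules. -/
@[simps] def isoMk {M N : LeftComod k B} (e : M.carrier ≃ₗ[k] N.carrier)
    (h : N.coact ∘ₗ e.toLinearMap = e.toLinearMap.lTensor B ∘ₗ M.coact) : M ≅ N where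
  hom := ⟨e.toLinearMap, h⟩
  inv := ⟨e.symm.toLinearMap, by
    ext n
    obtain ⟨m, rfl⟩ := e.surjective n
    have := LinearMap.congr_fun h m
    simp only [LinearMap.comp_apply, LinearEquiv.coe_coe] at this
    simp only [LinearMap.comp_apply, LinearEquiv.coe_coe, this, LinearEquiv.symm_apply_apply]
    rw [← LinearMap.lTensor_comp_apply]
    simp⟩
  hom_inv_id := by ext; simp
  inv_hom_id := by ext; simp

/-- The forgetful functor to vector spaces. -/
@[simps] def forget (k B : Type u) [Field k] [Ring B] [Bialgebra k B] :
    LeftComod k B ⥤ ModuleCat.{u} k where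
  obj M := ModuleCat.of k M.carrier
  map f := ModuleCat.ofHom f.lin

instance : (forget k B).Faithful where
  map_injective h := hom_ext (congrArg ModuleCat.Hom.hom h)

/-- The tensor product of two comodules, with the diagonal coaction. -/
@[simps] def tensor (M N : LeftComod k B) : LeftComod k B where
  carrier := M.carrier ⊗[k] N.carrier
  coact := diagCoaction M.coact N.coact
  isCoaction := M.isCoaction.diag N.isCoaction

/-- The trivial one-dimensional comodule. -/
@[simps] def unit (k B : Type u) [Field k] [Ring B] [Bialgebra k B] : LeftComod k B where
  carrier := k
  coact := trivialCoaction k B k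
  isCoaction := isLeftCoaction_trivial

/-- The tensor product of two morphisms. -/
def tensorMap {M M' N N' : LeftComod k B} (f : M ⟶ M') (g : N ⟶ N') :
    tensor M N ⟶ tensor M' N' where
  lin := TensorProduct.map f.lin g.lin
  comm := by
    have h : ∀ (x : B ⊗[k] M.carrier) (y : B ⊗[k] N.carrier),
        (LinearMap.mul' k B).rTensor _
          (TensorProduct.tensorTensorTensorComm k B M'.carrier B N'.carrier
            (f.lin.lTensor B x ⊗ₜ g.lin.lTensor B y)) =
        (TensorProduct.map f.lin g.lin).lTensor B ((LinearMap.mul' k B).rTensor _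
          (TensorProduct.tensorTensorTensorComm k B M.carrier B N.carrier (x ⊗ₜ y))) := by
      intro x y
      induction x with
      | zero => simp
      | add x₁ x₂ h₁ h₂ => simp only [TensorProduct.add_tmul, map_add, h₁, h₂]
      | tmul b m =>
        induction y with
        | add x₁ x₂ h₁ h₂ => simp only [TensorProduct.tmul_add, map_add, h₁, h₂]
        | _ => simp
    apply TensorProduct.ext'
    intro m n
    have := h (M.coact m) (N.coact n)
    rw [← f.comm_apply, ← g.comm_apply] at this
    exact this

/-- The associator of vector spaces is a comodule isomorphism. -/
def assocIso (M N P : LeftComod k B) : tensor (tensor M N) P ≅ tensor M (tensor N P) :=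
  isoMk (TensorProduct.assoc k M.carrier N.carrier P.carrier) <| by
    have h : ∀ (x : B ⊗[k] M.carrier) (y : B ⊗[k] N.carrier) (z : B ⊗[k] P.carrier),
        (LinearMap.mul' k B).rTensor _
          (TensorProduct.tensorTensorTensorComm k B M.carrier B (N.carrier ⊗[k] P.carrier)
            (x ⊗ₜ ((LinearMap.mul' k B).rTensor _
              (TensorProduct.tensorTensorTensorComm k B N.carrier B P.carrier (y ⊗ₜ z))))) =
        (TensorProduct.assoc k M.carrier N.carrier P.carrier).toLinearMap.lTensor B
          ((LinearMap.mul' k B).rTensor _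
          (TensorProduct.tensorTensorTensorComm k B (M.carrier ⊗[k] N.carrier) B P.carrier
            (((LinearMap.mul' k B).rTensor _
              (TensorProduct.tensorTensorTensorComm k B M.carrier B N.carrier (x ⊗ₜ y))) ⊗ₜ
                z))) := by
      intro x y z
      induction x with
      | zero => simp
      | add x₁ x₂ h₁ h₂ => simp only [TensorProduct.add_tmul, map_add, h₁, h₂]
      | tmul b m =>
        induction y with
        | zero => simp
        | add x₁ x₂ h₁ h₂ =>
          simp only [TensorProduct.tmul_add, TensorProduct.add_tmul, map_add, h₁, h₂]
        | tmul b' n =>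
          induction z with
          | add x₁ x₂ h₁ h₂ => simp only [TensorProduct.tmul_add, map_add, h₁, h₂]
          | _ => simp [mul_assoc]
    apply TensorProduct.ext_threefold
    intro m n p
    exact h (M.coact m) (N.coact n) (P.coact p)

/-- The left unitor of vector spaces is a comodule isomorphism. -/
def leftUnitorIso (M : LeftComod k B) : tensor (unit k B) M ≅ M :=
  isoMk (TensorProduct.lid k M.carrier) <| by
    have h : ∀ (a : k) (x : B ⊗[k] M.carrier), a • x =
        (TensorProduct.lid k M.carrier).toLinearMap.lTensor B
          ((LinearMap.mul' k B).rTensor _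
          (TensorProduct.tensorTensorTensorComm k B k B M.carrier
            ((1 ⊗ₜ a) ⊗ₜ x))) := by
      intro a x
      induction x with
      | add x₁ x₂ h₁ h₂ => simp only [TensorProduct.tmul_add, map_add, smul_add, h₁, h₂]
      | _ => simp
    apply TensorProduct.ext'
    intro (a : k) m
    exact (map_smul M.coact a m).trans (h a (M.coact m))

/-- The right unitor of vector spaces is a comodule isomorphism. -/
def rightUnitorIso (M : LeftComod k B) : tensor M (unit k B) ≅ M :=
  isoMk (TensorProduct.rid k M.carrier) <| by
    have h : ∀ (a : k) (x : B ⊗[k] M.carrier), a • x =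
        (TensorProduct.rid k M.carrier).toLinearMap.lTensor B
          ((LinearMap.mul' k B).rTensor _
          (TensorProduct.tensorTensorTensorComm k B M.carrier B k
            (x ⊗ₜ (1 ⊗ₜ a)))) := by
      intro a x
      induction x with
      | add x₁ x₂ h₁ h₂ => simp only [TensorProduct.add_tmul, map_add, smul_add, h₁, h₂]
      | _ => simp
    apply TensorProduct.ext'
    intro m (a : k)
    exact (map_smul M.coact a m).trans (h a (M.coact m))

instance : MonoidalCategoryStruct (LeftComod k B) where
  tensorObj M N := tensor M N
  whiskerLeft M _ _ f := tensorMap (𝟙 M) f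
  whiskerRight f N := tensorMap f (𝟙 N)
  tensorHom f g := tensorMap f g
  tensorUnit := unit k B
  associator M N P := assocIso M N P
  leftUnitor M := leftUnitorIso M
  rightUnitor M := rightUnitorIso M

/-- The monoidal category `ᴮVec`: the monoidal structure is the one of vector spaces. -/
instance : MonoidalCategory (LeftComod k B) :=
  Monoidal.induced (forget k B)
    { μIso M N := Iso.refl _
      whiskerLeft_eq := fun X Y₁ Y₂ f => by ext : 1; exact TensorProduct.ext' fun _ _ => rfl
      whiskerRight_eq := fun f Y => by ext : 1; exact TensorProduct.ext' fun _ _ => rfl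
      tensorHom_eq := fun f g => by ext : 1; exact TensorProduct.ext' fun _ _ => rfl
      εIso := Iso.refl _
      associator_eq := fun X Y Z => by
        ext : 1; exact TensorProduct.ext_threefold fun _ _ _ => rfl
      leftUnitor_eq := fun X => by ext : 1; exact TensorProduct.ext' fun _ _ => rfl
      rightUnitor_eq := fun X => by ext : 1; exact TensorProduct.ext' fun _ _ => rfl }

end LeftComod

/-! ### Cotensor products -/

section Cotensor

variable {k : Type u} [Field k] {B : Type u} [Ring B] [Bialgebra k B]
variable {V W X Y M N : Type u} [AddCommGroup V] [Module k V] [AddCommGroup W] [Module k W]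
  [AddCommGroup X] [Module k X] [AddCommGroup Y] [Module k Y]
  [AddCommGroup M] [Module k M] [AddCommGroup N] [Module k N]

lemma lTensor_inj (V : Type u) [AddCommGroup V] [Module k V] {i : M →ₗ[k] N}
    (hi : Function.Injective i) : Function.Injective (i.lTensor V) :=
  Module.Flat.lTensor_preserves_injective_linearMap i hi

lemma rTensor_inj (V : Type u) [AddCommGroup V] [Module k V] {i : M →ₗ[k] N}
    (hi : Function.Injective i) : Function.Injective (i.rTensor V) :=
  Module.Flat.rTensor_preserves_injective_linearMap i hi

lemma IsLeftCoaction.of_injective {c : V →ₗ[k] B ⊗[k] V} {c' : W →ₗ[k] B ⊗[k] W}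
    (hc : IsLeftCoaction c) (i : W →ₗ[k] V) (hi : Function.Injective i)
    (h : ∀ w, c (i w) = i.lTensor B (c' w)) : IsLeftCoaction c' where
  coassoc := by
    ext w
    apply lTensor_inj B (lTensor_inj B hi)
    have e1 : ∀ t : B ⊗[k] W, (i.lTensor B).lTensor B (TensorProduct.assoc k B B W
        ((Coalgebra.comul (R := k) (A := B)).rTensor W t)) =
        TensorProduct.assoc k B B V ((Coalgebra.comul (R := k) (A := B)).rTensor V
          (i.lTensor B t)) := by
      intro t
      induction t with
      | zero => simp
      | add x y hx hy => simp only [map_add, hx, hy]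
      | tmul b w =>
        simp only [LinearMap.rTensor_tmul, LinearMap.lTensor_tmul]
        generalize Coalgebra.comul (R := k) b = p
        induction p with
        | add x y hx hy => simp only [TensorProduct.add_tmul, map_add, hx, hy]
        | _ => simp
    have e2 : ∀ t : B ⊗[k] W, (i.lTensor B).lTensor B (c'.lTensor B t) =
        c.lTensor B (i.lTensor B t) := by
      intro t
      induction t with
      | add x y hx hy => simp only [map_add, hx, hy]
      | _ => simp [h]
    simp only [LinearMap.comp_apply, LinearEquiv.coe_coe]
    rw [e1, e2, ← h, hc.coassoc_apply]
  counit := by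
    ext w
    apply hi
    have e1 : ∀ t : B ⊗[k] W, i (TensorProduct.lid k W
        ((Coalgebra.counit (R := k) (A := B)).rTensor W t)) =
        TensorProduct.lid k V ((Coalgebra.counit (R := k) (A := B)).rTensor V
          (i.lTensor B t)) := by
      intro t
      induction t with
      | add x y hx hy => simp only [map_add, hx, hy]
      | _ => simp
    simp only [LinearMap.comp_apply, LinearEquiv.coe_coe, LinearMap.id_apply]
    rw [e1, ← h, hc.counit_apply]

lemma IsRightCoaction.of_injective {r : V →ₗ[k] V ⊗[k] B} {r' : W →ₗ[k] W ⊗[k] B}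
    (hr : IsRightCoaction r) (i : W →ₗ[k] V) (hi : Function.Injective i)
    (h : ∀ w, r (i w) = i.rTensor B (r' w)) : IsRightCoaction r' where
  coassoc := by
    ext w
    apply rTensor_inj (B ⊗[k] B) hi
    have e1 : ∀ t : W ⊗[k] B, i.rTensor (B ⊗[k] B)
        ((Coalgebra.comul (R := k) (A := B)).lTensor W t) =
        (Coalgebra.comul (R := k) (A := B)).lTensor V (i.rTensor B t) := by
      intro t
      induction t with
      | add x y hx hy => simp only [map_add, hx, hy]
      | _ => simp
    have e2 : ∀ t : W ⊗[k] B, i.rTensor (B ⊗[k] B) (TensorProduct.assoc k W B B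
        (r'.rTensor B t)) = TensorProduct.assoc k V B B (r.rTensor B (i.rTensor B t)) := by
      intro t
      induction t with
      | zero => simp
      | add x y hx hy => simp only [map_add, hx, hy]
      | tmul w b =>
        simp only [LinearMap.rTensor_tmul, h]
        generalize r' w = p
        induction p with
        | add x y hx hy => simp only [TensorProduct.add_tmul, map_add, hx, hy]
        | _ => simp
    simp only [LinearMap.comp_apply, LinearEquiv.coe_coe]
    rw [e1, e2, ← h, hr.coassoc_apply]
  counit := by
    ext w
    apply hi
    have e1 : ∀ t : W ⊗[k] B, i (TensorProduct.rid k W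
        ((Coalgebra.counit (R := k) (A := B)).lTensor W t)) =
        TensorProduct.rid k V ((Coalgebra.counit (R := k) (A := B)).lTensor V
          (i.rTensor B t)) := by
      intro t
      induction t with
      | add x y hx hy => simp only [map_add, hx, hy]
      | _ => simp
    simp only [LinearMap.comp_apply, LinearEquiv.coe_coe, LinearMap.id_apply]
    rw [e1, ← h, hr.counit_apply]

/-- The left coaction `x ⊗ n ↦ x₍₋₁₎ ⊗ (x₍₀₎ ⊗ n)` on `X ⊗ N`. -/
def leftTensor (c : X →ₗ[k] B ⊗[k] X) (N : Type u) [AddCommGroup N] [Module k N] :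
    X ⊗[k] N →ₗ[k] B ⊗[k] (X ⊗[k] N) :=
  (TensorProduct.assoc k B X N).toLinearMap ∘ₗ c.rTensor N

/-- The right coaction `m ⊗ x ↦ (m ⊗ x₍₀₎) ⊗ x₍₁₎` on `M ⊗ X`. -/
def rightTensor (r : X →ₗ[k] X ⊗[k] B) (M : Type u) [AddCommGroup M] [Module k M] :
    M ⊗[k] X →ₗ[k] (M ⊗[k] X) ⊗[k] B :=
  (TensorProduct.assoc k M X B).symm.toLinearMap ∘ₗ r.lTensor M

lemma leftTensor_tmul (c : X →ₗ[k] B ⊗[k] X) (x : X) (n : N) :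
    leftTensor c N (x ⊗ₜ n) = TensorProduct.assoc k B X N (c x ⊗ₜ n) := by
  simp [leftTensor]

lemma rightTensor_tmul (r : X →ₗ[k] X ⊗[k] B) (m : M) (x : X) :
    rightTensor r M (m ⊗ₜ x) = (TensorProduct.assoc k M X B).symm (m ⊗ₜ r x) := by
  simp [rightTensor]

lemma IsLeftCoaction.leftTensor {c : X →ₗ[k] B ⊗[k] X} (hc : IsLeftCoaction c) :
    IsLeftCoaction (leftTensor c N) where
  coassoc := by
    apply TensorProduct.ext'
    intro x n
    have e1 : ∀ t : B ⊗[k] X, TensorProduct.assoc k B B (X ⊗[k] N)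
        ((Coalgebra.comul (R := k) (A := B)).rTensor _ (TensorProduct.assoc k B X N (t ⊗ₜ n))) =
        (TensorProduct.assoc k B X N).toLinearMap.lTensor B (TensorProduct.assoc k B (B ⊗[k] X) N
          (TensorProduct.assoc k B B X
            ((Coalgebra.comul (R := k) (A := B)).rTensor _ t) ⊗ₜ n)) := by
      intro t
      induction t with
      | zero => simp
      | add x y hx hy => simp only [TensorProduct.add_tmul, map_add, hx, hy]
      | tmul b w =>
        simp only [LinearMap.rTensor_tmul, TensorProduct.assoc_tmul]
        generalize Coalgebra.comul (R := k) b = p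
        induction p with
        | add x y hx hy => simp only [TensorProduct.add_tmul, map_add, hx, hy]
        | _ => simp
    have e2 : ∀ t : B ⊗[k] X, (HopfTrimod.leftTensor c N).lTensor B
          (TensorProduct.assoc k B X N (t ⊗ₜ n)) =
        (TensorProduct.assoc k B X N).toLinearMap.lTensor B (TensorProduct.assoc k B (B ⊗[k] X) N
          (c.lTensor B t ⊗ₜ n)) := by
      intro t
      induction t with
      | add x y hx hy => simp only [TensorProduct.add_tmul, map_add, hx, hy]
      | _ => simp [leftTensor_tmul]
    simp only [LinearMap.comp_apply, LinearEquiv.coe_coe]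
    rw [leftTensor_tmul, e1, e2, hc.coassoc_apply]
  counit := by
    apply TensorProduct.ext'
    intro x n
    have e1 : ∀ t : B ⊗[k] X, TensorProduct.lid k (X ⊗[k] N)
        ((Coalgebra.counit (R := k) (A := B)).rTensor _ (TensorProduct.assoc k B X N (t ⊗ₜ n))) =
        TensorProduct.lid k X ((Coalgebra.counit (R := k) (A := B)).rTensor _ t) ⊗ₜ n := by
      intro t
      induction t with
      | add x y hx hy => simp only [TensorProduct.add_tmul, map_add, hx, hy]
      | _ => simp [TensorProduct.smul_tmul']
    simp only [LinearMap.comp_apply, LinearEquiv.coe_coe, LinearMap.id_apply]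
    rw [leftTensor_tmul, e1, hc.counit_apply]

lemma IsRightCoaction.rightTensor {r : X →ₗ[k] X ⊗[k] B} (hr : IsRightCoaction r) :
    IsRightCoaction (rightTensor r M) where
  coassoc := by
    apply TensorProduct.ext'
    intro m x
    have e1 : ∀ t : X ⊗[k] B, (Coalgebra.comul (R := k) (A := B)).lTensor _
          ((TensorProduct.assoc k M X B).symm (m ⊗ₜ t)) =
        (TensorProduct.assoc k M X (B ⊗[k] B)).symm
          (m ⊗ₜ (Coalgebra.comul (R := k) (A := B)).lTensor _ t) := by
      intro t
      induction t with
      | add x y hx hy => simp only [TensorProduct.tmul_add, map_add, hx, hy]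
      | _ => simp
    have e2 : ∀ t : X ⊗[k] B, TensorProduct.assoc k (M ⊗[k] X) B B
          ((HopfTrimod.rightTensor r M).rTensor B ((TensorProduct.assoc k M X B).symm (m ⊗ₜ t))) =
        (TensorProduct.assoc k M X (B ⊗[k] B)).symm
          (m ⊗ₜ TensorProduct.assoc k X B B (r.rTensor B t)) := by
      intro t
      induction t with
      | zero => simp
      | add x y hx hy => simp only [TensorProduct.tmul_add, map_add, hx, hy]
      | tmul x b =>
        simp only [LinearMap.rTensor_tmul, TensorProduct.assoc_symm_tmul, rightTensor_tmul]
        generalize r x = p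
        induction p with
        | add x y hx hy =>
          simp only [TensorProduct.add_tmul, TensorProduct.tmul_add, map_add, hx, hy]
        | _ => simp
    simp only [LinearMap.comp_apply, LinearEquiv.coe_coe]
    rw [rightTensor_tmul, e1, e2, hr.coassoc_apply]
  counit := by
    apply TensorProduct.ext'
    intro m x
    have e1 : ∀ t : X ⊗[k] B, TensorProduct.rid k (M ⊗[k] X)
        ((Coalgebra.counit (R := k) (A := B)).lTensor _
          ((TensorProduct.assoc k M X B).symm (m ⊗ₜ t))) =
        m ⊗ₜ TensorProduct.rid k X ((Coalgebra.counit (R := k) (A := B)).lTensor _ t) := by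
      intro t
      induction t with
      | add x y hx hy => simp only [TensorProduct.tmul_add, map_add, hx, hy]
      | _ => simp
    simp only [LinearMap.comp_apply, LinearEquiv.coe_coe, LinearMap.id_apply]
    rw [rightTensor_tmul, e1, hr.counit_apply]

/-- The cotensor product `X □ N`: the equalizer of `ρ ⊗ N` and `X ⊗ λ`, as a subspace of
`X ⊗ N`. -/
def cotensor (r : X →ₗ[k] X ⊗[k] B) (c : N →ₗ[k] B ⊗[k] N) : Submodule k (X ⊗[k] N) :=
  LinearMap.eqLocus ((TensorProduct.assoc k X B N).toLinearMap ∘ₗ r.rTensor N) (c.lTensor X)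

lemma mem_cotensor {r : X →ₗ[k] X ⊗[k] B} {c : N →ₗ[k] B ⊗[k] N} {t : X ⊗[k] N} :
    t ∈ cotensor r c ↔ TensorProduct.assoc k X B N (r.rTensor N t) = c.lTensor X t :=
  Iff.rfl

lemma mem_range_lTensor_eqLocus (f g : M →ₗ[k] N) (t : V ⊗[k] M) :
    t ∈ LinearMap.range ((LinearMap.eqLocus f g).subtype.lTensor V) ↔
      f.lTensor V t = g.lTensor V t := by
  have h := Module.Flat.lTensor_exact V (LinearMap.exact_subtype_ker_map (f - g))
  rw [← sub_eq_zero, ← LinearMap.sub_apply, ← LinearMap.lTensor_sub]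
  rw [LinearMap.eqLocus_eq_ker_sub]
  exact (h t).symm

lemma mem_range_rTensor_eqLocus (f g : M →ₗ[k] N) (t : M ⊗[k] V) :
    t ∈ LinearMap.range ((LinearMap.eqLocus f g).subtype.rTensor V) ↔
      f.rTensor V t = g.rTensor V t := by
  have h := Module.Flat.rTensor_exact V (LinearMap.exact_subtype_ker_map (f - g))
  rw [← sub_eq_zero, ← LinearMap.sub_apply, ← LinearMap.rTensor_sub]
  rw [LinearMap.eqLocus_eq_ker_sub]
  exact (h t).symm

/-- A left coaction and a right coaction commute: `(B ⊗ ρ) ∘ λ = (λ ⊗ B) ∘ ρ`. -/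
def Bicompatible (c : X →ₗ[k] B ⊗[k] X) (r : X →ₗ[k] X ⊗[k] B) : Prop :=
  r.lTensor B ∘ₗ c = (TensorProduct.assoc k B X B).toLinearMap ∘ₗ c.rTensor B ∘ₗ r

lemma Bicompatible.apply {c : X →ₗ[k] B ⊗[k] X} {r : X →ₗ[k] X ⊗[k] B} (h : Bicompatible c r)
    (x : X) : r.lTensor B (c x) = TensorProduct.assoc k B X B (c.rTensor B (r x)) :=
  LinearMap.congr_fun h x

end Cotensor

section Trimodule

variable {k : Type u} [Field k] {B : Type u} [Ring B] [Bialgebra k B]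
variable {V W X Y M N : Type u} [AddCommGroup V] [Module k V] [AddCommGroup W] [Module k W]
  [AddCommGroup X] [Module k X] [AddCommGroup Y] [Module k Y]
  [AddCommGroup M] [Module k M] [AddCommGroup N] [Module k N]

lemma leftTensor_mem {c : X →ₗ[k] B ⊗[k] X} {r : X →ₗ[k] X ⊗[k] B} (h : Bicompatible c r)
    {d : N →ₗ[k] B ⊗[k] N} (t : X ⊗[k] N) (ht : t ∈ cotensor r d) :
    leftTensor c N t ∈ LinearMap.range ((cotensor r d).subtype.lTensor B) := by
  have e1 : ∀ t : X ⊗[k] N, ((TensorProduct.assoc k X B N).toLinearMap ∘ₗ r.rTensor N).lTensor B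
      (leftTensor c N t) = leftTensor c (B ⊗[k] N)
        (TensorProduct.assoc k X B N (r.rTensor N t)) := by
    intro t
    induction t with
    | zero => simp
    | add x y hx hy => simp only [map_add, hx, hy]
    | tmul x n =>
      have e2 : ∀ s : B ⊗[k] X, ((TensorProduct.assoc k X B N).toLinearMap ∘ₗ
          r.rTensor N).lTensor B (TensorProduct.assoc k B X N (s ⊗ₜ n)) =
          (TensorProduct.assoc k X B N).toLinearMap.lTensor B
            (TensorProduct.assoc k B (X ⊗[k] B) N (r.lTensor B s ⊗ₜ n)) := by
        intro s
        induction s with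
        | add x y hx hy => simp only [TensorProduct.add_tmul, map_add, hx, hy]
        | _ => simp
      have e3 : ∀ s : X ⊗[k] B, leftTensor c (B ⊗[k] N) (TensorProduct.assoc k X B N (s ⊗ₜ n)) =
          (TensorProduct.assoc k X B N).toLinearMap.lTensor B
            (TensorProduct.assoc k B (X ⊗[k] B) N
              (TensorProduct.assoc k B X B (c.rTensor B s) ⊗ₜ n)) := by
        intro s
        induction s with
        | zero => simp
        | add x y hx hy => simp only [TensorProduct.add_tmul, map_add, hx, hy]
        | tmul x b =>
          simp only [LinearMap.rTensor_tmul, TensorProduct.assoc_tmul, leftTensor_tmul]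
          generalize c x = p
          induction p with
          | add x y hx hy => simp only [TensorProduct.add_tmul, map_add, hx, hy]
          | _ => simp
      rw [LinearMap.rTensor_tmul, e3, leftTensor_tmul, e2, h.apply]
  have e2 : ∀ t : X ⊗[k] N, (d.lTensor X).lTensor B (leftTensor c N t) =
      leftTensor c (B ⊗[k] N) (d.lTensor X t) := by
    intro t
    induction t with
    | zero => simp
    | add x y hx hy => simp only [map_add, hx, hy]
    | tmul x n =>
      simp only [LinearMap.lTensor_tmul, leftTensor_tmul]
      generalize c x = p
      induction p with
      | add x y hx hy => simp only [TensorProduct.add_tmul, map_add, hx, hy]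
      | _ => simp
  refine (mem_range_lTensor_eqLocus _ _ _).2 ?_
  rw [e1, e2, mem_cotensor.1 ht]

lemma rightTensor_mem {c : Y →ₗ[k] B ⊗[k] Y} {r : Y →ₗ[k] Y ⊗[k] B} (h : Bicompatible c r)
    {s : X →ₗ[k] X ⊗[k] B} (t : X ⊗[k] Y) (ht : t ∈ cotensor s c) :
    rightTensor r X t ∈ LinearMap.range ((cotensor s c).subtype.rTensor B) := by
  have e1 : ∀ t : X ⊗[k] Y, ((TensorProduct.assoc k X B Y).toLinearMap ∘ₗ s.rTensor Y).rTensor B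
      (rightTensor r X t) = (TensorProduct.assoc k X (B ⊗[k] Y) B).symm
        ((rightTensor r B).lTensor X (TensorProduct.assoc k X B Y (s.rTensor Y t))) := by
    intro t
    induction t with
    | zero => simp
    | add x y hx hy => simp only [map_add, hx, hy]
    | tmul x y =>
      have e4 : ∀ x : X, ∀ p : Y ⊗[k] B,
          ((TensorProduct.assoc k X B Y).toLinearMap ∘ₗ s.rTensor Y).rTensor B
            ((TensorProduct.assoc k X Y B).symm (x ⊗ₜ p)) =
          (TensorProduct.assoc k X (B ⊗[k] Y) B).symm
            ((TensorProduct.assoc k B Y B).symm.toLinearMap.lTensor X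
              (TensorProduct.assoc k X B (Y ⊗[k] B) (s x ⊗ₜ p))) := by
        intro x p
        induction p with
        | zero => simp
        | add x y hx hy => simp only [TensorProduct.tmul_add, map_add, hx, hy]
        | tmul y b =>
          simp only [TensorProduct.assoc_symm_tmul, LinearMap.rTensor_tmul, LinearMap.comp_apply,
            LinearEquiv.coe_coe]
          generalize s x = q
          induction q with
          | add x y hx hy => simp only [TensorProduct.add_tmul, map_add, hx, hy]
          | _ => simp
      have e5 : ∀ q : X ⊗[k] B, (rightTensor r B).lTensor X (TensorProduct.assoc k X B Y (q ⊗ₜ y)) =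
          (TensorProduct.assoc k B Y B).symm.toLinearMap.lTensor X
            (TensorProduct.assoc k X B (Y ⊗[k] B) (q ⊗ₜ r y)) := by
        intro q
        induction q with
        | add x y hx hy => simp only [TensorProduct.add_tmul, map_add, hx, hy]
        | _ => simp [rightTensor_tmul]
      rw [rightTensor_tmul, e4, LinearMap.rTensor_tmul, e5]
  have e2 : ∀ t : X ⊗[k] Y, (c.lTensor X).rTensor B (rightTensor r X t) =
      (TensorProduct.assoc k X (B ⊗[k] Y) B).symm
        ((rightTensor r B).lTensor X (c.lTensor X t)) := by
    intro t
    induction t with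
    | zero => simp
    | add x y hx hy => simp only [map_add, hx, hy]
    | tmul x y =>
      have e3 : ∀ p : Y ⊗[k] B, (c.lTensor X).rTensor B
            ((TensorProduct.assoc k X Y B).symm (x ⊗ₜ p)) =
          (TensorProduct.assoc k X (B ⊗[k] Y) B).symm (x ⊗ₜ c.rTensor B p) := by
        intro p
        induction p with
        | add x y hx hy => simp only [TensorProduct.tmul_add, map_add, hx, hy]
        | _ => simp
      have e4 : ∀ q : B ⊗[k] Y, rightTensor r B q =
          (TensorProduct.assoc k B Y B).symm (r.lTensor B q) := fun q => rfl
      rw [rightTensor_tmul, e3, LinearMap.lTensor_tmul, LinearMap.lTensor_tmul, e4, h.apply,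
        LinearEquiv.symm_apply_apply]
  refine (mem_range_rTensor_eqLocus _ _ _).2 ?_
  rw [e1, e2, mem_cotensor.1 ht]

/-- Restriction of a left coaction to a subspace. -/
def restrictLeft (E : Submodule k V) (c : V →ₗ[k] B ⊗[k] V)
    (h : ∀ v ∈ E, c v ∈ LinearMap.range (E.subtype.lTensor B)) : E →ₗ[k] B ⊗[k] E :=
  LinearMap.codRestrictOfInjective (c ∘ₗ E.subtype) (E.subtype.lTensor B)
    (lTensor_inj B E.injective_subtype) fun v => h v v.2

lemma restrictLeft_apply (E : Submodule k V) (c : V →ₗ[k] B ⊗[k] V)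
    (h : ∀ v ∈ E, c v ∈ LinearMap.range (E.subtype.lTensor B)) (v : E) :
    E.subtype.lTensor B (restrictLeft E c h v) = c v :=
  LinearMap.codRestrictOfInjective_comp_apply _ _ _ _ _

/-- Restriction of a right coaction to a subspace. -/
def restrictRight (E : Submodule k V) (r : V →ₗ[k] V ⊗[k] B)
    (h : ∀ v ∈ E, r v ∈ LinearMap.range (E.subtype.rTensor B)) : E →ₗ[k] E ⊗[k] B :=
  LinearMap.codRestrictOfInjective (r ∘ₗ E.subtype) (E.subtype.rTensor B)
    (rTensor_inj B E.injective_subtype) fun v => h v v.2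

lemma restrictRight_apply (E : Submodule k V) (r : V →ₗ[k] V ⊗[k] B)
    (h : ∀ v ∈ E, r v ∈ LinearMap.range (E.subtype.rTensor B)) (v : E) :
    E.subtype.rTensor B (restrictRight E r h v) = r v :=
  LinearMap.codRestrictOfInjective_comp_apply _ _ _ _ _

lemma IsLeftCoaction.restrict {c : V →ₗ[k] B ⊗[k] V} (hc : IsLeftCoaction c)
    (E : Submodule k V) (h : ∀ v ∈ E, c v ∈ LinearMap.range (E.subtype.lTensor B)) :
    IsLeftCoaction (restrictLeft E c h) :=
  hc.of_injective E.subtype E.injective_subtype fun v => (restrictLeft_apply E c h v).symm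

lemma IsRightCoaction.restrict {r : V →ₗ[k] V ⊗[k] B} (hr : IsRightCoaction r)
    (E : Submodule k V) (h : ∀ v ∈ E, r v ∈ LinearMap.range (E.subtype.rTensor B)) :
    IsRightCoaction (restrictRight E r h) :=
  hr.of_injective E.subtype E.injective_subtype fun v => (restrictRight_apply E r h v).symm

/-- The action of `B ⊗ B` on `V ⊗ W`, given actions of `B` on `V` and `W`. -/
def actionTensor (φ : B →ₐ[k] Module.End k V) (ψ : B →ₐ[k] Module.End k W) :
    B ⊗[k] B →ₐ[k] Module.End k (V ⊗[k] W) :=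
  Module.endTensorEndAlgHom.comp (Algebra.TensorProduct.map φ ψ)

/-- The diagonal action `b (v ⊗ w) = b₍₁₎ v ⊗ b₍₂₎ w` of `B` on `V ⊗ W`, given actions of `B` on `V`
and `W`. -/
def diagAction (φ : B →ₐ[k] Module.End k V) (ψ : B →ₐ[k] Module.End k W) :
    B →ₐ[k] Module.End k (V ⊗[k] W) :=
  (actionTensor φ ψ).comp (Bialgebra.comulAlgHom k B)

@[simp] lemma actionTensor_tmul (φ : B →ₐ[k] Module.End k V) (ψ : B →ₐ[k] Module.End k W)
    (b b' : B) (v : V) (w : W) :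
    actionTensor φ ψ (b ⊗ₜ b') (v ⊗ₜ w) = φ b v ⊗ₜ ψ b' w := rfl

lemma diagAction_apply (φ : B →ₐ[k] Module.End k V) (ψ : B →ₐ[k] Module.End k W) (b : B) :
    diagAction φ ψ b = actionTensor φ ψ (Coalgebra.comul (R := k) b) := rfl

/-- The regular action of `B` on itself by left multiplication. -/
abbrev regular (k B : Type u) [Field k] [Ring B] [Bialgebra k B] : B →ₐ[k] Module.End k B :=
  Algebra.lmul k B

end Trimodule

section Interchange

variable {k : Type u} [Field k] {B : Type u} [Ring B] [Bialgebra k B]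
variable {V W X Y M N : Type u} [AddCommGroup V] [Module k V] [AddCommGroup W] [Module k W]
  [AddCommGroup X] [Module k X] [AddCommGroup Y] [Module k Y]
  [AddCommGroup M] [Module k M] [AddCommGroup N] [Module k N]

lemma restrictLeft_comm {c : V →ₗ[k] B ⊗[k] V} {c' : W →ₗ[k] B ⊗[k] W} (E : Submodule k W)
    (h : ∀ w ∈ E, c' w ∈ LinearMap.range (E.subtype.lTensor B)) (f : V →ₗ[k] E) (v : V)
    (hf : c' (f v) = (E.subtype ∘ₗ f).lTensor B (c v)) :
    restrictLeft E c' h (f v) = f.lTensor B (c v) := by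
  apply lTensor_inj B E.injective_subtype
  rw [restrictLeft_apply, hf, LinearMap.lTensor_comp_apply]

lemma restrictRight_comm {r : V →ₗ[k] V ⊗[k] B} {r' : W →ₗ[k] W ⊗[k] B} (E : Submodule k W)
    (h : ∀ w ∈ E, r' w ∈ LinearMap.range (E.subtype.rTensor B)) (f : V →ₗ[k] E) (v : V)
    (hf : r' (f v) = (E.subtype ∘ₗ f).rTensor B (r v)) :
    restrictRight E r' h (f v) = f.rTensor B (r v) := by
  apply rTensor_inj B E.injective_subtype
  rw [restrictRight_apply, hf, LinearMap.rTensor_comp_apply]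

lemma map_mem_cotensor {r : X →ₗ[k] X ⊗[k] B} {r' : Y →ₗ[k] Y ⊗[k] B}
    {c : M →ₗ[k] B ⊗[k] M} {c' : N →ₗ[k] B ⊗[k] N} (f : X →ₗ[k] Y) (g : M →ₗ[k] N)
    (hf : ∀ x, r' (f x) = f.rTensor B (r x)) (hg : ∀ m, c' (g m) = g.lTensor B (c m))
    (t : X ⊗[k] M) (ht : t ∈ cotensor r c) : TensorProduct.map f g t ∈ cotensor r' c' := by
  have e1 : ∀ t : X ⊗[k] M, TensorProduct.assoc k Y B N
      (r'.rTensor N (TensorProduct.map f g t)) =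
      TensorProduct.map f (g.lTensor B) (TensorProduct.assoc k X B M (r.rTensor M t)) := by
    intro t
    induction t with
    | zero => simp
    | add x y hx hy => simp only [map_add, hx, hy]
    | tmul x m =>
      simp only [TensorProduct.map_tmul, LinearMap.rTensor_tmul, hf]
      generalize r x = q
      induction q with
      | add x y hx hy => simp only [TensorProduct.add_tmul, map_add, hx, hy]
      | _ => simp
  have e2 : ∀ t : X ⊗[k] M, c'.lTensor Y (TensorProduct.map f g t) =
      TensorProduct.map f (g.lTensor B) (c.lTensor X t) := by
    intro t
    induction t with
    | add x y hx hy => simp only [map_add, hx, hy]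
    | _ => simp [hg]
  rw [mem_cotensor, e1, e2, mem_cotensor.1 ht]

/-- The map `f □ g` between cotensor products. -/
def cotensorMap {r : X →ₗ[k] X ⊗[k] B} {r' : Y →ₗ[k] Y ⊗[k] B}
    {c : M →ₗ[k] B ⊗[k] M} {c' : N →ₗ[k] B ⊗[k] N} (f : X →ₗ[k] Y) (g : M →ₗ[k] N)
    (hf : ∀ x, r' (f x) = f.rTensor B (r x)) (hg : ∀ m, c' (g m) = g.lTensor B (c m)) :
    cotensor r c →ₗ[k] cotensor r' c' :=
  (TensorProduct.map f g).restrict (map_mem_cotensor f g hf hg)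

@[simp] lemma cotensorMap_coe {r : X →ₗ[k] X ⊗[k] B} {r' : Y →ₗ[k] Y ⊗[k] B}
    {c : M →ₗ[k] B ⊗[k] M} {c' : N →ₗ[k] B ⊗[k] N} (f : X →ₗ[k] Y) (g : M →ₗ[k] N)
    (hf : ∀ x, r' (f x) = f.rTensor B (r x)) (hg : ∀ m, c' (g m) = g.lTensor B (c m))
    (t : cotensor r c) : (cotensorMap f g hf hg t : Y ⊗[k] N) = TensorProduct.map f g t := rfl

lemma leftTensor_map {c : X →ₗ[k] B ⊗[k] X} {c' : Y →ₗ[k] B ⊗[k] Y} (f : X →ₗ[k] Y)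
    (g : M →ₗ[k] N) (hf : ∀ x, c' (f x) = f.lTensor B (c x)) (t : X ⊗[k] M) :
    leftTensor c' N (TensorProduct.map f g t) =
      (TensorProduct.map f g).lTensor B (leftTensor c M t) := by
  induction t with
  | zero => simp
  | add x y hx hy => simp only [map_add, hx, hy]
  | tmul x m =>
    simp only [TensorProduct.map_tmul, leftTensor_tmul, hf]
    generalize c x = q
    induction q with
    | add x y hx hy => simp only [TensorProduct.add_tmul, map_add, hx, hy]
    | _ => simp

lemma rightTensor_map {r : M →ₗ[k] M ⊗[k] B} {r' : N →ₗ[k] N ⊗[k] B} (f : X →ₗ[k] Y)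
    (g : M →ₗ[k] N) (hg : ∀ x, r' (g x) = g.rTensor B (r x)) (t : X ⊗[k] M) :
    rightTensor r' Y (TensorProduct.map f g t) =
      (TensorProduct.map f g).rTensor B (rightTensor r X t) := by
  induction t with
  | zero => simp
  | add x y hx hy => simp only [map_add, hx, hy]
  | tmul x m =>
    simp only [TensorProduct.map_tmul, rightTensor_tmul, hg]
    generalize r m = q
    induction q with
    | add x y hx hy => simp only [TensorProduct.tmul_add, map_add, hx, hy]
    | _ => simp

/-- An action `B → End(X)` as a linear map `B ⊗ X → X`. -/
def actMap (φ : B →ₐ[k] Module.End k X) : B ⊗[k] X →ₗ[k] X :=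
  TensorProduct.lift φ.toLinearMap

@[simp] lemma actMap_tmul (φ : B →ₐ[k] Module.End k X) (b : B) (x : X) :
    actMap φ (b ⊗ₜ x) = φ b x := rfl

/-- `(b ⊗ m) ⊗ (x ⊗ n) ↦ b x ⊗ (m ⊗ n)`. -/
def interchangeAux (φ : B →ₐ[k] Module.End k X) (M N : Type u) [AddCommGroup M] [Module k M]
    [AddCommGroup N] [Module k N] : (B ⊗[k] M) ⊗[k] (X ⊗[k] N) →ₗ[k] X ⊗[k] (M ⊗[k] N) :=
  (actMap φ).rTensor (M ⊗[k] N) ∘ₗ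
    (TensorProduct.tensorTensorTensorComm k B M X N).toLinearMap

@[simp] lemma interchangeAux_tmul (φ : B →ₐ[k] Module.End k X) (b : B) (m : M) (x : X) (n : N) :
    interchangeAux φ M N ((b ⊗ₜ m) ⊗ₜ (x ⊗ₜ n)) = φ b x ⊗ₜ (m ⊗ₜ n) := by
  simp [interchangeAux]

/-- The interchange map `M ⊗ (X ⊗ N) → X ⊗ (M ⊗ N)`,
`m ⊗ (x ⊗ n) ↦ m₍₋₁₎ x ⊗ (m₍₀₎ ⊗ n)`. -/
def interchangeLin (φ : B →ₐ[k] Module.End k X) (c : M →ₗ[k] B ⊗[k] M) (N : Type u)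
    [AddCommGroup N] [Module k N] : M ⊗[k] (X ⊗[k] N) →ₗ[k] X ⊗[k] (M ⊗[k] N) :=
  interchangeAux φ M N ∘ₗ c.rTensor (X ⊗[k] N)

lemma interchangeLin_tmul (φ : B →ₐ[k] Module.End k X) (c : M →ₗ[k] B ⊗[k] M) (m : M)
    (t : X ⊗[k] N) : interchangeLin φ c N (m ⊗ₜ t) = interchangeAux φ M N (c m ⊗ₜ t) := by
  simp [interchangeLin]

/-- `(b ⊗ (b' ⊗ m)) ⊗ (x ⊗ (c ⊗ n)) ↦ b x ⊗ (b' c ⊗ (m ⊗ n))`. -/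
def interchangeAux₂ (φ : B →ₐ[k] Module.End k X) (M N : Type u) [AddCommGroup M] [Module k M]
    [AddCommGroup N] [Module k N] :
    (B ⊗[k] (B ⊗[k] M)) ⊗[k] (X ⊗[k] (B ⊗[k] N)) →ₗ[k] X ⊗[k] (B ⊗[k] (M ⊗[k] N)) :=
  TensorProduct.map (actMap φ) ((LinearMap.mul' k B).rTensor (M ⊗[k] N) ∘ₗ
      (TensorProduct.tensorTensorTensorComm k B M B N).toLinearMap) ∘ₗ
    (TensorProduct.tensorTensorTensorComm k B (B ⊗[k] M) X (B ⊗[k] N)).toLinearMap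

@[simp] lemma interchangeAux₂_tmul (φ : B →ₐ[k] Module.End k X) (b b' c : B) (m : M) (x : X)
    (n : N) : interchangeAux₂ φ M N ((b ⊗ₜ (b' ⊗ₜ m)) ⊗ₜ (x ⊗ₜ (c ⊗ₜ n))) =
      φ b x ⊗ₜ ((b' * c) ⊗ₜ (m ⊗ₜ n)) := by
  simp [interchangeAux₂]

/-- `(b ⊗ (b' ⊗ m)) ⊗ (c ⊗ (x ⊗ n)) ↦ b c ⊗ (b' x ⊗ (m ⊗ n))`. -/
def interchangeAux₃ (φ : B →ₐ[k] Module.End k X) (M N : Type u) [AddCommGroup M] [Module k M]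
    [AddCommGroup N] [Module k N] :
    (B ⊗[k] (B ⊗[k] M)) ⊗[k] (B ⊗[k] (X ⊗[k] N)) →ₗ[k] B ⊗[k] (X ⊗[k] (M ⊗[k] N)) :=
  TensorProduct.map (LinearMap.mul' k B) (interchangeAux φ M N) ∘ₗ
    (TensorProduct.tensorTensorTensorComm k B (B ⊗[k] M) B (X ⊗[k] N)).toLinearMap

@[simp] lemma interchangeAux₃_tmul (φ : B →ₐ[k] Module.End k X) (b b' c : B) (m : M) (x : X)
    (n : N) : interchangeAux₃ φ M N ((b ⊗ₜ (b' ⊗ₜ m)) ⊗ₜ (c ⊗ₜ (x ⊗ₜ n))) =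
      (b * c) ⊗ₜ (φ b' x ⊗ₜ (m ⊗ₜ n)) := by
  simp [interchangeAux₃]

lemma interchangeLin_mem {φ : B →ₐ[k] Module.End k X} {r : X →ₗ[k] X ⊗[k] B}
    (hr : ∀ b x, r (φ b x) = diagAction φ (regular k B) b (r x))
    {c : M →ₗ[k] B ⊗[k] M} (hc : IsLeftCoaction c) {d : N →ₗ[k] B ⊗[k] N} (m : M)
    (t : X ⊗[k] N) (ht : t ∈ cotensor r d) :
    interchangeLin φ c N (m ⊗ₜ t) ∈ cotensor r (diagCoaction c d) := by
  have e1 : ∀ (p : B ⊗[k] M) (t : X ⊗[k] N),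
      TensorProduct.assoc k X B (M ⊗[k] N) (r.rTensor _ (interchangeAux φ M N (p ⊗ₜ t))) =
      interchangeAux₂ φ M N
        (TensorProduct.assoc k B B M ((Coalgebra.comul (R := k) (A := B)).rTensor M p) ⊗ₜ
        TensorProduct.assoc k X B N (r.rTensor N t)) := by
    intro p t
    induction p with
    | zero => simp
    | add x y hx hy => simp only [map_add, TensorProduct.add_tmul, hx, hy]
    | tmul b m =>
      induction t with
      | zero => simp
      | add x y hx hy => simp only [map_add, TensorProduct.tmul_add, hx, hy]
      | tmul x n =>
        simp only [interchangeAux_tmul, LinearMap.rTensor_tmul, hr, diagAction_apply]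
        generalize Coalgebra.comul (R := k) b = p
        generalize r x = q
        induction p with
        | zero => simp
        | add x y hx hy =>
          simp only [map_add, TensorProduct.add_tmul, hx, hy, LinearMap.add_apply]
        | tmul b₁ b₂ =>
          induction q with
          | add x y hx hy =>
            simp only [map_add, TensorProduct.add_tmul, TensorProduct.tmul_add, hx, hy]
          | _ => simp
  have e2 : ∀ (p : B ⊗[k] M) (t : X ⊗[k] N),
      (diagCoaction c d).lTensor X (interchangeAux φ M N (p ⊗ₜ t)) =
      interchangeAux₂ φ M N (c.lTensor B p ⊗ₜ d.lTensor X t) := by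
    intro p t
    induction p with
    | zero => simp
    | add x y hx hy => simp only [map_add, TensorProduct.add_tmul, hx, hy]
    | tmul b m =>
      induction t with
      | zero => simp
      | add x y hx hy => simp only [map_add, TensorProduct.tmul_add, hx, hy]
      | tmul x n =>
        simp [interchangeAux₂, diagCoaction]
  rw [mem_cotensor, interchangeLin_tmul, e1, e2, mem_cotensor.1 ht, hc.coassoc_apply]

lemma interchangeLin_colinear {φ : B →ₐ[k] Module.End k X} {l : X →ₗ[k] B ⊗[k] X}
    (hl : ∀ b x, l (φ b x) = diagAction (regular k B) φ b (l x))
    {c : M →ₗ[k] B ⊗[k] M} (hc : IsLeftCoaction c) (t : M ⊗[k] (X ⊗[k] N)) :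
    leftTensor l (M ⊗[k] N) (interchangeLin φ c N t) =
      (interchangeLin φ c N).lTensor B (diagCoaction c (leftTensor l N) t) := by
  have e1 : ∀ (p : B ⊗[k] M) (t : X ⊗[k] N),
      leftTensor l (M ⊗[k] N) (interchangeAux φ M N (p ⊗ₜ t)) =
      interchangeAux₃ φ M N
        (TensorProduct.assoc k B B M ((Coalgebra.comul (R := k) (A := B)).rTensor M p) ⊗ₜ
          leftTensor l N t) := by
    intro p t
    induction p with
    | zero => simp
    | add x y hx hy => simp only [map_add, TensorProduct.add_tmul, hx, hy]
    | tmul b m =>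
      induction t with
      | zero => simp
      | add x y hx hy => simp only [map_add, TensorProduct.tmul_add, hx, hy]
      | tmul x n =>
        simp only [interchangeAux_tmul, LinearMap.rTensor_tmul, leftTensor_tmul, hl,
          diagAction_apply]
        generalize Coalgebra.comul (R := k) b = p
        generalize l x = q
        induction p with
        | zero => simp
        | add x y hx hy =>
          simp only [map_add, TensorProduct.add_tmul, hx, hy, LinearMap.add_apply]
        | tmul b₁ b₂ =>
          induction q with
          | add x y hx hy =>
            simp only [map_add, TensorProduct.add_tmul, TensorProduct.tmul_add, hx, hy]
          | _ => simp
  have e2 : ∀ (p : B ⊗[k] M) (t : B ⊗[k] (X ⊗[k] N)),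
      (interchangeLin φ c N).lTensor B ((LinearMap.mul' k B).rTensor _
        (TensorProduct.tensorTensorTensorComm k B M B (X ⊗[k] N) (p ⊗ₜ t))) =
      interchangeAux₃ φ M N (c.lTensor B p ⊗ₜ t) := by
    intro p t
    induction p with
    | zero => simp
    | add x y hx hy => simp only [map_add, TensorProduct.add_tmul, hx, hy]
    | tmul b m =>
      induction t with
      | zero => simp
      | add x y hx hy => simp only [map_add, TensorProduct.tmul_add, hx, hy]
      | tmul x n =>
        simp [interchangeAux₃, interchangeLin]
  induction t with
  | zero => simp
  | add x y hx hy => simp only [map_add, hx, hy]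
  | tmul m t =>
    rw [interchangeLin_tmul, e1, hc.coassoc_apply, ← e2]
    simp [diagCoaction]

lemma interchangeLin_mem' {φ : B →ₐ[k] Module.End k X} {r : X →ₗ[k] X ⊗[k] B}
    (hr : ∀ b x, r (φ b x) = diagAction φ (regular k B) b (r x))
    {c : M →ₗ[k] B ⊗[k] M} (hc : IsLeftCoaction c) (d : N →ₗ[k] B ⊗[k] N)
    (t : M ⊗[k] cotensor r d) :
    interchangeLin φ c N ((cotensor r d).subtype.lTensor M t) ∈
      cotensor r (diagCoaction c d) := by
  induction t with
  | zero => rw [map_zero, map_zero]; exact Submodule.zero_mem _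
  | add x y hx hy => rw [map_add, map_add]; exact Submodule.add_mem _ hx hy
  | tmul m t => rw [LinearMap.lTensor_tmul]; exact interchangeLin_mem hr hc m t.1 t.2

/-- The interchange map `M ⊗ (X □ N) → X □ (M ⊗ N)`. -/
def interchange {φ : B →ₐ[k] Module.End k X} {r : X →ₗ[k] X ⊗[k] B}
    (hr : ∀ b x, r (φ b x) = diagAction φ (regular k B) b (r x))
    {c : M →ₗ[k] B ⊗[k] M} (hc : IsLeftCoaction c) (d : N →ₗ[k] B ⊗[k] N) :
    M ⊗[k] cotensor r d →ₗ[k] cotensor r (diagCoaction c d) :=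
  LinearMap.codRestrict _ (interchangeLin φ c N ∘ₗ (cotensor r d).subtype.lTensor M)
    (interchangeLin_mem' hr hc d)

lemma interchange_coe {φ : B →ₐ[k] Module.End k X} {r : X →ₗ[k] X ⊗[k] B}
    (hr : ∀ b x, r (φ b x) = diagAction φ (regular k B) b (r x))
    {c : M →ₗ[k] B ⊗[k] M} (hc : IsLeftCoaction c) (d : N →ₗ[k] B ⊗[k] N)
    (t : M ⊗[k] cotensor r d) : (interchange hr hc d t : X ⊗[k] (M ⊗[k] N)) =
      interchangeLin φ c N ((cotensor r d).subtype.lTensor M t) := rfl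

lemma cotensorMap_colinear {l : X →ₗ[k] B ⊗[k] X} {l' : Y →ₗ[k] B ⊗[k] Y}
    {r : X →ₗ[k] X ⊗[k] B} {r' : Y →ₗ[k] Y ⊗[k] B}
    (h : Bicompatible l r) (h' : Bicompatible l' r')
    {c : M →ₗ[k] B ⊗[k] M} {c' : N →ₗ[k] B ⊗[k] N} (f : X →ₗ[k] Y) (g : M →ₗ[k] N)
    (hl : ∀ x, l' (f x) = f.lTensor B (l x))
    (hf : ∀ x, r' (f x) = f.rTensor B (r x)) (hg : ∀ m, c' (g m) = g.lTensor B (c m))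
    (t : cotensor r c) :
    restrictLeft (cotensor r' c') (leftTensor l' N) (leftTensor_mem h') (cotensorMap f g hf hg t) =
      (cotensorMap f g hf hg).lTensor B
        (restrictLeft (cotensor r c) (leftTensor l M) (leftTensor_mem h) t) := by
  apply lTensor_inj B (Submodule.injective_subtype _)
  rw [restrictLeft_apply, cotensorMap_coe, leftTensor_map _ _ hl, ← LinearMap.lTensor_comp_apply,
    show (cotensor r' c').subtype ∘ₗ cotensorMap f g hf hg =
      TensorProduct.map f g ∘ₗ (cotensor r c).subtype from rfl,
    LinearMap.lTensor_comp_apply, restrictLeft_apply]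

lemma diagCoaction_lTensor {c : M →ₗ[k] B ⊗[k] M} {d : V →ₗ[k] B ⊗[k] V} {d' : W →ₗ[k] B ⊗[k] W}
    (g : V →ₗ[k] W) (hg : ∀ v, d' (g v) = g.lTensor B (d v)) (t : M ⊗[k] V) :
    diagCoaction c d' (g.lTensor M t) = (g.lTensor M).lTensor B (diagCoaction c d t) := by
  have e : ∀ (p : B ⊗[k] M) (q : B ⊗[k] V),
      (LinearMap.mul' k B).rTensor _ (TensorProduct.tensorTensorTensorComm k B M B W
        (p ⊗ₜ g.lTensor B q)) =
      (g.lTensor M).lTensor B ((LinearMap.mul' k B).rTensor _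
        (TensorProduct.tensorTensorTensorComm k B M B V (p ⊗ₜ q))) := by
    intro p q
    induction p with
    | zero => simp
    | add x y hx hy => simp only [map_add, TensorProduct.add_tmul, hx, hy]
    | tmul b m =>
      induction q with
      | add x y hx hy => simp only [map_add, TensorProduct.tmul_add, hx, hy]
      | _ => simp
  induction t with
  | zero => simp
  | add x y hx hy => simp only [map_add, hx, hy]
  | tmul m v =>
    have := e (c m) (d v)
    rw [← hg] at this
    simpa [diagCoaction] using this

lemma interchange_colinear {φ : B →ₐ[k] Module.End k X} {l : X →ₗ[k] B ⊗[k] X}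
    {r : X →ₗ[k] X ⊗[k] B} (h : Bicompatible l r)
    (hl : ∀ b x, l (φ b x) = diagAction (regular k B) φ b (l x))
    (hr : ∀ b x, r (φ b x) = diagAction φ (regular k B) b (r x))
    {c : M →ₗ[k] B ⊗[k] M} (hc : IsLeftCoaction c) (d : N →ₗ[k] B ⊗[k] N)
    (t : M ⊗[k] cotensor r d) :
    restrictLeft (cotensor r (diagCoaction c d)) (leftTensor l (M ⊗[k] N)) (leftTensor_mem h)
      (interchange hr hc d t) =
    (interchange hr hc d).lTensor B
      (diagCoaction c (restrictLeft (cotensor r d) (leftTensor l N) (leftTensor_mem h)) t) := by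
  apply lTensor_inj B (Submodule.injective_subtype _)
  rw [restrictLeft_apply, interchange_coe, interchangeLin_colinear hl hc,
    ← LinearMap.lTensor_comp_apply,
    show (cotensor r (diagCoaction c d)).subtype ∘ₗ interchange hr hc d =
      interchangeLin φ c N ∘ₗ (cotensor r d).subtype.lTensor M from rfl,
    LinearMap.lTensor_comp_apply,
    diagCoaction_lTensor (c := c) (cotensor r d).subtype
      (fun v => (restrictLeft_apply _ _ (leftTensor_mem h) v).symm)]

end Interchange

variable (k : Type u) [Field k] (B : Type u) [Ring B] [Bialgebra k B]

/-- A Hopf trimodule over `B`: a `B`-`B`-bicomodule with a left `B`-action which is a morphism of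
left and of right comodules, i.e. `(b x)₍₋₁₎ ⊗ (b x)₍₀₎ = b₍₁₎ x₍₋₁₎ ⊗ b₍₂₎ x₍₀₎` and
`(b x)₍₀₎ ⊗ (b x)₍₁₎ = b₍₁₎ x₍₀₎ ⊗ b₍₂₎ x₍₁₎`. -/
structure HopfTrimodule where
  carrier : Type u
  [addCommGroup : AddCommGroup carrier]
  [module : Module k carrier]
  lcoact : carrier →ₗ[k] B ⊗[k] carrier
  rcoact : carrier →ₗ[k] carrier ⊗[k] B
  act : B →ₐ[k] Module.End k carrier
  isLeft : IsLeftCoaction lcoact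
  isRight : IsRightCoaction rcoact
  bicompatible : Bicompatible lcoact rcoact
  lcoact_act : ∀ b x, lcoact (act b x) = diagAction (regular k B) act b (lcoact x)
  rcoact_act : ∀ b x, rcoact (act b x) = diagAction act (regular k B) b (rcoact x)

attribute [instance] HopfTrimodule.addCommGroup HopfTrimodule.module

variable {k B}

namespace HopfTrimodule

/-- Morphisms of Hopf trimodules: linear maps commuting with both coactions and the action. -/
@[ext]
structure Hom (X Y : HopfTrimodule k B) where
  lin : X.carrier →ₗ[k] Y.carrier
  lcomm : ∀ x, Y.lcoact (lin x) = lin.lTensor B (X.lcoact x)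
  rcomm : ∀ x, Y.rcoact (lin x) = lin.rTensor B (X.rcoact x)
  acomm : ∀ b x, lin (X.act b x) = Y.act b (lin x)

/-- The category of Hopf trimodules over `B`. -/
instance : Category (HopfTrimodule k B) where
  Hom X Y := Hom X Y
  id X := ⟨LinearMap.id, by simp, by simp, by simp⟩
  comp f g := ⟨g.lin ∘ₗ f.lin,
    by simp [f.lcomm, g.lcomm, LinearMap.lTensor_comp_apply],
    by simp [f.rcomm, g.rcomm, LinearMap.rTensor_comp_apply],
    by simp [f.acomm, g.acomm]⟩

@[ext] lemma hom_ext {X Y : HopfTrimodule k B} {f g : X ⟶ Y} (h : f.lin = g.lin) : f = g :=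
  Hom.ext h

@[simp] lemma id_lin (X : HopfTrimodule k B) : (𝟙 X : X ⟶ X).lin = LinearMap.id := rfl

@[simp] lemma comp_lin {X Y Z : HopfTrimodule k B} (f : X ⟶ Y) (g : Y ⟶ Z) :
    (f ≫ g).lin = g.lin ∘ₗ f.lin := rfl

/-- A linear isomorphism compatible with coactions and actions is an isomorphism of trimodules. -/
@[simps] def isoMk {X Y : HopfTrimodule k B} (e : X.carrier ≃ₗ[k] Y.carrier)
    (hl : ∀ x, Y.lcoact (e x) = e.toLinearMap.lTensor B (X.lcoact x))
    (hr : ∀ x, Y.rcoact (e x) = e.toLinearMap.rTensor B (X.rcoact x))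
    (ha : ∀ b x, e (X.act b x) = Y.act b (e x)) : X ≅ Y where
  hom := ⟨e.toLinearMap, hl, hr, ha⟩
  inv := ⟨e.symm.toLinearMap,
    fun y => by
      obtain ⟨x, rfl⟩ := e.surjective y
      simp only [LinearEquiv.coe_coe, LinearEquiv.symm_apply_apply]
      rw [hl, ← LinearMap.lTensor_comp_apply]
      simp,
    fun y => by
      obtain ⟨x, rfl⟩ := e.surjective y
      simp only [LinearEquiv.coe_coe, LinearEquiv.symm_apply_apply]
      rw [hr, ← LinearMap.rTensor_comp_apply]
      simp,
    fun b y => by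
      obtain ⟨x, rfl⟩ := e.surjective y
      simp [← ha]⟩
  hom_inv_id := by ext; simp
  inv_hom_id := by ext; simp

/-- The left comodule `X □ N`, with left coaction induced by the one of `X`. -/
@[simps] def cotensorComod (X : HopfTrimodule k B) (N : LeftComod k B) : LeftComod k B where
  carrier := cotensor X.rcoact N.coact
  coact := restrictLeft _ (leftTensor X.lcoact N.carrier) (leftTensor_mem X.bicompatible)
  isCoaction := X.isLeft.leftTensor.restrict _ _

lemma cotensorComod_hom_ext {X : HopfTrimodule k B} {M N : LeftComod k B}
    {f g : M ⟶ X.cotensorComod N}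
    (h : ∀ m, (f.lin m).1 = (g.lin m).1) : f = g :=
  LeftComod.hom_ext (LinearMap.ext fun m => Subtype.ext (h m))

/-- The morphism `f □ g : X □ M ⟶ Y □ N`. -/
@[simps] def cotensorComodMap {X Y : HopfTrimodule k B} {M N : LeftComod k B} (f : X ⟶ Y)
    (g : M ⟶ N) : X.cotensorComod M ⟶ Y.cotensorComod N where
  lin := cotensorMap f.lin g.lin f.rcomm g.comm_apply
  comm := LinearMap.ext fun t =>
    cotensorMap_colinear X.bicompatible Y.bicompatible _ _ f.lcomm f.rcomm g.comm_apply t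

/-- The functor `X □ - : ᴮVec ⥤ ᴮVec`. -/
@[simps] def cotensorFunctor (X : HopfTrimodule k B) : LeftComod k B ⥤ LeftComod k B where
  obj N := X.cotensorComod N
  map g := cotensorComodMap (𝟙 X) g
  map_id N := cotensorComod_hom_ext fun t => by
    change TensorProduct.map LinearMap.id LinearMap.id _ = _
    rw [TensorProduct.map_id]; rfl
  map_comp f g := cotensorComod_hom_ext fun t => by
    change TensorProduct.map LinearMap.id _ _ = TensorProduct.map LinearMap.id _
      (TensorProduct.map LinearMap.id _ _)
    rw [← LinearMap.comp_apply, ← TensorProduct.map_comp]; rfl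

/-- The interchange morphism `χ : M ⊗ (X □ N) ⟶ X □ (M ⊗ N)`,
`m ⊗ x ⊗ n ↦ m₍₋₁₎ x ⊗ m₍₀₎ ⊗ n`. -/
def interchangeHom (X : HopfTrimodule k B) (M N : LeftComod k B) :
    M ⊗ X.cotensorComod N ⟶ X.cotensorComod (M ⊗ N) where
  lin := interchange X.rcoact_act M.isCoaction N.coact
  comm := LinearMap.ext fun t =>
    interchange_colinear X.bicompatible X.lcoact_act X.rcoact_act M.isCoaction N.coact t

end HopfTrimodule

section InterchangeLaws

variable {k : Type u} [Field k] {B : Type u} [Ring B] [Bialgebra k B]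
variable {X Y M M' N N' P : Type u}
  [AddCommGroup X] [Module k X] [AddCommGroup Y] [Module k Y]
  [AddCommGroup M] [Module k M] [AddCommGroup N] [Module k N]
  [AddCommGroup M'] [Module k M'] [AddCommGroup N'] [Module k N'] [AddCommGroup P] [Module k P]

lemma interchangeLin_naturality {φ : B →ₐ[k] Module.End k X} {ψ : B →ₐ[k] Module.End k Y}
    {c : M →ₗ[k] B ⊗[k] M} {c' : M' →ₗ[k] B ⊗[k] M'} (h : X →ₗ[k] Y)
    (hh : ∀ b x, h (φ b x) = ψ b (h x)) (f : M →ₗ[k] M')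
    (hf : ∀ m, c' (f m) = f.lTensor B (c m)) (g : N →ₗ[k] N') (t : M ⊗[k] (X ⊗[k] N)) :
    interchangeLin ψ c' N' (TensorProduct.map f (TensorProduct.map h g) t) =
      TensorProduct.map h (TensorProduct.map f g) (interchangeLin φ c N t) := by
  induction t with
  | zero => simp
  | add x y hx hy => simp only [map_add, hx, hy]
  | tmul m t =>
    rw [TensorProduct.map_tmul, interchangeLin_tmul, interchangeLin_tmul, hf]
    generalize c m = p
    induction p with
    | zero => simp
    | add x y hx hy => simp only [map_add, TensorProduct.add_tmul, hx, hy]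
    | tmul b m =>
      induction t with
      | add x y hx hy => simp only [map_add, TensorProduct.tmul_add, hx, hy]
      | _ => simp [hh]

lemma interchangeLin_assoc (φ : B →ₐ[k] Module.End k X) (c : M →ₗ[k] B ⊗[k] M)
    (d : N →ₗ[k] B ⊗[k] N) (t : (M ⊗[k] N) ⊗[k] (X ⊗[k] P)) :
    (TensorProduct.assoc k M N P).toLinearMap.lTensor X
      (interchangeLin φ (diagCoaction c d) P t) =
    interchangeLin φ c (N ⊗[k] P) ((interchangeLin φ d P).lTensor M
      (TensorProduct.assoc k M N (X ⊗[k] P) t)) := by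
  have e : ∀ (p : B ⊗[k] M) (q : B ⊗[k] N) (t : X ⊗[k] P),
      (TensorProduct.assoc k M N P).toLinearMap.lTensor X
        (interchangeAux φ (M ⊗[k] N) P ((LinearMap.mul' k B).rTensor _
          (TensorProduct.tensorTensorTensorComm k B M B N (p ⊗ₜ q)) ⊗ₜ t)) =
      interchangeAux φ M (N ⊗[k] P) (p ⊗ₜ interchangeAux φ N P (q ⊗ₜ t)) := by
    intro p q t
    induction p with
    | zero => simp
    | add x y hx hy => simp only [map_add, TensorProduct.add_tmul, hx, hy]
    | tmul b m =>
      induction q with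
      | zero => simp
      | add x y hx hy =>
        simp only [map_add, TensorProduct.add_tmul, TensorProduct.tmul_add, hx, hy]
      | tmul b' n =>
        induction t with
        | add x y hx hy => simp only [map_add, TensorProduct.tmul_add, hx, hy]
        | _ => simp
  induction t with
  | zero => simp
  | add x y hx hy => simp only [map_add, hx, hy]
  | tmul s t =>
    induction s with
    | zero => simp
    | add x y hx hy => simp only [map_add, TensorProduct.add_tmul, hx, hy]
    | tmul m n =>
      rw [interchangeLin_tmul, TensorProduct.assoc_tmul, LinearMap.lTensor_tmul,
        interchangeLin_tmul, interchangeLin_tmul, ← e]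
      simp [diagCoaction]

lemma interchangeLin_unit (φ : B →ₐ[k] Module.End k X) (t : k ⊗[k] (X ⊗[k] N)) :
    (TensorProduct.lid k N).toLinearMap.lTensor X
      (interchangeLin φ (trivialCoaction k B k) N t) = TensorProduct.lid k (X ⊗[k] N) t := by
  induction t with
  | zero => simp
  | add x y hx hy => simp only [map_add, hx, hy]
  | tmul a t =>
    induction t with
    | add x y hx hy => simp only [map_add, TensorProduct.tmul_add, hx, hy]
    | _ => simp [interchangeLin_tmul, trivialCoaction]

lemma interchange_naturality {φ : B →ₐ[k] Module.End k X} {ψ : B →ₐ[k] Module.End k Y}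
    {r : X →ₗ[k] X ⊗[k] B} {s : Y →ₗ[k] Y ⊗[k] B}
    (hr : ∀ b x, r (φ b x) = diagAction φ (regular k B) b (r x))
    (hs : ∀ b x, s (ψ b x) = diagAction ψ (regular k B) b (s x))
    {c : M →ₗ[k] B ⊗[k] M} {c' : M' →ₗ[k] B ⊗[k] M'}
    (hc : IsLeftCoaction c) (hc' : IsLeftCoaction c')
    (d : N →ₗ[k] B ⊗[k] N) (d' : N' →ₗ[k] B ⊗[k] N') (h : X →ₗ[k] Y)
    (hh : ∀ b x, h (φ b x) = ψ b (h x)) (f : M →ₗ[k] M')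
    (hf : ∀ m, c' (f m) = f.lTensor B (c m)) (g : N →ₗ[k] N')
    (G : cotensor r d →ₗ[k] cotensor s d')
    (hG : ∀ t, (G t : Y ⊗[k] N') = TensorProduct.map h g t) (t : M ⊗[k] cotensor r d) :
    (interchange hs hc' d' (TensorProduct.map f G t) : Y ⊗[k] (M' ⊗[k] N')) =
      TensorProduct.map h (TensorProduct.map f g) (interchange hr hc d t : X ⊗[k] (M ⊗[k] N)) := by
  have e : (cotensor s d').subtype.lTensor M' (TensorProduct.map f G t) =
      TensorProduct.map f (TensorProduct.map h g) ((cotensor r d).subtype.lTensor M t) := by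
    induction t with
    | add x y hx hy => simp only [map_add, hx, hy]
    | _ => simp [hG]
  rw [interchange_coe, interchange_coe, e, interchangeLin_naturality h hh f hf g]

lemma interchange_assoc {φ : B →ₐ[k] Module.End k X} {r : X →ₗ[k] X ⊗[k] B}
    (hr : ∀ b x, r (φ b x) = diagAction φ (regular k B) b (r x))
    {c : M →ₗ[k] B ⊗[k] M} (hc : IsLeftCoaction c) {d : N →ₗ[k] B ⊗[k] N} (hd : IsLeftCoaction d)
    (e : P →ₗ[k] B ⊗[k] P) (t : (M ⊗[k] N) ⊗[k] cotensor r e) :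
    TensorProduct.map LinearMap.id (TensorProduct.assoc k M N P).toLinearMap
      (interchange hr (hc.diag hd) e t : X ⊗[k] ((M ⊗[k] N) ⊗[k] P)) =
    (interchange hr hc (diagCoaction d e) (TensorProduct.map LinearMap.id (interchange hr hd e)
      (TensorProduct.assoc k M N _ t)) : X ⊗[k] (M ⊗[k] (N ⊗[k] P))) := by
  have e1 : (cotensor r (diagCoaction d e)).subtype.lTensor M
      (TensorProduct.map LinearMap.id (interchange hr hd e) (TensorProduct.assoc k M N _ t)) =
      (interchangeLin φ d P).lTensor M (TensorProduct.assoc k M N (X ⊗[k] P)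
        ((cotensor r e).subtype.lTensor (M ⊗[k] N) t)) := by
    induction t with
    | zero => simp
    | add x y hx hy => simp only [map_add, hx, hy]
    | tmul s t =>
      induction s with
      | add x y hx hy => simp only [map_add, TensorProduct.add_tmul, hx, hy]
      | _ => simp [interchange_coe]
  rw [interchange_coe, interchange_coe, e1]
  exact interchangeLin_assoc _ _ _ _

lemma interchange_unit {φ : B →ₐ[k] Module.End k X} {r : X →ₗ[k] X ⊗[k] B}
    (hr : ∀ b x, r (φ b x) = diagAction φ (regular k B) b (r x))
    (d : N →ₗ[k] B ⊗[k] N) (t : k ⊗[k] cotensor r d) :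
    (TensorProduct.lid k (cotensor r d) t : X ⊗[k] N) =
    TensorProduct.map LinearMap.id (TensorProduct.lid k N).toLinearMap
      (interchange hr isLeftCoaction_trivial d t : X ⊗[k] (k ⊗[k] N)) := by
  have e : TensorProduct.lid k (X ⊗[k] N) ((cotensor r d).subtype.lTensor k t) =
      (TensorProduct.lid k (cotensor r d) t : X ⊗[k] N) := by
    induction t with
    | add x y hx hy => simp only [map_add, hx, hy, Submodule.coe_add]
    | _ => simp
  rw [interchange_coe, ← e]
  exact (interchangeLin_unit _ _).symm

end InterchangeLaws

namespace HopfTrimodule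

variable {k : Type u} [Field k] {B : Type u} [Ring B] [Bialgebra k B]

/-- The lax module functor `(X □ -, χ)` of a Hopf trimodule. -/
def toLaxModuleEnd (X : HopfTrimodule k B) : LaxModuleEnd (LeftComod k B) where
  functor := X.cotensorFunctor
  lax :=
    { μₗ := fun M N => X.interchangeHom M N
      μₗ_naturality_left := fun {M M'} f N => cotensorComod_hom_ext fun t =>
        interchange_naturality X.rcoact_act X.rcoact_act M.isCoaction M'.isCoaction N.coact N.coact
          LinearMap.id (fun _ _ => rfl) f.lin f.comm_apply LinearMap.id LinearMap.id
          (fun _ => by rw [TensorProduct.map_id]; rfl) t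
      μₗ_naturality_right := fun M {N N'} g => cotensorComod_hom_ext fun t =>
        (interchange_naturality X.rcoact_act X.rcoact_act M.isCoaction M.isCoaction N.coact N'.coact
          LinearMap.id (fun _ _ => rfl) LinearMap.id (fun _ => by simp) g.lin
          (cotensorComodMap (𝟙 X) g).lin (fun _ => rfl) t)
      μₗ_associativity := fun M N P => cotensorComod_hom_ext fun t =>
        interchange_assoc X.rcoact_act M.isCoaction N.isCoaction P.coact t
      μₗ_unitality := fun N => cotensorComod_hom_ext fun t =>
        interchange_unit X.rcoact_act N.coact t }

lemma lax_comm {X Y : HopfTrimodule k B} (f : X ⟶ Y) (M N : LeftComod k B) :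
    (M ◁ cotensorComodMap f (𝟙 N)) ≫ Y.interchangeHom M N =
      X.interchangeHom M N ≫ cotensorComodMap f (𝟙 (M ⊗ N)) :=
  cotensorComod_hom_ext fun t => by
    refine (interchange_naturality X.rcoact_act Y.rcoact_act M.isCoaction M.isCoaction N.coact
      N.coact f.lin f.acomm LinearMap.id (fun _ => by simp) LinearMap.id
      (cotensorComodMap f (𝟙 N)).lin (fun _ => rfl) t).trans ?_
    rw [TensorProduct.map_id]
    rfl

lemma cotensorComodMap_comp {X Y Z : HopfTrimodule k B} {M N P : LeftComod k B} (f : X ⟶ Y)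
    (f' : Y ⟶ Z) (g : M ⟶ N) (g' : N ⟶ P) :
    cotensorComodMap (f ≫ f') (g ≫ g') = cotensorComodMap f g ≫ cotensorComodMap f' g' :=
  cotensorComod_hom_ext fun t => by
    change TensorProduct.map (f'.lin ∘ₗ f.lin) (g'.lin ∘ₗ g.lin) _ =
      TensorProduct.map f'.lin g'.lin (TensorProduct.map f.lin g.lin _)
    rw [TensorProduct.map_comp]; rfl

end HopfTrimodule

variable (k : Type u) [Field k] (B : Type u) [Ring B] [Bialgebra k B]

/-- The functor `Σ : X ↦ (X □ -, χ)` from Hopf trimodules to lax module endofunctors of `ᴮVec`. -/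
def cotensorLax : HopfTrimodule k B ⥤ LaxModuleEnd (LeftComod k B) where
  obj X := X.toLaxModuleEnd
  map {X Y} f :=
    { nat :=
        { app := fun N => HopfTrimodule.cotensorComodMap f (𝟙 N)
          naturality := fun M N g => by
            change HopfTrimodule.cotensorComodMap (𝟙 X) g ≫ HopfTrimodule.cotensorComodMap f (𝟙 N) =
              HopfTrimodule.cotensorComodMap f (𝟙 M) ≫ HopfTrimodule.cotensorComodMap (𝟙 Y) g
            rw [← HopfTrimodule.cotensorComodMap_comp, ← HopfTrimodule.cotensorComodMap_comp]
            simp only [Category.id_comp, Category.comp_id] }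
      comm := fun M N => HopfTrimodule.lax_comm f M N }
  map_id X := LaxModuleEnd.hom_ext <| NatTrans.ext <| funext fun N =>
    X.cotensorFunctor.map_id N
  map_comp {X Y Z} f g := LaxModuleEnd.hom_ext <| NatTrans.ext <| funext fun N =>
    (congrArg (HopfTrimodule.cotensorComodMap (f ≫ g)) (Category.id_comp (𝟙 N)).symm).trans
      (HopfTrimodule.cotensorComodMap_comp f g (𝟙 N) (𝟙 N))


/-! ### The functor `B ⊗ -` from comodules to Hopf trimodules -/

section FreeTrimodule

variable {k : Type u} [Field k] {B : Type u} [Ring B] [Bialgebra k B]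
variable {M N : Type u} [AddCommGroup M] [Module k M] [AddCommGroup N] [Module k N]

/-- The right coaction `b ⊗ m ↦ (b₍₁₎ ⊗ m) ⊗ b₍₂₎` on `B ⊗ M`. -/
def freeRight (k B M : Type u) [Field k] [Ring B] [Bialgebra k B] [AddCommGroup M] [Module k M] :
    B ⊗[k] M →ₗ[k] (B ⊗[k] M) ⊗[k] B :=
  (TensorProduct.rightComm k B B M).toLinearMap ∘ₗ
    (Coalgebra.comul (R := k) (A := B)).rTensor M

/-- The left action `a (b ⊗ m) = a b ⊗ m` on `B ⊗ M`. -/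
def freeAct (k B M : Type u) [Field k] [Ring B] [Bialgebra k B] [AddCommGroup M] [Module k M] :
    B →ₐ[k] Module.End k (B ⊗[k] M) :=
  (Module.End.rTensorAlgHom k B M).comp (regular k B)

lemma freeRight_tmul (b : B) (m : M) : freeRight k B M (b ⊗ₜ m) =
    TensorProduct.rightComm k B B M (Coalgebra.comul (R := k) b ⊗ₜ m) := by
  simp [freeRight]

@[simp] lemma freeAct_tmul (a b : B) (m : M) : freeAct k B M a (b ⊗ₜ m) = (a * b) ⊗ₜ m := rfl

lemma isRightCoaction_freeRight : IsRightCoaction (freeRight k B M) where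
  coassoc := by
    apply TensorProduct.ext'
    intro b m
    have e1 : ∀ p : B ⊗[k] B, TensorProduct.assoc k (B ⊗[k] M) B B
        ((freeRight k B M).rTensor B (TensorProduct.rightComm k B B M (p ⊗ₜ m))) =
        ((TensorProduct.mk k B M).flip m).rTensor (B ⊗[k] B) (TensorProduct.assoc k B B B
          ((Coalgebra.comul (R := k) (A := B)).rTensor B p)) := by
      intro p
      induction p with
      | zero => simp
      | add x y hx hy => simp only [map_add, TensorProduct.add_tmul, hx, hy]
      | tmul b b' =>
        simp only [TensorProduct.rightComm_tmul, LinearMap.rTensor_tmul, freeRight_tmul]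
        generalize Coalgebra.comul (R := k) b = p
        induction p with
        | add x y hx hy => simp only [map_add, TensorProduct.add_tmul, hx, hy]
        | _ => simp
    have e2 : ∀ p : B ⊗[k] B, (Coalgebra.comul (R := k) (A := B)).lTensor (B ⊗[k] M)
        (TensorProduct.rightComm k B B M (p ⊗ₜ m)) =
        ((TensorProduct.mk k B M).flip m).rTensor (B ⊗[k] B)
          ((Coalgebra.comul (R := k) (A := B)).lTensor B p) := by
      intro p
      induction p with
      | add x y hx hy => simp only [map_add, TensorProduct.add_tmul, hx, hy]
      | _ => simp
    simp only [LinearMap.comp_apply, LinearEquiv.coe_coe]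
    rw [freeRight_tmul, e1, e2, Coalgebra.coassoc_apply]
  counit := by
    apply TensorProduct.ext'
    intro b m
    have e1 : ∀ p : B ⊗[k] B, TensorProduct.rid k (B ⊗[k] M)
        ((Coalgebra.counit (R := k) (A := B)).lTensor (B ⊗[k] M)
        (TensorProduct.rightComm k B B M (p ⊗ₜ m))) =
        TensorProduct.rid k B ((Coalgebra.counit (R := k) (A := B)).lTensor B p) ⊗ₜ m := by
      intro p
      induction p with
      | add x y hx hy => simp only [map_add, TensorProduct.add_tmul, hx, hy]
      | _ => simp [TensorProduct.smul_tmul']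
    simp only [LinearMap.comp_apply, LinearEquiv.coe_coe, LinearMap.id_apply]
    rw [freeRight_tmul, e1, Coalgebra.lTensor_counit_comul]
    simp

lemma bicompatible_free {c : M →ₗ[k] B ⊗[k] M} :
    Bicompatible (diagCoaction (Coalgebra.comul (R := k) (A := B)) c) (freeRight k B M) := by
  apply TensorProduct.ext'
  intro b m
  have e1 : ∀ (p : B ⊗[k] B) (q : B ⊗[k] M), (freeRight k B M).lTensor B
      ((LinearMap.mul' k B).rTensor _
        (TensorProduct.tensorTensorTensorComm k B B B M (p ⊗ₜ q))) =
      TensorProduct.map (LinearMap.mul' k B) (TensorProduct.rightComm k B B M).toLinearMap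
        (TensorProduct.tensorTensorTensorComm k B (B ⊗[k] B) B M
          ((Coalgebra.comul (R := k) (A := B)).lTensor B p ⊗ₜ q)) := by
    intro p q
    induction p with
    | zero => simp
    | add x y hx hy => simp only [map_add, TensorProduct.add_tmul, hx, hy]
    | tmul b b' =>
      induction q with
      | add x y hx hy => simp only [map_add, TensorProduct.tmul_add, hx, hy]
      | _ => simp [freeRight_tmul]
  have e2 : ∀ (p : B ⊗[k] B), TensorProduct.assoc k B (B ⊗[k] M) B
      ((diagCoaction (Coalgebra.comul (R := k) (A := B)) c).rTensor B
        (TensorProduct.rightComm k B B M (p ⊗ₜ m))) =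
      TensorProduct.map (LinearMap.mul' k B) (TensorProduct.rightComm k B B M).toLinearMap
        (TensorProduct.tensorTensorTensorComm k B (B ⊗[k] B) B M
          (TensorProduct.assoc k B B B
            ((Coalgebra.comul (R := k) (A := B)).rTensor B p) ⊗ₜ c m)) := by
    intro p
    induction p with
    | zero => simp
    | add x y hx hy => simp only [map_add, TensorProduct.add_tmul, hx, hy]
    | tmul b b' =>
      simp only [TensorProduct.rightComm_tmul, LinearMap.rTensor_tmul, diagCoaction,
        LinearMap.comp_apply, LinearEquiv.coe_coe, TensorProduct.map_tmul]
      generalize Coalgebra.comul (R := k) b = p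
      generalize c m = q
      induction p with
      | zero => simp
      | add x y hx hy => simp only [map_add, TensorProduct.add_tmul, hx, hy]
      | tmul b₁ b₂ =>
        induction q with
        | add x y hx hy =>
          simp only [map_add, TensorProduct.add_tmul, TensorProduct.tmul_add, hx, hy]
        | _ => simp
  simp only [LinearMap.comp_apply, LinearEquiv.coe_coe]
  rw [freeRight_tmul, e2, Coalgebra.coassoc_apply, ← e1]
  simp [diagCoaction]

lemma diagCoaction_freeAct (c : M →ₗ[k] B ⊗[k] M) (a : B) (t : B ⊗[k] M) :
    diagCoaction (Coalgebra.comul (R := k) (A := B)) c (freeAct k B M a t) =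
      diagAction (regular k B) (freeAct k B M) a
        (diagCoaction (Coalgebra.comul (R := k) (A := B)) c t) := by
  induction t with
  | zero => simp
  | add x y hx hy => simp only [map_add, hx, hy]
  | tmul b m =>
    simp only [freeAct_tmul, diagCoaction, LinearMap.comp_apply, TensorProduct.map_tmul,
      LinearEquiv.coe_coe, Bialgebra.comul_mul, diagAction_apply]
    generalize Coalgebra.comul (R := k) a = s
    generalize Coalgebra.comul (R := k) b = p
    generalize c m = q
    induction s with
    | zero => simp
    | add x y hx hy =>
      simp only [map_add, add_mul, TensorProduct.add_tmul, hx, hy, LinearMap.add_apply]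
    | tmul a₁ a₂ =>
      induction p with
      | zero => simp
      | add x y hx hy => simp only [map_add, mul_add, TensorProduct.add_tmul, hx, hy]
      | tmul b₁ b₂ =>
        induction q with
        | add x y hx hy => simp only [map_add, TensorProduct.tmul_add, hx, hy]
        | _ => simp [mul_assoc]

lemma freeRight_freeAct (a : B) (t : B ⊗[k] M) :
    freeRight k B M (freeAct k B M a t) =
      diagAction (freeAct k B M) (regular k B) a (freeRight k B M t) := by
  induction t with
  | zero => simp
  | add x y hx hy => simp only [map_add, hx, hy]
  | tmul b m =>
    simp only [freeAct_tmul, freeRight_tmul, Bialgebra.comul_mul, diagAction_apply]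
    generalize Coalgebra.comul (R := k) a = s
    generalize Coalgebra.comul (R := k) b = p
    induction s with
    | zero => simp
    | add x y hx hy =>
      simp only [map_add, add_mul, TensorProduct.add_tmul, hx, hy, LinearMap.add_apply]
    | tmul a₁ a₂ =>
      induction p with
      | add x y hx hy => simp only [map_add, mul_add, TensorProduct.add_tmul, hx, hy]
      | _ => simp

lemma freeRight_lTensor (f : M →ₗ[k] N) (t : B ⊗[k] M) :
    freeRight k B N (f.lTensor B t) = (f.lTensor B).rTensor B (freeRight k B M t) := by
  induction t with
  | zero => simp
  | add x y hx hy => simp only [map_add, hx, hy]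
  | tmul b m =>
    simp only [LinearMap.lTensor_tmul, freeRight_tmul]
    generalize Coalgebra.comul (R := k) b = p
    induction p with
    | add x y hx hy => simp only [map_add, TensorProduct.add_tmul, hx, hy]
    | _ => simp

lemma freeAct_lTensor (f : M →ₗ[k] N) (a : B) (t : B ⊗[k] M) :
    f.lTensor B (freeAct k B M a t) = freeAct k B N a (f.lTensor B t) := by
  induction t with
  | add x y hx hy => simp only [map_add, hx, hy]
  | _ => simp

end FreeTrimodule

section

variable (k : Type u) [Field k] (B : Type u) [Ring B] [Bialgebra k B]

/-- The Hopf trimodule `B ⊗ M` of a left comodule `M`: the left coaction is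
`b ⊗ m ↦ b₍₁₎ m₍₋₁₎ ⊗ (b₍₂₎ ⊗ m₍₀₎)`, the right coaction is `b ⊗ m ↦ (b₍₁₎ ⊗ m) ⊗ b₍₂₎` and the
action is `a (b ⊗ m) = a b ⊗ m`. -/
@[simps] def freeTrimodule (M : LeftComod k B) : HopfTrimodule k B where
  carrier := B ⊗[k] M.carrier
  lcoact := diagCoaction (Coalgebra.comul (R := k) (A := B)) M.coact
  rcoact := freeRight k B M.carrier
  act := freeAct k B M.carrier
  isLeft := (isLeftCoaction_comul k B).diag M.isCoaction
  isRight := isRightCoaction_freeRight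
  bicompatible := bicompatible_free
  lcoact_act := diagCoaction_freeAct M.coact
  rcoact_act := freeRight_freeAct

/-- The functor `B ⊗ -` from left comodules to Hopf trimodules. -/
@[simps] def freeFunctor : LeftComod k B ⥤ HopfTrimodule k B where
  obj M := freeTrimodule k B M
  map f :=
    { lin := f.lin.lTensor B
      lcomm := diagCoaction_lTensor f.lin f.comm_apply
      rcomm := freeRight_lTensor f.lin
      acomm := freeAct_lTensor f.lin }
  map_id M := HopfTrimodule.hom_ext (LinearMap.lTensor_id B M.carrier)
  map_comp f g := HopfTrimodule.hom_ext (LinearMap.lTensor_comp B g.lin f.lin)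

/-- A twisted antipode for `B`: an antipode for the bialgebra `Bᶜᵒᵖ`, i.e. a linear map `S` with
`S(b₍₂₎) b₍₁₎ = ε(b) 1 = b₍₂₎ S(b₍₁₎)` for all `b`. -/
def IsTwistedAntipode (S : B →ₗ[k] B) : Prop :=
  LinearMap.mul' k B ∘ₗ S.rTensor B ∘ₗ (TensorProduct.comm k B B).toLinearMap ∘ₗ
      Coalgebra.comul = Algebra.linearMap k B ∘ₗ Coalgebra.counit ∧
  LinearMap.mul' k B ∘ₗ S.lTensor B ∘ₗ (TensorProduct.comm k B B).toLinearMap ∘ₗ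
      Coalgebra.comul = Algebra.linearMap k B ∘ₗ Coalgebra.counit

/-- `B` admits a twisted antipode. -/
def HasTwistedAntipode : Prop := ∃ S : B →ₗ[k] B, IsTwistedAntipode k B S

/-- Finite-dimensional comodules. -/
def IsFinDim : ObjectProperty (LeftComod k B) := fun M => FiniteDimensional k M.carrier

instance : (IsFinDim k B).IsMonoidal where
  prop_unit := by change FiniteDimensional k k; infer_instance
  prop_tensor M N hM hN := by
    have : FiniteDimensional k M.carrier := hM
    have : FiniteDimensional k N.carrier := hN
    change FiniteDimensional k (M.carrier ⊗[k] N.carrier)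
    infer_instance

/-- The monoidal category `ᴮvecfd` of finite-dimensional left `B`-comodules. -/
abbrev FinComod := (IsFinDim k B).FullSubcategory

end

/-! ### The monoidal category of Hopf trimodules under the cotensor product -/

section CotensorTrimodule

variable {k : Type u} [Field k] {B : Type u} [Ring B] [Bialgebra k B]
variable {V W V' W' X Y Z : Type u}
  [AddCommGroup V] [Module k V] [AddCommGroup W] [Module k W]
  [AddCommGroup V'] [Module k V'] [AddCommGroup W'] [Module k W']
  [AddCommGroup X] [Module k X] [AddCommGroup Y] [Module k Y] [AddCommGroup Z] [Module k Z]

lemma map_diagAction {φ : B →ₐ[k] Module.End k V} {φ' : B →ₐ[k] Module.End k V'}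
    {ψ : B →ₐ[k] Module.End k W} {ψ' : B →ₐ[k] Module.End k W'} (f : V →ₗ[k] V') (g : W →ₗ[k] W')
    (hf : ∀ b v, f (φ b v) = φ' b (f v)) (hg : ∀ b w, g (ψ b w) = ψ' b (g w)) (b : B)
    (t : V ⊗[k] W) : TensorProduct.map f g (diagAction φ ψ b t) =
      diagAction φ' ψ' b (TensorProduct.map f g t) := by
  rw [diagAction_apply, diagAction_apply]
  generalize Coalgebra.comul (R := k) b = p
  induction t with
  | zero => simp
  | add x y hx hy => simp only [map_add, hx, hy]
  | tmul v w =>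
    induction p with
    | add x y hx hy => simp only [map_add, LinearMap.add_apply, hx, hy]
    | _ => simp [hf, hg]

/-- The action of `B ⊗ (B ⊗ B)` on `X ⊗ (Y ⊗ Z)`. -/
def actionTensor₃ (φ : B →ₐ[k] Module.End k X) (ψ : B →ₐ[k] Module.End k Y)
    (χ : B →ₐ[k] Module.End k Z) : B ⊗[k] (B ⊗[k] B) →ₐ[k] Module.End k (X ⊗[k] (Y ⊗[k] Z)) :=
  Module.endTensorEndAlgHom.comp (Algebra.TensorProduct.map φ (actionTensor ψ χ))

@[simp] lemma actionTensor₃_tmul (φ : B →ₐ[k] Module.End k X) (ψ : B →ₐ[k] Module.End k Y)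
    (χ : B →ₐ[k] Module.End k Z) (b : B) (p : B ⊗[k] B) (x : X) (t : Y ⊗[k] Z) :
    actionTensor₃ φ ψ χ (b ⊗ₜ p) (x ⊗ₜ t) = φ b x ⊗ₜ actionTensor ψ χ p t := rfl

lemma actionTensor_diagAction (φ : B →ₐ[k] Module.End k X) (ψ : B →ₐ[k] Module.End k Y)
    (χ : B →ₐ[k] Module.End k Z) (p : B ⊗[k] B) (t : X ⊗[k] (Y ⊗[k] Z)) :
    actionTensor φ (diagAction ψ χ) p t =
      actionTensor₃ φ ψ χ ((Coalgebra.comul (R := k) (A := B)).lTensor B p) t := by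
  induction t with
  | zero => simp
  | add x y hx hy => simp only [map_add, hx, hy]
  | tmul x t =>
    induction p with
    | add x y hx hy => simp only [map_add, LinearMap.add_apply, hx, hy]
    | _ => simp [diagAction_apply]

lemma diagAction_actionTensor (φ : B →ₐ[k] Module.End k X) (ψ : B →ₐ[k] Module.End k Y)
    (χ : B →ₐ[k] Module.End k Z) (p : B ⊗[k] B) (t : (X ⊗[k] Y) ⊗[k] Z) :
    TensorProduct.assoc k X Y Z (actionTensor (diagAction φ ψ) χ p t) =
      actionTensor₃ φ ψ χ (TensorProduct.assoc k B B B
        ((Coalgebra.comul (R := k) (A := B)).rTensor B p)) (TensorProduct.assoc k X Y Z t) := by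
  induction t with
  | zero => simp
  | add x y hx hy => simp only [map_add, hx, hy]
  | tmul s z =>
    induction p with
    | zero => simp
    | add x y hx hy => simp only [map_add, LinearMap.add_apply, hx, hy]
    | tmul b₁ b₂ =>
      simp only [actionTensor_tmul, diagAction_apply, LinearMap.rTensor_tmul]
      generalize Coalgebra.comul (R := k) b₁ = q
      induction s with
      | zero => simp
      | add x y hx hy => simp only [map_add, TensorProduct.add_tmul, hx, hy]
      | tmul x y =>
        induction q with
        | add x y hx hy =>
          simp only [map_add, LinearMap.add_apply, TensorProduct.add_tmul, hx, hy]
        | _ => simp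

lemma diagAction_assoc (φ : B →ₐ[k] Module.End k X) (ψ : B →ₐ[k] Module.End k Y)
    (χ : B →ₐ[k] Module.End k Z) (b : B) (t : (X ⊗[k] Y) ⊗[k] Z) :
    TensorProduct.assoc k X Y Z (diagAction (diagAction φ ψ) χ b t) =
      diagAction φ (diagAction ψ χ) b (TensorProduct.assoc k X Y Z t) := by
  rw [diagAction_apply, diagAction_apply, diagAction_actionTensor, actionTensor_diagAction,
    Coalgebra.coassoc_apply]

lemma diagAction_mem {φ : B →ₐ[k] Module.End k X} {ψ : B →ₐ[k] Module.End k Y}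
    {r : X →ₗ[k] X ⊗[k] B} {l : Y →ₗ[k] B ⊗[k] Y}
    (hr : ∀ b x, r (φ b x) = diagAction φ (regular k B) b (r x))
    (hl : ∀ b y, l (ψ b y) = diagAction (regular k B) ψ b (l y)) (b : B) (t : X ⊗[k] Y)
    (ht : t ∈ cotensor r l) : diagAction φ ψ b t ∈ cotensor r l := by
  have e1 : ∀ t : X ⊗[k] Y, r.rTensor Y (diagAction φ ψ b t) =
      diagAction (diagAction φ (regular k B)) ψ b (r.rTensor Y t) := fun t =>
    map_diagAction r LinearMap.id hr (fun _ _ => rfl) b t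
  have e2 : ∀ t : X ⊗[k] Y, l.lTensor X (diagAction φ ψ b t) =
      diagAction φ (diagAction (regular k B) ψ) b (l.lTensor X t) := fun t =>
    map_diagAction LinearMap.id l (fun _ _ => rfl) hl b t
  rw [mem_cotensor, e1, e2, diagAction_assoc, mem_cotensor.1 ht]

/-- Restriction of an action to an invariant subspace. -/
def restrictAct (φ : B →ₐ[k] Module.End k V) (E : Submodule k V) (h : ∀ b, ∀ v ∈ E, φ b v ∈ E) :
    B →ₐ[k] Module.End k E where
  toFun b := (φ b).restrict (h b)
  map_one' := by ext v; simp
  map_mul' b b' := by ext v; simp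
  map_zero' := by ext v; simp
  map_add' b b' := by ext v; simp
  commutes' a := by ext v; simp [Module.algebraMap_end_apply]

lemma restrictAct_coe (φ : B →ₐ[k] Module.End k V) (E : Submodule k V)
    (h : ∀ b, ∀ v ∈ E, φ b v ∈ E) (b : B) (v : E) : (restrictAct φ E h b v : V) = φ b v := rfl

lemma leftTensor_diagAction {φ : B →ₐ[k] Module.End k X} (ψ : B →ₐ[k] Module.End k Y)
    {l : X →ₗ[k] B ⊗[k] X} (hl : ∀ b x, l (φ b x) = diagAction (regular k B) φ b (l x)) (b : B)
    (t : X ⊗[k] Y) : leftTensor l Y (diagAction φ ψ b t) =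
      diagAction (regular k B) (diagAction φ ψ) b (leftTensor l Y t) := by
  have e1 : l.rTensor Y (diagAction φ ψ b t) =
      diagAction (diagAction (regular k B) φ) ψ b (l.rTensor Y t) :=
    map_diagAction l LinearMap.id hl (fun _ _ => rfl) b t
  change TensorProduct.assoc k B X Y (l.rTensor Y (diagAction φ ψ b t)) = _
  rw [e1, diagAction_assoc]; rfl

lemma rightTensor_diagAction (φ : B →ₐ[k] Module.End k X) {ψ : B →ₐ[k] Module.End k Y}
    {r : Y →ₗ[k] Y ⊗[k] B} (hr : ∀ b x, r (ψ b x) = diagAction ψ (regular k B) b (r x)) (b : B)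
    (t : X ⊗[k] Y) : rightTensor r X (diagAction φ ψ b t) =
      diagAction (diagAction φ ψ) (regular k B) b (rightTensor r X t) := by
  have e1 : r.lTensor X (diagAction φ ψ b t) =
      diagAction φ (diagAction ψ (regular k B)) b (r.lTensor X t) :=
    map_diagAction LinearMap.id r (fun _ _ => rfl) hr b t
  change (TensorProduct.assoc k X Y B).symm (r.lTensor X (diagAction φ ψ b t)) = _
  rw [e1, LinearEquiv.symm_apply_eq, diagAction_assoc]
  congr 1
  exact ((TensorProduct.assoc k X Y B).apply_symm_apply _).symm

lemma bicompatible_tensor (l : X →ₗ[k] B ⊗[k] X) (r : Y →ₗ[k] Y ⊗[k] B) :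
    Bicompatible (leftTensor l Y) (rightTensor r X) := by
  apply TensorProduct.ext'
  intro x y
  have e1 : ∀ p : B ⊗[k] X, (rightTensor r X).lTensor B (TensorProduct.assoc k B X Y (p ⊗ₜ y)) =
      (TensorProduct.assoc k X Y B).symm.toLinearMap.lTensor B
        (TensorProduct.assoc k B X (Y ⊗[k] B) (p ⊗ₜ r y)) := by
    intro p
    induction p with
    | add x y hx hy => simp only [map_add, TensorProduct.add_tmul, hx, hy]
    | _ => simp [rightTensor_tmul]
  have e2 : ∀ q : Y ⊗[k] B, TensorProduct.assoc k B (X ⊗[k] Y) B ((leftTensor l Y).rTensor B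
      ((TensorProduct.assoc k X Y B).symm (x ⊗ₜ q))) =
      (TensorProduct.assoc k X Y B).symm.toLinearMap.lTensor B
        (TensorProduct.assoc k B X (Y ⊗[k] B) (l x ⊗ₜ q)) := by
    intro q
    induction q with
    | zero => simp
    | add x y hx hy => simp only [map_add, TensorProduct.tmul_add, hx, hy]
    | tmul y b =>
      simp only [TensorProduct.assoc_symm_tmul, LinearMap.rTensor_tmul, leftTensor_tmul]
      generalize l x = p
      induction p with
      | add x y hx hy => simp only [map_add, TensorProduct.add_tmul, hx, hy]
      | _ => simp
  simp only [LinearMap.comp_apply, LinearEquiv.coe_coe]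
  rw [leftTensor_tmul, rightTensor_tmul, e1, e2]

lemma Bicompatible.restrict {l : V →ₗ[k] B ⊗[k] V} {r : V →ₗ[k] V ⊗[k] B} (h : Bicompatible l r)
    (E : Submodule k V) (hl : ∀ v ∈ E, l v ∈ LinearMap.range (E.subtype.lTensor B))
    (hr : ∀ v ∈ E, r v ∈ LinearMap.range (E.subtype.rTensor B)) :
    Bicompatible (restrictLeft E l hl) (restrictRight E r hr) := by
  ext v
  apply lTensor_inj B (rTensor_inj B E.injective_subtype)
  have e1 : ∀ p : B ⊗[k] E, (E.subtype.rTensor B).lTensor B ((restrictRight E r hr).lTensor B p) =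
      r.lTensor B (E.subtype.lTensor B p) := by
    intro p
    induction p with
    | add x y hx hy => simp only [map_add, hx, hy]
    | _ => simp [restrictRight_apply]
  have e2 : ∀ q : E ⊗[k] B, (E.subtype.rTensor B).lTensor B (TensorProduct.assoc k B E B
      ((restrictLeft E l hl).rTensor B q)) =
      TensorProduct.assoc k B V B (l.rTensor B (E.subtype.rTensor B q)) := by
    intro q
    induction q with
    | zero => simp
    | add x y hx hy => simp only [map_add, hx, hy]
    | tmul v b =>
      simp only [LinearMap.rTensor_tmul, Submodule.subtype_apply, ← restrictLeft_apply E l hl]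
      generalize restrictLeft E l hl v = p
      induction p with
      | add x y hx hy => simp only [map_add, TensorProduct.add_tmul, hx, hy]
      | _ => simp
  simp only [LinearMap.comp_apply, LinearEquiv.coe_coe]
  rw [e1, e2, restrictLeft_apply, restrictRight_apply, h.apply]

lemma restrictLeft_act {l : V →ₗ[k] B ⊗[k] V} {φ : B →ₐ[k] Module.End k V}
    (h : ∀ b v, l (φ b v) = diagAction (regular k B) φ b (l v)) (E : Submodule k V)
    (hl : ∀ v ∈ E, l v ∈ LinearMap.range (E.subtype.lTensor B)) (hφ : ∀ b, ∀ v ∈ E, φ b v ∈ E)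
    (b : B) (v : E) : restrictLeft E l hl (restrictAct φ E hφ b v) =
      diagAction (regular k B) (restrictAct φ E hφ) b (restrictLeft E l hl v) := by
  apply lTensor_inj B E.injective_subtype
  rw [restrictLeft_apply, restrictAct_coe, h, ← restrictLeft_apply E l hl]
  exact (map_diagAction LinearMap.id E.subtype (fun _ _ => rfl) (fun _ _ => rfl) b _).symm

lemma restrictRight_act {r : V →ₗ[k] V ⊗[k] B} {φ : B →ₐ[k] Module.End k V}
    (h : ∀ b v, r (φ b v) = diagAction φ (regular k B) b (r v)) (E : Submodule k V)
    (hr : ∀ v ∈ E, r v ∈ LinearMap.range (E.subtype.rTensor B)) (hφ : ∀ b, ∀ v ∈ E, φ b v ∈ E)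
    (b : B) (v : E) : restrictRight E r hr (restrictAct φ E hφ b v) =
      diagAction (restrictAct φ E hφ) (regular k B) b (restrictRight E r hr v) := by
  apply rTensor_inj B E.injective_subtype
  rw [restrictRight_apply, restrictAct_coe, h, ← restrictRight_apply E r hr]
  exact (map_diagAction E.subtype LinearMap.id (fun _ _ => rfl) (fun _ _ => rfl) b _).symm

lemma mem_cotensor_restrictRight {r : V →ₗ[k] V ⊗[k] B} {c : Z →ₗ[k] B ⊗[k] Z}
    (E : Submodule k V) (hr : ∀ v ∈ E, r v ∈ LinearMap.range (E.subtype.rTensor B))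
    (t : E ⊗[k] Z) :
    t ∈ cotensor (restrictRight E r hr) c ↔ E.subtype.rTensor Z t ∈ cotensor r c := by
  rw [mem_cotensor, mem_cotensor,
    ← (rTensor_inj (B ⊗[k] Z) E.injective_subtype).eq_iff]
  have e1 : ∀ t : E ⊗[k] Z, E.subtype.rTensor (B ⊗[k] Z) (TensorProduct.assoc k E B Z
      ((restrictRight E r hr).rTensor Z t)) =
      TensorProduct.assoc k V B Z (r.rTensor Z (E.subtype.rTensor Z t)) := by
    intro q
    induction q with
    | zero => simp
    | add x y hx hy => simp only [map_add, hx, hy]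
    | tmul v b =>
      simp only [LinearMap.rTensor_tmul, Submodule.subtype_apply, ← restrictRight_apply E r hr]
      generalize restrictRight E r hr v = p
      induction p with
      | add x y hx hy => simp only [map_add, TensorProduct.add_tmul, hx, hy]
      | _ => simp
  have e2 : ∀ t : E ⊗[k] Z, E.subtype.rTensor (B ⊗[k] Z) (c.lTensor E t) =
      c.lTensor V (E.subtype.rTensor Z t) := by
    intro q
    induction q with
    | add x y hx hy => simp only [map_add, hx, hy]
    | _ => simp
  rw [e1, e2]

lemma mem_cotensor_restrictLeft {r : X →ₗ[k] X ⊗[k] B} {c : V →ₗ[k] B ⊗[k] V}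
    (E : Submodule k V) (hc : ∀ v ∈ E, c v ∈ LinearMap.range (E.subtype.lTensor B))
    (t : X ⊗[k] E) :
    t ∈ cotensor r (restrictLeft E c hc) ↔ E.subtype.lTensor X t ∈ cotensor r c := by
  rw [mem_cotensor, mem_cotensor,
    ← (lTensor_inj X (lTensor_inj B E.injective_subtype)).eq_iff]
  have e1 : ∀ t : X ⊗[k] E, (E.subtype.lTensor B).lTensor X (TensorProduct.assoc k X B E
      (r.rTensor E t)) =
      TensorProduct.assoc k X B V (r.rTensor V (E.subtype.lTensor X t)) := by
    intro q
    induction q with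
    | zero => simp
    | add x y hx hy => simp only [map_add, hx, hy]
    | tmul x v =>
      simp only [LinearMap.rTensor_tmul, LinearMap.lTensor_tmul]
      generalize r x = p
      induction p with
      | add x y hx hy => simp only [map_add, TensorProduct.add_tmul, hx, hy]
      | _ => simp
  have e2 : ∀ t : X ⊗[k] E, (E.subtype.lTensor B).lTensor X ((restrictLeft E c hc).lTensor X t) =
      c.lTensor X (E.subtype.lTensor X t) := by
    intro q
    induction q with
    | add x y hx hy => simp only [map_add, hx, hy]
    | _ => simp [restrictLeft_apply]
  rw [e1, e2]

lemma assoc_mem_cotensor_leftTensor {r : X →ₗ[k] X ⊗[k] B} {c : Y →ₗ[k] B ⊗[k] Y}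
    (t : (X ⊗[k] Y) ⊗[k] Z) : TensorProduct.assoc k X Y Z t ∈ cotensor r (leftTensor c Z) ↔
      t ∈ LinearMap.range ((cotensor r c).subtype.rTensor Z) := by
  refine Iff.trans ?_ (mem_range_rTensor_eqLocus _ _ _).symm
  have e1 : ∀ t : (X ⊗[k] Y) ⊗[k] Z, TensorProduct.assoc k X B (Y ⊗[k] Z)
      (r.rTensor (Y ⊗[k] Z) (TensorProduct.assoc k X Y Z t)) =
      (TensorProduct.assoc k B Y Z).toLinearMap.lTensor X (TensorProduct.assoc k X (B ⊗[k] Y) Z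
      (((TensorProduct.assoc k X B Y).toLinearMap ∘ₗ r.rTensor Y).rTensor Z t)) := by
    intro t
    induction t with
    | zero => simp
    | add x y hx hy => simp only [map_add, hx, hy]
    | tmul s z =>
      induction s with
      | zero => simp
      | add x y hx hy => simp only [map_add, TensorProduct.add_tmul, hx, hy]
      | tmul x y =>
        simp only [LinearMap.rTensor_tmul, TensorProduct.assoc_tmul, LinearMap.comp_apply,
          LinearEquiv.coe_coe]
        generalize r x = p
        induction p with
        | add x y hx hy => simp only [map_add, TensorProduct.add_tmul, hx, hy]
        | _ => simp
  have e2 : ∀ t : (X ⊗[k] Y) ⊗[k] Z,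
      (leftTensor c Z).lTensor X (TensorProduct.assoc k X Y Z t) =
      (TensorProduct.assoc k B Y Z).toLinearMap.lTensor X (TensorProduct.assoc k X (B ⊗[k] Y) Z
      ((c.lTensor X).rTensor Z t)) := by
    intro t
    induction t with
    | zero => simp
    | add x y hx hy => simp only [map_add, hx, hy]
    | tmul s z =>
      induction s with
      | add x y hx hy => simp only [map_add, TensorProduct.add_tmul, hx, hy]
      | _ => simp [leftTensor_tmul]
  rw [mem_cotensor, e1, e2]
  have hi : Function.Injective ((TensorProduct.assoc k B Y Z).toLinearMap.lTensor X) :=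
    ((TensorProduct.assoc k B Y Z).lTensor X).injective
  exact hi.eq_iff.trans (TensorProduct.assoc k X (B ⊗[k] Y) Z).injective.eq_iff

lemma mem_cotensor_rightTensor {r : Y →ₗ[k] Y ⊗[k] B} {c : Z →ₗ[k] B ⊗[k] Z}
    (t : (X ⊗[k] Y) ⊗[k] Z) : t ∈ cotensor (rightTensor r X) c ↔
      TensorProduct.assoc k X Y Z t ∈ LinearMap.range ((cotensor r c).subtype.lTensor X) := by
  refine Iff.trans ?_ (mem_range_lTensor_eqLocus _ _ _).symm
  have e1 : ∀ t : (X ⊗[k] Y) ⊗[k] Z, ((TensorProduct.assoc k Y B Z).toLinearMap ∘ₗ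
      r.rTensor Z).lTensor X (TensorProduct.assoc k X Y Z t) =
      TensorProduct.assoc k X Y (B ⊗[k] Z) (TensorProduct.assoc k (X ⊗[k] Y) B Z
        ((rightTensor r X).rTensor Z t)) := by
    intro t
    induction t with
    | zero => simp
    | add x y hx hy => simp only [map_add, hx, hy]
    | tmul s z =>
      induction s with
      | zero => simp
      | add x y hx hy => simp only [map_add, TensorProduct.add_tmul, hx, hy]
      | tmul x y =>
        simp only [LinearMap.rTensor_tmul, TensorProduct.assoc_tmul, LinearMap.comp_apply,
          LinearEquiv.coe_coe, LinearMap.lTensor_tmul, rightTensor_tmul]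
        generalize r y = p
        induction p with
        | add x y hx hy =>
          simp only [map_add, TensorProduct.add_tmul, TensorProduct.tmul_add, hx, hy]
        | _ => simp
  have e2 : ∀ t : (X ⊗[k] Y) ⊗[k] Z,
      (c.lTensor Y).lTensor X (TensorProduct.assoc k X Y Z t) =
      TensorProduct.assoc k X Y (B ⊗[k] Z) (c.lTensor (X ⊗[k] Y) t) := by
    intro t
    induction t with
    | zero => simp
    | add x y hx hy => simp only [map_add, hx, hy]
    | tmul s z =>
      simp only [LinearMap.lTensor_tmul]
      induction s with
      | add x y hx hy => simp only [map_add, TensorProduct.add_tmul, hx, hy]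
      | _ => simp
  rw [mem_cotensor, e1, e2, (TensorProduct.assoc k X Y (B ⊗[k] Z)).injective.eq_iff]

end CotensorTrimodule

namespace HopfTrimodule

variable {k : Type u} [Field k] {B : Type u} [Ring B] [Bialgebra k B]

/-- The cotensor product `X □ Y` of Hopf trimodules: the left coaction is the one of `X`, the right
coaction is the one of `Y`, and the action is the diagonal one. -/
@[simps] def cotensorObj (X Y : HopfTrimodule k B) : HopfTrimodule k B where
  carrier := cotensor X.rcoact Y.lcoact
  lcoact := restrictLeft _ (leftTensor X.lcoact Y.carrier) (leftTensor_mem X.bicompatible)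
  rcoact := restrictRight _ (rightTensor Y.rcoact X.carrier) (rightTensor_mem Y.bicompatible)
  act := restrictAct (diagAction X.act Y.act) _ (diagAction_mem X.rcoact_act Y.lcoact_act)
  isLeft := X.isLeft.leftTensor.restrict _ _
  isRight := Y.isRight.rightTensor.restrict _ _
  bicompatible := (bicompatible_tensor _ _).restrict _ _ _
  lcoact_act := restrictLeft_act (leftTensor_diagAction Y.act X.lcoact_act) _ _ _
  rcoact_act := restrictRight_act (rightTensor_diagAction X.act Y.rcoact_act) _ _ _

/-- The bialgebra `B` itself, as a Hopf trimodule. -/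
@[simps] def unit (k B : Type u) [Field k] [Ring B] [Bialgebra k B] : HopfTrimodule k B where
  carrier := B
  lcoact := Coalgebra.comul
  rcoact := Coalgebra.comul
  act := regular k B
  isLeft := isLeftCoaction_comul k B
  isRight := isRightCoaction_comul k B
  bicompatible := Coalgebra.coassoc.symm
  lcoact_act b x := by
    rw [diagAction_apply]
    change Coalgebra.comul (b * x) = _
    rw [Bialgebra.comul_mul]
    generalize Coalgebra.comul (R := k) b = p
    generalize Coalgebra.comul (R := k) x = q
    induction p with
    | zero => simp
    | add x y hx hy => simp only [map_add, add_mul, LinearMap.add_apply, hx, hy]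
    | tmul b₁ b₂ =>
      induction q with
      | add x y hx hy => simp only [map_add, mul_add, hx, hy]
      | _ => simp
  rcoact_act b x := by
    rw [diagAction_apply]
    change Coalgebra.comul (b * x) = _
    rw [Bialgebra.comul_mul]
    generalize Coalgebra.comul (R := k) b = p
    generalize Coalgebra.comul (R := k) x = q
    induction p with
    | zero => simp
    | add x y hx hy => simp only [map_add, add_mul, LinearMap.add_apply, hx, hy]
    | tmul b₁ b₂ =>
      induction q with
      | add x y hx hy => simp only [map_add, mul_add, hx, hy]
      | _ => simp

end HopfTrimodule

section CotensorAssoc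

variable {k : Type u} [Field k] {B : Type u} [Ring B] [Bialgebra k B]
variable {V W V' W' X Y Z X' Y' Z' : Type u}
  [AddCommGroup V] [Module k V] [AddCommGroup W] [Module k W]
  [AddCommGroup V'] [Module k V'] [AddCommGroup W'] [Module k W']
  [AddCommGroup X] [Module k X] [AddCommGroup Y] [Module k Y] [AddCommGroup Z] [Module k Z]
  [AddCommGroup X'] [Module k X'] [AddCommGroup Y'] [Module k Y'] [AddCommGroup Z'] [Module k Z']

/-- `(X □ Y) □ Z → X ⊗ (Y ⊗ Z)`. -/
def cotensorInclL (E : Submodule k (X ⊗[k] Y)) (F : Submodule k (E ⊗[k] Z)) :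
    F →ₗ[k] X ⊗[k] (Y ⊗[k] Z) :=
  (TensorProduct.assoc k X Y Z).toLinearMap ∘ₗ E.subtype.rTensor Z ∘ₗ F.subtype

/-- `X □ (Y □ Z) → X ⊗ (Y ⊗ Z)`. -/
def cotensorInclR (E : Submodule k (Y ⊗[k] Z)) (F : Submodule k (X ⊗[k] E)) :
    F →ₗ[k] X ⊗[k] (Y ⊗[k] Z) :=
  E.subtype.lTensor X ∘ₗ F.subtype

lemma cotensorInclL_injective (E : Submodule k (X ⊗[k] Y)) (F : Submodule k (E ⊗[k] Z)) :
    Function.Injective (cotensorInclL E F) :=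
  (TensorProduct.assoc k X Y Z).injective.comp
    ((rTensor_inj Z E.injective_subtype).comp F.injective_subtype)

lemma cotensorInclR_injective (E : Submodule k (Y ⊗[k] Z)) (F : Submodule k (X ⊗[k] E)) :
    Function.Injective (cotensorInclR E F) :=
  (lTensor_inj X E.injective_subtype).comp F.injective_subtype

lemma range_cotensorIncl {rX : X →ₗ[k] X ⊗[k] B} {lY : Y →ₗ[k] B ⊗[k] Y} {rY : Y →ₗ[k] Y ⊗[k] B}
    (h : Bicompatible lY rY) {lZ : Z →ₗ[k] B ⊗[k] Z} :
    LinearMap.range (cotensorInclL (cotensor rX lY)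
      (cotensor (restrictRight (cotensor rX lY) (rightTensor rY X) (rightTensor_mem h)) lZ)) =
    LinearMap.range (cotensorInclR (cotensor rY lZ)
      (cotensor rX (restrictLeft (cotensor rY lZ) (leftTensor lY Z) (leftTensor_mem h)))) := by
  ext u
  obtain ⟨u, rfl⟩ := (TensorProduct.assoc k X Y Z).surjective u
  trans TensorProduct.assoc k X Y Z u ∈ cotensor rX (leftTensor lY Z) ∧
    u ∈ cotensor (rightTensor rY X) lZ
  · rw [assoc_mem_cotensor_leftTensor]
    constructor
    · rintro ⟨⟨t, ht⟩, e⟩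
      have e' : (cotensor rX lY).subtype.rTensor Z t = u :=
        (TensorProduct.assoc k X Y Z).injective e
      subst e'
      exact ⟨⟨t, rfl⟩, (mem_cotensor_restrictRight _ _ _).1 ht⟩
    · rintro ⟨⟨t, rfl⟩, ht⟩
      exact ⟨⟨t, (mem_cotensor_restrictRight _ _ _).2 ht⟩, rfl⟩
  · rw [mem_cotensor_rightTensor]
    constructor
    · rintro ⟨h₁, t, ht⟩
      rw [← ht] at h₁
      exact ⟨⟨t, (mem_cotensor_restrictLeft _ _ _).2 h₁⟩, ht⟩
    · rintro ⟨⟨t, ht⟩, e⟩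
      have e' : (cotensor rY lZ).subtype.lTensor X t = TensorProduct.assoc k X Y Z u := e
      rw [← e']
      exact ⟨(mem_cotensor_restrictLeft _ _ _).1 ht, ⟨t, rfl⟩⟩

/-- The associativity isomorphism `(X □ Y) □ Z ≃ X □ (Y □ Z)`. -/
def cotensorAssoc (rX : X →ₗ[k] X ⊗[k] B) {lY : Y →ₗ[k] B ⊗[k] Y} {rY : Y →ₗ[k] Y ⊗[k] B}
    (h : Bicompatible lY rY) (lZ : Z →ₗ[k] B ⊗[k] Z) :
    cotensor (restrictRight (cotensor rX lY) (rightTensor rY X) (rightTensor_mem h)) lZ ≃ₗ[k]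
    cotensor rX (restrictLeft (cotensor rY lZ) (leftTensor lY Z) (leftTensor_mem h)) :=
  (LinearEquiv.ofInjective _ (cotensorInclL_injective _ _)).trans
    ((LinearEquiv.ofEq _ _ (range_cotensorIncl h)).trans
      (LinearEquiv.ofInjective _ (cotensorInclR_injective _ _)).symm)

lemma cotensorAssoc_spec (rX : X →ₗ[k] X ⊗[k] B) {lY : Y →ₗ[k] B ⊗[k] Y} {rY : Y →ₗ[k] Y ⊗[k] B}
    (h : Bicompatible lY rY) (lZ : Z →ₗ[k] B ⊗[k] Z)
    (t : cotensor (restrictRight (cotensor rX lY) (rightTensor rY X) (rightTensor_mem h)) lZ) :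
    cotensorInclR _ _ (cotensorAssoc rX h lZ t) = cotensorInclL _ _ t := by
  have e := (LinearEquiv.ofInjective _ (cotensorInclR_injective (cotensor rY lZ)
    (cotensor rX (restrictLeft (cotensor rY lZ) (leftTensor lY Z)
      (leftTensor_mem h))))).apply_symm_apply
    (LinearEquiv.ofEq _ _ (range_cotensorIncl h)
      (LinearEquiv.ofInjective _ (cotensorInclL_injective _ _) t))
  exact congrArg Subtype.val e

lemma leftTensor_assoc (l : X →ₗ[k] B ⊗[k] X) (t : (X ⊗[k] Y) ⊗[k] Z) :
    leftTensor l (Y ⊗[k] Z) (TensorProduct.assoc k X Y Z t) =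
      (TensorProduct.assoc k X Y Z).toLinearMap.lTensor B (leftTensor (leftTensor l Y) Z t) := by
  induction t with
  | zero => simp
  | add x y hx hy => simp only [map_add, hx, hy]
  | tmul s z =>
    induction s with
    | zero => simp
    | add x y hx hy => simp only [map_add, TensorProduct.add_tmul, hx, hy]
    | tmul x y =>
      simp only [TensorProduct.assoc_tmul, leftTensor_tmul]
      generalize l x = p
      induction p with
      | add x y hx hy => simp only [map_add, TensorProduct.add_tmul, hx, hy]
      | _ => simp

lemma rightTensor_assoc (r : Z →ₗ[k] Z ⊗[k] B) (t : (X ⊗[k] Y) ⊗[k] Z) :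
    rightTensor (rightTensor r Y) X (TensorProduct.assoc k X Y Z t) =
      (TensorProduct.assoc k X Y Z).toLinearMap.rTensor B (rightTensor r (X ⊗[k] Y) t) := by
  induction t with
  | zero => simp
  | add x y hx hy => simp only [map_add, hx, hy]
  | tmul s z =>
    induction s with
    | zero => simp
    | add x y hx hy => simp only [map_add, TensorProduct.add_tmul, hx, hy]
    | tmul x y =>
      simp only [TensorProduct.assoc_tmul, rightTensor_tmul]
      generalize r z = p
      induction p with
      | add x y hx hy => simp only [map_add, TensorProduct.tmul_add, hx, hy]
      | _ => simp

lemma cotensorAssoc_lcoact {lX : X →ₗ[k] B ⊗[k] X} {rX : X →ₗ[k] X ⊗[k] B}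
    (hX : Bicompatible lX rX) {lY : Y →ₗ[k] B ⊗[k] Y} {rY : Y →ₗ[k] Y ⊗[k] B}
    (h : Bicompatible lY rY) (lZ : Z →ₗ[k] B ⊗[k] Z)
    (hXY : Bicompatible (restrictLeft (cotensor rX lY) (leftTensor lX Y) (leftTensor_mem hX))
      (restrictRight (cotensor rX lY) (rightTensor rY X) (rightTensor_mem h)))
    (t : cotensor (restrictRight (cotensor rX lY) (rightTensor rY X) (rightTensor_mem h)) lZ) :
    restrictLeft _ (leftTensor lX (cotensor rY lZ)) (leftTensor_mem hX) (cotensorAssoc rX h lZ t) =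
      (cotensorAssoc rX h lZ).toLinearMap.lTensor B
        (restrictLeft (cotensor (restrictRight (cotensor rX lY) (rightTensor rY X) (rightTensor_mem h)) lZ)
          (leftTensor (restrictLeft (cotensor rX lY) (leftTensor lX Y)
            (leftTensor_mem hX)) Z) (leftTensor_mem hXY) t) := by
  apply lTensor_inj B (cotensorInclR_injective _ _)
  rw [← LinearMap.lTensor_comp_apply, show cotensorInclR _ _ ∘ₗ (cotensorAssoc rX h lZ).toLinearMap
    = cotensorInclL _ _ from LinearMap.ext (cotensorAssoc_spec rX h lZ)]
  have e1 : ∀ s, (cotensorInclR (cotensor rY lZ) (cotensor rX (restrictLeft (cotensor rY lZ)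
      (leftTensor lY Z) (leftTensor_mem h)))).lTensor B (restrictLeft _
        (leftTensor lX (cotensor rY lZ)) (leftTensor_mem hX) s) =
      leftTensor lX (Y ⊗[k] Z) (cotensorInclR _ _ s) := by
    intro s
    rw [cotensorInclR, LinearMap.lTensor_comp_apply, restrictLeft_apply]
    exact (leftTensor_map LinearMap.id (cotensor rY lZ).subtype (fun _ => by simp) s.1).symm
  rw [e1, cotensorAssoc_spec, cotensorInclL, LinearMap.lTensor_comp_apply,
    LinearMap.lTensor_comp_apply]
  refine (leftTensor_assoc _ _).trans (congrArg _ ?_)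
  refine Eq.trans ?_ (congrArg (((cotensor rX lY).subtype.rTensor Z).lTensor B)
    (restrictLeft_apply (cotensor (restrictRight (cotensor rX lY) (rightTensor rY X) (rightTensor_mem h)) lZ)
      (leftTensor (restrictLeft (cotensor rX lY) (leftTensor lX Y) (leftTensor_mem hX)) Z)
      (leftTensor_mem hXY) t)).symm
  exact leftTensor_map (cotensor rX lY).subtype LinearMap.id
    (fun x => (restrictLeft_apply _ _ (leftTensor_mem hX) x).symm) t.1

lemma cotensorAssoc_rcoact (rX : X →ₗ[k] X ⊗[k] B)
    {lY : Y →ₗ[k] B ⊗[k] Y} {rY : Y →ₗ[k] Y ⊗[k] B}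
    (h : Bicompatible lY rY) {lZ : Z →ₗ[k] B ⊗[k] Z} {rZ : Z →ₗ[k] Z ⊗[k] B}
    (hZ : Bicompatible lZ rZ)
    (hYZ : Bicompatible (restrictLeft (cotensor rY lZ) (leftTensor lY Z) (leftTensor_mem h))
      (restrictRight (cotensor rY lZ) (rightTensor rZ Y) (rightTensor_mem hZ)))
    (t : cotensor (restrictRight (cotensor rX lY) (rightTensor rY X) (rightTensor_mem h)) lZ) :
    restrictRight _ (rightTensor (restrictRight (cotensor rY lZ) (rightTensor rZ Y)
        (rightTensor_mem hZ)) X) (rightTensor_mem hYZ) (cotensorAssoc rX h lZ t) =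
      (cotensorAssoc rX h lZ).toLinearMap.rTensor B
        (restrictRight (cotensor (restrictRight (cotensor rX lY) (rightTensor rY X) (rightTensor_mem h)) lZ)
          (rightTensor rZ (cotensor rX lY)) (rightTensor_mem hZ) t) := by
  apply rTensor_inj B (cotensorInclR_injective _ _)
  rw [← LinearMap.rTensor_comp_apply, show cotensorInclR _ _ ∘ₗ (cotensorAssoc rX h lZ).toLinearMap
    = cotensorInclL _ _ from LinearMap.ext (cotensorAssoc_spec rX h lZ)]
  have e1 : ∀ s, (cotensorInclR (cotensor rY lZ) (cotensor rX (restrictLeft (cotensor rY lZ)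
      (leftTensor lY Z) (leftTensor_mem h)))).rTensor B (restrictRight _
        (rightTensor (restrictRight (cotensor rY lZ) (rightTensor rZ Y)
        (rightTensor_mem hZ)) X) (rightTensor_mem hYZ) s) =
      rightTensor (rightTensor rZ Y) X (cotensorInclR _ _ s) := by
    intro s
    rw [cotensorInclR, LinearMap.rTensor_comp_apply, restrictRight_apply]
    exact (rightTensor_map LinearMap.id (cotensor rY lZ).subtype
      (fun x => (restrictRight_apply _ _ (rightTensor_mem hZ) x).symm) s.1).symm
  rw [e1, cotensorAssoc_spec, cotensorInclL, LinearMap.rTensor_comp_apply,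
    LinearMap.rTensor_comp_apply]
  refine (rightTensor_assoc _ _).trans (congrArg _ ?_)
  refine Eq.trans ?_ (congrArg _ (restrictRight_apply _ _ (rightTensor_mem hZ) t)).symm
  exact rightTensor_map (cotensor rX lY).subtype LinearMap.id (fun _ => by simp) t.1

/-- If linear maps between the (iterated) cotensor products are compatible with the associators of
the ambient tensor products, then they satisfy the pentagon identity. -/
lemma pentagon_aux {P₁ P₂ P₃ D E F G T T₁ T₂ T₃ S : Type u}
    [AddCommGroup P₁] [Module k P₁] [AddCommGroup P₂] [Module k P₂] [AddCommGroup P₃] [Module k P₃]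
    [AddCommGroup D] [Module k D] [AddCommGroup E] [Module k E] [AddCommGroup F] [Module k F]
    [AddCommGroup G] [Module k G] [AddCommGroup T] [Module k T] [AddCommGroup T₁] [Module k T₁]
    [AddCommGroup T₂] [Module k T₂] [AddCommGroup T₃] [Module k T₃] [AddCommGroup S] [Module k S]
    {i₁ : P₁ →ₗ[k] W ⊗[k] X} {i₂ : P₂ →ₗ[k] X ⊗[k] Y} {i₃ : P₃ →ₗ[k] Y ⊗[k] Z}
    {iD : D →ₗ[k] P₁ ⊗[k] Y} {iE : E →ₗ[k] W ⊗[k] P₂} {iF : F →ₗ[k] P₂ ⊗[k] Z}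
    {iG : G →ₗ[k] X ⊗[k] P₃} {iT : T →ₗ[k] D ⊗[k] Z} {iT₁ : T₁ →ₗ[k] E ⊗[k] Z}
    {iT₂ : T₂ →ₗ[k] W ⊗[k] F} {iT₃ : T₃ →ₗ[k] W ⊗[k] G} {iS : S →ₗ[k] P₁ ⊗[k] P₃}
    (h₃ : Function.Injective i₃) (hG : Function.Injective iG) (hT₃ : Function.Injective iT₃)
    {a₁ : D →ₗ[k] E} {a₂ : T₁ →ₗ[k] T₂} {a₃ : F →ₗ[k] G} {a₄ : T →ₗ[k] S} {a₅ : S →ₗ[k] T₃}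
    {b : T →ₗ[k] T₁} {c : T₂ →ₗ[k] T₃}
    (e₁ : i₂.lTensor W ∘ₗ iE ∘ₗ a₁ = (TensorProduct.assoc k W X Y).toLinearMap ∘ₗ
      i₁.rTensor Y ∘ₗ iD)
    (e₂ : iF.lTensor W ∘ₗ iT₂ ∘ₗ a₂ = (TensorProduct.assoc k W P₂ Z).toLinearMap ∘ₗ
      iE.rTensor Z ∘ₗ iT₁)
    (e₃ : i₃.lTensor X ∘ₗ iG ∘ₗ a₃ = (TensorProduct.assoc k X Y Z).toLinearMap ∘ₗ
      i₂.rTensor Z ∘ₗ iF)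
    (e₄ : i₃.lTensor P₁ ∘ₗ iS ∘ₗ a₄ = (TensorProduct.assoc k P₁ Y Z).toLinearMap ∘ₗ
      iD.rTensor Z ∘ₗ iT)
    (e₅ : iG.lTensor W ∘ₗ iT₃ ∘ₗ a₅ = (TensorProduct.assoc k W X P₃).toLinearMap ∘ₗ
      i₁.rTensor P₃ ∘ₗ iS)
    (eb : iT₁ ∘ₗ b = a₁.rTensor Z ∘ₗ iT) (ec : iT₃ ∘ₗ c = a₃.lTensor W ∘ₗ iT₂) :
    c ∘ₗ a₂ ∘ₗ b = a₅ ∘ₗ a₄ := by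
  have f₁ := LinearMap.congr_fun e₁
  have f₂ := LinearMap.congr_fun e₂
  have f₃ := LinearMap.congr_fun e₃
  have f₄ := LinearMap.congr_fun e₄
  have f₅ := LinearMap.congr_fun e₅
  have fb := LinearMap.congr_fun eb
  have fc := LinearMap.congr_fun ec
  simp only [LinearMap.comp_apply, LinearEquiv.coe_coe] at f₁ f₂ f₃ f₄ f₅ fb fc
  ext t
  apply hT₃
  apply lTensor_inj W hG
  apply lTensor_inj W (lTensor_inj X h₃)
  simp only [LinearMap.comp_apply]
  have n₁ : ∀ u : (W ⊗[k] X) ⊗[k] P₃, (i₃.lTensor X).lTensor W (TensorProduct.assoc k W X P₃ u) =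
      TensorProduct.assoc k W X (Y ⊗[k] Z) (i₃.lTensor (W ⊗[k] X) u) := fun u => by
    induction u with
    | zero => simp
    | add x y hx hy => simp only [map_add, hx, hy]
    | tmul s z =>
      induction s with
      | add x y hx hy => simp only [map_add, TensorProduct.add_tmul, hx, hy]
      | _ => simp
  have n₂ : ∀ u : (P₁ ⊗[k] Y) ⊗[k] Z, i₁.rTensor (Y ⊗[k] Z) (TensorProduct.assoc k P₁ Y Z u) =
      TensorProduct.assoc k (W ⊗[k] X) Y Z ((i₁.rTensor Y).rTensor Z u) := fun u => by
    induction u with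
    | zero => simp
    | add x y hx hy => simp only [map_add, hx, hy]
    | tmul s z =>
      induction s with
      | add x y hx hy => simp only [map_add, TensorProduct.add_tmul, hx, hy]
      | _ => simp
  have n₃ : ∀ u : P₁ ⊗[k] P₃, i₃.lTensor (W ⊗[k] X) (i₁.rTensor P₃ u) =
      i₁.rTensor (Y ⊗[k] Z) (i₃.lTensor P₁ u) := fun u => by
    rw [← LinearMap.comp_apply, ← LinearMap.comp_apply, LinearMap.lTensor_comp_rTensor,
      LinearMap.rTensor_comp_lTensor]
  have n₄ : ∀ u : (W ⊗[k] P₂) ⊗[k] Z, (i₂.rTensor Z).lTensor W (TensorProduct.assoc k W P₂ Z u) =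
      TensorProduct.assoc k W (X ⊗[k] Y) Z ((i₂.lTensor W).rTensor Z u) := fun u => by
    induction u with
    | zero => simp
    | add x y hx hy => simp only [map_add, hx, hy]
    | tmul s z =>
      induction s with
      | add x y hx hy => simp only [map_add, TensorProduct.add_tmul, hx, hy]
      | _ => simp
  have n₅ : ∀ u : ((W ⊗[k] X) ⊗[k] Y) ⊗[k] Z,
      (TensorProduct.assoc k X Y Z).toLinearMap.lTensor W (TensorProduct.assoc k W (X ⊗[k] Y) Z
        ((TensorProduct.assoc k W X Y).toLinearMap.rTensor Z u)) =
      TensorProduct.assoc k W X (Y ⊗[k] Z) (TensorProduct.assoc k (W ⊗[k] X) Y Z u) := fun u => by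
    induction u with
    | zero => simp
    | add x y hx hy => simp only [map_add, hx, hy]
    | tmul s z =>
      induction s with
      | zero => simp
      | add x y hx hy => simp only [map_add, TensorProduct.add_tmul, hx, hy]
      | tmul s y =>
        induction s with
        | add x y hx hy => simp only [map_add, TensorProduct.add_tmul, hx, hy]
        | _ => simp
  rw [f₅, n₁, n₃, f₄, n₂, ← n₅, fc]
  have g₃ : ∀ u : W ⊗[k] F, (i₃.lTensor X).lTensor W (iG.lTensor W (a₃.lTensor W u)) =
      (TensorProduct.assoc k X Y Z).toLinearMap.lTensor W
        ((i₂.rTensor Z).lTensor W (iF.lTensor W u)) := fun u => by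
    simp only [← LinearMap.lTensor_comp_apply]
    rw [e₃]
  have g₁ : ∀ u : D ⊗[k] Z, (i₂.lTensor W).rTensor Z (iE.rTensor Z (a₁.rTensor Z u)) =
      (TensorProduct.assoc k W X Y).toLinearMap.rTensor Z
        ((i₁.rTensor Y).rTensor Z (iD.rTensor Z u)) := fun u => by
    simp only [← LinearMap.rTensor_comp_apply]
    rw [e₁]
  rw [g₃, f₂, fb, n₄, g₁]

/-- The triangle identity, in the same situation. -/
lemma triangle_aux {P₁ P₂ D T S : Type u}
    [AddCommGroup P₁] [Module k P₁] [AddCommGroup P₂] [Module k P₂] [AddCommGroup D] [Module k D]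
    [AddCommGroup T] [Module k T] [AddCommGroup S] [Module k S]
    {i₁ : P₁ →ₗ[k] X ⊗[k] B} {i₂ : P₂ →ₗ[k] B ⊗[k] Y} {iT : T →ₗ[k] P₁ ⊗[k] Y}
    {iS : S →ₗ[k] X ⊗[k] P₂} {iD : D →ₗ[k] X ⊗[k] Y} (hD : Function.Injective iD)
    {a : T →ₗ[k] S} {b : T →ₗ[k] D} {c : S →ₗ[k] D}
    (ea : i₂.lTensor X ∘ₗ iS ∘ₗ a = (TensorProduct.assoc k X B Y).toLinearMap ∘ₗ
      i₁.rTensor Y ∘ₗ iT)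
    (eb : iD ∘ₗ b = TensorProduct.map ((TensorProduct.rid k X).toLinearMap ∘ₗ
      (Coalgebra.counit (R := k) (A := B)).lTensor X ∘ₗ i₁) LinearMap.id ∘ₗ iT)
    (ec : iD ∘ₗ c = TensorProduct.map LinearMap.id ((TensorProduct.lid k Y).toLinearMap ∘ₗ
      (Coalgebra.counit (R := k) (A := B)).rTensor Y ∘ₗ i₂) ∘ₗ iS) : c ∘ₗ a = b := by
  have n : ∀ u : (X ⊗[k] B) ⊗[k] Y, ((TensorProduct.rid k X).toLinearMap ∘ₗ
        (Coalgebra.counit (R := k) (A := B)).lTensor X).rTensor Y u =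
      ((TensorProduct.lid k Y).toLinearMap ∘ₗ
        (Coalgebra.counit (R := k) (A := B)).rTensor Y).lTensor X
          (TensorProduct.assoc k X B Y u) := fun u => by
    induction u with
    | zero => simp
    | add x y hx hy => simp only [map_add, hx, hy]
    | tmul s z =>
      induction s with
      | add x y hx hy => simp only [map_add, TensorProduct.add_tmul, hx, hy]
      | _ => simp [TensorProduct.smul_tmul]
  have fa := LinearMap.congr_fun ea
  have fb := LinearMap.congr_fun eb
  have fc := LinearMap.congr_fun ec
  simp only [LinearMap.comp_apply, LinearEquiv.coe_coe] at fa fb fc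
  ext t
  apply hD
  rw [fb, LinearMap.comp_apply, fc]
  have g₁ : ∀ u : P₁ ⊗[k] Y, TensorProduct.map ((TensorProduct.rid k X).toLinearMap ∘ₗ
      (Coalgebra.counit (R := k) (A := B)).lTensor X ∘ₗ i₁) LinearMap.id u =
      ((TensorProduct.rid k X).toLinearMap ∘ₗ
        (Coalgebra.counit (R := k) (A := B)).lTensor X).rTensor Y (i₁.rTensor Y u) := fun u => by
    rw [← LinearMap.rTensor_comp_apply]; rfl
  have g₂ : ∀ u : X ⊗[k] P₂, TensorProduct.map LinearMap.id
      ((TensorProduct.lid k Y).toLinearMap ∘ₗ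
        (Coalgebra.counit (R := k) (A := B)).rTensor Y ∘ₗ i₂) u =
      ((TensorProduct.lid k Y).toLinearMap ∘ₗ
        (Coalgebra.counit (R := k) (A := B)).rTensor Y).lTensor X (i₂.lTensor X u) := fun u => by
    rw [← LinearMap.lTensor_comp_apply]; rfl
  rw [g₁, g₂, n, fa]

lemma IsLeftCoaction.mem_cotensor {l : X →ₗ[k] B ⊗[k] X} (h : IsLeftCoaction l) (x : X) :
    l x ∈ cotensor (Coalgebra.comul (R := k) (A := B)) l :=
  h.coassoc_apply x

lemma IsRightCoaction.mem_cotensor {r : X →ₗ[k] X ⊗[k] B} (h : IsRightCoaction r) (x : X) :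
    r x ∈ cotensor r (Coalgebra.comul (R := k) (A := B)) :=
  h.coassoc_apply x

/-- The isomorphism `X ≃ B □ X` given by the coaction. -/
def cotensorLid {l : X →ₗ[k] B ⊗[k] X} (h : IsLeftCoaction l) :
    X ≃ₗ[k] cotensor (Coalgebra.comul (R := k) (A := B)) l :=
  LinearEquiv.ofLinearMap (LinearMap.codRestrict _ l h.mem_cotensor)
    ((TensorProduct.lid k X).toLinearMap ∘ₗ (Coalgebra.counit (R := k) (A := B)).rTensor X ∘ₗ
      Submodule.subtype _)
    (LinearMap.ext fun t => Subtype.ext <| by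
      have e1 : ∀ u : B ⊗[k] X, l (TensorProduct.lid k X
          ((Coalgebra.counit (R := k) (A := B)).rTensor X u)) =
          TensorProduct.lid k (B ⊗[k] X)
            ((Coalgebra.counit (R := k) (A := B)).rTensor (B ⊗[k] X) (l.lTensor B u)) := by
        intro u
        induction u with
        | add x y hx hy => simp only [map_add, hx, hy]
        | _ => simp
      have e2 : ∀ u : B ⊗[k] X, TensorProduct.lid k (B ⊗[k] X)
          ((Coalgebra.counit (R := k) (A := B)).rTensor (B ⊗[k] X)
            (TensorProduct.assoc k B B X ((Coalgebra.comul (R := k) (A := B)).rTensor X u))) =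
          u := (isLeftCoaction_comul k B).leftTensor (N := X) |>.counit_apply
      exact (e1 t.1).trans ((congrArg _ (congrArg _ (mem_cotensor.1 t.2).symm)).trans (e2 t.1)))
    h.counit

/-- The isomorphism `X ≃ X □ B` given by the coaction. -/
def cotensorRid {r : X →ₗ[k] X ⊗[k] B} (h : IsRightCoaction r) :
    X ≃ₗ[k] cotensor r (Coalgebra.comul (R := k) (A := B)) :=
  LinearEquiv.ofLinearMap (LinearMap.codRestrict _ r h.mem_cotensor)
    ((TensorProduct.rid k X).toLinearMap ∘ₗ (Coalgebra.counit (R := k) (A := B)).lTensor X ∘ₗ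
      Submodule.subtype _)
    (LinearMap.ext fun t => Subtype.ext <| by
      have e1 : ∀ u : X ⊗[k] B, r (TensorProduct.rid k X
          ((Coalgebra.counit (R := k) (A := B)).lTensor X u)) =
          TensorProduct.rid k (X ⊗[k] B)
            ((Coalgebra.counit (R := k) (A := B)).lTensor (X ⊗[k] B) (r.rTensor B u)) := by
        intro u
        induction u with
        | add x y hx hy => simp only [map_add, hx, hy]
        | _ => simp
      have e2 : ∀ u : X ⊗[k] B, TensorProduct.rid k (X ⊗[k] B)
          ((Coalgebra.counit (R := k) (A := B)).lTensor (X ⊗[k] B)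
            ((TensorProduct.assoc k X B B).symm
              ((Coalgebra.comul (R := k) (A := B)).lTensor X u))) =
          u := (isRightCoaction_comul k B).rightTensor (M := X) |>.counit_apply
      refine (e1 t.1).trans ((congrArg _ (congrArg _ ?_)).trans (e2 t.1))
      rw [← mem_cotensor.1 t.2, LinearEquiv.symm_apply_apply])
    h.counit


lemma cotensorMap_colinear_right {l : V' →ₗ[k] B ⊗[k] V'} {l' : W' →ₗ[k] B ⊗[k] W'}
    {r : V' →ₗ[k] V' ⊗[k] B} {r' : W' →ₗ[k] W' ⊗[k] B}
    (h : Bicompatible l r) (h' : Bicompatible l' r')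
    {s : X →ₗ[k] X ⊗[k] B} {s' : Y →ₗ[k] Y ⊗[k] B} (f : X →ₗ[k] Y) (g : V' →ₗ[k] W')
    (hf : ∀ x, s' (f x) = f.rTensor B (s x)) (hg : ∀ m, l' (g m) = g.lTensor B (l m))
    (hr : ∀ m, r' (g m) = g.rTensor B (r m)) (t : cotensor s l) :
    restrictRight (cotensor s' l') (rightTensor r' Y) (rightTensor_mem h')
        (cotensorMap f g hf hg t) =
      (cotensorMap f g hf hg).rTensor B
        (restrictRight (cotensor s l) (rightTensor r X) (rightTensor_mem h) t) := by
  apply rTensor_inj B (Submodule.injective_subtype _)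
  rw [restrictRight_apply, cotensorMap_coe, rightTensor_map _ _ hr, ← LinearMap.rTensor_comp_apply,
    show (cotensor s' l').subtype ∘ₗ cotensorMap f g hf hg =
      TensorProduct.map f g ∘ₗ (cotensor s l).subtype from rfl,
    LinearMap.rTensor_comp_apply, restrictRight_apply]

lemma cotensorAssoc_act {φX : B →ₐ[k] Module.End k X} {φY : B →ₐ[k] Module.End k Y}
    {φZ : B →ₐ[k] Module.End k Z} {rX : X →ₗ[k] X ⊗[k] B}
    (hX : ∀ b x, rX (φX b x) = diagAction φX (regular k B) b (rX x))
    {lY : Y →ₗ[k] B ⊗[k] Y} {rY : Y →ₗ[k] Y ⊗[k] B} (h : Bicompatible lY rY)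
    (hY : ∀ b x, lY (φY b x) = diagAction (regular k B) φY b (lY x))
    (hY' : ∀ b x, rY (φY b x) = diagAction φY (regular k B) b (rY x))
    {lZ : Z →ₗ[k] B ⊗[k] Z} (hZ : ∀ b x, lZ (φZ b x) = diagAction (regular k B) φZ b (lZ x))
    (hXY : ∀ b x, restrictRight (cotensor rX lY) (rightTensor rY X) (rightTensor_mem h)
        (restrictAct (diagAction φX φY) _ (diagAction_mem hX hY) b x) =
      diagAction (restrictAct (diagAction φX φY) _ (diagAction_mem hX hY)) (regular k B) b
        (restrictRight (cotensor rX lY) (rightTensor rY X) (rightTensor_mem h) x))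
    (hYZ : ∀ b x, restrictLeft (cotensor rY lZ) (leftTensor lY Z) (leftTensor_mem h)
        (restrictAct (diagAction φY φZ) _ (diagAction_mem hY' hZ) b x) =
      diagAction (regular k B) (restrictAct (diagAction φY φZ) _ (diagAction_mem hY' hZ)) b
        (restrictLeft (cotensor rY lZ) (leftTensor lY Z) (leftTensor_mem h) x))
    (b : B)
    (t : cotensor (restrictRight (cotensor rX lY) (rightTensor rY X) (rightTensor_mem h)) lZ) :
    cotensorAssoc rX h lZ (restrictAct
        (diagAction (restrictAct (diagAction φX φY) _ (diagAction_mem hX hY)) φZ) _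
        (diagAction_mem hXY hZ) b t) =
      restrictAct (diagAction φX (restrictAct (diagAction φY φZ) _ (diagAction_mem hY' hZ))) _
        (diagAction_mem hX hYZ) b (cotensorAssoc rX h lZ t) := by
  apply cotensorInclR_injective (cotensor rY lZ)
    (cotensor rX (restrictLeft (cotensor rY lZ) (leftTensor lY Z) (leftTensor_mem h)))
  rw [cotensorAssoc_spec]
  have e1 : ∀ s, cotensorInclR (cotensor rY lZ)
      (cotensor rX (restrictLeft (cotensor rY lZ) (leftTensor lY Z) (leftTensor_mem h)))
      (restrictAct (diagAction φX (restrictAct (diagAction φY φZ) _ (diagAction_mem hY' hZ))) _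
        (diagAction_mem hX hYZ) b s) =
      diagAction φX (diagAction φY φZ) b (cotensorInclR _ _ s) := fun s =>
    map_diagAction LinearMap.id (cotensor rY lZ).subtype (fun _ _ => rfl) (fun _ _ => rfl) b s.1
  rw [e1, cotensorAssoc_spec]
  refine (congrArg (TensorProduct.assoc k X Y Z) (map_diagAction (cotensor rX lY).subtype
    LinearMap.id (fun _ _ => rfl) (fun _ _ => rfl) b t.1)).trans ?_
  exact diagAction_assoc _ _ _ _ _

lemma cotensorAssoc_naturality {rX : X →ₗ[k] X ⊗[k] B} {rX' : X' →ₗ[k] X' ⊗[k] B}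
    {lY : Y →ₗ[k] B ⊗[k] Y} {rY : Y →ₗ[k] Y ⊗[k] B} (h : Bicompatible lY rY)
    {lY' : Y' →ₗ[k] B ⊗[k] Y'} {rY' : Y' →ₗ[k] Y' ⊗[k] B} (h' : Bicompatible lY' rY')
    {lZ : Z →ₗ[k] B ⊗[k] Z} {lZ' : Z' →ₗ[k] B ⊗[k] Z'}
    (f : X →ₗ[k] X') (g : Y →ₗ[k] Y') (e : Z →ₗ[k] Z')
    (hf : ∀ x, rX' (f x) = f.rTensor B (rX x)) (hg : ∀ x, lY' (g x) = g.lTensor B (lY x))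
    (hg' : ∀ x, rY' (g x) = g.rTensor B (rY x)) (he : ∀ x, lZ' (e x) = e.lTensor B (lZ x))
    (hfg : ∀ x, restrictRight (cotensor rX' lY') (rightTensor rY' X') (rightTensor_mem h')
        (cotensorMap f g hf hg x) = (cotensorMap f g hf hg).rTensor B
      (restrictRight (cotensor rX lY) (rightTensor rY X) (rightTensor_mem h) x))
    (hge : ∀ x, restrictLeft (cotensor rY' lZ') (leftTensor lY' Z') (leftTensor_mem h')
        (cotensorMap g e hg' he x) = (cotensorMap g e hg' he).lTensor B
      (restrictLeft (cotensor rY lZ) (leftTensor lY Z) (leftTensor_mem h) x)) :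
    (cotensorAssoc rX' h' lZ').toLinearMap ∘ₗ cotensorMap (cotensorMap f g hf hg) e hfg he =
      cotensorMap f (cotensorMap g e hg' he) hf hge ∘ₗ (cotensorAssoc rX h lZ).toLinearMap := by
  ext1 t
  apply cotensorInclR_injective (cotensor rY' lZ')
    (cotensor rX' (restrictLeft (cotensor rY' lZ') (leftTensor lY' Z') (leftTensor_mem h')))
  simp only [LinearMap.comp_apply, LinearEquiv.coe_coe]
  rw [cotensorAssoc_spec]
  have e1 : ∀ u : X ⊗[k] cotensor rY lZ, (cotensor rY' lZ').subtype.lTensor X'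
      (TensorProduct.map f (cotensorMap g e hg' he) u) =
      TensorProduct.map f (TensorProduct.map g e) ((cotensor rY lZ).subtype.lTensor X u) := by
    intro u
    induction u with
    | add x y hx hy => simp only [map_add, hx, hy]
    | _ => simp
  have e2 : ∀ u : cotensor rX lY ⊗[k] Z, TensorProduct.assoc k X' Y' Z'
      ((cotensor rX' lY').subtype.rTensor Z'
        (TensorProduct.map (cotensorMap f g hf hg) e u)) =
      TensorProduct.map f (TensorProduct.map g e)
        (TensorProduct.assoc k X Y Z ((cotensor rX lY).subtype.rTensor Z u)) := by
    intro u
    induction u with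
    | zero => simp
    | add x y hx hy => simp only [map_add, hx, hy]
    | tmul x y =>
      simp only [TensorProduct.map_tmul, LinearMap.rTensor_tmul, Submodule.subtype_apply,
        cotensorMap_coe]
      exact (LinearMap.congr_fun (TensorProduct.map_map_comp_assoc_eq f g e)
        ((x : X ⊗[k] Y) ⊗ₜ[k] y)).symm
  refine (e2 t.1).trans (Eq.trans (congrArg _ ?_) (e1 (cotensorAssoc rX h lZ t).1).symm)
  exact (cotensorAssoc_spec rX h lZ t).symm

lemma lid_naturality (f : X →ₗ[k] Y) (u : B ⊗[k] X) :
    TensorProduct.lid k Y ((Coalgebra.counit (R := k) (A := B)).rTensor Y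
      (TensorProduct.map LinearMap.id f u)) =
    f (TensorProduct.lid k X ((Coalgebra.counit (R := k) (A := B)).rTensor X u)) := by
  induction u with
  | add x y hx hy => simp only [map_add, hx, hy]
  | _ => simp

lemma rid_naturality (f : X →ₗ[k] Y) (u : X ⊗[k] B) :
    TensorProduct.rid k Y ((Coalgebra.counit (R := k) (A := B)).lTensor Y
      (TensorProduct.map f LinearMap.id u)) =
    f (TensorProduct.rid k X ((Coalgebra.counit (R := k) (A := B)).lTensor X u)) := by
  induction u with
  | add x y hx hy => simp only [map_add, hx, hy]
  | _ => simp

lemma bicompatible_comul : Bicompatible (k := k) (Coalgebra.comul (R := k) (A := B))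
    Coalgebra.comul :=
  Coalgebra.coassoc.symm

lemma cotensorLid_lcoact {l : X →ₗ[k] B ⊗[k] X} (h : IsLeftCoaction l) (x : X) :
    restrictLeft _ (leftTensor (Coalgebra.comul (R := k) (A := B)) X)
      (leftTensor_mem bicompatible_comul) (cotensorLid h x) =
      (cotensorLid h).toLinearMap.lTensor B (l x) :=
  restrictLeft_comm _ _ (cotensorLid h).toLinearMap x (h.coassoc_apply x)

lemma cotensorLid_rcoact {l : X →ₗ[k] B ⊗[k] X} (h : IsLeftCoaction l)
    {r : X →ₗ[k] X ⊗[k] B} (h' : Bicompatible l r) (x : X) :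
    restrictRight _ (rightTensor r B) (rightTensor_mem h') (cotensorLid h x) =
      (cotensorLid h).toLinearMap.rTensor B (r x) :=
  restrictRight_comm _ _ (cotensorLid h).toLinearMap x
    ((LinearEquiv.symm_apply_eq _).2 (h'.apply x))

lemma cotensorRid_lcoact {r : X →ₗ[k] X ⊗[k] B} (h : IsRightCoaction r)
    {l : X →ₗ[k] B ⊗[k] X} (h' : Bicompatible l r) (x : X) :
    restrictLeft _ (leftTensor l B) (leftTensor_mem h') (cotensorRid h x) =
      (cotensorRid h).toLinearMap.lTensor B (l x) :=
  restrictLeft_comm _ _ (cotensorRid h).toLinearMap x (h'.apply x).symm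

lemma cotensorRid_rcoact {r : X →ₗ[k] X ⊗[k] B} (h : IsRightCoaction r) (x : X) :
    restrictRight _ (rightTensor (Coalgebra.comul (R := k) (A := B)) X)
      (rightTensor_mem bicompatible_comul) (cotensorRid h x) =
      (cotensorRid h).toLinearMap.rTensor B (r x) :=
  restrictRight_comm _ _ (cotensorRid h).toLinearMap x
    ((LinearEquiv.symm_apply_eq _).2 (h.coassoc_apply x).symm)

end CotensorAssoc

namespace HopfTrimodule

variable {k : Type u} [Field k] {B : Type u} [Ring B] [Bialgebra k B]

/-- The morphism `f □ g` of Hopf trimodules. -/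
def cotensorHom {X X' Y Y' : HopfTrimodule k B} (f : X ⟶ X') (g : Y ⟶ Y') :
    cotensorObj X Y ⟶ cotensorObj X' Y' where
  lin := cotensorMap f.lin g.lin f.rcomm g.lcomm
  lcomm := cotensorMap_colinear X.bicompatible X'.bicompatible _ _ f.lcomm f.rcomm g.lcomm
  rcomm := cotensorMap_colinear_right Y.bicompatible Y'.bicompatible _ _ f.rcomm g.lcomm g.rcomm
  acomm b t := Subtype.ext (map_diagAction f.lin g.lin f.acomm g.acomm b t.1)

/-- The associator of the cotensor product. -/
def assocIso (X Y Z : HopfTrimodule k B) :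
    cotensorObj (cotensorObj X Y) Z ≅ cotensorObj X (cotensorObj Y Z) :=
  isoMk (cotensorAssoc X.rcoact Y.bicompatible Z.lcoact)
    (cotensorAssoc_lcoact X.bicompatible Y.bicompatible Z.lcoact (cotensorObj X Y).bicompatible)
    (cotensorAssoc_rcoact X.rcoact Y.bicompatible Z.bicompatible (cotensorObj Y Z).bicompatible)
    (cotensorAssoc_act X.rcoact_act Y.bicompatible Y.lcoact_act Y.rcoact_act Z.lcoact_act
      (cotensorObj X Y).rcoact_act (cotensorObj Y Z).lcoact_act)

/-- The left unitor of the cotensor product, `B □ X ≅ X`, inverse to the left coaction of `X`. -/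
def leftUnitorIso (X : HopfTrimodule k B) : cotensorObj (unit k B) X ≅ X :=
  (isoMk (X := X) (Y := cotensorObj (unit k B) X) (cotensorLid (B := B) X.isLeft)
    (cotensorLid_lcoact X.isLeft) (cotensorLid_rcoact X.isLeft X.bicompatible)
    (fun b x => Subtype.ext (X.lcoact_act b x))).symm

/-- The right unitor of the cotensor product, `X □ B ≅ X`, inverse to the right coaction of `X`. -/
def rightUnitorIso (X : HopfTrimodule k B) : cotensorObj X (unit k B) ≅ X :=
  (isoMk (X := X) (Y := cotensorObj X (unit k B)) (cotensorRid (B := B) X.isRight)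
    (cotensorRid_lcoact X.isRight X.bicompatible) (cotensorRid_rcoact X.isRight)
    (fun b x => Subtype.ext (X.rcoact_act b x))).symm

instance : MonoidalCategoryStruct (HopfTrimodule k B) where
  tensorObj X Y := cotensorObj X Y
  whiskerLeft X _ _ g := cotensorHom (𝟙 X) g
  whiskerRight f Y := cotensorHom f (𝟙 Y)
  tensorHom f g := cotensorHom f g
  tensorUnit := unit k B
  associator X Y Z := assocIso X Y Z
  leftUnitor X := leftUnitorIso X
  rightUnitor X := rightUnitorIso X

/-- The monoidal category of Hopf trimodules under the cotensor product. -/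
instance : MonoidalCategory (HopfTrimodule k B) :=
  MonoidalCategory.ofTensorHom
    (id_tensorHom_id := fun X Y => hom_ext <| LinearMap.ext fun t => Subtype.ext <|
      LinearMap.congr_fun TensorProduct.map_id t.1)
    (id_tensorHom := fun _ _ _ _ => rfl)
    (tensorHom_id := fun _ _ => rfl)
    (tensorHom_comp_tensorHom := fun f g h i => hom_ext <| LinearMap.ext fun t => Subtype.ext <|
      (LinearMap.congr_fun (TensorProduct.map_comp h.lin i.lin f.lin g.lin) t.1).symm)
    (associator_naturality := fun {X₁ X₂ X₃ Y₁ Y₂ Y₃} f g h => hom_ext <|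
      cotensorAssoc_naturality X₂.bicompatible Y₂.bicompatible f.lin g.lin h.lin f.rcomm g.lcomm
        g.rcomm h.lcomm (cotensorHom f g).rcomm (cotensorHom g h).lcomm)
    (leftUnitor_naturality := fun {X Y} f => hom_ext <| LinearMap.ext fun t =>
      lid_naturality (B := B) f.lin t.1)
    (rightUnitor_naturality := fun {X Y} f => hom_ext <| LinearMap.ext fun t =>
      rid_naturality (B := B) f.lin t.1)
    (pentagon := fun W X Y Z => hom_ext <| by
      have e := pentagon_aux (W := W.carrier) (X := X.carrier) (Y := Y.carrier) (Z := Z.carrier)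
        (i₁ := (cotensor W.rcoact X.lcoact).subtype)
        (i₂ := (cotensor X.rcoact Y.lcoact).subtype)
        (i₃ := (cotensor Y.rcoact Z.lcoact).subtype)
        (iD := (cotensor (cotensorObj W X).rcoact Y.lcoact).subtype)
        (iE := (cotensor W.rcoact (cotensorObj X Y).lcoact).subtype)
        (iF := (cotensor (cotensorObj X Y).rcoact Z.lcoact).subtype)
        (iG := (cotensor X.rcoact (cotensorObj Y Z).lcoact).subtype)
        (iT := (cotensor (cotensorObj (cotensorObj W X) Y).rcoact Z.lcoact).subtype)
        (iT₁ := (cotensor (cotensorObj W (cotensorObj X Y)).rcoact Z.lcoact).subtype)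
        (iT₂ := (cotensor W.rcoact (cotensorObj (cotensorObj X Y) Z).lcoact).subtype)
        (iT₃ := (cotensor W.rcoact (cotensorObj X (cotensorObj Y Z)).lcoact).subtype)
        (iS := (cotensor (cotensorObj W X).rcoact (cotensorObj Y Z).lcoact).subtype)
        (Submodule.injective_subtype _) (Submodule.injective_subtype _)
        (Submodule.injective_subtype _)
        (a₁ := (assocIso W X Y).hom.lin) (a₂ := (assocIso W (cotensorObj X Y) Z).hom.lin)
        (a₃ := (assocIso X Y Z).hom.lin) (a₄ := (assocIso (cotensorObj W X) Y Z).hom.lin)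
        (a₅ := (assocIso W X (cotensorObj Y Z)).hom.lin)
        (b := (cotensorHom (assocIso W X Y).hom (𝟙 Z)).lin)
        (c := (cotensorHom (𝟙 W) (assocIso X Y Z).hom).lin)
        (LinearMap.ext (cotensorAssoc_spec W.rcoact X.bicompatible Y.lcoact))
        (LinearMap.ext (cotensorAssoc_spec W.rcoact (cotensorObj X Y).bicompatible Z.lcoact))
        (LinearMap.ext (cotensorAssoc_spec X.rcoact Y.bicompatible Z.lcoact))
        (LinearMap.ext (cotensorAssoc_spec (cotensorObj W X).rcoact Y.bicompatible Z.lcoact))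
        (LinearMap.ext (cotensorAssoc_spec W.rcoact X.bicompatible (cotensorObj Y Z).lcoact))
        rfl rfl
      exact e)
    (triangle := fun X Y => hom_ext <| by
      have e := triangle_aux (B := B) (X := X.carrier) (Y := Y.carrier)
        (i₁ := (cotensor X.rcoact (unit k B).lcoact).subtype)
        (i₂ := (cotensor (unit k B).rcoact Y.lcoact).subtype)
        (iT := (cotensor (cotensorObj X (unit k B)).rcoact Y.lcoact).subtype)
        (iS := (cotensor X.rcoact (cotensorObj (unit k B) Y).lcoact).subtype)
        (iD := (cotensor X.rcoact Y.lcoact).subtype)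
        (Submodule.injective_subtype _)
        (a := (assocIso X (unit k B) Y).hom.lin)
        (b := (cotensorHom (rightUnitorIso X).hom (𝟙 Y)).lin)
        (c := (cotensorHom (𝟙 X) (leftUnitorIso Y).hom).lin)
        (LinearMap.ext (cotensorAssoc_spec X.rcoact (unit k B).bicompatible Y.lcoact))
        rfl rfl
      exact e)

end HopfTrimodule

end

end HopfTrimod

open HopfTrimod

namespace HopfTrimod

noncomputable section

section ModuleEnd

open MonoidalLeftAction Functor LaxModuleEnd

universe v w

variable {C : Type w} [Category.{v} C] [MonoidalCategory C]

/-- The module endofunctor `- ⊗ V`. -/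
@[simps] def tensorRightEnd (V : C) : LaxModuleEnd C where
  functor := tensorRight V
  lax :=
    { μₗ := fun M N => (α_ M N V).inv
      μₗ_naturality_left := fun f N => by simp
      μₗ_naturality_right := fun M _ _ f => by simp
      μₗ_associativity := fun M N P => by simp
      μₗ_unitality := fun N => by simp }

lemma isStrong_tensorRightEnd (V : C) : IsStrong C (tensorRightEnd V) :=
  fun M N => inferInstanceAs (IsIso (α_ M N V).inv)

variable (C) in
/-- The functor `V ↦ - ⊗ V` from `C` with the reversed tensor product to strong module
endofunctors. -/
@[simps] def tensorRightStrong : Cᴹᵒᵖ ⥤ StrongModuleEnd C where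
  obj V := ⟨tensorRightEnd V.unmop, isStrong_tensorRightEnd _⟩
  map {V W} f := ObjectProperty.homMk
    { nat := (tensoringRight C).map f.unmop
      comm := fun M N => by
        change M ◁ (N ◁ f.unmop) ≫ (α_ M N W.unmop).inv =
          (α_ M N V.unmop).inv ≫ ((M ⊗ N) ◁ f.unmop)
        simp }
  map_id V := by
    ext : 2
    exact (tensoringRight C).map_id _
  map_comp f g := by
    ext : 2
    exact (tensoringRight C).map_comp _ _

/-- `V ↦ - ⊗ V` carries the reversed tensor product to composition. -/
def tensorRightStrongCore : (tensorRightStrong C).CoreMonoidal where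
  εIso := (IsStrong C).isoMk <| isoMk (rightUnitorNatIso C).symm fun M N => by
    change M ◁ (ρ_ N).inv ≫ (α_ M N (𝟙_ C)).inv = 𝟙 _ ≫ (ρ_ (M ⊗ N)).inv
    simp
  μIso V W := (IsStrong C).isoMk <| isoMk
    (NatIso.ofComponents (fun N => α_ N W.unmop V.unmop) (fun f => by
      change ((f ▷ W.unmop) ▷ V.unmop) ≫ _ = _ ≫ (f ▷ (W.unmop ⊗ V.unmop))
      simp)) fun M N => by
    change M ◁ (α_ N W.unmop V.unmop).hom ≫ (α_ M N (W.unmop ⊗ V.unmop)).inv =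
      ((α_ M (N ⊗ W.unmop) V.unmop).inv ≫ (α_ M N W.unmop).inv ▷ V.unmop) ≫
        (α_ (M ⊗ N) W.unmop V.unmop).hom
    monoidal
  μIso_hom_natural_left {V W} f X := by
    ext N
    change ((N ⊗ X.unmop) ◁ f.unmop ≫ (𝟙 (N ⊗ X.unmop)) ▷ W.unmop) ≫ (α_ N X.unmop W.unmop).hom =
      (α_ N X.unmop V.unmop).hom ≫ N ◁ (X.unmop ◁ f.unmop)
    simp
  μIso_hom_natural_right {V W} X f := by
    ext N
    change (𝟙 _ ≫ (N ◁ f.unmop) ▷ X.unmop) ≫ (α_ N W.unmop X.unmop).hom =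
      (α_ N V.unmop X.unmop).hom ≫ N ◁ (f.unmop ▷ X.unmop)
    simp
  associativity U V W := by
    ext N
    change ((α_ (N ⊗ W.unmop) V.unmop U.unmop).hom ≫ (𝟙 (N ⊗ W.unmop)) ▷ _) ≫
        (α_ _ _ _).hom ≫ N ◁ (α_ W.unmop V.unmop U.unmop).inv =
      𝟙 _ ≫ (𝟙 _ ≫ (α_ N W.unmop V.unmop).hom ▷ U.unmop) ≫ (α_ _ _ _).hom
    monoidal
  left_unitality V := by
    ext N
    change 𝟙 _ = ((ρ_ (N ⊗ V.unmop)).inv ≫ (𝟙 (N ⊗ V.unmop)) ▷ 𝟙_ C) ≫ (α_ _ _ _).hom ≫ N ◁ (ρ_ V.unmop).hom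
    monoidal
  right_unitality V := by
    ext N
    change 𝟙 _ = (𝟙 _ ≫ (ρ_ N).inv ▷ V.unmop) ≫ (α_ _ _ _).hom ≫ N ◁ (λ_ V.unmop).hom
    monoidal

/-- A strong module endofunctor `F` is isomorphic to `- ⊗ F(𝟙)`. -/
def tensorRightEndIso (F : StrongModuleEnd C) :
    tensorRightEnd (F.obj.functor.obj (𝟙_ C)) ≅ F.obj :=
  LaxModuleEnd.isoMk (NatIso.ofComponents
    (fun N => (@asIso C _ (N ⊗ F.obj.functor.obj (𝟙_ C)) _ (F.obj.str N (𝟙_ C)) (F.property N (𝟙_ C))) ≪≫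
      F.obj.functor.mapIso (ρ_ N))
    (fun {M N} f => by
      change f ▷ _ ≫ F.obj.str N (𝟙_ C) ≫ _ = (F.obj.str M (𝟙_ C) ≫ _) ≫ _
      have := LaxLeftLinear.μₗ_naturality_left F.obj.functor f (𝟙_ C)
      erw [reassoc_of% this]
      simp [← Functor.map_comp])) fun M N => by
    change M ◁ (F.obj.str N (𝟙_ C) ≫ F.obj.functor.map (ρ_ N).hom) ≫ F.obj.str M N =
      (α_ M N _).inv ≫ F.obj.str (M ⊗ N) (𝟙_ C) ≫ F.obj.functor.map (ρ_ (M ⊗ N)).hom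
    have h1 := LaxLeftLinear.μₗ_naturality_right F.obj.functor M (ρ_ N).hom
    have h2 := LaxLeftLinear.μₗ_associativity_inv F.obj.functor M N (𝟙_ C)
    change M ◁ F.obj.functor.map (ρ_ N).hom ≫ F.obj.str M N =
      F.obj.str M (N ⊗ 𝟙_ C) ≫ F.obj.functor.map (M ◁ (ρ_ N).hom) at h1
    change M ◁ F.obj.str N (𝟙_ C) ≫ F.obj.str M (N ⊗ 𝟙_ C) ≫ F.obj.functor.map (α_ M N _).inv =
      (α_ M N _).inv ≫ F.obj.str (M ⊗ N) (𝟙_ C) at h2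
    rw [MonoidalCategory.whiskerLeft_comp, Category.assoc, h1, ← reassoc_of% h2,
      ← Functor.map_comp]
    simp

variable (C) in
/-- Strong module endofunctors of `C` are the functors `- ⊗ V`. -/
def tensorRightEquivalence : Cᴹᵒᵖ ≌ StrongModuleEnd C :=
  CategoryTheory.Equivalence.mk (tensorRightStrong C) (evalUnit C)
    (NatIso.ofComponents (fun V => (λ_ V.unmop).symm.mop) fun {V W} f =>
      Quiver.Hom.unmop_inj (leftUnitor_inv_naturality f.unmop))
    (NatIso.ofComponents (fun F => (IsStrong C).isoMk (tensorRightEndIso F)) fun {F G} f => by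
      ext N
      change N ◁ f.hom.nat.app (𝟙_ C) ≫ G.obj.str N (𝟙_ C) ≫ G.obj.functor.map (ρ_ N).hom =
        (F.obj.str N (𝟙_ C) ≫ F.obj.functor.map (ρ_ N).hom) ≫ f.hom.nat.app N
      have h := f.hom.comm N (𝟙_ C)
      change N ◁ f.hom.nat.app (𝟙_ C) ≫ G.obj.str N (𝟙_ C) =
        F.obj.str N (𝟙_ C) ≫ f.hom.nat.app (N ⊗ 𝟙_ C) at h
      rw [reassoc_of% h, Category.assoc, f.hom.nat.naturality]
      rfl)

end ModuleEnd

end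

end HopfTrimod

namespace HopfTrimod

noncomputable section

section Galois

variable {k : Type u} [Field k] {B : Type u} [Ring B] [Bialgebra k B]
variable {V M X : Type u} [AddCommGroup V] [Module k V] [AddCommGroup M] [Module k M]
  [AddCommGroup X] [Module k X]

/-- The map `B ⊗ V → V ⊗ B`, `b ⊗ v ↦ b₍₁₎ v ⊗ b₍₂₎`. -/
def galoisMap (φ : B →ₐ[k] Module.End k V) : B ⊗[k] V →ₗ[k] V ⊗[k] B :=
  TensorProduct.lift ((LinearMap.rTensorHom B ∘ₗ φ.toLinearMap.flip).flip ∘ₗ Coalgebra.comul)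

lemma galoisMap_tmul (φ : B →ₐ[k] Module.End k V) (b : B) (v : V) :
    galoisMap φ (b ⊗ₜ v) = (φ.toLinearMap.flip v).rTensor B (Coalgebra.comul (R := k) b) := rfl

/-- The map `V ⊗ B → B ⊗ V`, `v ⊗ b ↦ b₍₂₎ ⊗ S(b₍₁₎) v`. -/
def galoisInv (S : B →ₗ[k] B) (φ : B →ₐ[k] Module.End k V) : V ⊗[k] B →ₗ[k] B ⊗[k] V :=
  TensorProduct.lift ((LinearMap.lcomp k _ ((TensorProduct.comm k B B).toLinearMap ∘ₗ
    Coalgebra.comul)) ∘ₗ LinearMap.lTensorHom B ∘ₗ LinearMap.lcomp k V S ∘ₗ φ.toLinearMap.flip)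

lemma galoisInv_tmul (S : B →ₗ[k] B) (φ : B →ₐ[k] Module.End k V) (b : B) (v : V) :
    galoisInv S φ (v ⊗ₜ b) = (φ.toLinearMap.flip v ∘ₗ S).lTensor B
      (TensorProduct.comm k B B (Coalgebra.comul (R := k) b)) := rfl

lemma galoisMap_galoisInv {S : B →ₗ[k] B} (hS : IsTwistedAntipode k B S)
    (φ : B →ₐ[k] Module.End k V) (t : V ⊗[k] B) : galoisMap φ (galoisInv S φ t) = t := by
  induction t with
  | zero => simp
  | add x y hx hy => simp only [map_add, hx, hy]
  | tmul v b =>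
    have e : ∀ p : B ⊗[k] B, galoisMap φ ((φ.toLinearMap.flip v ∘ₗ S).lTensor B
        (TensorProduct.comm k B B p)) =
        (φ.toLinearMap.flip v ∘ₗ LinearMap.mul' k B ∘ₗ S.lTensor B ∘ₗ
          (TensorProduct.comm k B B).toLinearMap).rTensor B
          ((TensorProduct.assoc k B B B).symm
            ((Coalgebra.comul (R := k) (A := B)).lTensor B p)) := by
      intro p
      induction p with
      | zero => simp
      | add x y hx hy => simp only [map_add, hx, hy]
      | tmul a c =>
        simp only [TensorProduct.comm_tmul, LinearMap.lTensor_tmul, galoisMap_tmul]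
        generalize Coalgebra.comul (R := k) c = q
        induction q with
        | add x y hx hy => simp only [map_add, TensorProduct.tmul_add, hx, hy]
        | _ => simp
    have h2 : φ.toLinearMap.flip v ∘ₗ Algebra.linearMap k B = LinearMap.toSpanSingleton k V v := by
      ext; simp
    rw [galoisInv_tmul, e, Coalgebra.coassoc_symm_apply, ← LinearMap.rTensor_comp_apply]
    simp only [LinearMap.comp_assoc]
    rw [hS.2, ← LinearMap.comp_assoc, h2, LinearMap.rTensor_comp_apply,
      Coalgebra.rTensor_counit_comul]
    simp

lemma galoisInv_galoisMap {S : B →ₗ[k] B} (hS : IsTwistedAntipode k B S)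
    (φ : B →ₐ[k] Module.End k V) (t : B ⊗[k] V) : galoisInv S φ (galoisMap φ t) = t := by
  induction t with
  | zero => simp
  | add x y hx hy => simp only [map_add, hx, hy]
  | tmul b v =>
    have e : ∀ p : B ⊗[k] B, galoisInv S φ ((φ.toLinearMap.flip v).rTensor B p) =
        TensorProduct.comm k V B ((φ.toLinearMap.flip v ∘ₗ LinearMap.mul' k B ∘ₗ S.rTensor B ∘ₗ
          (TensorProduct.comm k B B).toLinearMap).rTensor B
          ((TensorProduct.assoc k B B B).symm
            ((Coalgebra.comul (R := k) (A := B)).lTensor B p))) := by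
      intro p
      induction p with
      | zero => simp
      | add x y hx hy => simp only [map_add, hx, hy]
      | tmul a c =>
        simp only [LinearMap.rTensor_tmul, LinearMap.lTensor_tmul, galoisInv_tmul]
        generalize Coalgebra.comul (R := k) c = q
        induction q with
        | add x y hx hy => simp only [map_add, TensorProduct.tmul_add, hx, hy]
        | _ => simp
    have h2 : φ.toLinearMap.flip v ∘ₗ Algebra.linearMap k B = LinearMap.toSpanSingleton k V v := by
      ext; simp
    rw [galoisMap_tmul, e, Coalgebra.coassoc_symm_apply, ← LinearMap.rTensor_comp_apply]
    simp only [LinearMap.comp_assoc]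
    rw [hS.1, ← LinearMap.comp_assoc, h2, LinearMap.rTensor_comp_apply,
      Coalgebra.rTensor_counit_comul]
    simp

lemma galoisMap_bijective {S : B →ₗ[k] B} (hS : IsTwistedAntipode k B S)
    (φ : B →ₐ[k] Module.End k V) : Function.Bijective (galoisMap φ) :=
  ⟨Function.LeftInverse.injective (galoisInv_galoisMap hS φ),
    Function.RightInverse.surjective (galoisMap_galoisInv hS φ)⟩

/-- The map `B ⊗ M → M`, `b ⊗ m ↦ ε(b) m`. -/
def counitLeft (k B M : Type u) [Field k] [Ring B] [Bialgebra k B] [AddCommGroup M] [Module k M] :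
    B ⊗[k] M →ₗ[k] M :=
  (TensorProduct.lid k M).toLinearMap ∘ₗ (Coalgebra.counit (R := k) (A := B)).rTensor M

@[simp] lemma counitLeft_tmul (b : B) (m : M) :
    counitLeft k B M (b ⊗ₜ m) = Coalgebra.counit (R := k) b • m := rfl

lemma comm_counitLeft_freeRight (t : B ⊗[k] M) :
    TensorProduct.comm k M B ((counitLeft k B M).rTensor B (freeRight k B M t)) = t := by
  induction t with
  | zero => simp
  | add x y hx hy => simp only [map_add, hx, hy]
  | tmul b m =>
    have e : ∀ p : B ⊗[k] B, TensorProduct.comm k M B ((counitLeft k B M).rTensor B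
        (TensorProduct.rightComm k B B M (p ⊗ₜ m))) =
        TensorProduct.lid k B ((Coalgebra.counit (R := k) (A := B)).rTensor B p) ⊗ₜ m := by
      intro p
      induction p with
      | add x y hx hy => simp only [map_add, TensorProduct.add_tmul, hx, hy]
      | _ => simp [TensorProduct.smul_tmul]
    rw [freeRight_tmul, e, Coalgebra.rTensor_counit_comul]
    simp

/-- The coinvariants of a right coaction. -/
def coinvariants (r : X →ₗ[k] X ⊗[k] B) : Submodule k X :=
  LinearMap.eqLocus r ((TensorProduct.mk k X B).flip 1)

lemma mem_coinvariants {r : X →ₗ[k] X ⊗[k] B} {x : X} : x ∈ coinvariants r ↔ r x = x ⊗ₜ 1 :=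
  Iff.rfl

lemma eq_of_mem_coinvariants_free {t : B ⊗[k] M} (ht : t ∈ coinvariants (freeRight k B M)) :
    t = 1 ⊗ₜ counitLeft k B M t := by
  conv_lhs => rw [← comm_counitLeft_freeRight t, mem_coinvariants.1 ht]
  simp

lemma one_tmul_mem_coinvariants (m : M) : (1 : B) ⊗ₜ m ∈ coinvariants (freeRight k B M) := by
  rw [mem_coinvariants, freeRight_tmul, Bialgebra.comul_one, Algebra.TensorProduct.one_def]
  simp

lemma lcoact_mem_coinvariants {l : X →ₗ[k] B ⊗[k] X} {r : X →ₗ[k] X ⊗[k] B}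
    (h : Bicompatible l r) (x : X) (hx : x ∈ coinvariants r) :
    l x ∈ LinearMap.range ((coinvariants r).subtype.lTensor B) := by
  refine (mem_range_lTensor_eqLocus _ _ _).2 ?_
  rw [h.apply, mem_coinvariants.1 hx, LinearMap.rTensor_tmul]
  generalize l x = p
  induction p with
  | add x y hx hy => simp only [map_add, TensorProduct.add_tmul, hx, hy]
  | _ => simp

variable {φ : B →ₐ[k] Module.End k X} {r : X →ₗ[k] X ⊗[k] B}

lemma galoisMap_diagAction_lTensor (hφ : ∀ b x, r (φ b x) = diagAction φ (regular k B) b (r x))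
    (t : B ⊗[k] X) : galoisMap (diagAction φ (regular k B)) (r.lTensor B t) =
      r.rTensor B (galoisMap φ t) := by
  induction t with
  | zero => simp
  | add x y hx hy => simp only [map_add, hx, hy]
  | tmul b x =>
    rw [LinearMap.lTensor_tmul, galoisMap_tmul, galoisMap_tmul]
    generalize Coalgebra.comul (R := k) b = p
    induction p with
    | add x y hx hy => simp only [map_add, hx, hy]
    | _ => simp [hφ]

variable (φ) in
lemma galoisMap_diagAction_one (t : B ⊗[k] X) : galoisMap (diagAction φ (regular k B))
      (((TensorProduct.mk k X B).flip 1).lTensor B t) =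
      (TensorProduct.assoc k X B B).symm
        ((Coalgebra.comul (R := k) (A := B)).lTensor X (galoisMap φ t)) := by
  induction t with
  | zero => simp
  | add x y hx hy => simp only [map_add, hx, hy]
  | tmul b x =>
    rw [LinearMap.lTensor_tmul, galoisMap_tmul, galoisMap_tmul]
    have e1 : ∀ p : B ⊗[k] B, ((diagAction φ (regular k B)).toLinearMap.flip
        ((TensorProduct.mk k X B).flip 1 x)).rTensor B p =
        ((φ.toLinearMap.flip x).rTensor B).rTensor B
          ((Coalgebra.comul (R := k) (A := B)).rTensor B p) := by
      intro p
      induction p with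
      | zero => simp
      | add x y hx hy => simp only [map_add, hx, hy]
      | tmul a c =>
        simp only [LinearMap.rTensor_tmul, LinearMap.flip_apply, AlgHom.toLinearMap_apply,
          TensorProduct.mk_apply, diagAction_apply]
        generalize Coalgebra.comul (R := k) a = q
        induction q with
        | add x y hx hy =>
          simp only [map_add, LinearMap.add_apply, TensorProduct.add_tmul, hx, hy]
        | _ => simp
    have e2 : ∀ p : B ⊗[k] B, (TensorProduct.assoc k X B B).symm
        ((Coalgebra.comul (R := k) (A := B)).lTensor X ((φ.toLinearMap.flip x).rTensor B p)) =
        ((φ.toLinearMap.flip x).rTensor B).rTensor B ((TensorProduct.assoc k B B B).symm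
          ((Coalgebra.comul (R := k) (A := B)).lTensor B p)) := by
      intro p
      induction p with
      | zero => simp
      | add x y hx hy => simp only [map_add, hx, hy]
      | tmul a c =>
        simp only [LinearMap.rTensor_tmul, LinearMap.lTensor_tmul]
        generalize Coalgebra.comul (R := k) c = q
        induction q with
        | add x y hx hy => simp only [map_add, TensorProduct.tmul_add, hx, hy]
        | _ => simp
    rw [e1, e2, Coalgebra.coassoc_symm_apply]

/-- The multiplication `B ⊗ Xᶜᵒ → X`. -/
def coinvariantsCounit (φ : B →ₐ[k] Module.End k X) (r : X →ₗ[k] X ⊗[k] B) :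
    B ⊗[k] coinvariants r →ₗ[k] X :=
  actMap φ ∘ₗ (coinvariants r).subtype.lTensor B

variable (φ) in
lemma rid_galoisMap (t : B ⊗[k] X) : TensorProduct.rid k X
    ((Coalgebra.counit (R := k) (A := B)).lTensor X (galoisMap φ t)) = actMap φ t := by
  induction t with
  | zero => simp
  | add x y hx hy => simp only [map_add, hx, hy]
  | tmul b x =>
    have e : ∀ p : B ⊗[k] B, TensorProduct.rid k X ((Coalgebra.counit (R := k) (A := B)).lTensor X
        ((φ.toLinearMap.flip x).rTensor B p)) =
        φ (TensorProduct.rid k B ((Coalgebra.counit (R := k) (A := B)).lTensor B p)) x := by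
      intro p
      induction p with
      | add x y hx hy => simp only [map_add, hx, hy, LinearMap.add_apply]
      | _ => simp
    rw [galoisMap_tmul, e, Coalgebra.lTensor_counit_comul]
    simp

lemma rcoact_coinvariantsCounit (hφ : ∀ b x, r (φ b x) = diagAction φ (regular k B) b (r x))
    (t : B ⊗[k] coinvariants r) :
    r (coinvariantsCounit φ r t) = galoisMap φ ((coinvariants r).subtype.lTensor B t) := by
  induction t with
  | zero => simp
  | add x y hx hy => simp only [map_add, hx, hy]
  | tmul b x =>
    simp only [coinvariantsCounit, LinearMap.comp_apply, LinearMap.lTensor_tmul,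
      Submodule.subtype_apply, actMap_tmul, hφ, galoisMap_tmul, mem_coinvariants.1 x.2,
      diagAction_apply]
    generalize Coalgebra.comul (R := k) b = p
    induction p with
    | add x y hx hy => simp only [map_add, hx, hy, LinearMap.add_apply]
    | _ => simp

lemma coinvariantsCounit_bijective {S : B →ₗ[k] B} (hS : IsTwistedAntipode k B S)
    (hr : IsRightCoaction r) (hφ : ∀ b x, r (φ b x) = diagAction φ (regular k B) b (r x)) :
    Function.Bijective (coinvariantsCounit φ r) := by
  constructor
  · intro t t' h
    have h := congrArg r h
    rw [rcoact_coinvariantsCounit hφ, rcoact_coinvariantsCounit hφ] at h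
    exact lTensor_inj B (Submodule.injective_subtype _) ((galoisMap_bijective hS φ).1 h)
  · intro x
    obtain ⟨t, ht⟩ := (galoisMap_bijective hS φ).2 (r x)
    have h : t ∈ LinearMap.range ((coinvariants r).subtype.lTensor B) := by
      refine (mem_range_lTensor_eqLocus _ _ _).2
        ((galoisMap_bijective hS (diagAction φ (regular k B))).1 ?_)
      rw [galoisMap_diagAction_lTensor hφ, galoisMap_diagAction_one, ht, ← hr.coassoc_apply,
        LinearEquiv.symm_apply_apply]
    obtain ⟨s, rfl⟩ := h
    refine ⟨s, ?_⟩
    have := rid_galoisMap φ ((coinvariants r).subtype.lTensor B s)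
    rw [ht, hr.counit_apply] at this
    exact this.symm

end Galois

section GaloisRegular

variable {k : Type u} [Field k] {B : Type u} [Ring B] [Bialgebra k B]

lemma galoisMap_mulRight (n : B) (t : B ⊗[k] B) :
    galoisMap (regular k B) ((LinearMap.mulRight k n).lTensor B t) =
      (LinearMap.mulRight k n).rTensor B (galoisMap (regular k B) t) := by
  induction t with
  | zero => simp
  | add x y hx hy => simp only [map_add, hx, hy]
  | tmul b m =>
    rw [LinearMap.lTensor_tmul, galoisMap_tmul, galoisMap_tmul]
    generalize Coalgebra.comul (R := k) b = p
    induction p with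
    | add x y hx hy => simp only [map_add, hx, hy]
    | _ => simp [mul_assoc]

lemma galoisMap_freeRight (t : B ⊗[k] B) :
    (galoisMap (regular k B)).rTensor B (freeRight k B B t) =
      (TensorProduct.assoc k B B B).symm
        ((Coalgebra.comul (R := k) (A := B)).lTensor B (galoisMap (regular k B) t)) := by
  rw [← galoisMap_diagAction_one]
  induction t with
  | zero => simp
  | add x y hx hy => simp only [map_add, hx, hy]
  | tmul b m =>
    rw [LinearMap.lTensor_tmul, galoisMap_tmul, freeRight_tmul]
    generalize Coalgebra.comul (R := k) b = p
    induction p with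
    | zero => simp
    | add x y hx hy => simp only [map_add, TensorProduct.add_tmul, hx, hy]
    | tmul a c =>
      simp only [TensorProduct.rightComm_tmul, LinearMap.rTensor_tmul, galoisMap_tmul,
        LinearMap.flip_apply, AlgHom.toLinearMap_apply, diagAction_apply]
      generalize Coalgebra.comul (R := k) a = q
      induction q with
      | add x y hx hy =>
        simp only [map_add, TensorProduct.add_tmul, hx, hy, LinearMap.add_apply]
      | _ => simp

lemma hasTwistedAntipode_of_galoisMap_bijective
    (h : Function.Bijective (galoisMap (regular k B))) : HasTwistedAntipode k B := by
  let e := LinearEquiv.ofBijective _ h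
  let γ : B →ₗ[k] B ⊗[k] B := e.symm.toLinearMap ∘ₗ TensorProduct.mk k B B 1
  have hγ : ∀ b, galoisMap (regular k B) (γ b) = 1 ⊗ₜ b := fun b => e.apply_symm_apply _
  let S : B →ₗ[k] B := counitLeft k B B ∘ₗ γ
  have h1 : ∀ b, freeRight k B B (γ b) = γ.rTensor B (Coalgebra.comul (R := k) b) := by
    intro b
    apply (e.rTensor B).injective
    change (galoisMap (regular k B)).rTensor B _ = (galoisMap (regular k B)).rTensor B _
    rw [galoisMap_freeRight, hγ, LinearMap.lTensor_tmul]
    generalize Coalgebra.comul (R := k) b = p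
    induction p with
    | add x y hx hy => simp only [map_add, TensorProduct.tmul_add, hx, hy]
    | _ => simp [hγ]
  have h2 : ∀ b, γ b = S.lTensor B (TensorProduct.comm k B B (Coalgebra.comul (R := k) b)) := by
    intro b
    rw [← comm_counitLeft_freeRight (γ b), h1, ← LinearMap.rTensor_comp_apply]
    generalize Coalgebra.comul (R := k) b = p
    induction p with
    | add x y hx hy => simp only [map_add, hx, hy]
    | _ => simp [S]
  have h3 : ∀ n c, e.symm (n ⊗ₜ c) = (LinearMap.mulRight k n).lTensor B (γ c) := by
    intro n c
    rw [LinearEquiv.symm_apply_eq]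
    change _ = galoisMap _ _
    rw [galoisMap_mulRight, hγ]
    simp
  refine ⟨S, ?_, ?_⟩
  · ext b
    have h4 : galoisMap (regular k B) (b ⊗ₜ 1) = Coalgebra.comul (R := k) b := by
      rw [galoisMap_tmul]
      have : (regular k B).toLinearMap.flip 1 = LinearMap.id := LinearMap.ext fun b => by simp
      rw [this, LinearMap.rTensor_id_apply]
    have h5 : ∀ p : B ⊗[k] B, counitLeft k B B (e.symm p) =
        LinearMap.mul' k B (S.rTensor B (TensorProduct.comm k B B p)) := by
      intro p
      induction p with
      | zero => simp
      | add x y hx hy => simp only [map_add, hx, hy]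
      | tmul n c =>
        rw [h3]
        simp only [TensorProduct.comm_tmul, LinearMap.rTensor_tmul, LinearMap.mul'_apply, S,
          LinearMap.comp_apply]
        generalize γ c = q
        induction q with
        | add x y hx hy => simp only [map_add, add_mul, hx, hy]
        | _ => simp
    have h6 := h5 (Coalgebra.comul (R := k) b)
    rw [← h4, show e.symm (galoisMap (regular k B) (b ⊗ₜ 1)) = b ⊗ₜ 1 from
      e.symm_apply_apply _, h4] at h6
    simp only [LinearMap.comp_apply, LinearEquiv.coe_coe, ← h6]
    simp [Algebra.algebraMap_eq_smul_one]
  · ext b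
    have h4 := rid_galoisMap (regular k B) (γ b)
    rw [hγ, h2] at h4
    have h5 : actMap (regular k B) = LinearMap.mul' k B := by ext; simp
    rw [h5] at h4
    simp only [LinearMap.comp_apply, LinearEquiv.coe_coe, ← h4]
    simp [Algebra.algebraMap_eq_smul_one]

end GaloisRegular

end

end HopfTrimod

namespace HopfTrimod

noncomputable section

section FreeEquivalence

variable {k : Type u} [Field k] {B : Type u} [Ring B] [Bialgebra k B]

instance : (freeFunctor k B).Faithful where
  map_injective {M N} f g h := LeftComod.hom_ext <| LinearMap.ext fun m => by
    have h1 : f.lin.lTensor B ((1 : B) ⊗ₜ[k] m) = g.lin.lTensor B (1 ⊗ₜ m) :=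
      LinearMap.congr_fun (congrArg HopfTrimodule.Hom.lin h) _
    simpa using congrArg (counitLeft k B N.carrier) h1

lemma map_mem_coinvariants {X Y : Type u} [AddCommGroup X] [Module k X] [AddCommGroup Y]
    [Module k Y] {r : X →ₗ[k] X ⊗[k] B} {s : Y →ₗ[k] Y ⊗[k] B} (f : X →ₗ[k] Y)
    (hf : ∀ x, s (f x) = f.rTensor B (r x)) {x : X} (hx : x ∈ coinvariants r) :
    f x ∈ coinvariants s := by
  rw [mem_coinvariants] at hx ⊢
  rw [hf, hx, LinearMap.rTensor_tmul]

lemma diagCoaction_one_tmul {M : Type u} [AddCommGroup M] [Module k M] (c : M →ₗ[k] B ⊗[k] M)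
    (m : M) : diagCoaction (Coalgebra.comul (R := k) (A := B)) c (1 ⊗ₜ m) =
      (TensorProduct.mk k B M 1).lTensor B (c m) := by
  simp only [diagCoaction, LinearMap.comp_apply, TensorProduct.map_tmul, Bialgebra.comul_one,
    LinearEquiv.coe_coe, Algebra.TensorProduct.one_def]
  generalize c m = q
  induction q with
  | add x y hx hy => simp only [map_add, TensorProduct.tmul_add, hx, hy]
  | _ => simp

lemma apply_tmul_of_act {M X : Type u} [AddCommGroup M] [Module k M] [AddCommGroup X] [Module k X]
    {φ : B →ₐ[k] Module.End k X} (h : B ⊗[k] M →ₗ[k] X)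
    (hh : ∀ b t, h (freeAct k B M b t) = φ b (h t)) (b : B) (m : M) :
    h (b ⊗ₜ m) = φ b (h (1 ⊗ₜ m)) := by
  rw [← hh, freeAct_tmul, mul_one]

lemma counitLeft_colinear {M N : Type u} [AddCommGroup M] [Module k M] [AddCommGroup N]
    [Module k N] {c : M →ₗ[k] B ⊗[k] M} {d : N →ₗ[k] B ⊗[k] N} (h : B ⊗[k] M →ₗ[k] B ⊗[k] N)
    (f : M →ₗ[k] N) (hf : ∀ m, h (1 ⊗ₜ m) = 1 ⊗ₜ f m)
    (hh : ∀ t, diagCoaction (Coalgebra.comul (R := k) (A := B)) d (h t) =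
      h.lTensor B (diagCoaction (Coalgebra.comul (R := k) (A := B)) c t)) (m : M) :
    d (f m) = f.lTensor B (c m) := by
  have h1 := hh (1 ⊗ₜ m)
  rw [hf, diagCoaction_one_tmul, diagCoaction_one_tmul, ← LinearMap.lTensor_comp_apply,
    show h ∘ₗ TensorProduct.mk k B M 1 = TensorProduct.mk k B N 1 ∘ₗ f from LinearMap.ext hf] at h1
  replace h1 := congrArg ((counitLeft k B N).lTensor B) h1
  have h2 : counitLeft k B N ∘ₗ TensorProduct.mk k B N 1 = LinearMap.id := by
    ext; simp
  rw [LinearMap.lTensor_comp_apply, ← LinearMap.lTensor_comp_apply, ← LinearMap.lTensor_comp_apply,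
    h2] at h1
  simpa using h1

instance : (freeFunctor k B).Full where
  map_surjective {M N} h := by
    let h' : B ⊗[k] M.carrier →ₗ[k] B ⊗[k] N.carrier := h.lin
    let f : M.carrier →ₗ[k] N.carrier :=
      counitLeft k B N.carrier ∘ₗ h' ∘ₗ TensorProduct.mk k B M.carrier 1
    have hf : ∀ m, h' (1 ⊗ₜ m) = 1 ⊗ₜ[k] f m := fun m =>
      eq_of_mem_coinvariants_free (map_mem_coinvariants h' h.rcomm (one_tmul_mem_coinvariants m))
    refine ⟨⟨f, LinearMap.ext (counitLeft_colinear h' f hf h.lcomm)⟩,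
      HopfTrimodule.hom_ext <| TensorProduct.ext' fun b m => ?_⟩
    change b ⊗ₜ f m = h' (b ⊗ₜ m)
    rw [apply_tmul_of_act (φ := freeAct k B N.carrier) h' h.acomm, hf, freeAct_tmul, mul_one]

namespace HopfTrimodule

/-- The left comodule of right coinvariants of a Hopf trimodule. -/
@[simps] def coinvariantsComod (X : HopfTrimodule k B) : LeftComod k B where
  carrier := coinvariants X.rcoact
  coact := restrictLeft _ X.lcoact (lcoact_mem_coinvariants X.bicompatible)
  isCoaction := X.isLeft.restrict _ _

lemma coinvariantsCounit_lcoact (X : HopfTrimodule k B)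
    (t : B ⊗[k] coinvariants X.rcoact) :
    X.lcoact (coinvariantsCounit X.act X.rcoact t) =
      (coinvariantsCounit X.act X.rcoact).lTensor B
        (diagCoaction (Coalgebra.comul (R := k) (A := B))
          (restrictLeft _ X.lcoact (lcoact_mem_coinvariants X.bicompatible)) t) := by
  induction t with
  | zero => simp
  | add x y hx hy => simp only [map_add, hx, hy]
  | tmul b x =>
    have h1 : X.lcoact x.1 = _ :=
      (restrictLeft_apply _ X.lcoact (lcoact_mem_coinvariants X.bicompatible) x).symm
    change X.lcoact (X.act b x) = _
    rw [X.lcoact_act, h1, diagAction_apply]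
    simp only [diagCoaction, LinearMap.comp_apply, TensorProduct.map_tmul, LinearEquiv.coe_coe]
    generalize Coalgebra.comul (R := k) b = p
    generalize restrictLeft _ X.lcoact (lcoact_mem_coinvariants X.bicompatible) x = q
    induction p with
    | zero => simp
    | add x y hx hy => simp only [map_add, TensorProduct.add_tmul, hx, hy, LinearMap.add_apply]
    | tmul a c =>
      induction q with
      | add x y hx hy => simp only [map_add, TensorProduct.tmul_add, hx, hy]
      | _ => simp [coinvariantsCounit]

lemma coinvariantsCounit_rcoact (X : HopfTrimodule k B)
    (t : B ⊗[k] coinvariants X.rcoact) :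
    X.rcoact (coinvariantsCounit X.act X.rcoact t) =
      (coinvariantsCounit X.act X.rcoact).rTensor B (freeRight k B _ t) := by
  rw [rcoact_coinvariantsCounit X.rcoact_act]
  induction t with
  | zero => simp
  | add x y hx hy => simp only [map_add, hx, hy]
  | tmul b x =>
    rw [LinearMap.lTensor_tmul, galoisMap_tmul, freeRight_tmul]
    generalize Coalgebra.comul (R := k) b = p
    induction p with
    | add x y hx hy => simp only [map_add, TensorProduct.add_tmul, hx, hy]
    | _ => simp [coinvariantsCounit]

lemma coinvariantsCounit_act (X : HopfTrimodule k B) (b : B)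
    (t : B ⊗[k] coinvariants X.rcoact) :
    coinvariantsCounit X.act X.rcoact (freeAct k B _ b t) =
      X.act b (coinvariantsCounit X.act X.rcoact t) := by
  induction t with
  | add x y hx hy => simp only [map_add, hx, hy]
  | _ => simp [coinvariantsCounit]

variable (k B) in
lemma comul_regular (b x : B) : Coalgebra.comul (R := k) (regular k B b x) =
    diagAction (regular k B) (regular k B) b (Coalgebra.comul (R := k) x) :=
  (unit k B).lcoact_act b x

variable (k B) in
/-- The Hopf trimodule `B ⊗ B` with the left coaction of the first factor, the right coaction of
the second factor and the diagonal action. -/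
def square : HopfTrimodule k B where
  carrier := B ⊗[k] B
  lcoact := leftTensor (Coalgebra.comul (R := k) (A := B)) B
  rcoact := rightTensor (Coalgebra.comul (R := k) (A := B)) B
  act := diagAction (regular k B) (regular k B)
  isLeft := IsLeftCoaction.leftTensor (N := B) (isLeftCoaction_comul k B)
  isRight := IsRightCoaction.rightTensor (M := B) (isRightCoaction_comul k B)
  bicompatible := bicompatible_tensor (X := B) (Y := B) Coalgebra.comul Coalgebra.comul
  lcoact_act b x := leftTensor_diagAction (φ := regular k B) (regular k B) (comul_regular k B) b x
  rcoact_act b x := rightTensor_diagAction (regular k B) (ψ := regular k B) (comul_regular k B) b x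

lemma square_coinvariants {t : B ⊗[k] B} (ht : t ∈
     coinvariants (rightTensor (Coalgebra.comul (R := k) (A := B)) B)) :
    t = TensorProduct.rid k B ((Coalgebra.counit (R := k) (A := B)).lTensor B t) ⊗ₜ 1 := by
  have e : ∀ t : B ⊗[k] B, ((TensorProduct.rid k B).toLinearMap ∘ₗ
      (Coalgebra.counit (R := k) (A := B)).lTensor B).rTensor B
        (rightTensor (Coalgebra.comul (R := k) (A := B)) B t) = t := by
    intro t
    induction t with
    | zero => simp
    | add x y hx hy => simp only [map_add, hx, hy]
    | tmul a b =>
      have e : ∀ p : B ⊗[k] B, ((TensorProduct.rid k B).toLinearMap ∘ₗ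
          (Coalgebra.counit (R := k) (A := B)).lTensor B).rTensor B
            ((TensorProduct.assoc k B B B).symm (a ⊗ₜ p)) =
          a ⊗ₜ TensorProduct.lid k B ((Coalgebra.counit (R := k) (A := B)).rTensor B p) := by
        intro p
        induction p with
        | add x y hx hy => simp only [map_add, TensorProduct.tmul_add, hx, hy]
        | _ => simp [TensorProduct.smul_tmul]
      rw [rightTensor_tmul, e, Coalgebra.rTensor_counit_comul]
      simp
  have h := e t
  rw [show rightTensor (Coalgebra.comul (R := k) (A := B)) B t = t ⊗ₜ 1 from ht] at h
  exact h.symm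

lemma tmul_one_mem_coinvariants (x : B) :
    (x ⊗ₜ 1 : B ⊗[k] B) ∈ coinvariants (rightTensor (Coalgebra.comul (R := k) (A := B)) B) := by
  rw [mem_coinvariants, rightTensor_tmul, Bialgebra.comul_one, Algebra.TensorProduct.one_def]
  simp

end HopfTrimodule

open HopfTrimodule

variable (k B) in
theorem hasTwistedAntipode_iff_isEquivalence :
    HasTwistedAntipode k B ↔ (freeFunctor k B).IsEquivalence := by
  constructor
  · rintro ⟨S, hS⟩
    have : (freeFunctor k B).EssSurj := ⟨fun X => ⟨X.coinvariantsComod, ⟨isoMk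
      (X := freeTrimodule k B X.coinvariantsComod) (Y := X)
      (LinearEquiv.ofBijective _ (coinvariantsCounit_bijective hS X.isRight X.rcoact_act))
      X.coinvariantsCounit_lcoact X.coinvariantsCounit_rcoact X.coinvariantsCounit_act⟩⟩⟩
    exact { }
  · intro h
    apply hasTwistedAntipode_of_galoisMap_bijective
    obtain ⟨M, ⟨g⟩⟩ := h.essSurj.mem_essImage (square k B)
    change freeTrimodule k B M ≅ square k B at g
    let f : B ⊗[k] M.carrier →ₗ[k] B ⊗[k] B := g.hom.lin
    let f' : B ⊗[k] B →ₗ[k] B ⊗[k] M.carrier := g.inv.lin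
    let n : M.carrier →ₗ[k] B := (TensorProduct.rid k B).toLinearMap ∘ₗ
      (Coalgebra.counit (R := k) (A := B)).lTensor B ∘ₗ f ∘ₗ TensorProduct.mk k B _ 1
    have hn : ∀ m, f (1 ⊗ₜ m) = n m ⊗ₜ[k] 1 := fun m =>
      square_coinvariants (map_mem_coinvariants f g.hom.rcomm (one_tmul_mem_coinvariants m))
    have hg : ∀ t, f' (f t) = t := fun t =>
      LinearMap.congr_fun (congrArg Hom.lin g.hom_inv_id) t
    have hg' : ∀ t, f (f' t) = t := fun t =>
      LinearMap.congr_fun (congrArg Hom.lin g.inv_hom_id) t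
    have hn' : Function.Surjective n := by
      intro x
      have h1 := eq_of_mem_coinvariants_free
        (map_mem_coinvariants f' g.inv.rcomm (tmul_one_mem_coinvariants x))
      refine ⟨counitLeft k B M.carrier (f' (x ⊗ₜ[k] 1)), ?_⟩
      have h2 := hn (counitLeft k B M.carrier (f' (x ⊗ₜ[k] 1)))
      rw [← h1, hg'] at h2
      have h3 := congrArg (fun t => TensorProduct.rid k B
        ((Coalgebra.counit (R := k) (A := B)).lTensor B t)) h2
      simpa using h3.symm
    have hβ : ∀ t, galoisMap (regular k B) (n.lTensor B t) = f t := by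
      intro t
      induction t with
      | zero => simp
      | add x y hx hy => simp only [map_add, hx, hy]
      | tmul b m =>
        rw [apply_tmul_of_act (φ := diagAction (regular k B) (regular k B)) f g.hom.acomm, hn,
          LinearMap.lTensor_tmul, galoisMap_tmul, diagAction_apply]
        generalize Coalgebra.comul (R := k) b = p
        induction p with
        | add x y hx hy => simp only [map_add, hx, hy, LinearMap.add_apply]
        | _ => simp
    constructor
    · intro t t' h
      obtain ⟨s, rfl⟩ := LinearMap.lTensor_surjective B hn' t
      obtain ⟨s', rfl⟩ := LinearMap.lTensor_surjective B hn' t'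
      rw [hβ, hβ] at h
      rw [← hg s, h, hg]
    · intro t
      exact ⟨n.lTensor B (f' t), (hβ _).trans (hg' t)⟩

end FreeEquivalence

end

end HopfTrimod

namespace HopfTrimod

noncomputable section

section Comonadic

open Limits

variable (k : Type u) [Field k] (B : Type u) [Ring B] [Bialgebra k B]

variable {k B} in
lemma counitLeft_lTensor_leftTensor {V : Type u} [AddCommGroup V] [Module k V] (t : B ⊗[k] V) :
    (counitLeft k B V).lTensor B (leftTensor (Coalgebra.comul (R := k) (A := B)) V t) = t := by
  induction t with
  | zero => simp
  | add x y hx hy => simp only [map_add, hx, hy]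
  | tmul b v =>
    have e : ∀ p : B ⊗[k] B, (counitLeft k B V).lTensor B (TensorProduct.assoc k B B V (p ⊗ₜ v)) =
        TensorProduct.rid k B ((Coalgebra.counit (R := k) (A := B)).lTensor B p) ⊗ₜ v := fun p => by
      induction p with
      | add x y hx hy => simp only [map_add, TensorProduct.add_tmul, hx, hy]
      | _ => simp [TensorProduct.smul_tmul]
    rw [leftTensor_tmul, e]
    congr 1
    exact (isRightCoaction_comul k B).counit_apply b

/-- The comonad `B ⊗ -` on vector spaces. -/
def tensorComonad : Comonad (ModuleCat.{u} k) where
  toFunctor := tensorLeft (ModuleCat.of k B)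
  ε := { app V := ModuleCat.ofHom (counitLeft k B V)
         naturality V W f := by
          ext : 1
          exact TensorProduct.ext' fun b v => (map_smul f.hom _ _).symm }
  δ := { app V := ModuleCat.ofHom (leftTensor (Coalgebra.comul (R := k) (A := B)) V)
         naturality V W f := by
          ext : 1
          exact LinearMap.ext fun t => leftTensor_map LinearMap.id f.hom (fun b =>
            (LinearMap.congr_fun (LinearMap.lTensor_id B B) _).symm) t }
  coassoc V := by
    ext : 1
    exact ((isLeftCoaction_comul k B).leftTensor (N := V)).coassoc.symm
  left_counit V := by
    ext : 1
    exact ((isLeftCoaction_comul k B).leftTensor (N := V)).counit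
  right_counit V := by
    ext : 1
    exact LinearMap.ext counitLeft_lTensor_leftTensor

/-- Left comodules as coalgebras over the comonad `B ⊗ -`. -/
def toCoalgebra : LeftComod k B ⥤ (tensorComonad k B).Coalgebra where
  obj M :=
    { A := ModuleCat.of k M.carrier
      a := ModuleCat.ofHom M.coact
      counit := ModuleCat.hom_ext M.isCoaction.counit
      coassoc := ModuleCat.hom_ext M.isCoaction.coassoc }
  map f :=
    { f := ModuleCat.ofHom f.lin
      h := ModuleCat.hom_ext f.comm.symm }

instance : (toCoalgebra k B).Faithful where
  map_injective h := LeftComod.hom_ext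
    (congrArg (fun f => ModuleCat.Hom.hom (Comonad.Coalgebra.Hom.f f)) h)

instance : (toCoalgebra k B).Full where
  map_surjective f := ⟨⟨f.f.hom, (congrArg ModuleCat.Hom.hom f.h).symm⟩, rfl⟩

instance : (toCoalgebra k B).EssSurj where
  mem_essImage X := ⟨⟨X.A, X.a.hom, ⟨congrArg ModuleCat.Hom.hom X.coassoc,
    congrArg ModuleCat.Hom.hom X.counit⟩⟩, ⟨Iso.refl _⟩⟩

instance : (toCoalgebra k B).IsEquivalence where

instance (J : Type*) [Category J] [FinCategory J] :
    PreservesLimitsOfShape J (tensorComonad k B).toFunctor :=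
  inferInstanceAs (PreservesLimitsOfShape J (tensorLeft (ModuleCat.of k B)))

/-- The forgetful functor creates finite limits. -/
instance (J : Type) [SmallCategory J] [FinCategory J] :
    CreatesLimitsOfShape J (LeftComod.forget k B) :=
  inferInstanceAs (CreatesLimitsOfShape J (toCoalgebra k B ⋙ (tensorComonad k B).forget))

/-- The forgetful functor creates colimits. -/
instance (J : Type u) [SmallCategory J] :
    CreatesColimitsOfShape J (LeftComod.forget k B) :=
  inferInstanceAs (CreatesColimitsOfShape J (toCoalgebra k B ⋙ (tensorComonad k B).forget))

/-- The underlying set of `X ⊗ M`, for a comodule `M`. -/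
abbrev tensorType (X : Type u) [AddCommGroup X] [Module k X] : LeftComod k B ⥤ Type u :=
  LeftComod.forget k B ⋙ tensorLeft (ModuleCat.of k X) ⋙ CategoryTheory.forget (ModuleCat k)

/-- The underlying set of a comodule. -/
abbrev comodType : LeftComod k B ⥤ Type u :=
  LeftComod.forget k B ⋙ CategoryTheory.forget (ModuleCat k)

variable {k B}

lemma lTensor_lTensor_assoc_symm (X Y : Type u) [AddCommGroup X] [Module k X] [AddCommGroup Y]
    [Module k Y] {M N : Type u} [AddCommGroup M] [Module k M] [AddCommGroup N] [Module k N]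
    (f : M →ₗ[k] N) (t : X ⊗[k] (Y ⊗[k] M)) :
    (TensorProduct.assoc k X Y N).symm ((f.lTensor Y).lTensor X t) =
      f.lTensor (X ⊗[k] Y) ((TensorProduct.assoc k X Y M).symm t) := by
  rw [LinearMap.lTensor_tensor]
  simp

lemma comod_isLimit_iff {J : Type} [SmallCategory J] [FinCategory J] {K : J ⥤ LeftComod k B}
    (c : Cone K) : Nonempty (IsLimit c) ↔ ∀ s : ∀ j, (K.obj j).carrier,
      (∀ {i j} (f : i ⟶ j), (K.map f).lin (s i) = s j) →
        ∃! x : c.pt.carrier, ∀ j, (c.π.app j).lin x = s j := by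
  trans Nonempty (IsLimit ((comodType k B).mapCone c))
  · exact ⟨fun ⟨h⟩ => ⟨isLimitOfPreserves _ h⟩, fun ⟨h⟩ => ⟨isLimitOfReflects _ h⟩⟩
  · rw [Types.isLimit_iff]
    exact ⟨fun h s hs => h s hs, fun h s hs => h s hs⟩

lemma existsUnique_tensor_of_isLimit (X : Type u) [AddCommGroup X] [Module k X]
    {J : Type} [SmallCategory J] [FinCategory J] {K : J ⥤ LeftComod k B} {c : Cone K}
    (hc : IsLimit c) (s : ∀ j, X ⊗[k] (K.obj j).carrier)
    (hs : ∀ {i j} (f : i ⟶ j), (K.map f).lin.lTensor X (s i) = s j) :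
    ∃! x : X ⊗[k] c.pt.carrier, ∀ j, (c.π.app j).lin.lTensor X x = s j :=
  (Types.isLimit_iff _).1 ⟨isLimitOfPreserves (tensorType k B X) hc⟩ s hs

lemma eq_of_isLimit_tensor (X : Type u) [AddCommGroup X] [Module k X]
    {J : Type} [SmallCategory J] [FinCategory J] {K : J ⥤ LeftComod k B} {c : Cone K}
    (hc : IsLimit c) {x y : X ⊗[k] c.pt.carrier}
    (h : ∀ j, (c.π.app j).lin.lTensor X x = (c.π.app j).lin.lTensor X y) : x = y :=
  (existsUnique_tensor_of_isLimit X hc (fun j => (c.π.app j).lin.lTensor X y) fun {i j} f => by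
    rw [← LinearMap.lTensor_comp_apply, ← LeftComod.comp_lin, c.w]).unique h fun _ => rfl

lemma eq_of_isLimit_tensor_tensor (X Y : Type u) [AddCommGroup X] [Module k X] [AddCommGroup Y]
    [Module k Y] {J : Type} [SmallCategory J] [FinCategory J] {K : J ⥤ LeftComod k B} {c : Cone K}
    (hc : IsLimit c) {x y : X ⊗[k] (Y ⊗[k] c.pt.carrier)}
    (h : ∀ j, ((c.π.app j).lin.lTensor Y).lTensor X x =
      ((c.π.app j).lin.lTensor Y).lTensor X y) : x = y := by
  refine (TensorProduct.assoc k X Y c.pt.carrier).symm.injective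
    (eq_of_isLimit_tensor (X ⊗[k] Y) hc fun j => ?_)
  exact (lTensor_lTensor_assoc_symm X Y _ x).symm.trans
    ((congrArg _ (h j)).trans (lTensor_lTensor_assoc_symm X Y _ y))

lemma comod_isColimit_iff {J : Type u} [SmallCategory J] [IsFiltered J] {K : J ⥤ LeftComod k B}
    (c : Cocone K) : Nonempty (IsColimit c) ↔
      (∀ x : c.pt.carrier, ∃ j, ∃ y : (K.obj j).carrier, (c.ι.app j).lin y = x) ∧
      ∀ j, ∀ x y : (K.obj j).carrier, (c.ι.app j).lin x = (c.ι.app j).lin y →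
        ∃ i, ∃ f : j ⟶ i, (K.map f).lin x = (K.map f).lin y := by
  trans Nonempty (IsColimit ((comodType k B).mapCocone c))
  · exact ⟨fun ⟨h⟩ => ⟨isColimitOfPreserves _ h⟩, fun ⟨h⟩ => ⟨isColimitOfReflects _ h⟩⟩
  · constructor
    · rintro ⟨h⟩
      exact ⟨Types.jointly_surjective_of_isColimit h, fun j x y e =>
        (Types.FilteredColimit.isColimit_eq_iff' h x y).1 e⟩
    · rintro ⟨h₁, h₂⟩
      exact ⟨Types.FilteredColimit.isColimitOf' _ _
        (fun x => (h₁ x).imp fun j hj => hj.imp fun y e => e.symm) h₂⟩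

lemma exists_tensor_of_isColimit (X : Type u) [AddCommGroup X] [Module k X]
    {J : Type u} [SmallCategory J] [IsFiltered J] {K : J ⥤ LeftComod k B} {c : Cocone K}
    (hc : IsColimit c) (x : X ⊗[k] c.pt.carrier) :
    ∃ j, ∃ y : X ⊗[k] (K.obj j).carrier, (c.ι.app j).lin.lTensor X y = x :=
  Types.jointly_surjective_of_isColimit (isColimitOfPreserves (tensorType k B X) hc) x

lemma exists_eq_tensor_of_isColimit (X : Type u) [AddCommGroup X] [Module k X]
    {J : Type u} [SmallCategory J] [IsFiltered J] {K : J ⥤ LeftComod k B} {c : Cocone K}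
    (hc : IsColimit c) {j : J} (x y : X ⊗[k] (K.obj j).carrier)
    (h : (c.ι.app j).lin.lTensor X x = (c.ι.app j).lin.lTensor X y) :
    ∃ i, ∃ f : j ⟶ i, (K.map f).lin.lTensor X x = (K.map f).lin.lTensor X y :=
  (Types.FilteredColimit.isColimit_eq_iff' (isColimitOfPreserves (tensorType k B X) hc) x y).1 h

lemma exists_eq_tensor_tensor_of_isColimit (X Y : Type u) [AddCommGroup X] [Module k X]
    [AddCommGroup Y] [Module k Y]
    {J : Type u} [SmallCategory J] [IsFiltered J] {K : J ⥤ LeftComod k B} {c : Cocone K}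
    (hc : IsColimit c) {j : J} (x y : X ⊗[k] (Y ⊗[k] (K.obj j).carrier))
    (h : ((c.ι.app j).lin.lTensor Y).lTensor X x = ((c.ι.app j).lin.lTensor Y).lTensor X y) :
    ∃ i, ∃ f : j ⟶ i, ((K.map f).lin.lTensor Y).lTensor X x =
      ((K.map f).lin.lTensor Y).lTensor X y := by
  obtain ⟨i, f, e⟩ := exists_eq_tensor_of_isColimit (X ⊗[k] Y) hc
    ((TensorProduct.assoc k X Y _).symm x) ((TensorProduct.assoc k X Y _).symm y) (by
      rw [← lTensor_lTensor_assoc_symm, ← lTensor_lTensor_assoc_symm]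
      exact congrArg _ h)
  refine ⟨i, f, (TensorProduct.assoc k X Y _).symm.injective ?_⟩
  rw [lTensor_lTensor_assoc_symm, lTensor_lTensor_assoc_symm, e]

lemma cotensor_left_naturality {X : Type u} [AddCommGroup X] [Module k X]
    (r : X →ₗ[k] X ⊗[k] B) {M N : LeftComod k B} (f : M ⟶ N) (t : X ⊗[k] M.carrier) :
    TensorProduct.assoc k X B N.carrier (r.rTensor N.carrier (f.lin.lTensor X t)) =
      (f.lin.lTensor B).lTensor X
        (TensorProduct.assoc k X B M.carrier (r.rTensor M.carrier t)) := by
  induction t with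
  | zero => simp
  | add x y hx hy => simp only [map_add, hx, hy]
  | tmul x m =>
    simp only [LinearMap.lTensor_tmul, LinearMap.rTensor_tmul]
    generalize r x = p
    induction p with
    | add x y hx hy => simp only [map_add, TensorProduct.add_tmul, hx, hy]
    | _ => simp

lemma cotensor_right_naturality (X : Type u) [AddCommGroup X] [Module k X]
    {M N : LeftComod k B} (f : M ⟶ N) (t : X ⊗[k] M.carrier) :
    N.coact.lTensor X (f.lin.lTensor X t) =
      (f.lin.lTensor B).lTensor X (M.coact.lTensor X t) := by
  rw [← LinearMap.lTensor_comp_apply, ← LinearMap.lTensor_comp_apply, f.comm]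

lemma preservesFiniteLimits_cotensorFunctor (X : HopfTrimodule k B) :
    PreservesFiniteLimits X.cotensorFunctor where
  preservesFiniteLimits J _ _ := ⟨fun {K} => ⟨fun {c} hc => (comod_isLimit_iff _).2 <| by
    intro s hs
    let s' : ∀ j, X.carrier ⊗[k] (K.obj j).carrier := fun j => (s j).1
    obtain ⟨t, ht, hu⟩ := existsUnique_tensor_of_isLimit X.carrier hc s'
      fun f => congrArg Subtype.val (hs f)
    have ht : ∀ j, (c.π.app j).lin.lTensor X.carrier t = (s j).1 := ht
    refine ⟨⟨t, mem_cotensor.2 ?_⟩, fun j => Subtype.ext (ht j),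
      fun y hy => Subtype.ext (hu y.1 fun j => congrArg Subtype.val (hy j))⟩
    refine eq_of_isLimit_tensor_tensor X.carrier B hc fun j => ?_
    refine (cotensor_left_naturality X.rcoact (c.π.app j) t).symm.trans (Eq.trans ?_
      (cotensor_right_naturality X.carrier (c.π.app j) t))
    refine (congrArg (fun u => TensorProduct.assoc k _ _ _ (X.rcoact.rTensor _ u)) (ht j)).trans
      ((mem_cotensor.1 (s j).2).trans (congrArg _ (ht j).symm))⟩⟩

lemma preservesFilteredColimits_cotensorFunctor (X : HopfTrimodule k B) :
    PreservesFilteredColimits X.cotensorFunctor where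
  preserves_filtered_colimits J _ _ := ⟨fun {K} => ⟨fun {c} hc => (comod_isColimit_iff _).2 <| by
    constructor
    · rintro ⟨t, ht⟩
      obtain ⟨j, y, rfl⟩ := exists_tensor_of_isColimit X.carrier hc t
      obtain ⟨i, f, e⟩ := exists_eq_tensor_tensor_of_isColimit X.carrier B hc
        (TensorProduct.assoc k X.carrier B _ (X.rcoact.rTensor _ y))
        ((K.obj j).coact.lTensor X.carrier y) (by
          rw [← cotensor_left_naturality, ← cotensor_right_naturality]
          exact mem_cotensor.1 ht)
      rw [← cotensor_left_naturality, ← cotensor_right_naturality] at e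
      refine ⟨i, ⟨(K.map f).lin.lTensor X.carrier y, mem_cotensor.2 e⟩, Subtype.ext ?_⟩
      change (c.ι.app i).lin.lTensor X.carrier ((K.map f).lin.lTensor X.carrier y) = _
      rw [← LinearMap.lTensor_comp_apply, ← LeftComod.comp_lin, c.w]
    · intro j x y h
      obtain ⟨i, f, e⟩ := exists_eq_tensor_of_isColimit X.carrier hc x.1 y.1
        (congrArg Subtype.val h)
      exact ⟨i, f, Subtype.ext e⟩⟩⟩

lemma isLexFinitary_cotensorLax (X : HopfTrimodule k B) :
    LaxModuleEnd.IsLexFinitary (LeftComod k B) ((cotensorLax k B).obj X) :=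
  ⟨preservesFiniteLimits_cotensorFunctor X, preservesFilteredColimits_cotensorFunctor X⟩

end Comonadic

end

end HopfTrimod

namespace HopfTrimod

noncomputable section

section FreeCotensor

variable {k : Type u} [Field k] {B : Type u} [Ring B] [Bialgebra k B]
variable {V W M N : Type u} [AddCommGroup V] [Module k V] [AddCommGroup W] [Module k W]
  [AddCommGroup M] [Module k M] [AddCommGroup N] [Module k N]

/-- The map `N ⊗ V → (B ⊗ V) ⊗ N`, `n ⊗ v ↦ (n₍₋₁₎ ⊗ v) ⊗ n₍₀₎`. -/
def toFreeTensor (c : N →ₗ[k] B ⊗[k] N) (V : Type u) [AddCommGroup V] [Module k V] :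
    N ⊗[k] V →ₗ[k] (B ⊗[k] V) ⊗[k] N :=
  (TensorProduct.rightComm k B N V).toLinearMap ∘ₗ c.rTensor V

lemma toFreeTensor_tmul (c : N →ₗ[k] B ⊗[k] N) (n : N) (v : V) :
    toFreeTensor c V (n ⊗ₜ v) = ((TensorProduct.mk k B V).flip v).rTensor N (c n) := by
  simp only [toFreeTensor, LinearMap.comp_apply, LinearMap.rTensor_tmul, LinearEquiv.coe_coe]
  generalize c n = p
  induction p with
  | add x y hx hy => simp only [map_add, TensorProduct.add_tmul, hx, hy]
  | _ => simp

/-- The map `(B ⊗ V) ⊗ N → N ⊗ V`, `(b ⊗ v) ⊗ n ↦ ε(b) n ⊗ v`. -/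
def ofFreeTensor (k B N V : Type u) [Field k] [Ring B] [Bialgebra k B] [AddCommGroup V]
    [Module k V] [AddCommGroup N] [Module k N] : (B ⊗[k] V) ⊗[k] N →ₗ[k] N ⊗[k] V :=
  (TensorProduct.comm k V N).toLinearMap ∘ₗ (counitLeft k B V).rTensor N

lemma toFreeTensor_mem {c : N →ₗ[k] B ⊗[k] N} (hc : IsLeftCoaction c) (t : N ⊗[k] V) :
    toFreeTensor c V t ∈ cotensor (freeRight k B V) c := by
  induction t with
  | zero => simp
  | add x y hx hy => rw [map_add]; exact add_mem hx hy
  | tmul n v =>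
    have e : ∀ p : B ⊗[k] N, TensorProduct.assoc k (B ⊗[k] V) B N ((freeRight k B V).rTensor N
        (((TensorProduct.mk k B V).flip v).rTensor N p)) =
        ((TensorProduct.mk k B V).flip v).rTensor (B ⊗[k] N)
          (TensorProduct.assoc k B B N ((Coalgebra.comul (R := k) (A := B)).rTensor N p)) := by
      intro p
      induction p with
      | zero => simp
      | add x y hx hy => simp only [map_add, hx, hy]
      | tmul b n =>
        simp only [LinearMap.rTensor_tmul, LinearMap.flip_apply, TensorProduct.mk_apply,
          freeRight_tmul]
        generalize Coalgebra.comul (R := k) b = q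
        induction q with
        | add x y hx hy => simp only [map_add, TensorProduct.add_tmul, hx, hy]
        | _ => simp
    rw [mem_cotensor, toFreeTensor_tmul, e, hc.coassoc_apply]
    exact (LinearMap.congr_fun (LinearMap.rTensor_comp_lTensor _ _ _) _).trans
      (LinearMap.congr_fun (LinearMap.lTensor_comp_rTensor _ _ _) _).symm

lemma ofFreeTensor_toFreeTensor {c : N →ₗ[k] B ⊗[k] N} (hc : IsLeftCoaction c) (t : N ⊗[k] V) :
    ofFreeTensor k B N V (toFreeTensor c V t) = t := by
  induction t with
  | zero => simp
  | add x y hx hy => simp only [map_add, hx, hy]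
  | tmul n v =>
    have e : ∀ p : B ⊗[k] N, ofFreeTensor k B N V (((TensorProduct.mk k B V).flip v).rTensor N p) =
        counitLeft k B N p ⊗ₜ v := by
      intro p
      induction p with
      | add x y hx hy => simp only [map_add, TensorProduct.add_tmul, hx, hy]
      | _ => simp [ofFreeTensor, TensorProduct.smul_tmul]
    rw [toFreeTensor_tmul, e]
    congr 1
    exact hc.counit_apply n

lemma toFreeTensor_ofFreeTensor {c : N →ₗ[k] B ⊗[k] N} {t : (B ⊗[k] V) ⊗[k] N}
    (ht : t ∈ cotensor (freeRight k B V) c) :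
    toFreeTensor c V (ofFreeTensor k B N V t) = t := by
  let R : V ⊗[k] (B ⊗[k] N) →ₗ[k] (B ⊗[k] V) ⊗[k] N :=
    (TensorProduct.comm k V B).toLinearMap.rTensor N ∘ₗ
      (TensorProduct.assoc k V B N).symm.toLinearMap
  have e1 : ∀ t : (B ⊗[k] V) ⊗[k] N, R ((counitLeft k B V).rTensor (B ⊗[k] N)
      (TensorProduct.assoc k (B ⊗[k] V) B N ((freeRight k B V).rTensor N t))) = t := by
    intro t
    induction t with
    | zero => simp
    | add x y hx hy => simp only [map_add, hx, hy]
    | tmul p n =>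
      have e : ∀ q : (B ⊗[k] V) ⊗[k] B, R ((counitLeft k B V).rTensor (B ⊗[k] N)
          (TensorProduct.assoc k (B ⊗[k] V) B N (q ⊗ₜ n))) =
          TensorProduct.comm k V B ((counitLeft k B V).rTensor B q) ⊗ₜ n := by
        intro q
        induction q with
        | add x y hx hy => simp only [map_add, TensorProduct.add_tmul, hx, hy]
        | _ => simp [R]
      rw [LinearMap.rTensor_tmul, e, comm_counitLeft_freeRight]
  have e2 : ∀ t : (B ⊗[k] V) ⊗[k] N, R ((counitLeft k B V).rTensor (B ⊗[k] N)
      (c.lTensor (B ⊗[k] V) t)) = toFreeTensor c V (ofFreeTensor k B N V t) := by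
    intro t
    induction t with
    | zero => simp
    | add x y hx hy => simp only [map_add, hx, hy]
    | tmul p n =>
      simp only [LinearMap.lTensor_tmul, LinearMap.rTensor_tmul, ofFreeTensor,
        LinearMap.comp_apply, LinearEquiv.coe_coe, TensorProduct.comm_tmul, toFreeTensor_tmul]
      generalize c n = q
      induction q with
      | add x y hx hy => simp only [map_add, TensorProduct.tmul_add, hx, hy]
      | _ => simp [R]
  rw [← e2, ← mem_cotensor.1 ht, e1]

/-- The isomorphism `N ⊗ V ≃ (B ⊗ V) □ N`. -/
def freeCotensorEquiv {c : N →ₗ[k] B ⊗[k] N} (hc : IsLeftCoaction c) (V : Type u)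
    [AddCommGroup V] [Module k V] : N ⊗[k] V ≃ₗ[k] cotensor (freeRight k B V) c :=
  LinearEquiv.ofLinearMap (LinearMap.codRestrict _ (toFreeTensor c V) (toFreeTensor_mem hc))
    (ofFreeTensor k B N V ∘ₗ Submodule.subtype _)
    (LinearMap.ext fun t => Subtype.ext (toFreeTensor_ofFreeTensor t.2))
    (LinearMap.ext (ofFreeTensor_toFreeTensor hc))

lemma subtype_comp_freeCotensorEquiv {c : N →ₗ[k] B ⊗[k] N} (hc : IsLeftCoaction c) :
    (cotensor (freeRight k B V) c).subtype ∘ₗ (freeCotensorEquiv hc V).toLinearMap =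
      toFreeTensor c V :=
  LinearMap.ext fun _ => rfl

lemma toFreeTensor_colinear {c : N →ₗ[k] B ⊗[k] N} (hc : IsLeftCoaction c)
    (d : V →ₗ[k] B ⊗[k] V) (t : N ⊗[k] V) :
    leftTensor (diagCoaction (Coalgebra.comul (R := k) (A := B)) d) N (toFreeTensor c V t) =
      (toFreeTensor c V).lTensor B (diagCoaction c d t) := by
  induction t with
  | zero => simp
  | add x y hx hy => simp only [map_add, hx, hy]
  | tmul n v =>
    let S : (B ⊗[k] (B ⊗[k] N)) ⊗[k] (B ⊗[k] V) →ₗ[k] B ⊗[k] ((B ⊗[k] V) ⊗[k] N) :=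
      TensorProduct.map (LinearMap.mul' k B) (TensorProduct.rightComm k B N V).toLinearMap ∘ₗ
        (TensorProduct.tensorTensorTensorComm k B (B ⊗[k] N) B V).toLinearMap
    have e1 : ∀ (p : B ⊗[k] N) (q : B ⊗[k] V), TensorProduct.assoc k B (B ⊗[k] V) N
        (((LinearMap.mul' k B).rTensor (B ⊗[k] V) ∘ₗ
          (TensorProduct.tensorTensorTensorComm k B B B V).toLinearMap ∘ₗ
          (TensorProduct.mk k (B ⊗[k] B) (B ⊗[k] V)).flip q ∘ₗ
          (Coalgebra.comul (R := k) (A := B))).rTensor N p) =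
        S (TensorProduct.assoc k B B N ((Coalgebra.comul (R := k) (A := B)).rTensor N p) ⊗ₜ q) := by
      intro p q
      induction p with
      | zero => simp
      | add x y hx hy => simp only [map_add, TensorProduct.add_tmul, hx, hy]
      | tmul b n =>
        simp only [LinearMap.rTensor_tmul, LinearMap.comp_apply, LinearEquiv.coe_coe,
          LinearMap.flip_apply, TensorProduct.mk_apply]
        generalize Coalgebra.comul (R := k) b = s
        induction s with
        | zero => simp
        | add x y hx hy => simp only [map_add, TensorProduct.add_tmul, hx, hy]
        | tmul b₁ b₂ =>
          induction q with
          | add x y hx hy =>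
            simp only [map_add, TensorProduct.add_tmul, TensorProduct.tmul_add, hx, hy]
          | _ => simp [S]
    have e2 : ∀ (p : B ⊗[k] N) (q : B ⊗[k] V), S (c.lTensor B p ⊗ₜ q) =
        (toFreeTensor c V).lTensor B ((LinearMap.mul' k B).rTensor (N ⊗[k] V)
          (TensorProduct.tensorTensorTensorComm k B N B V (p ⊗ₜ q))) := by
      intro p q
      induction p with
      | zero => simp
      | add x y hx hy => simp only [map_add, TensorProduct.add_tmul, hx, hy]
      | tmul b n =>
        induction q with
        | add x y hx hy => simp only [map_add, TensorProduct.tmul_add, hx, hy]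
        | _ => simp [S, toFreeTensor]
    refine Eq.trans ?_ ((e1 (c n) (d v)).trans ((congrArg (fun u => S (u ⊗ₜ d v))
      (hc.coassoc_apply n)).trans (e2 (c n) (d v))))
    rw [toFreeTensor_tmul, leftTensor, LinearMap.comp_apply, ← LinearMap.rTensor_comp_apply]
    rfl

lemma freeCotensorEquiv_colinear {c : N →ₗ[k] B ⊗[k] N} (hc : IsLeftCoaction c)
    (d : V →ₗ[k] B ⊗[k] V) (t : N ⊗[k] V) :
    restrictLeft (cotensor (freeRight k B V) c)
        (leftTensor (diagCoaction (Coalgebra.comul (R := k) (A := B)) d) N)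
        (leftTensor_mem bicompatible_free) (freeCotensorEquiv hc V t) =
      (freeCotensorEquiv hc V).toLinearMap.lTensor B (diagCoaction c d t) :=
  restrictLeft_comm (cotensor (freeRight k B V) c) (leftTensor_mem bicompatible_free)
    (freeCotensorEquiv hc V).toLinearMap t (by
      rw [subtype_comp_freeCotensorEquiv]
      exact toFreeTensor_colinear hc d t)

lemma toFreeTensor_interchange (c : M →ₗ[k] B ⊗[k] M) (d : N →ₗ[k] B ⊗[k] N)
    (t : M ⊗[k] (N ⊗[k] V)) :
    interchangeLin (freeAct k B V) c N ((toFreeTensor d V).lTensor M t) =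
      toFreeTensor (diagCoaction c d) V ((TensorProduct.assoc k M N V).symm t) := by
  induction t with
  | zero => simp
  | add x y hx hy => simp only [map_add, hx, hy]
  | tmul m s =>
    induction s with
    | zero => simp
    | add x y hx hy => simp only [map_add, TensorProduct.tmul_add, hx, hy]
    | tmul n v =>
      simp only [LinearMap.lTensor_tmul, interchangeLin_tmul, toFreeTensor_tmul,
        TensorProduct.assoc_symm_tmul, diagCoaction, LinearMap.comp_apply, LinearEquiv.coe_coe,
        TensorProduct.map_tmul]
      generalize c m = p
      generalize d n = q
      induction p with
      | zero => simp
      | add x y hx hy => simp only [map_add, TensorProduct.add_tmul, hx, hy]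
      | tmul b m =>
        induction q with
        | add x y hx hy => simp only [map_add, TensorProduct.tmul_add, hx, hy]
        | _ => simp [freeAct_tmul]

lemma freeCotensorEquiv_interchange (V : Type u) [AddCommGroup V] [Module k V]
    (c : M →ₗ[k] B ⊗[k] M) {d : N →ₗ[k] B ⊗[k] N}
    (hd : IsLeftCoaction d) (t : M ⊗[k] (N ⊗[k] V)) :
    interchangeLin (freeAct k B V) c N ((cotensor (freeRight k B V) d).subtype.lTensor M
      ((freeCotensorEquiv hd V).toLinearMap.lTensor M t)) =
      toFreeTensor (diagCoaction c d) V ((TensorProduct.assoc k M N V).symm t) := by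
  rw [← toFreeTensor_interchange, ← subtype_comp_freeCotensorEquiv hd,
    ← LinearMap.lTensor_comp_apply]

lemma toFreeTensor_naturality {c : M →ₗ[k] B ⊗[k] M} {d : N →ₗ[k] B ⊗[k] N} (f : M →ₗ[k] N)
    (hf : ∀ m, d (f m) = f.lTensor B (c m)) (g : V →ₗ[k] W) (t : M ⊗[k] V) :
    toFreeTensor d W (TensorProduct.map f g t) =
      TensorProduct.map (g.lTensor B) f (toFreeTensor c V t) := by
  induction t with
  | zero => simp
  | add x y hx hy => simp only [map_add, hx, hy]
  | tmul m v =>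
    rw [TensorProduct.map_tmul, toFreeTensor_tmul, toFreeTensor_tmul, hf]
    generalize c m = p
    induction p with
    | add x y hx hy => simp only [map_add, hx, hy]
    | _ => simp

end FreeCotensor

variable {k : Type u} [Field k] {B : Type u} [Ring B] [Bialgebra k B]

/-- The isomorphism `N ⊗ V ≅ (B ⊗ V) □ N` of comodules. -/
def freeCotensorIso (N V : LeftComod k B) :
    N ⊗ V ≅ (freeTrimodule k B V).cotensorComod N :=
  LeftComod.isoMk (M := N ⊗ V) (N := (freeTrimodule k B V).cotensorComod N)
    (freeCotensorEquiv N.isCoaction V.carrier)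
    (LinearMap.ext (freeCotensorEquiv_colinear N.isCoaction V.coact))

/-- The isomorphism of module functors between `- ⊗ V` and `(B ⊗ V) □ -`. -/
def tensorRightEndFreeIso (V : LeftComod k B) :
    tensorRightEnd V ≅ (cotensorLax k B).obj (freeTrimodule k B V) :=
  LaxModuleEnd.isoMk (NatIso.ofComponents (fun N => freeCotensorIso N V) fun {M N} f =>
    HopfTrimodule.cotensorComod_hom_ext fun t => by
      have h := toFreeTensor_naturality (c := M.coact) (d := N.coact) f.lin f.comm_apply
        (LinearMap.id (R := k) (M := V.carrier)) t
      rw [LinearMap.lTensor_id] at h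
      exact h) fun M N =>
    HopfTrimodule.cotensorComod_hom_ext fun t => by
      exact freeCotensorEquiv_interchange V.carrier M.coact N.isCoaction t

variable (k B) in
lemma isStrong_le_isLexFinitary :
    LaxModuleEnd.IsStrong (LeftComod k B) ≤ LaxModuleEnd.IsLexFinitary (LeftComod k B) := by
  intro F hF
  let e : (HopfTrimodule.cotensorFunctor (freeTrimodule k B (F.functor.obj (𝟙_ _)))) ≅ F.functor :=
    let i : (cotensorLax k B).obj (freeTrimodule k B (F.functor.obj (𝟙_ _))) ≅ F :=
      (tensorRightEndFreeIso (F.functor.obj (𝟙_ _))).symm ≪≫ tensorRightEndIso ⟨F, hF⟩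
    ⟨i.hom.nat, i.inv.nat, congrArg LaxModuleEnd.Hom.nat i.hom_inv_id,
      congrArg LaxModuleEnd.Hom.nat i.inv_hom_id⟩
  have := preservesFiniteLimits_cotensorFunctor (freeTrimodule k B (F.functor.obj (𝟙_ _)))
  have := preservesFilteredColimits_cotensorFunctor (freeTrimodule k B (F.functor.obj (𝟙_ _)))
  exact ⟨Limits.preservesFiniteLimits_of_natIso e,
    ⟨fun _ _ _ => Limits.preservesColimitsOfShape_of_natIso e⟩⟩

end

end HopfTrimod

namespace HopfTrimod

noncomputable section

section Trivial

variable (k : Type u) [Field k] (B : Type u) [Ring B] [Bialgebra k B]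

/-- The comodule with trivial coaction on a vector space. -/
@[simps] def trivialComod (V : Type u) [AddCommGroup V] [Module k V] : LeftComod k B where
  carrier := V
  coact := trivialCoaction k B V
  isCoaction := isLeftCoaction_trivial

/-- The comodule `B`. -/
@[simps] def regularComod : LeftComod k B where
  carrier := B
  coact := Coalgebra.comul
  isCoaction := isLeftCoaction_comul k B

variable {k B} {V W : Type u} [AddCommGroup V] [Module k V] [AddCommGroup W] [Module k W]

variable (B) in
/-- Linear maps are morphisms of trivial comodules. -/
@[simps] def trivialMap (f : V →ₗ[k] W) : trivialComod k B V ⟶ trivialComod k B W where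
  lin := f
  comm := rfl

lemma diagCoaction_trivial {N : Type u} [AddCommGroup N] [Module k N] (d : N →ₗ[k] B ⊗[k] N) (v : V)
    (n : N) : diagCoaction (trivialCoaction k B V) d (v ⊗ₜ n) =
      (TensorProduct.mk k V N v).lTensor B (d n) := by
  simp only [diagCoaction, LinearMap.comp_apply, TensorProduct.map_tmul, trivialCoaction,
    TensorProduct.mk_apply, LinearEquiv.coe_coe]
  generalize d n = p
  induction p with
  | add x y hx hy => simp only [map_add, TensorProduct.tmul_add, hx, hy]
  | _ => simp

variable (k B V W) in
/-- The tensor product of trivial comodules is trivial. -/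
def trivialTensor : trivialComod k B (V ⊗[k] W) ≅ trivialComod k B V ⊗ trivialComod k B W :=
  LeftComod.isoMk (M := trivialComod k B (V ⊗[k] W)) (N := trivialComod k B V ⊗ trivialComod k B W)
    (LinearEquiv.refl k (V ⊗[k] W))
    (TensorProduct.ext' fun v w => by
      change diagCoaction (trivialCoaction k B V) (trivialCoaction k B W) (v ⊗ₜ w) =
        1 ⊗ₜ (v ⊗ₜ w)
      rw [diagCoaction_trivial]
      rfl)

/-- The coaction of `M`, as a morphism from `M` to the cofree comodule `M ⊗ B`. -/
@[simps] def cofreeCoact (M : LeftComod k B) :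
    M ⟶ LeftComod.tensor (trivialComod k B M.carrier) (regularComod k B) where
  lin := (TensorProduct.comm k B M.carrier).toLinearMap ∘ₗ M.coact
  comm := by
    ext m
    have e1 : ∀ p : B ⊗[k] M.carrier, diagCoaction (trivialCoaction k B M.carrier)
        (Coalgebra.comul (R := k) (A := B)) (TensorProduct.comm k B M.carrier p) =
        (TensorProduct.comm k B M.carrier).toLinearMap.lTensor B
          (TensorProduct.assoc k B B M.carrier
            ((Coalgebra.comul (R := k) (A := B)).rTensor M.carrier p)) := by
      intro p
      induction p with
      | zero => simp
      | add x y hx hy => simp only [map_add, hx, hy]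
      | tmul b m =>
        rw [TensorProduct.comm_tmul, diagCoaction_trivial, LinearMap.rTensor_tmul]
        generalize Coalgebra.comul (R := k) b = q
        induction q with
        | add x y hx hy => simp only [map_add, TensorProduct.add_tmul, hx, hy]
        | _ => simp
    refine (e1 (M.coact m)).trans ?_
    rw [M.isCoaction.coassoc_apply, ← LinearMap.lTensor_comp_apply]
    rfl

end Trivial

section Lax

variable {k : Type u} [Field k] {B : Type u} [Ring B] [Bialgebra k B]

namespace LaxModuleEnd

variable (F : LaxModuleEnd (LeftComod k B))

/-- The linear map underlying the structure morphism `V ⊗ F(M) ⟶ F(V ⊗ M)`. -/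
def strLin (V M : LeftComod k B) :
    V.carrier ⊗[k] (F.functor.obj M).carrier →ₗ[k] (F.functor.obj (LeftComod.tensor V M)).carrier :=
  (F.str V M).lin

lemma strLin_colinear (V M : LeftComod k B) (t : V.carrier ⊗[k] (F.functor.obj M).carrier) :
    (F.functor.obj (LeftComod.tensor V M)).coact (F.strLin V M t) =
      (F.strLin V M).lTensor B (diagCoaction V.coact (F.functor.obj M).coact t) :=
  (F.str V M).comm_apply t

lemma strLin_naturality_left {V W : LeftComod k B} (f : V ⟶ W) (M : LeftComod k B)
    (t : V.carrier ⊗[k] (F.functor.obj M).carrier) :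
    F.strLin W M (f.lin.rTensor _ t) =
      (F.functor.map (LeftComod.tensorMap f (𝟙 M))).lin (F.strLin V M t) :=
  LinearMap.congr_fun (congrArg LeftComod.Hom.lin
    (Functor.LaxLeftLinear.μₗ_naturality_left F.functor f M)) t

lemma strLin_naturality_right (V : LeftComod k B) {M N : LeftComod k B} (f : M ⟶ N)
    (t : V.carrier ⊗[k] (F.functor.obj M).carrier) :
    F.strLin V N ((F.functor.map f).lin.lTensor _ t) =
      (F.functor.map (LeftComod.tensorMap (𝟙 V) f)).lin (F.strLin V M t) :=
  LinearMap.congr_fun (congrArg LeftComod.Hom.lin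
    (Functor.LaxLeftLinear.μₗ_naturality_right F.functor V f)) t

lemma strLin_assoc (V W M : LeftComod k B)
    (t : (V.carrier ⊗[k] W.carrier) ⊗[k] (F.functor.obj M).carrier) :
    (F.functor.map (LeftComod.assocIso V W M).hom).lin (F.strLin (LeftComod.tensor V W) M t) =
      F.strLin V (LeftComod.tensor W M) ((F.strLin W M).lTensor V.carrier
        (TensorProduct.assoc k V.carrier W.carrier (F.functor.obj M).carrier t)) :=
  LinearMap.congr_fun (congrArg LeftComod.Hom.lin
    (Functor.LaxLeftLinear.μₗ_associativity F.functor V W M)) t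

lemma strLin_unit (M : LeftComod k B) (t : k ⊗[k] (F.functor.obj M).carrier) :
    (F.functor.map (LeftComod.leftUnitorIso M).hom).lin
      (F.strLin (LeftComod.unit k B) M t) = TensorProduct.lid k _ t := by
  have h : (λ_ (F.functor.obj M)).hom =
      F.str (𝟙_ (LeftComod k B)) M ≫ F.functor.map (λ_ M).hom :=
    Functor.LaxLeftLinear.μₗ_unitality (C := LeftComod k B) F.functor M
  exact (LinearMap.congr_fun (congrArg LeftComod.Hom.lin h) t).symm

lemma hom_strLin {F G : LaxModuleEnd (LeftComod k B)} (f : F ⟶ G) (V M : LeftComod k B)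
    (t : V.carrier ⊗[k] (F.functor.obj M).carrier) :
    G.strLin V M ((f.nat.app M).lin.lTensor _ t) =
      (f.nat.app (LeftComod.tensor V M)).lin (F.strLin V M t) :=
  LinearMap.congr_fun (congrArg LeftComod.Hom.lin (f.comm V M)) t

lemma map_comp_lin {L M N : LeftComod k B} (f : L ⟶ M) (g : M ⟶ N) (y : (F.functor.obj L).carrier) :
    (F.functor.map (f ≫ g)).lin y = (F.functor.map g).lin ((F.functor.map f).lin y) :=
  LinearMap.congr_fun (congrArg LeftComod.Hom.lin (F.functor.map_comp f g)) y

end LaxModuleEnd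

end Lax

end

end HopfTrimod

namespace HopfTrimod

noncomputable section

namespace LaxModuleEnd

open Limits

variable {k : Type u} [Field k] {B : Type u} [Ring B] [Bialgebra k B]

variable (B) in
/-- The morphism `V ⊗ M ⟶ M` given by a linear form on a vector space `V`. -/
def formMap {V : Type u} [AddCommGroup V] [Module k V] (f : V →ₗ[k] k) (M : LeftComod k B) :
    LeftComod.tensor (trivialComod k B V) M ⟶ M :=
  LeftComod.tensorMap (M' := LeftComod.unit k B) (trivialMap B f) (𝟙 M) ≫
    (LeftComod.leftUnitorIso M).hom

/-- For a basis of `V` indexed by a finite set, `V ⊗ M` is a finite product of copies of `M`. -/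
lemma isLimit_fan_formMap {V : Type u} [AddCommGroup V] [Module k V] {n : ℕ}
    (e : Module.Basis (Fin n) k V) (M : LeftComod k B) :
    Nonempty (IsLimit (Fan.mk (f := fun _ : Fin n => M) _ fun i => formMap B (e.coord i) M)) := by
  refine (comod_isLimit_iff _).2 fun s _ => ?_
  let s' : Fin n →₀ M.carrier := Finsupp.equivFunOnFinite.symm fun i => s ⟨i⟩
  refine ⟨(TensorProduct.equivFinsuppOfBasisLeft e).symm s', fun ⟨i⟩ => ?_, fun y hy => ?_⟩
  · refine (TensorProduct.equivFinsuppOfBasisLeft_apply e _ i).symm.trans ?_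
    rw [LinearEquiv.apply_symm_apply]
    rfl
  · refine ((LinearEquiv.eq_symm_apply _).2 (Finsupp.ext fun i => ?_))
    exact (TensorProduct.equivFinsuppOfBasisLeft_apply e _ i).trans (hy ⟨i⟩)

lemma exists_mem_span_tensor {V M : Type u} [AddCommGroup V] [Module k V] [AddCommGroup M]
    [Module k M] (t : V ⊗[k] M) : ∃ s : Finset V, ∃ x : Submodule.span k (s : Set V) ⊗[k] M,
      (Submodule.span k (s : Set V)).subtype.rTensor M x = t := by
  classical
  induction t with
  | zero => exact ⟨∅, 0, map_zero _⟩
  | tmul v m =>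
    exact ⟨{v}, ⟨v, Submodule.subset_span (by simp)⟩ ⊗ₜ m, rfl⟩
  | add x y hx hy =>
    obtain ⟨s, x, rfl⟩ := hx
    obtain ⟨s', y, rfl⟩ := hy
    have h : (s : Set V) ⊆ ((s ∪ s' : Finset V) : Set V) := by simp
    have h' : (s' : Set V) ⊆ ((s ∪ s' : Finset V) : Set V) := by simp
    refine ⟨s ∪ s', (Submodule.inclusion (Submodule.span_mono h)).rTensor M x +
      (Submodule.inclusion (Submodule.span_mono h')).rTensor M y, ?_⟩
    rw [map_add, ← LinearMap.rTensor_comp_apply, ← LinearMap.rTensor_comp_apply]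
    rfl

/-- The comodules `E ⊗ M`, for the spans `E` of finite subsets of `V`. -/
@[simps] def spanTensor (V : Type u) [AddCommGroup V] [Module k V] (M : LeftComod k B) :
    Finset V ⥤ LeftComod k B where
  obj s := LeftComod.tensor (trivialComod k B (Submodule.span k (s : Set V))) M
  map f := LeftComod.tensorMap
    (trivialMap B (Submodule.inclusion (Submodule.span_mono (Finset.coe_subset.2 f.le)))) (𝟙 M)
  map_id _ := LeftComod.hom_ext (TensorProduct.ext' fun _ _ => rfl)
  map_comp _ _ := LeftComod.hom_ext (TensorProduct.ext' fun _ _ => rfl)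

/-- The comodule `V ⊗ M` with the inclusions of `E ⊗ M`. -/
@[simps] def spanTensorCocone (V : Type u) [AddCommGroup V] [Module k V] (M : LeftComod k B) :
    Cocone (spanTensor V M) where
  pt := LeftComod.tensor (trivialComod k B V) M
  ι :=
    { app s := LeftComod.tensorMap (trivialMap B (Submodule.span k (s : Set V)).subtype) (𝟙 M)
      naturality _ _ _ := LeftComod.hom_ext (TensorProduct.ext' fun _ _ => rfl) }

lemma isColimit_spanTensorCocone (V : Type u) [AddCommGroup V] [Module k V] (M : LeftComod k B) :
    Nonempty (IsColimit (spanTensorCocone V M)) :=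
  (comod_isColimit_iff _).2 ⟨exists_mem_span_tensor, fun s _ _ h =>
    ⟨s, 𝟙 s, congrArg _ (rTensor_inj M.carrier (Submodule.injective_subtype _) h)⟩⟩

variable (F : LaxModuleEnd (LeftComod k B))

/-- The structure morphism `V ⊗ F(M) ⟶ F(V ⊗ M)` for a trivial comodule `V`. -/
def trivialStr (V : Type u) [AddCommGroup V] [Module k V] (M : LeftComod k B) :
    V ⊗[k] (F.functor.obj M).carrier →ₗ[k]
      (F.functor.obj (LeftComod.tensor (trivialComod k B V) M)).carrier :=
  F.strLin (trivialComod k B V) M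

lemma map_formMap_trivialStr {V : Type u} [AddCommGroup V] [Module k V] (f : V →ₗ[k] k)
    (M : LeftComod k B) (t : V ⊗[k] (F.functor.obj M).carrier) :
    (F.functor.map (formMap B f M)).lin (F.trivialStr V M t) =
      TensorProduct.lid k _ (f.rTensor _ t) := by
  rw [formMap, map_comp_lin]
  have h := F.strLin_naturality_left (W := LeftComod.unit k B) (trivialMap B f) M t
  exact (congrArg _ h.symm).trans (F.strLin_unit M _)

lemma eq_of_forall_form {V M ι : Type*} [AddCommGroup V] [Module k V] [AddCommGroup M]
    [Module k M] (e : Module.Basis ι k V) {t t' : V ⊗[k] M}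
    (h : ∀ i, TensorProduct.lid k M ((e.coord i).rTensor M t) =
      TensorProduct.lid k M ((e.coord i).rTensor M t')) : t = t' := by
  classical
  refine (TensorProduct.equivFinsuppOfBasisLeft e).injective (Finsupp.ext fun i => ?_)
  rw [TensorProduct.equivFinsuppOfBasisLeft_apply, TensorProduct.equivFinsuppOfBasisLeft_apply, h]

lemma trivialStr_injective (V : Type u) [AddCommGroup V] [Module k V] (M : LeftComod k B) :
    Function.Injective (F.trivialStr V M) := fun t t' h =>
  eq_of_forall_form (Module.Basis.ofVectorSpace k V) fun i => by
    rw [← map_formMap_trivialStr, ← map_formMap_trivialStr, h]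

variable {F}

lemma trivialStr_surjective_of_basis [PreservesFiniteLimits F.functor] {V : Type u}
    [AddCommGroup V] [Module k V]
    {n : ℕ} (e : Module.Basis (Fin n) k V) (M : LeftComod k B) :
    Function.Surjective (F.trivialStr V M) := by
  intro z
  obtain ⟨h⟩ := isLimit_fan_formMap e M
  let s' : Fin n →₀ (F.functor.obj M).carrier := Finsupp.equivFunOnFinite.symm fun i =>
    (F.functor.map (formMap B (e.coord i) M)).lin z
  refine ⟨(TensorProduct.equivFinsuppOfBasisLeft e).symm s', ?_⟩
  refine ((comod_isLimit_iff _).1 ⟨isLimitOfPreserves F.functor h⟩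
    (fun i => (F.functor.map (formMap B (e.coord i.as) M)).lin z) ?_).unique ?_ ?_
  · rintro ⟨i⟩ ⟨j⟩ ⟨⟨f⟩⟩
    cases f
    exact LinearMap.congr_fun (congrArg LeftComod.Hom.lin
      ((Discrete.functor (fun _ : Fin n => M) ⋙ F.functor).map_id ⟨i⟩)) _
  · rintro ⟨i⟩
    refine (map_formMap_trivialStr F (e.coord i) M _).trans ?_
    rw [← TensorProduct.equivFinsuppOfBasisLeft_apply e, LinearEquiv.apply_symm_apply]
    rfl
  · rintro ⟨i⟩
    rfl

lemma trivialStr_bijective (hF : IsLexFinitary _ F) (V : Type u) [AddCommGroup V] [Module k V]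
    (M : LeftComod k B) : Function.Bijective (F.trivialStr V M) := by
  refine ⟨F.trivialStr_injective V M, fun z => ?_⟩
  have := hF.1
  have := hF.2
  obtain ⟨h⟩ := isColimit_spanTensorCocone V M
  obtain ⟨s, z, rfl⟩ := ((comod_isColimit_iff _).1 ⟨isColimitOfPreserves F.functor h⟩).1 z
  obtain ⟨t, rfl⟩ := trivialStr_surjective_of_basis
    (Module.finBasis k (Submodule.span k (s : Set V))) M z
  exact ⟨_, F.strLin_naturality_left
    (trivialMap B (Submodule.span k (s : Set V)).subtype) M t⟩

/-- The isomorphism `V ⊗ F(M) ≃ F(V ⊗ M)` for a vector space `V`. -/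
def trivialEquiv (hF : IsLexFinitary _ F) (V : Type u) [AddCommGroup V] [Module k V]
    (M : LeftComod k B) : V ⊗[k] (F.functor.obj M).carrier ≃ₗ[k]
      (F.functor.obj (LeftComod.tensor (trivialComod k B V) M)).carrier :=
  LinearEquiv.ofBijective _ (trivialStr_bijective hF V M)

end LaxModuleEnd

end

end HopfTrimod

namespace HopfTrimod

noncomputable section

section Equalizer

open Limits

variable {k : Type u} [Field k] {B : Type u} [Ring B] [Bialgebra k B]

lemma isLimit_fork_iff {M N P : LeftComod k B} {i : M ⟶ N} {p q : N ⟶ P} (w : i ≫ p = i ≫ q) :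
    Nonempty (IsLimit (Fork.ofι i w)) ↔ ∀ n, p.lin n = q.lin n → ∃! m, i.lin m = n := by
  rw [comod_isLimit_iff]
  constructor
  · intro h n hn
    let s : ∀ j, ((parallelPair p q).obj j).carrier
      | .zero => n
      | .one => p.lin n
    obtain ⟨m, hm, hu⟩ := h s (by
      rintro _ _ (_ | _ | _)
      · rfl
      · exact hn.symm
      · exact LinearMap.congr_fun (congrArg LeftComod.Hom.lin ((parallelPair p q).map_id _)) _)
    exact ⟨m, hm .zero, fun m' hm' => hu m' fun j => by
      cases j
      · exact hm'
      · exact congrArg p.lin hm'⟩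
  · intro h s hs
    obtain ⟨m, hm, hu⟩ := h (s .zero) ((hs WalkingParallelPairHom.left).trans
      (hs WalkingParallelPairHom.right).symm)
    refine ⟨m, fun j => ?_, fun m' hm' => hu m' (hm' .zero)⟩
    cases j
    · exact hm
    · exact (congrArg p.lin hm).trans (hs WalkingParallelPairHom.left)

/-- A functor that preserves finite limits preserves equalizers, described by elements. -/
lemma existsUnique_map_of_equalizer (G : LeftComod k B ⥤ LeftComod k B) [PreservesFiniteLimits G]
    {M N P : LeftComod k B} {i : M ⟶ N} {p q : N ⟶ P} (w : i ≫ p = i ≫ q)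
    (h : ∀ n, p.lin n = q.lin n → ∃! m, i.lin m = n) (z : (G.obj N).carrier)
    (hz : (G.map p).lin z = (G.map q).lin z) : ∃! y, (G.map i).lin y = z := by
  obtain ⟨h⟩ := (isLimit_fork_iff w).2 h
  have w' : G.map i ≫ G.map p = G.map i ≫ G.map q := by rw [← G.map_comp, w, G.map_comp]
  exact (isLimit_fork_iff w').1 ⟨isLimitForkMapOfIsLimit G w h⟩ z hz

end Equalizer

section Cofree

variable {k : Type u} [Field k] {B : Type u} [Ring B] [Bialgebra k B]

lemma cofreeCoact_naturality {M N : LeftComod k B} (f : M ⟶ N) :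
    cofreeCoact M ≫ LeftComod.tensorMap (trivialMap B f.lin) (𝟙 (regularComod k B)) =
      f ≫ cofreeCoact N :=
  LeftComod.hom_ext <| LinearMap.ext fun m => by
    have e : ∀ p : B ⊗[k] M.carrier, TensorProduct.map f.lin LinearMap.id
        (TensorProduct.comm k B M.carrier p) =
        TensorProduct.comm k B N.carrier (f.lin.lTensor B p) := fun p =>
      TensorProduct.map_comm f.lin LinearMap.id p
    exact (e _).trans (congrArg _ (f.comm_apply m).symm)

variable (B) in
/-- The associator for trivial comodules `V` and `W`. -/
def trivialAssoc (V W : Type u) [AddCommGroup V] [Module k V] [AddCommGroup W] [Module k W]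
    (M : LeftComod k B) : LeftComod.tensor (trivialComod k B (V ⊗[k] W)) M ⟶
      LeftComod.tensor (trivialComod k B V) (LeftComod.tensor (trivialComod k B W) M) :=
  LeftComod.tensorMap (trivialTensor k B V W).hom (𝟙 M) ≫ (LeftComod.assocIso _ _ M).hom

lemma trivialAssoc_lin (V W : Type u) [AddCommGroup V] [Module k V] [AddCommGroup W] [Module k W]
    (M : LeftComod k B) (t : (V ⊗[k] W) ⊗[k] M.carrier) :
    (trivialAssoc B V W M).lin t = TensorProduct.assoc k V W M.carrier t :=
  congrArg (TensorProduct.assoc k V W M.carrier)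
    (LinearMap.congr_fun (TensorProduct.map_id (R := k) (M := V ⊗[k] W) (N := M.carrier)) t)

/-- The first of the two maps `M ⊗ B ⟶ M ⊗ (B ⊗ B)` of which `M` is the equalizer. -/
def cofreeLeft (M : LeftComod k B) :
    LeftComod.tensor (trivialComod k B M.carrier) (regularComod k B) ⟶
      LeftComod.tensor (trivialComod k B M.carrier)
        (LeftComod.tensor (trivialComod k B B) (regularComod k B)) :=
  LeftComod.tensorMap (trivialMap B (cofreeCoact M).lin) (𝟙 (regularComod k B)) ≫
    trivialAssoc B M.carrier B (regularComod k B)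

/-- The second of the two maps `M ⊗ B ⟶ M ⊗ (B ⊗ B)` of which `M` is the equalizer. -/
def cofreeRight (M : LeftComod k B) :
    LeftComod.tensor (trivialComod k B M.carrier) (regularComod k B) ⟶
      LeftComod.tensor (trivialComod k B M.carrier)
        (LeftComod.tensor (trivialComod k B B) (regularComod k B)) :=
  LeftComod.tensorMap (𝟙 _) (cofreeCoact (regularComod k B))

/-- The map `U ⊗ (V ⊗ W) ≃ W ⊗ (V ⊗ U)` that reverses the order of the factors. -/
def reverseFactors (k U V W : Type u) [Field k] [AddCommGroup U] [Module k U] [AddCommGroup V]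
    [Module k V] [AddCommGroup W] [Module k W] : U ⊗[k] (V ⊗[k] W) ≃ₗ[k] W ⊗[k] (V ⊗[k] U) :=
  (TensorProduct.comm k U (V ⊗[k] W)) ≪≫ₗ
    (TensorProduct.congr (TensorProduct.comm k V W) (LinearEquiv.refl k U)) ≪≫ₗ
      (TensorProduct.assoc k W V U)

lemma reverseFactors_tmul {U V W : Type u} [AddCommGroup U] [Module k U] [AddCommGroup V]
    [Module k V] [AddCommGroup W] [Module k W] (u : U) (v : V) (w : W) :
    reverseFactors k U V W (u ⊗ₜ (v ⊗ₜ w)) = w ⊗ₜ (v ⊗ₜ u) := by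
  simp [reverseFactors]

lemma cofreeLeft_comm (M : LeftComod k B) (t : B ⊗[k] M.carrier) :
    (cofreeLeft M).lin (TensorProduct.comm k B M.carrier t) =
      reverseFactors k B B M.carrier (M.coact.lTensor B t) := by
  have e : ∀ t : B ⊗[k] M.carrier, TensorProduct.assoc k M.carrier B B
      (((TensorProduct.comm k B M.carrier).toLinearMap ∘ₗ M.coact).rTensor B
        (TensorProduct.comm k B M.carrier t)) =
      reverseFactors k B B M.carrier (M.coact.lTensor B t) := by
    intro t
    induction t with
    | zero => simp
    | add x y hx hy => simp only [map_add, hx, hy]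
    | tmul b m => rfl
  exact (trivialAssoc_lin _ _ _ _).trans (e t)

lemma cofreeRight_comm (M : LeftComod k B) (t : B ⊗[k] M.carrier) :
    (cofreeRight M).lin (TensorProduct.comm k B M.carrier t) =
      reverseFactors k B B M.carrier (TensorProduct.assoc k B B M.carrier
        ((Coalgebra.comul (R := k) (A := B)).rTensor M.carrier t)) := by
  have e : ∀ t : B ⊗[k] M.carrier, ((TensorProduct.comm k B B).toLinearMap ∘ₗ
      Coalgebra.comul (R := k) (A := B)).lTensor M.carrier (TensorProduct.comm k B M.carrier t) =
      reverseFactors k B B M.carrier (TensorProduct.assoc k B B M.carrier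
        ((Coalgebra.comul (R := k) (A := B)).rTensor M.carrier t)) := by
    intro t
    induction t with
    | zero => simp
    | add x y hx hy => simp only [map_add, hx, hy]
    | tmul b m =>
      simp only [TensorProduct.comm_tmul, LinearMap.lTensor_tmul, LinearMap.comp_apply,
        LinearMap.rTensor_tmul, LinearEquiv.coe_coe]
      generalize Coalgebra.comul (R := k) b = p
      induction p with
      | add x y hx hy =>
        simp only [map_add, TensorProduct.tmul_add, TensorProduct.add_tmul, hx, hy]
      | _ => simp [reverseFactors_tmul]
  exact e t

lemma cofreeCoact_fork (M : LeftComod k B) :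
    cofreeCoact M ≫ cofreeLeft M = cofreeCoact M ≫ cofreeRight M :=
  LeftComod.hom_ext <| LinearMap.ext fun m =>
    (cofreeLeft_comm M (M.coact m)).trans
      ((congrArg _ (M.isCoaction.coassoc_apply m).symm).trans (cofreeRight_comm M (M.coact m)).symm)

lemma existsUnique_cofreeCoact (M : LeftComod k B) (t : M.carrier ⊗[k] B)
    (ht : (cofreeLeft M).lin t = (cofreeRight M).lin t) : ∃! m, (cofreeCoact M).lin m = t := by
  obtain ⟨t, rfl⟩ := (TensorProduct.comm k B M.carrier).surjective t
  have h : t ∈ cotensor (Coalgebra.comul (R := k) (A := B)) M.coact :=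
    (reverseFactors k B B M.carrier).injective
      ((cofreeRight_comm M t).symm.trans (ht.symm.trans (cofreeLeft_comm M t)))
  obtain ⟨m, hm⟩ := (cotensorLid M.isCoaction).surjective ⟨t, h⟩
  refine ⟨m, congrArg (TensorProduct.comm k B M.carrier) (congrArg Subtype.val hm), fun m' hm' => ?_⟩
  exact (cotensorLid M.isCoaction).injective (Subtype.ext
    (((TensorProduct.comm k B M.carrier).injective hm').trans (congrArg Subtype.val hm).symm))

end Cofree

end

end HopfTrimod

namespace HopfTrimod

noncomputable section

section LinearAlgebra

variable {k : Type u} [Field k] {B : Type u} [Ring B] [Bialgebra k B]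
variable {X M N : Type u} [AddCommGroup X] [Module k X] [AddCommGroup M] [Module k M]
  [AddCommGroup N] [Module k N]

lemma comm_mem_cotensor_iff (r : X →ₗ[k] B ⊗[k] X) (c : M →ₗ[k] B ⊗[k] M) (t : M ⊗[k] X) :
    TensorProduct.comm k M X t ∈ cotensor ((TensorProduct.comm k B X).toLinearMap ∘ₗ r) c ↔
      r.lTensor M t = TensorProduct.assoc k M B X
        (((TensorProduct.comm k B M).toLinearMap ∘ₗ c).rTensor X t) := by
  have e1 : ∀ t : M ⊗[k] X, TensorProduct.assoc k X B M (((TensorProduct.comm k B X).toLinearMap ∘ₗ r).rTensor M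
      (TensorProduct.comm k M X t)) = reverseFactors k M B X (r.lTensor M t) := by
    intro t
    induction t with
    | zero => simp
    | add x y hx hy => simp only [map_add, hx, hy]
    | tmul m x =>
      simp only [TensorProduct.comm_tmul, LinearMap.rTensor_tmul, LinearMap.lTensor_tmul,
        LinearMap.comp_apply, LinearEquiv.coe_coe]
      generalize r x = p
      induction p with
      | add x y hx hy =>
        simp only [map_add, TensorProduct.tmul_add, TensorProduct.add_tmul, hx, hy]
      | _ => simp [reverseFactors_tmul]
  have e2 : ∀ t : M ⊗[k] X, c.lTensor X (TensorProduct.comm k M X t) = reverseFactors k M B X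
      (TensorProduct.assoc k M B X (((TensorProduct.comm k B M).toLinearMap ∘ₗ c).rTensor X t)) := by
    intro t
    induction t with
    | zero => simp
    | add x y hx hy => simp only [map_add, hx, hy]
    | tmul m x =>
      simp only [TensorProduct.comm_tmul, LinearMap.rTensor_tmul, LinearMap.lTensor_tmul,
        LinearMap.comp_apply, LinearEquiv.coe_coe]
      generalize c m = p
      induction p with
      | add x y hx hy =>
        simp only [map_add, TensorProduct.tmul_add, TensorProduct.add_tmul, hx, hy]
      | _ => simp [reverseFactors_tmul]
  rw [mem_cotensor, e1, e2, EmbeddingLike.apply_eq_iff_eq]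

lemma leftTensor_comm (l : X →ₗ[k] B ⊗[k] X) (t : M ⊗[k] X) :
    leftTensor l M (TensorProduct.comm k M X t) =
      (TensorProduct.comm k M X).toLinearMap.lTensor B
        (diagCoaction (trivialCoaction k B M) l t) := by
  induction t with
  | zero => simp
  | add x y hx hy => simp only [map_add, hx, hy]
  | tmul m x =>
    rw [TensorProduct.comm_tmul, leftTensor_tmul, diagCoaction_trivial]
    generalize l x = p
    induction p with
    | add x y hx hy => simp only [map_add, TensorProduct.add_tmul, hx, hy]
    | _ => simp

lemma actMap_lTensor_diagCoaction (φ : B →ₐ[k] Module.End k X) (l : X →ₗ[k] B ⊗[k] X) (b : B)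
    (x : X) : (actMap φ).lTensor B (diagCoaction (Coalgebra.comul (R := k) (A := B)) l (b ⊗ₜ x)) =
      diagAction (regular k B) φ b (l x) := by
  simp only [diagCoaction, LinearMap.comp_apply, TensorProduct.map_tmul, LinearEquiv.coe_coe,
    diagAction_apply]
  generalize Coalgebra.comul (R := k) b = p
  generalize l x = q
  induction p with
  | zero => simp
  | add x y hx hy =>
    simp only [map_add, TensorProduct.add_tmul, LinearMap.add_apply, hx, hy]
  | tmul b₁ b₂ =>
    induction q with
    | add x y hx hy => simp only [map_add, TensorProduct.tmul_add, hx, hy]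
    | _ => simp

lemma mul_lTensor_interchangeLin (φ : B →ₐ[k] Module.End k X) (b : B) (t : X ⊗[k] B) :
    (LinearMap.mul' k B).lTensor X (interchangeLin φ (Coalgebra.comul (R := k) (A := B)) B
      (b ⊗ₜ t)) = diagAction φ (regular k B) b t := by
  simp only [interchangeLin_tmul, diagAction_apply]
  generalize Coalgebra.comul (R := k) b = p
  induction p with
  | zero => simp
  | add x y hx hy =>
    simp only [map_add, TensorProduct.add_tmul, LinearMap.add_apply, hx, hy]
  | tmul b₁ b₂ =>
    induction t with
    | add x y hx hy => simp only [map_add, TensorProduct.tmul_add, hx, hy]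
    | _ => simp

lemma interchangeLin_comm (φ : B →ₐ[k] Module.End k X) (c : N →ₗ[k] B ⊗[k] N)
    (t : N ⊗[k] (M ⊗[k] X)) :
    interchangeLin φ c M ((TensorProduct.comm k M X).toLinearMap.lTensor N t) =
      TensorProduct.comm k (N ⊗[k] M) X ((actMap φ).lTensor (N ⊗[k] M)
        (TensorProduct.assoc k (N ⊗[k] M) B X
          (((TensorProduct.comm k B (N ⊗[k] M)).toLinearMap ∘ₗ
            diagCoaction c (trivialCoaction k B M)).rTensor X
              ((TensorProduct.assoc k N M X).symm t)))) := by
  induction t with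
  | zero => simp
  | add x y hx hy => simp only [map_add, hx, hy]
  | tmul n s =>
    induction s with
    | zero => simp
    | add x y hx hy => simp only [map_add, TensorProduct.tmul_add, hx, hy]
    | tmul m x =>
      simp only [LinearMap.lTensor_tmul, interchangeLin_tmul, TensorProduct.assoc_symm_tmul,
        LinearMap.rTensor_tmul, LinearMap.comp_apply, LinearEquiv.coe_coe, diagCoaction,
        TensorProduct.map_tmul, trivialCoaction, TensorProduct.mk_apply]
      generalize c n = p
      induction p with
      | add x y hx hy => simp only [map_add, TensorProduct.add_tmul, hx, hy]
      | _ => simp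

lemma comul_mul' (t : B ⊗[k] B) :
    Coalgebra.comul (R := k) (LinearMap.mul' k B t) = (LinearMap.mul' k B).lTensor B
      (diagCoaction (Coalgebra.comul (R := k) (A := B)) (Coalgebra.comul (R := k) (A := B)) t) := by
  induction t with
  | zero => simp
  | add x y hx hy => simp only [map_add, hx, hy]
  | tmul a b =>
    have h := (HopfTrimodule.unit k B).lcoact_act a b
    exact h.trans (actMap_lTensor_diagCoaction (regular k B) _ a b).symm

end LinearAlgebra

section Mul

variable (k : Type u) [Field k] (B : Type u) [Ring B] [Bialgebra k B]

/-- The multiplication `B ⊗ B ⟶ B`, as a morphism of comodules. -/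
def mulHom : LeftComod.tensor (regularComod k B) (regularComod k B) ⟶ regularComod k B where
  lin := (LinearMap.mul' k B : B ⊗[k] B →ₗ[k] B)
  comm := LinearMap.ext (comul_mul' (k := k) (B := B))

/-- The unit `k ⟶ B`, as a morphism of comodules. -/
def unitHom : LeftComod.unit k B ⟶ regularComod k B where
  lin := (Algebra.linearMap k B : k →ₗ[k] B)
  comm := by
    change Coalgebra.comul ∘ₗ Algebra.linearMap k B =
      (Algebra.linearMap k B).lTensor B ∘ₗ trivialCoaction k B k
    ext
    simp [trivialCoaction, Algebra.TensorProduct.one_def]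

lemma unitHom_mulHom : LeftComod.tensorMap (unitHom k B) (𝟙 (regularComod k B)) ≫ mulHom k B =
    (LeftComod.leftUnitorIso (regularComod k B)).hom :=
  LeftComod.hom_ext (TensorProduct.ext' fun (a : k) (b : B) => (Algebra.smul_def a b).symm)

lemma mulHom_assoc : (LeftComod.assocIso (regularComod k B) (regularComod k B)
      (regularComod k B)).hom ≫ LeftComod.tensorMap (𝟙 (regularComod k B)) (mulHom k B) ≫
      mulHom k B =
    LeftComod.tensorMap (mulHom k B) (𝟙 (regularComod k B)) ≫ mulHom k B :=
  LeftComod.hom_ext (TensorProduct.ext_threefold fun (a b c : B) => (mul_assoc a b c).symm)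

lemma cofreeCoact_formMap : cofreeCoact (regularComod k B) ≫
    LaxModuleEnd.formMap B (Coalgebra.counit (R := k) (A := B)) (regularComod k B) = 𝟙 _ := by
  refine LeftComod.hom_ext (LinearMap.ext fun (b : B) => ?_)
  have e : ∀ p : B ⊗[k] B, TensorProduct.lid k B ((Coalgebra.counit (R := k) (A := B)).rTensor B
      (TensorProduct.comm k B B p)) =
      TensorProduct.rid k B ((Coalgebra.counit (R := k) (A := B)).lTensor B p) := fun p => by
    induction p with
    | add x y hx hy => simp only [map_add, hx, hy]
    | _ => simp
  exact (e _).trans ((isRightCoaction_comul k B).counit_apply b)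

variable {k B}

/-- The morphism `N ⊗ (M ⊗ B) ⟶ (N ⊗ M) ⊗ B`, `n ⊗ (m ⊗ b) ↦ (n₍₀₎ ⊗ m) ⊗ n₍₋₁₎ b`, where `M` has
the trivial coaction in the source and `N ⊗ M` has the trivial coaction in the target. -/
def cofreeInterchange (N : LeftComod k B) (M : Type u) [AddCommGroup M] [Module k M] :
    LeftComod.tensor N (LeftComod.tensor (trivialComod k B M) (regularComod k B)) ⟶
      LeftComod.tensor (trivialComod k B (N.carrier ⊗[k] M)) (regularComod k B) :=
  (LeftComod.assocIso N (trivialComod k B M) (regularComod k B)).inv ≫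
    LeftComod.tensorMap (cofreeCoact (LeftComod.tensor N (trivialComod k B M))) (𝟙 _) ≫
    (LeftComod.assocIso (trivialComod k B (N.carrier ⊗[k] M)) (regularComod k B)
      (regularComod k B)).hom ≫
    LeftComod.tensorMap (𝟙 _) (mulHom k B)

lemma cofreeCoact_tensor (N M : LeftComod k B) :
    LeftComod.tensorMap (𝟙 N) (cofreeCoact M) ≫ cofreeInterchange N M.carrier =
      cofreeCoact (LeftComod.tensor N M) := by
  refine LeftComod.hom_ext (TensorProduct.ext' fun n m => ?_)
  have e : ∀ q : B ⊗[k] M.carrier,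
     (LinearMap.mul' k B).lTensor (N.carrier ⊗[k] M.carrier)
      (TensorProduct.assoc k (N.carrier ⊗[k] M.carrier) B B
        (((TensorProduct.comm k B (N.carrier ⊗[k] M.carrier)).toLinearMap ∘ₗ
            diagCoaction N.coact (trivialCoaction k B M.carrier)).rTensor B
          ((TensorProduct.assoc k N.carrier M.carrier B).symm (n ⊗ₜ
            TensorProduct.comm k B M.carrier q)))) =
      TensorProduct.comm k B (N.carrier ⊗[k] M.carrier)
        ((LinearMap.mul' k B).rTensor (N.carrier ⊗[k] M.carrier)
          (TensorProduct.tensorTensorTensorComm k B N.carrier B M.carrier (N.coact n ⊗ₜ q))) := by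
    intro q
    induction q with
    | zero => simp
    | add x y hx hy => simp only [map_add, TensorProduct.tmul_add, hx, hy]
    | tmul b m =>
      simp only [TensorProduct.comm_tmul, TensorProduct.assoc_symm_tmul,
        LinearMap.rTensor_tmul, LinearMap.comp_apply, LinearEquiv.coe_coe, diagCoaction,
        TensorProduct.map_tmul, trivialCoaction, TensorProduct.mk_apply]
      generalize N.coact n = p
      induction p with
      | add x y hx hy => simp only [map_add, TensorProduct.add_tmul, hx, hy]
      | _ => simp
  exact e (M.coact m)

end Mul

end

end HopfTrimod

namespace HopfTrimod

noncomputable section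

namespace LaxModuleEnd

open Limits

variable {k : Type u} [Field k] {B : Type u} [Ring B] [Bialgebra k B]
variable (F : LaxModuleEnd (LeftComod k B))

/-- The underlying comodule `F(B)` of the Hopf trimodule of a lax module endofunctor `F`. -/
abbrev fiber : LeftComod k B := F.functor.obj (regularComod k B)

lemma trivialStr_naturality_left {V W : Type u} [AddCommGroup V] [Module k V] [AddCommGroup W]
    [Module k W] (f : V →ₗ[k] W) (M : LeftComod k B) (t : V ⊗[k] (F.functor.obj M).carrier) :
    F.trivialStr W M (f.rTensor _ t) =
      (F.functor.map (LeftComod.tensorMap (trivialMap B f) (𝟙 M))).lin (F.trivialStr V M t) :=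
  F.strLin_naturality_left (trivialMap B f) M t

lemma trivialStr_naturality_right (V : Type u) [AddCommGroup V] [Module k V] {M N : LeftComod k B}
    (f : M ⟶ N) (t : V ⊗[k] (F.functor.obj M).carrier) :
    F.trivialStr V N ((F.functor.map f).lin.lTensor V t) =
      (F.functor.map (LeftComod.tensorMap (𝟙 _) f)).lin (F.trivialStr V M t) :=
  F.strLin_naturality_right (trivialComod k B V) f t

lemma trivialStr_assoc (V W : Type u) [AddCommGroup V] [Module k V] [AddCommGroup W] [Module k W]
    (M : LeftComod k B) (t : (V ⊗[k] W) ⊗[k] (F.functor.obj M).carrier) :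
    (F.functor.map (trivialAssoc B V W M)).lin (F.trivialStr (V ⊗[k] W) M t) =
      F.trivialStr V (LeftComod.tensor (trivialComod k B W) M)
        ((F.trivialStr W M).lTensor V (TensorProduct.assoc k V W _ t)) := by
  rw [trivialAssoc, map_comp_lin]
  have h := F.strLin_naturality_left (trivialTensor k B V W).hom M t
  refine (congrArg _ h.symm).trans ((F.strLin_assoc _ _ M _).trans ?_)
  exact congrArg (fun u => F.trivialStr V (LeftComod.tensor (trivialComod k B W) M)
        ((F.trivialStr W M).lTensor V (TensorProduct.assoc k V W _ u)))
    (LinearMap.congr_fun (LinearMap.rTensor_id _ _) t)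

lemma trivialStr_colinear (V : Type u) [AddCommGroup V] [Module k V] (M : LeftComod k B)
    (t : V ⊗[k] (F.functor.obj M).carrier) :
    (F.functor.obj (LeftComod.tensor (trivialComod k B V) M)).coact (F.trivialStr V M t) =
      (F.trivialStr V M).lTensor B
        (diagCoaction (trivialCoaction k B V) (F.functor.obj M).coact t) :=
  F.strLin_colinear (trivialComod k B V) M t

/-- The action `B ⊗ F(B) → F(B)`. -/
def actLin : B ⊗[k] F.fiber.carrier →ₗ[k] F.fiber.carrier :=
  (F.functor.map (mulHom k B)).lin ∘ₗ F.strLin (regularComod k B) (regularComod k B)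

lemma actLin_one (x : F.fiber.carrier) : F.actLin (1 ⊗ₜ x) = x := by
  have h := F.strLin_naturality_left (unitHom k B) (regularComod k B) ((1 : k) ⊗ₜ[k] x)
  have h₁ : F.actLin (Algebra.linearMap k B 1 ⊗ₜ x) = _ := congrArg (F.functor.map (mulHom k B)).lin h
  rw [← map_comp_lin, unitHom_mulHom, Algebra.linearMap_apply, map_one] at h₁
  exact h₁.trans ((F.strLin_unit (regularComod k B) (1 ⊗ₜ x)).trans
    ((TensorProduct.lid_tmul x 1).trans (one_smul k x)))

lemma actLin_mul (a b : B) (x : F.fiber.carrier) :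
    F.actLin ((a * b) ⊗ₜ x) = F.actLin (a ⊗ₜ F.actLin (b ⊗ₜ x)) := by
  have h₁ := F.strLin_naturality_right (regularComod k B) (mulHom k B)
    (a ⊗ₜ[k] F.strLin (regularComod k B) (regularComod k B) (b ⊗ₜ x))
  have h₂ := F.strLin_assoc (regularComod k B) (regularComod k B) (regularComod k B)
    ((a ⊗ₜ[k] b) ⊗ₜ[k] x)
  have h₃ := F.strLin_naturality_left (mulHom k B) (regularComod k B) ((a ⊗ₜ[k] b) ⊗ₜ[k] x)
  have h₄ : F.actLin (a ⊗ₜ F.actLin (b ⊗ₜ x)) = _ := congrArg (F.functor.map (mulHom k B)).lin h₁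
  have h₅ : F.actLin ((a * b) ⊗ₜ x) = _ := congrArg (F.functor.map (mulHom k B)).lin h₃
  rw [h₄, h₅, ← map_comp_lin, ← map_comp_lin, ← mulHom_assoc, map_comp_lin]
  exact congrArg _ h₂

/-- The action of `B` on `F(B)`. -/
def act : B →ₐ[k] Module.End k F.fiber.carrier :=
  AlgHom.ofLinearMap (TensorProduct.curry F.actLin) (LinearMap.ext F.actLin_one)
    fun a b => LinearMap.ext (F.actLin_mul a b)

lemma actMap_act : actMap F.act = F.actLin := TensorProduct.ext' fun _ _ => rfl

lemma act_apply (b : B) (x : F.fiber.carrier) : F.act b x = F.actLin (b ⊗ₜ x) := rfl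

lemma coact_act (b : B) (x : F.fiber.carrier) :
    F.fiber.coact (F.act b x) = diagAction (regular k B) F.act b (F.fiber.coact x) := by
  rw [← actMap_lTensor_diagCoaction, actMap_act, act_apply]
  refine ((F.functor.map (mulHom k B)).comm_apply _).trans ?_
  have h := F.strLin_colinear (regularComod k B) (regularComod k B) (b ⊗ₜ x)
  refine (congrArg _ h).trans ?_
  rw [← LinearMap.lTensor_comp_apply]
  rfl

/-- The map `F(c)`, where `c : N ⊗ (M ⊗ B) ⟶ (N ⊗ M) ⊗ B` is `cofreeInterchange N M`. -/
lemma map_cofreeInterchange (N : LeftComod k B) (M : Type u) [AddCommGroup M] [Module k M]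
    (t : N.carrier ⊗[k] (M ⊗[k] F.fiber.carrier)) :
    (F.functor.map (cofreeInterchange N M)).lin (F.strLin N _
      ((F.trivialStr M (regularComod k B)).lTensor N.carrier t)) =
    F.trivialStr (N.carrier ⊗[k] M) (regularComod k B)
      (F.actLin.lTensor (N.carrier ⊗[k] M) (TensorProduct.assoc k (N.carrier ⊗[k] M) B _
        (((TensorProduct.comm k B (N.carrier ⊗[k] M)).toLinearMap ∘ₗ
            diagCoaction N.coact (trivialCoaction k B M)).rTensor F.fiber.carrier
              ((TensorProduct.assoc k N.carrier M F.fiber.carrier).symm t)))) := by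
  obtain ⟨t, rfl⟩ := (TensorProduct.assoc k N.carrier M F.fiber.carrier).surjective t
  rw [LinearEquiv.symm_apply_apply]
  refine (F.map_comp_lin (LeftComod.assocIso N (trivialComod k B M) (regularComod k B)).inv _
    _).trans ?_
  have h₁ := F.strLin_assoc N (trivialComod k B M) (regularComod k B) t
  have h₁' : (F.functor.map (LeftComod.assocIso N (trivialComod k B M) (regularComod k B)).inv).lin
      (F.strLin N _ ((F.trivialStr M (regularComod k B)).lTensor N.carrier
        (TensorProduct.assoc k N.carrier M F.fiber.carrier t))) =
      F.strLin (LeftComod.tensor N (trivialComod k B M)) (regularComod k B) t := by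
    refine (congrArg _ h₁.symm).trans ?_
    rw [← map_comp_lin, Iso.hom_inv_id, F.functor.map_id]
    rfl
  refine (congrArg _ h₁').trans ?_
  refine (F.map_comp_lin (LeftComod.tensorMap (cofreeCoact
    (LeftComod.tensor N (trivialComod k B M))) (𝟙 (regularComod k B))) _ _).trans ?_
  refine (F.map_comp_lin (LeftComod.assocIso (trivialComod k B (N.carrier ⊗[k] M))
    (regularComod k B) (regularComod k B)).hom _ _).trans ?_
  have h₂ := F.strLin_naturality_left (cofreeCoact (LeftComod.tensor N (trivialComod k B M)))
    (regularComod k B) t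
  have h₃ := F.strLin_assoc (trivialComod k B (N.carrier ⊗[k] M)) (regularComod k B)
    (regularComod k B) (((TensorProduct.comm k B (N.carrier ⊗[k] M)).toLinearMap ∘ₗ
            diagCoaction N.coact (trivialCoaction k B M)).rTensor F.fiber.carrier t)
  refine (congrArg _ ((congrArg _ h₂.symm).trans h₃)).trans ?_
  refine (F.strLin_naturality_right (trivialComod k B (N.carrier ⊗[k] M)) (mulHom k B) _).symm.trans
    ?_
  refine congrArg (F.trivialStr (N.carrier ⊗[k] M) (regularComod k B)) ?_
  exact (LinearMap.lTensor_comp_apply _ _ _ _).symm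

variable {F} (hF : IsLexFinitary _ F)

/-- The map `F(M) → M ⊗ F(B)` induced by the coaction `M ⟶ M ⊗ B`. -/
def cofreeMap (M : LeftComod k B) :
    (F.functor.obj M).carrier →ₗ[k] M.carrier ⊗[k] F.fiber.carrier :=
  (trivialEquiv hF M.carrier (regularComod k B)).symm.toLinearMap ∘ₗ
    (F.functor.map (cofreeCoact M)).lin

lemma trivialStr_cofreeMap (M : LeftComod k B) (y : (F.functor.obj M).carrier) :
    F.trivialStr M.carrier (regularComod k B) (cofreeMap hF M y) =
      (F.functor.map (cofreeCoact M)).lin y :=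
  (trivialEquiv hF M.carrier (regularComod k B)).apply_symm_apply _

lemma cofreeMap_naturality {M N : LeftComod k B} (f : M ⟶ N) (y : (F.functor.obj M).carrier) :
    cofreeMap hF N ((F.functor.map f).lin y) = f.lin.rTensor _ (cofreeMap hF M y) := by
  apply F.trivialStr_injective
  rw [trivialStr_cofreeMap, trivialStr_naturality_left, trivialStr_cofreeMap, ← map_comp_lin,
    ← map_comp_lin, cofreeCoact_naturality]

lemma cofreeMap_colinear (M : LeftComod k B) (y : (F.functor.obj M).carrier) :
    diagCoaction (trivialCoaction k B M.carrier) F.fiber.coact (cofreeMap hF M y) =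
      (cofreeMap hF M).lTensor B ((F.functor.obj M).coact y) := by
  apply lTensor_inj B (F.trivialStr_injective M.carrier (regularComod k B))
  rw [← trivialStr_colinear, trivialStr_cofreeMap, ← LinearMap.lTensor_comp_apply]
  refine ((F.functor.map (cofreeCoact M)).comm_apply y).trans ?_
  congr 2
  exact LinearMap.ext fun y => (trivialStr_cofreeMap hF M y).symm

lemma lid_cofreeMap (x : F.fiber.carrier) : TensorProduct.lid k _
    ((Coalgebra.counit (R := k) (A := B)).rTensor _ (cofreeMap hF (regularComod k B) x)) = x := by
  refine (F.map_formMap_trivialStr _ _ _).symm.trans ?_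
  refine (congrArg _ (trivialStr_cofreeMap hF (regularComod k B) x)).trans ?_
  refine (F.map_comp_lin (cofreeCoact (regularComod k B)) _ x).symm.trans ?_
  exact LinearMap.congr_fun (congrArg LeftComod.Hom.lin
    ((congrArg F.functor.map (cofreeCoact_formMap k B)).trans (F.functor.map_id _))) x

lemma map_cofreeLeft (M : LeftComod k B) (t : M.carrier ⊗[k] F.fiber.carrier) :
    (F.functor.map (cofreeLeft M)).lin (F.trivialStr M.carrier (regularComod k B) t) =
      F.trivialStr M.carrier _ ((F.trivialStr B (regularComod k B)).lTensor M.carrier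
        (TensorProduct.assoc k M.carrier B F.fiber.carrier
          (((TensorProduct.comm k B M.carrier).toLinearMap ∘ₗ M.coact).rTensor _ t))) := by
  refine (F.map_comp_lin _ (trivialAssoc B M.carrier B (regularComod k B)) _).trans ?_
  refine (congrArg _ (F.trivialStr_naturality_left (cofreeCoact M).lin (regularComod k B)
    t).symm).trans ?_
  exact F.trivialStr_assoc M.carrier B (regularComod k B) _

lemma map_cofreeRight (M : LeftComod k B) (t : M.carrier ⊗[k] F.fiber.carrier) :
    (F.functor.map (cofreeRight M)).lin (F.trivialStr M.carrier (regularComod k B) t) =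
      F.trivialStr M.carrier _ ((F.trivialStr B (regularComod k B)).lTensor M.carrier
        ((cofreeMap hF (regularComod k B)).lTensor M.carrier t)) := by
  refine (F.trivialStr_naturality_right M.carrier (cofreeCoact (regularComod k B)) t).symm.trans ?_
  refine congrArg (F.trivialStr M.carrier _) ?_
  refine Eq.trans ?_ (LinearMap.lTensor_comp_apply M.carrier (F.trivialStr B (regularComod k B))
    (cofreeMap hF (regularComod k B)) t)
  exact congrArg (fun f => LinearMap.lTensor M.carrier f t)
    (LinearMap.ext fun y => (trivialStr_cofreeMap hF (regularComod k B) y).symm)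

/-- The right coaction `F(B) → F(B) ⊗ B`. -/
def fiberRight : F.fiber.carrier →ₗ[k] F.fiber.carrier ⊗[k] B :=
  (TensorProduct.comm k B F.fiber.carrier).toLinearMap ∘ₗ cofreeMap hF (regularComod k B)

lemma comm_mem_cotensor_fiberRight (M : LeftComod k B) (t : M.carrier ⊗[k] F.fiber.carrier) :
    TensorProduct.comm k M.carrier F.fiber.carrier t ∈ cotensor (fiberRight hF) M.coact ↔
      (F.functor.map (cofreeLeft M)).lin (F.trivialStr M.carrier (regularComod k B) t) =
        (F.functor.map (cofreeRight M)).lin (F.trivialStr M.carrier (regularComod k B) t) := by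
  rw [map_cofreeLeft, map_cofreeRight hF, (F.trivialStr_injective M.carrier _).eq_iff]
  exact (comm_mem_cotensor_iff (B := B) (cofreeMap hF (regularComod k B)) M.coact t).trans (eq_comm.trans
    (lTensor_inj M.carrier (F.trivialStr_injective B (regularComod k B))).eq_iff.symm)

lemma comm_cofreeMap_mem (M : LeftComod k B) (y : (F.functor.obj M).carrier) :
    TensorProduct.comm k M.carrier F.fiber.carrier (cofreeMap hF M y) ∈
      cotensor (fiberRight hF) M.coact := by
  rw [comm_mem_cotensor_fiberRight, trivialStr_cofreeMap, ← map_comp_lin, ← map_comp_lin,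
    cofreeCoact_fork]

lemma comm_cofreeMap_injective (M : LeftComod k B) {y y' : (F.functor.obj M).carrier}
    (h : cofreeMap hF M y = cofreeMap hF M y') : y = y' := by
  have := hF.1
  have h' := congrArg (F.trivialStr M.carrier (regularComod k B)) h
  rw [trivialStr_cofreeMap, trivialStr_cofreeMap] at h'
  refine (existsUnique_map_of_equalizer F.functor (cofreeCoact_fork M) (existsUnique_cofreeCoact M)
    ((F.functor.map (cofreeCoact M)).lin y') ?_).unique h' rfl
  rw [← map_comp_lin, ← map_comp_lin, cofreeCoact_fork]

lemma exists_comm_cofreeMap_eq (M : LeftComod k B) {t : F.fiber.carrier ⊗[k] M.carrier}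
    (ht : t ∈ cotensor (fiberRight hF) M.coact) :
    ∃ y, TensorProduct.comm k M.carrier F.fiber.carrier (cofreeMap hF M y) = t := by
  have := hF.1
  obtain ⟨t, rfl⟩ := (TensorProduct.comm k M.carrier F.fiber.carrier).surjective t
  obtain ⟨y, hy, -⟩ := existsUnique_map_of_equalizer F.functor (cofreeCoact_fork M)
    (existsUnique_cofreeCoact M) _ ((comm_mem_cotensor_fiberRight hF M t).1 ht)
  refine ⟨y, congrArg _ (F.trivialStr_injective M.carrier (regularComod k B) ?_)⟩
  rw [trivialStr_cofreeMap, hy]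

lemma cofreeMap_strLin (N M : LeftComod k B)
    (t : N.carrier ⊗[k] (F.functor.obj M).carrier) :
    TensorProduct.comm k _ F.fiber.carrier
      (cofreeMap hF (LeftComod.tensor N M) (F.strLin N M t)) =
      interchangeLin F.act N.coact M.carrier
        (((TensorProduct.comm k M.carrier F.fiber.carrier).toLinearMap ∘ₗ
          cofreeMap hF M).lTensor N.carrier t) := by
  rw [LinearMap.lTensor_comp_apply, interchangeLin_comm, actMap_act]
  refine congrArg (TensorProduct.comm k (N.carrier ⊗[k] M.carrier) F.fiber.carrier) ?_
  apply F.trivialStr_injective (N.carrier ⊗[k] M.carrier)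
  rw [← map_cofreeInterchange]
  refine (trivialStr_cofreeMap hF (LeftComod.tensor N M) _).trans ?_
  rw [← LinearMap.lTensor_comp_apply, ← cofreeCoact_tensor]
  refine (F.map_comp_lin _ (cofreeInterchange N M.carrier) _).trans ?_
  refine congrArg _ ((F.strLin_naturality_right N (cofreeCoact M) t).symm.trans ?_)
  exact congrArg (fun f => F.strLin N _ (LinearMap.lTensor N.carrier f t))
    (LinearMap.ext fun y => (trivialStr_cofreeMap hF M y).symm)

/-- The Hopf trimodule `F(B)` of a left exact finitary lax module endofunctor `F`. -/
@[simps] def toTrimodule : HopfTrimodule k B where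
  carrier := F.fiber.carrier
  lcoact := F.fiber.coact
  rcoact := fiberRight hF
  act := F.act
  isLeft := F.fiber.isCoaction
  isRight :=
    { coassoc := LinearMap.ext fun x => comm_cofreeMap_mem hF (regularComod k B) x
      counit := LinearMap.ext fun x => by
        have e : ∀ t : B ⊗[k] F.fiber.carrier, TensorProduct.rid k _
            ((Coalgebra.counit (R := k) (A := B)).lTensor _ (TensorProduct.comm k B _ t)) =
            TensorProduct.lid k _ ((Coalgebra.counit (R := k) (A := B)).rTensor _ t) := fun t => by
          induction t with
          | add x y hx hy => simp only [map_add, hx, hy]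
          | _ => simp
        exact (e _).trans (lid_cofreeMap hF x) }
  bicompatible := LinearMap.ext fun x => by
    have h := (leftTensor_comm F.fiber.coact (cofreeMap hF (regularComod k B) x)).trans
      (congrArg _ (cofreeMap_colinear hF (regularComod k B) x))
    exact (LinearMap.lTensor_comp_apply B _ _ _).trans h.symm
  lcoact_act := F.coact_act
  rcoact_act b x := by
    rw [← mul_lTensor_interchangeLin]
    have h := cofreeMap_strLin hF (regularComod k B) (regularComod k B) (b ⊗ₜ x)
    have h₁ := cofreeMap_naturality hF (mulHom k B)
      (F.strLin (regularComod k B) (regularComod k B) (b ⊗ₜ x))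
    refine (congrArg (TensorProduct.comm k B F.fiber.carrier) h₁).trans ?_
    refine (TensorProduct.map_comm LinearMap.id (LinearMap.mul' k B) _).symm.trans ?_
    exact congrArg ((LinearMap.mul' k B).lTensor F.fiber.carrier) h

end LaxModuleEnd

end

end HopfTrimod

namespace HopfTrimod

noncomputable section

namespace LaxModuleEnd

open Limits

variable {k : Type u} [Field k] {B : Type u} [Ring B] [Bialgebra k B]
variable {F : LaxModuleEnd (LeftComod k B)} (hF : IsLexFinitary _ F)

/-- The isomorphism `F(M) ≃ F(B) □ M`. -/
def fiberEquiv (M : LeftComod k B) :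
    (F.functor.obj M).carrier ≃ₗ[k] cotensor (fiberRight hF) M.coact :=
  LinearEquiv.ofBijective (LinearMap.codRestrict _
      ((TensorProduct.comm k M.carrier F.fiber.carrier).toLinearMap ∘ₗ cofreeMap hF M)
      (comm_cofreeMap_mem hF M))
    ⟨fun _ _ h => comm_cofreeMap_injective hF M
      ((TensorProduct.comm k M.carrier F.fiber.carrier).injective (congrArg Subtype.val h)),
    fun t => by
      obtain ⟨y, hy⟩ := exists_comm_cofreeMap_eq hF M t.2
      exact ⟨y, Subtype.ext hy⟩⟩

lemma fiberEquiv_colinear (M : LeftComod k B) (y : (F.functor.obj M).carrier) :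
    ((toTrimodule hF).cotensorComod M).coact (fiberEquiv hF M y) =
      (fiberEquiv hF M).toLinearMap.lTensor B ((F.functor.obj M).coact y) := by
  refine restrictLeft_comm (cotensor (fiberRight hF) M.coact)
    (leftTensor_mem (toTrimodule hF).bicompatible) (fiberEquiv hF M).toLinearMap y ?_
  have h : (cotensor (fiberRight hF) M.coact).subtype ∘ₗ (fiberEquiv hF M).toLinearMap =
    (TensorProduct.comm k M.carrier F.fiber.carrier).toLinearMap ∘ₗ cofreeMap hF M := rfl
  rw [h, LinearMap.lTensor_comp_apply, ← cofreeMap_colinear]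
  exact leftTensor_comm F.fiber.coact (cofreeMap hF M y)

/-- A left exact finitary lax module endofunctor `F` is isomorphic to `F(B) □ -`. -/
def cotensorFiberIso : F ≅ (cotensorLax k B).obj (toTrimodule hF) :=
  LaxModuleEnd.isoMk (F := F) (G := (cotensorLax k B).obj (toTrimodule hF))
    (NatIso.ofComponents (F := F.functor) (G := (toTrimodule hF).cotensorFunctor)
      (fun M => LeftComod.isoMk (M := F.functor.obj M) (N := (toTrimodule hF).cotensorComod M)
        (fiberEquiv hF M) (LinearMap.ext (fiberEquiv_colinear hF M)))
      fun {M N} f => LeftComod.hom_ext <| LinearMap.ext fun y => Subtype.ext <|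
        (congrArg (TensorProduct.comm k N.carrier F.fiber.carrier)
          (cofreeMap_naturality hF f y)).trans (TensorProduct.map_comm LinearMap.id f.lin _).symm)
    fun V M => LeftComod.hom_ext <| LinearMap.ext fun t => Subtype.ext <| by
      refine Eq.trans (congrArg (interchangeLin F.act V.coact M.carrier) ?_)
        (cofreeMap_strLin hF V M t).symm
      exact (LinearMap.lTensor_comp_apply V.carrier (cotensor (fiberRight hF) M.coact).subtype
        (fiberEquiv hF M).toLinearMap t).symm

end LaxModuleEnd

open LaxModuleEnd

variable {k : Type u} [Field k] {B : Type u} [Ring B] [Bialgebra k B]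

section Full

variable {X Y : HopfTrimodule k B}

/-- The components `X □ M → Y □ M` of a module transformation. -/
def transApp (g : (cotensorLax k B).obj X ⟶ (cotensorLax k B).obj Y) (M : LeftComod k B) :
    cotensor X.rcoact M.coact →ₗ[k] cotensor Y.rcoact M.coact :=
  (g.nat.app M).lin

variable (g : (cotensorLax k B).obj X ⟶ (cotensorLax k B).obj Y)

lemma transApp_naturality {M N : LeftComod k B} (f : M ⟶ N) (t : cotensor X.rcoact M.coact) :
    transApp g N ((X.cotensorFunctor.map f).lin t) =
      (Y.cotensorFunctor.map f).lin (transApp g M t) :=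
  LinearMap.congr_fun (congrArg LeftComod.Hom.lin (g.nat.naturality f)) t

lemma transApp_interchange (V M : LeftComod k B)
    (s : V.carrier ⊗[k] cotensor X.rcoact M.coact) :
    transApp g (LeftComod.tensor V M) (interchange X.rcoact_act V.isCoaction M.coact s) =
      interchange Y.rcoact_act V.isCoaction M.coact ((transApp g M).lTensor V.carrier s) :=
  (hom_strLin g V M s).symm

/-- The map `X → Y` induced by a module transformation `X □ - ⟶ Y □ -`. -/
def transLin : X.carrier →ₗ[k] Y.carrier :=
  (cotensorRid Y.isRight).symm.toLinearMap ∘ₗ transApp g (regularComod k B) ∘ₗ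
    (cotensorRid X.isRight).toLinearMap

lemma cotensorRid_transLin (x : X.carrier) :
    cotensorRid Y.isRight (transLin g x) =
      transApp g (regularComod k B) (cotensorRid X.isRight x) :=
  (cotensorRid Y.isRight).apply_symm_apply _

lemma lTensor_cofreeCoact {X : Type u} [AddCommGroup X] [Module k X] {r : X →ₗ[k] X ⊗[k] B}
    (φ : B →ₐ[k] Module.End k X) (M : LeftComod k B) {t : X ⊗[k] M.carrier} (ht : t ∈ cotensor r M.coact) :
    (cofreeCoact M).lin.lTensor X t = interchangeLin φ (trivialCoaction k B M.carrier) B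
      (r.lTensor M.carrier (TensorProduct.comm k X M.carrier t)) := by
  have e : ∀ u : (X ⊗[k] B) ⊗[k] M.carrier,
      (TensorProduct.comm k B M.carrier).toLinearMap.lTensor X
        (TensorProduct.assoc k X B M.carrier u) =
        interchangeLin φ (trivialCoaction k B M.carrier) B
          (TensorProduct.comm k _ M.carrier u) := fun u => by
    induction u with
    | zero => simp
    | add x y hx hy => simp only [map_add, hx, hy]
    | tmul u m =>
      induction u with
      | add x y hx hy => simp only [map_add, TensorProduct.add_tmul, hx, hy]
      | _ => simp [interchangeLin_tmul, trivialCoaction]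
  have h := mem_cotensor.1 ht
  refine (LinearMap.lTensor_comp_apply X (TensorProduct.comm k B M.carrier).toLinearMap M.coact
    t).trans ((congrArg _ h.symm).trans ((e _).trans ?_))
  exact congrArg _ (TensorProduct.map_comm LinearMap.id r t).symm

lemma counit_cofreeCoact {X : Type u} [AddCommGroup X] [Module k X] (M : LeftComod k B)
    (t : X ⊗[k] M.carrier) :
    ((TensorProduct.rid k M.carrier).toLinearMap ∘ₗ
      (Coalgebra.counit (R := k) (A := B)).lTensor M.carrier).lTensor X
        ((cofreeCoact M).lin.lTensor X t) = t := by
  have e : ∀ u : B ⊗[k] M.carrier, TensorProduct.rid k M.carrier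
      ((Coalgebra.counit (R := k) (A := B)).lTensor M.carrier
        (TensorProduct.comm k B M.carrier u)) =
      TensorProduct.lid k M.carrier ((Coalgebra.counit (R := k) (A := B)).rTensor M.carrier u) :=
    fun u => by
      induction u with
      | add x y hx hy => simp only [map_add, hx, hy]
      | _ => simp
  refine (LinearMap.lTensor_comp_apply X ((TensorProduct.rid k M.carrier).toLinearMap ∘ₗ
      (Coalgebra.counit (R := k) (A := B)).lTensor M.carrier) (cofreeCoact M).lin t).symm.trans ?_
  have h : ((TensorProduct.rid k M.carrier).toLinearMap ∘ₗ
      (Coalgebra.counit (R := k) (A := B)).lTensor M.carrier) ∘ₗ (cofreeCoact M).lin =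
      LinearMap.id := LinearMap.ext fun m => (e _).trans (M.isCoaction.counit_apply m)
  exact (congrArg (fun f => LinearMap.lTensor X f t) h).trans
    (LinearMap.congr_fun (LinearMap.lTensor_id _ _) t)

lemma counit_interchangeLin {X : Type u} [AddCommGroup X] [Module k X] {r : X →ₗ[k] X ⊗[k] B}
    (hr : IsRightCoaction r) (φ : B →ₐ[k] Module.End k X) (M : Type u) [AddCommGroup M] [Module k M]
    (u : M ⊗[k] X) :
    ((TensorProduct.rid k M).toLinearMap ∘ₗ
      (Coalgebra.counit (R := k) (A := B)).lTensor M).lTensor X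
        (interchangeLin φ (trivialCoaction k B M) B (r.lTensor M u)) =
      TensorProduct.comm k M X u := by
  have e : ∀ (m : M) (s : X ⊗[k] B), ((TensorProduct.rid k M).toLinearMap ∘ₗ
      (Coalgebra.counit (R := k) (A := B)).lTensor M).lTensor X
        (interchangeLin φ (trivialCoaction k B M) B (m ⊗ₜ s)) =
      TensorProduct.rid k X ((Coalgebra.counit (R := k) (A := B)).lTensor X s) ⊗ₜ m :=
    fun m s => by
      induction s with
      | zero => simp
      | add x y hx hy =>
        simp only [map_add, TensorProduct.tmul_add, TensorProduct.add_tmul, hx, hy]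
      | tmul x b =>
        simp [interchangeLin_tmul, trivialCoaction, TensorProduct.smul_tmul]
  induction u with
  | zero => simp
  | add x y hx hy => simp only [map_add, hx, hy]
  | tmul m x => rw [LinearMap.lTensor_tmul, e, hr.counit_apply, TensorProduct.comm_tmul]

lemma cofreeCoact_eq_interchange (M : LeftComod k B) (t : cotensor X.rcoact M.coact) :
    (X.cotensorFunctor.map (cofreeCoact M)).lin t =
      interchange X.rcoact_act (trivialComod k B M.carrier).isCoaction (regularComod k B).coact
        ((cotensorRid X.isRight).toLinearMap.lTensor M.carrier
          (TensorProduct.comm k X.carrier M.carrier t.1)) := by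
  refine Subtype.ext ((lTensor_cofreeCoact X.act M t.2).trans ?_)
  refine congrArg (interchangeLin X.act (trivialCoaction k B M.carrier) B) ?_
  exact LinearMap.lTensor_comp_apply M.carrier
    (cotensor X.rcoact (Coalgebra.comul (R := k) (A := B))).subtype
    (cotensorRid X.isRight).toLinearMap _

lemma transApp_coe (M : LeftComod k B) (t : cotensor X.rcoact M.coact) :
    (transApp g M t : Y.carrier ⊗[k] M.carrier) = (transLin g).rTensor M.carrier t.1 := by
  have h := transApp_naturality g (cofreeCoact M) t
  rw [cofreeCoact_eq_interchange] at h
  have h₁ := (transApp_interchange g (trivialComod k B M.carrier) (regularComod k B) _).symm.trans h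
  have h₂ := congrArg (((TensorProduct.rid k M.carrier).toLinearMap ∘ₗ
      (Coalgebra.counit (R := k) (A := B)).lTensor M.carrier).lTensor Y.carrier)
    (congrArg Subtype.val h₁)
  refine ((counit_cofreeCoact M (transApp g M t).1).symm.trans (h₂.symm.trans ?_))
  have h₃ : ∀ (T : cotensor X.rcoact (Coalgebra.comul (R := k) (A := B)) →ₗ[k]
      cotensor Y.rcoact (Coalgebra.comul (R := k) (A := B))),
      (∀ x, cotensorRid Y.isRight (transLin g x) = T (cotensorRid X.isRight x)) →
      ∀ u : M.carrier ⊗[k] X.carrier,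
      (cotensor Y.rcoact (Coalgebra.comul (R := k) (A := B))).subtype.lTensor M.carrier
        (T.lTensor M.carrier
          ((cotensorRid X.isRight).toLinearMap.lTensor M.carrier u)) =
      Y.rcoact.lTensor M.carrier ((transLin g).lTensor M.carrier u) := fun T hT u => by
    induction u with
    | zero => simp
    | add x y hx hy => simp only [map_add, hx, hy]
    | tmul m x => exact congrArg (fun y => m ⊗ₜ[k] Subtype.val y) (hT x).symm
  refine (congrArg _ (congrArg (interchangeLin Y.act (trivialCoaction k B M.carrier) B)
    (h₃ _ (cotensorRid_transLin g) _))).trans ?_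
  rw [counit_interchangeLin Y.isRight]
  generalize t.1 = u
  induction u with
  | add x y hx hy => simp only [map_add, hx, hy]
  | _ => simp

lemma transLin_rcomm (x : X.carrier) :
    Y.rcoact (transLin g x) = (transLin g).rTensor B (X.rcoact x) :=
  (congrArg Subtype.val (cotensorRid_transLin g x)).trans
    (transApp_coe g (regularComod k B) (cotensorRid X.isRight x))

lemma transLin_lcomm (x : X.carrier) :
    Y.lcoact (transLin g x) = (transLin g).lTensor B (X.lcoact x) := by
  apply lTensor_inj B (cotensorRid Y.isRight).injective
  refine (cotensorRid_lcoact Y.isRight Y.bicompatible (transLin g x)).symm.trans ?_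
  refine (congrArg _ (cotensorRid_transLin g x)).trans ?_
  refine ((g.nat.app (regularComod k B)).comm_apply _).trans ?_
  refine (congrArg _ (cotensorRid_lcoact X.isRight X.bicompatible x)).trans ?_
  refine (LinearMap.lTensor_comp_apply B (transApp g (regularComod k B))
    (cotensorRid X.isRight).toLinearMap (X.lcoact x)).symm.trans ?_
  refine Eq.trans ?_ (LinearMap.lTensor_comp_apply B (cotensorRid Y.isRight).toLinearMap
    (transLin g) (X.lcoact x))
  exact congrArg (fun f => LinearMap.lTensor B f (X.lcoact x))
    (LinearMap.ext fun x => (cotensorRid_transLin g x).symm)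

lemma counit_interchangeLin_comul {X : Type u} [AddCommGroup X] [Module k X]
    {r : X →ₗ[k] X ⊗[k] B} (hr : IsRightCoaction r) (φ : B →ₐ[k] Module.End k X) (b : B) (x : X) :
    TensorProduct.rid k X ((Coalgebra.counit (R := k) (A := B) ∘ₗ LinearMap.mul' k B).lTensor X
        (interchangeLin φ (Coalgebra.comul (R := k) (A := B)) B (b ⊗ₜ r x))) = φ b x := by
  have e : ∀ s : X ⊗[k] B, TensorProduct.rid k X
      ((Coalgebra.counit (R := k) (A := B) ∘ₗ LinearMap.mul' k B).lTensor X
        (interchangeLin φ (Coalgebra.comul (R := k) (A := B)) B (b ⊗ₜ s))) =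
      φ b (TensorProduct.rid k X ((Coalgebra.counit (R := k) (A := B)).lTensor X s)) := fun s => by
    induction s with
    | zero => simp
    | add x y hx hy => simp only [map_add, TensorProduct.tmul_add, hx, hy]
    | tmul x c =>
      have e' : ∀ p : B ⊗[k] B, TensorProduct.rid k X
          ((Coalgebra.counit (R := k) (A := B) ∘ₗ LinearMap.mul' k B).lTensor X
            (interchangeAux φ B B (p ⊗ₜ (x ⊗ₜ c)))) =
          Coalgebra.counit (R := k) c • φ (TensorProduct.rid k B
            ((Coalgebra.counit (R := k) (A := B)).lTensor B p)) x := fun p => by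
        induction p with
        | zero => simp
        | add x y hx hy =>
          simp only [map_add, TensorProduct.add_tmul, hx, hy, LinearMap.add_apply, smul_add]
        | tmul b₁ b₂ => simp [mul_comm, mul_smul]
      rw [interchangeLin_tmul, e', (isRightCoaction_comul k B).counit_apply]
      simp
  rw [e, hr.counit_apply]

lemma transLin_acomm (b : B) (x : X.carrier) :
    transLin g (X.act b x) = Y.act b (transLin g x) := by
  have h := congrArg Subtype.val (transApp_interchange g (regularComod k B) (regularComod k B)
    (b ⊗ₜ cotensorRid X.isRight x))
  have h₁ := (transApp_coe g _ _).symm.trans h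
  have h₂ : ∀ y : cotensor Y.rcoact (Coalgebra.comul (R := k) (A := B)),
      cotensorRid Y.isRight (transLin g x) = y →
      interchangeLin Y.act (Coalgebra.comul (R := k) (A := B)) B (b ⊗ₜ y.1) =
      interchangeLin Y.act (Coalgebra.comul (R := k) (A := B)) B (b ⊗ₜ Y.rcoact (transLin g x)) := by
    rintro _ rfl
    rfl
  have e : ∀ u : X.carrier ⊗[k] (B ⊗[k] B), transLin g (TensorProduct.rid k X.carrier
      ((Coalgebra.counit (R := k) (A := B) ∘ₗ LinearMap.mul' k B).lTensor X.carrier u)) =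
      TensorProduct.rid k Y.carrier
      ((Coalgebra.counit (R := k) (A := B) ∘ₗ LinearMap.mul' k B).lTensor Y.carrier
        ((transLin g).rTensor (B ⊗[k] B) u)) := fun u => by
    induction u with
    | add x y hx hy => simp only [map_add, hx, hy]
    | _ => simp
  rw [← counit_interchangeLin_comul X.isRight, ← counit_interchangeLin_comul Y.isRight, e]
  exact congrArg (fun u => TensorProduct.rid k Y.carrier
    ((Coalgebra.counit (R := k) (A := B) ∘ₗ LinearMap.mul' k B).lTensor Y.carrier u))
    (h₁.trans (h₂ _ (cotensorRid_transLin g x)))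

/-- The morphism of Hopf trimodules induced by a module transformation `X □ - ⟶ Y □ -`. -/
def transHom : X ⟶ Y where
  lin := transLin g
  lcomm := transLin_lcomm g
  rcomm := transLin_rcomm g
  acomm := transLin_acomm g

end Full

instance : (cotensorLax k B).Full where
  map_surjective {_ _} g := ⟨transHom g, LaxModuleEnd.hom_ext <| NatTrans.ext <| funext fun M =>
    LeftComod.hom_ext <| LinearMap.ext fun t => Subtype.ext (transApp_coe g M t).symm⟩

instance : (cotensorLax k B).Faithful where
  map_injective {X Y} f g h := HopfTrimodule.hom_ext <| LinearMap.ext fun x => by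
    have h' := LinearMap.congr_fun (congrArg (fun f => LeftComod.Hom.lin
      (f.nat.app (regularComod k B))) h) (cotensorRid X.isRight x)
    have h₁ : ∀ f : X ⟶ Y, Subtype.val ((((cotensorLax k B).map f).nat.app
        (regularComod k B)).lin (cotensorRid X.isRight x)) = Y.rcoact (f.lin x) :=
      fun f => (f.rcomm x).symm
    have h₂ := (h₁ f).symm.trans ((congrArg Subtype.val h').trans (h₁ g))
    rw [← Y.isRight.counit_apply (f.lin x), h₂, Y.isRight.counit_apply]

/-- Hopf trimodules are equivalent to left exact finitary lax module endofunctors. -/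
instance isEquivalence_lift_cotensorLax :
    (ObjectProperty.lift _ (cotensorLax k B) isLexFinitary_cotensorLax).IsEquivalence where
  essSurj := ⟨fun F => ⟨toTrimodule F.property,
    ⟨(ObjectProperty.isoMk _ (cotensorFiberIso F.property)).symm⟩⟩⟩

end

end HopfTrimod

namespace HopfTrimod

noncomputable section

section LinearAlgebra

variable {k : Type u} [Field k] {B : Type u} [Ring B] [Bialgebra k B]
variable {V N N' X X' Y Y' Z Z' : Type u}
  [AddCommGroup V] [Module k V] [AddCommGroup N] [Module k N] [AddCommGroup N'] [Module k N']
  [AddCommGroup X] [Module k X] [AddCommGroup X'] [Module k X'] [AddCommGroup Y] [Module k Y]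
  [AddCommGroup Y'] [Module k Y'] [AddCommGroup Z] [Module k Z] [AddCommGroup Z'] [Module k Z']

lemma assoc_subtype_map {E : Submodule k (X ⊗[k] Y)} {E' : Submodule k (X' ⊗[k] Y')}
    (f : X →ₗ[k] X') (g : Y →ₗ[k] Y') (e : Z →ₗ[k] Z') (A : E →ₗ[k] E')
    (hA : ∀ s, (A s : X' ⊗[k] Y') = TensorProduct.map f g s) (u : E ⊗[k] Z) :
    TensorProduct.assoc k X' Y' Z' (E'.subtype.rTensor Z' (TensorProduct.map A e u)) =
      TensorProduct.map f (TensorProduct.map g e)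
        (TensorProduct.assoc k X Y Z (E.subtype.rTensor Z u)) := by
  induction u with
  | zero => simp
  | add x y hx hy => simp only [map_add, hx, hy]
  | tmul x y =>
    simp only [TensorProduct.map_tmul, LinearMap.rTensor_tmul, Submodule.subtype_apply, hA]
    exact (LinearMap.congr_fun (TensorProduct.map_map_comp_assoc_eq f g e)
      ((x : X ⊗[k] Y) ⊗ₜ[k] y)).symm

lemma subtype_map {E : Submodule k (Y ⊗[k] Z)} {E' : Submodule k (Y' ⊗[k] Z')}
    (f : X →ₗ[k] X') (g : Y →ₗ[k] Y') (e : Z →ₗ[k] Z') (A : E →ₗ[k] E')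
    (hA : ∀ s, (A s : Y' ⊗[k] Z') = TensorProduct.map g e s) (u : X ⊗[k] E) :
    E'.subtype.lTensor X' (TensorProduct.map f A u) =
      TensorProduct.map f (TensorProduct.map g e) (E.subtype.lTensor X u) := by
  induction u with
  | add x y hx hy => simp only [map_add, hx, hy]
  | _ => simp [hA]

lemma cotensorAssoc_map {rX : X →ₗ[k] X ⊗[k] B} {rX' : X' →ₗ[k] X' ⊗[k] B}
    {lY : Y →ₗ[k] B ⊗[k] Y} {rY : Y →ₗ[k] Y ⊗[k] B} (h : Bicompatible lY rY)
    {lY' : Y' →ₗ[k] B ⊗[k] Y'} {rY' : Y' →ₗ[k] Y' ⊗[k] B} (h' : Bicompatible lY' rY')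
    {lZ : Z →ₗ[k] B ⊗[k] Z} {lZ' : Z' →ₗ[k] B ⊗[k] Z'}
    (f : X →ₗ[k] X') (g : Y →ₗ[k] Y') (e : Z →ₗ[k] Z')
    (A : cotensor rX lY →ₗ[k] cotensor rX' lY')
    (hA : ∀ s, (A s : X' ⊗[k] Y') = TensorProduct.map f g s)
    (A' : cotensor rY lZ →ₗ[k] cotensor rY' lZ')
    (hA' : ∀ s, (A' s : Y' ⊗[k] Z') = TensorProduct.map g e s)
    {t : cotensor (restrictRight (cotensor rX lY) (rightTensor rY X) (rightTensor_mem h)) lZ}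
    {t' : cotensor (restrictRight (cotensor rX' lY') (rightTensor rY' X') (rightTensor_mem h')) lZ'}
    (ht : t'.1 = TensorProduct.map A e t.1) :
    (cotensorAssoc rX' h' lZ' t').1 = TensorProduct.map f A' (cotensorAssoc rX h lZ t).1 := by
  apply lTensor_inj X' (cotensor rY' lZ').injective_subtype
  refine (cotensorAssoc_spec rX' h' lZ' t').trans ?_
  rw [subtype_map f g e A' hA']
  refine Eq.trans ?_ (congrArg (TensorProduct.map f (TensorProduct.map g e))
    (cotensorAssoc_spec rX h lZ t)).symm
  refine (congrArg (fun u => TensorProduct.assoc k X' Y' Z'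
    ((cotensor rX' lY').subtype.rTensor Z' u)) ht).trans ?_
  exact assoc_subtype_map f g e A hA t.1

lemma interchangeLin_diagAction (φ : B →ₐ[k] Module.End k X) (ψ : B →ₐ[k] Module.End k Y)
    {c : V →ₗ[k] B ⊗[k] V} (hc : IsLeftCoaction c) (u : V ⊗[k] ((X ⊗[k] Y) ⊗[k] N)) :
    TensorProduct.assoc k X Y (V ⊗[k] N) (interchangeLin (diagAction φ ψ) c N u) =
      (interchangeLin ψ c N).lTensor X (interchangeLin φ c (Y ⊗[k] N)
        ((TensorProduct.assoc k X Y N).toLinearMap.lTensor V u)) := by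
  have e (x : X) (y : Y) (n : N) : ∃ T : B ⊗[k] (B ⊗[k] V) →ₗ[k] X ⊗[k] (Y ⊗[k] (V ⊗[k] N)),
      ∀ b p, T (b ⊗ₜ p) = φ b x ⊗ₜ interchangeAux ψ V N (p ⊗ₜ (y ⊗ₜ n)) :=
    ⟨TensorProduct.map (φ.toLinearMap.flip x)
      ((interchangeAux ψ V N).comp ((TensorProduct.mk k (B ⊗[k] V) (Y ⊗[k] N)).flip (y ⊗ₜ n))),
      fun _ _ => rfl⟩
  induction u with
  | zero => simp
  | add x y hx hy => simp only [map_add, hx, hy]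
  | tmul v u =>
    induction u with
    | zero => simp
    | add x y hx hy => simp only [map_add, TensorProduct.tmul_add, hx, hy]
    | tmul u n =>
      induction u with
      | zero => simp
      | add x y hx hy => simp only [map_add, TensorProduct.add_tmul, TensorProduct.tmul_add, hx, hy]
      | tmul x y =>
        obtain ⟨T, hT⟩ := e x y n
        have e1 : ∀ p : B ⊗[k] V, TensorProduct.assoc k X Y (V ⊗[k] N)
            (interchangeAux (diagAction φ ψ) V N (p ⊗ₜ ((x ⊗ₜ y) ⊗ₜ n))) =
            T (TensorProduct.assoc k B B V
              ((Coalgebra.comul (R := k) (A := B)).rTensor V p)) := fun p => by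
          induction p with
          | zero => simp
          | add x y hx hy => simp only [map_add, TensorProduct.add_tmul, hx, hy]
          | tmul b v =>
            rw [interchangeAux_tmul, diagAction_apply, LinearMap.rTensor_tmul]
            generalize Coalgebra.comul (R := k) b = q
            induction q with
            | zero => simp
            | add x y hx hy =>
              simp only [map_add, TensorProduct.add_tmul, LinearMap.add_apply, hx, hy]
            | tmul b₁ b₂ => simp [hT]
        have e2 : ∀ p : B ⊗[k] V, (interchangeLin ψ c N).lTensor X
            (interchangeAux φ V (Y ⊗[k] N) (p ⊗ₜ (x ⊗ₜ (y ⊗ₜ n)))) = T (c.lTensor B p) := fun p => by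
          induction p with
          | zero => simp
          | add x y hx hy => simp only [map_add, TensorProduct.add_tmul, hx, hy]
          | tmul b v =>
            rw [interchangeAux_tmul, LinearMap.lTensor_tmul, LinearMap.lTensor_tmul, hT,
              interchangeLin_tmul]
        rw [interchangeLin_tmul, e1, hc.coassoc_apply, LinearMap.lTensor_tmul, LinearEquiv.coe_coe,
          TensorProduct.assoc_tmul, interchangeLin_tmul, e2]

lemma interchangeLin_regular (c : V →ₗ[k] B ⊗[k] V) (d : N →ₗ[k] B ⊗[k] N) (t : V ⊗[k] N) :
    interchangeLin (regular k B) c N (d.lTensor V t) = diagCoaction c d t := by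
  induction t with
  | zero => simp
  | add x y hx hy => simp only [map_add, hx, hy]
  | tmul v n =>
    rw [LinearMap.lTensor_tmul, interchangeLin_tmul]
    simp only [diagCoaction, LinearMap.comp_apply, TensorProduct.map_tmul, LinearEquiv.coe_coe]
    generalize c v = p
    generalize d n = q
    induction p with
    | zero => simp
    | add x y hx hy => simp only [map_add, TensorProduct.add_tmul, hx, hy]
    | tmul b v =>
      induction q with
      | add x y hx hy => simp only [map_add, TensorProduct.tmul_add, hx, hy]
      | _ => simp

lemma cotensorAssoc_interchange {φX : B →ₐ[k] Module.End k X} {φY : B →ₐ[k] Module.End k Y}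
    {rX : X →ₗ[k] X ⊗[k] B} (hX : ∀ b x, rX (φX b x) = diagAction φX (regular k B) b (rX x))
    {lY : Y →ₗ[k] B ⊗[k] Y} {rY : Y →ₗ[k] Y ⊗[k] B} (h : Bicompatible lY rY)
    (hY : ∀ b x, lY (φY b x) = diagAction (regular k B) φY b (lY x))
    (hY' : ∀ b x, rY (φY b x) = diagAction φY (regular k B) b (rY x))
    (hXY : ∀ b x, restrictRight (cotensor rX lY) (rightTensor rY X) (rightTensor_mem h)
        (restrictAct (diagAction φX φY) _ (diagAction_mem hX hY) b x) =
      diagAction (restrictAct (diagAction φX φY) _ (diagAction_mem hX hY)) (regular k B) b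
        (restrictRight (cotensor rX lY) (rightTensor rY X) (rightTensor_mem h) x))
    {c : V →ₗ[k] B ⊗[k] V} (hc : IsLeftCoaction c) (d : N →ₗ[k] B ⊗[k] N)
    (A : V ⊗[k] cotensor rY d →ₗ[k] cotensor rY (diagCoaction c d))
    (hA : ∀ s, (A s : Y ⊗[k] (V ⊗[k] N)) = interchange hY' hc d s)
    (t : V ⊗[k] cotensor (restrictRight (cotensor rX lY) (rightTensor rY X)
      (rightTensor_mem h)) d) :
    (cotensorAssoc rX h (diagCoaction c d) (interchange hXY hc d t)).1 =
      A.lTensor X (interchangeLin φX c (cotensor rY d)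
        (((cotensor rX (restrictLeft (cotensor rY d) (leftTensor lY N)
          (leftTensor_mem h))).subtype ∘ₗ
          (cotensorAssoc rX h d).toLinearMap).lTensor V t)) := by
  apply lTensor_inj X (cotensor rY (diagCoaction c d)).injective_subtype
  refine (cotensorAssoc_spec rX h (diagCoaction c d) (interchange hXY hc d t)).trans ?_
  have h₁ : ∀ u : V ⊗[k] (cotensor rX lY ⊗[k] N), (cotensor rX lY).subtype.rTensor (V ⊗[k] N)
      (interchangeLin (restrictAct (diagAction φX φY) _ (diagAction_mem hX hY)) c N u) =
      interchangeLin (diagAction φX φY) c N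
        (((cotensor rX lY).subtype.rTensor N).lTensor V u) := fun u => by
    have := interchangeLin_naturality (N := N) (N' := N) (φ := restrictAct (diagAction φX φY) _ (diagAction_mem hX hY))
      (ψ := diagAction φX φY) (c := c) (c' := c) (cotensor rX lY).subtype (fun _ _ => rfl)
      LinearMap.id (fun _ => by simp) LinearMap.id u
    rw [TensorProduct.map_id] at this
    exact this.symm
  have h₂ : ∀ u : X ⊗[k] (V ⊗[k] cotensor rY d), (cotensor rY (diagCoaction c d)).subtype.lTensor X
      (A.lTensor X u) = (interchangeLin φY c N).lTensor X
        (((cotensor rY d).subtype.lTensor V).lTensor X u) := fun u => by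
    rw [← LinearMap.lTensor_comp_apply, ← LinearMap.lTensor_comp_apply]
    exact congrArg (fun f => LinearMap.lTensor X f u) (LinearMap.ext hA)
  have h₃ : ∀ u : V ⊗[k] (X ⊗[k] cotensor rY d), ((cotensor rY d).subtype.lTensor V).lTensor X
      (interchangeLin φX c (cotensor rY d) u) = interchangeLin φX c (Y ⊗[k] N)
        (((cotensor rY d).subtype.lTensor X).lTensor V u) := fun u =>
    (interchangeLin_naturality (φ := φX) (ψ := φX) (c := c) (c' := c) LinearMap.id
      (fun _ _ => rfl) LinearMap.id (fun _ => by simp) (cotensor rY d).subtype u).symm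
  refine (congrArg (TensorProduct.assoc k X Y (V ⊗[k] N)) (h₁ _)).trans ?_
  rw [interchangeLin_diagAction φX φY hc, h₂, h₃]
  refine congrArg (fun u => (interchangeLin φY c N).lTensor X (interchangeLin φX c (Y ⊗[k] N) u)) ?_
  have h₄ : cotensorInclL (cotensor rX lY) (cotensor (restrictRight (cotensor rX lY)
      (rightTensor rY X) (rightTensor_mem h)) d) =
      cotensorInclR (cotensor rY d) (cotensor rX (restrictLeft (cotensor rY d) (leftTensor lY N)
          (leftTensor_mem h))) ∘ₗ (cotensorAssoc rX h d).toLinearMap :=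
    LinearMap.ext fun t => (cotensorAssoc_spec rX h d t).symm
  have h₅ := congrArg (fun f => LinearMap.lTensor V f t) h₄
  simp only [cotensorInclL, cotensorInclR, LinearMap.lTensor_comp_apply] at h₅
  refine h₅.trans ?_
  rw [LinearMap.lTensor_comp_apply]

end LinearAlgebra

end

end HopfTrimod

namespace HopfTrimod

noncomputable section

section Monoidal

open LaxModuleEnd

variable {k : Type u} [Field k] {B : Type u} [Ring B] [Bialgebra k B]

/-- The isomorphism `(X □ Y) □ N ≅ X □ (Y □ N)`. -/
def cotensorAssocComod (X Y : HopfTrimodule k B) (N : LeftComod k B) :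
    (HopfTrimodule.cotensorObj X Y).cotensorComod N ≅ X.cotensorComod (Y.cotensorComod N) :=
  LeftComod.isoMk (M := (HopfTrimodule.cotensorObj X Y).cotensorComod N)
    (N := X.cotensorComod (Y.cotensorComod N)) (cotensorAssoc X.rcoact Y.bicompatible N.coact)
    (LinearMap.ext fun t => cotensorAssoc_lcoact X.bicompatible Y.bicompatible N.coact
      (HopfTrimodule.cotensorObj X Y).bicompatible t)

/-- The isomorphism `(X □ Y) □ - ≅ X □ (Y □ -)` of module endofunctors. -/
def cotensorCompIso (X Y : HopfTrimodule k B) :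
    (cotensorLax k B).obj (X ⊗ Y) ≅ (cotensorLax k B).obj X ⊗ (cotensorLax k B).obj Y :=
  LaxModuleEnd.isoMk (F := (cotensorLax k B).obj (X ⊗ Y))
    (G := LaxModuleEnd.comp ((cotensorLax k B).obj X) ((cotensorLax k B).obj Y))
    (NatIso.ofComponents (F := (HopfTrimodule.cotensorObj X Y).cotensorFunctor)
      (G := Y.cotensorFunctor ⋙ X.cotensorFunctor) (cotensorAssocComod X Y)
      fun f => HopfTrimodule.cotensorComod_hom_ext fun _ =>
        cotensorAssoc_map Y.bicompatible Y.bicompatible LinearMap.id LinearMap.id f.lin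
          LinearMap.id (fun _ => (LinearMap.congr_fun TensorProduct.map_id _).symm)
          (Y.cotensorFunctor.map f).lin (fun _ => rfl) rfl)
    fun V N => HopfTrimodule.cotensorComod_hom_ext fun t =>
      (congrArg (fun u => (interchange Y.rcoact_act V.isCoaction N.coact).lTensor X.carrier
        (interchangeLin X.act V.coact (cotensor Y.rcoact N.coact) u))
        (LinearMap.lTensor_comp_apply V.carrier (Submodule.subtype _)
          (cotensorAssoc X.rcoact Y.bicompatible N.coact).toLinearMap t).symm).trans
      (cotensorAssoc_interchange X.rcoact_act Y.bicompatible Y.lcoact_act Y.rcoact_act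
        (HopfTrimodule.cotensorObj X Y).rcoact_act V.isCoaction N.coact
        (interchange Y.rcoact_act V.isCoaction N.coact) (fun _ => rfl) t).symm

/-- The isomorphism `N ≅ B □ N` of module endofunctors. -/
def cotensorUnitIso : 𝟙_ (LaxModuleEnd (LeftComod k B)) ≅
    (cotensorLax k B).obj (𝟙_ (HopfTrimodule k B)) :=
  LaxModuleEnd.isoMk (F := LaxModuleEnd.unit (LeftComod k B))
    (G := (cotensorLax k B).obj (HopfTrimodule.unit k B))
    (NatIso.ofComponents (F := 𝟭 (LeftComod k B))
      (G := (HopfTrimodule.unit k B).cotensorFunctor)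
      (fun N => LeftComod.isoMk (N := (HopfTrimodule.unit k B).cotensorComod N)
        (cotensorLid (B := B) N.isCoaction) (LinearMap.ext fun t => cotensorLid_lcoact N.isCoaction t))
      fun f => HopfTrimodule.cotensorComod_hom_ext fun t => f.comm_apply t)
    fun V N => HopfTrimodule.cotensorComod_hom_ext fun t =>
      (congrArg (interchangeLin (regular k B) V.coact N.carrier)
        (LinearMap.lTensor_comp_apply V.carrier
          (cotensor (Coalgebra.comul (R := k) (A := B)) N.coact).subtype
          (cotensorLid N.isCoaction).toLinearMap t).symm).trans
        (interchangeLin_regular (B := B) V.coact N.coact t)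

lemma cotensorAssoc_leftUnitor (X : HopfTrimodule k B) (N : LeftComod k B)
    (t : cotensor X.rcoact N.coact) :
    cotensorAssoc (HopfTrimodule.unit k B).rcoact X.bicompatible N.coact
      ((HopfTrimodule.cotensorComodMap (HopfTrimodule.leftUnitorIso X).inv (𝟙 N)).lin t) =
    cotensorLid (X.cotensorComod N).isCoaction t := by
  apply cotensorInclR_injective (cotensor X.rcoact N.coact) (cotensor (Coalgebra.comul
    (R := k) (A := B)) (X.cotensorComod N).coact)
  refine (cotensorAssoc_spec (HopfTrimodule.unit k B).rcoact X.bicompatible N.coact _).trans ?_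
  refine Eq.trans ?_ (restrictLeft_apply _ (leftTensor X.lcoact N.carrier)
    (leftTensor_mem X.bicompatible) t).symm
  have e : ∀ u : X.carrier ⊗[k] N.carrier,
      (cotensor (Coalgebra.comul (R := k) (A := B)) X.lcoact).subtype.rTensor N.carrier
        (TensorProduct.map (cotensorLid X.isLeft).toLinearMap LinearMap.id u) =
      X.lcoact.rTensor N.carrier u := fun u =>
    (LinearMap.rTensor_comp_apply N.carrier _ (cotensorLid X.isLeft).toLinearMap u).symm
  exact congrArg (TensorProduct.assoc k B X.carrier N.carrier) (e t.1)

lemma cotensorAssoc_rightUnitor (X : HopfTrimodule k B) (N : LeftComod k B)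
    (t : cotensor X.rcoact N.coact) :
    (cotensorAssoc X.rcoact (HopfTrimodule.unit k B).bicompatible N.coact
      ((HopfTrimodule.cotensorComodMap (HopfTrimodule.rightUnitorIso X).inv (𝟙 N)).lin t)).1 =
    (cotensorLid N.isCoaction).toLinearMap.lTensor X.carrier t.1 := by
  apply lTensor_inj X.carrier
    (cotensor (Coalgebra.comul (R := k) (A := B)) N.coact).injective_subtype
  refine (cotensorAssoc_spec X.rcoact (HopfTrimodule.unit k B).bicompatible N.coact _).trans ?_
  refine Eq.trans ?_ (LinearMap.lTensor_comp_apply X.carrier _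
    (cotensorLid N.isCoaction).toLinearMap t.1)
  refine Eq.trans ?_ (mem_cotensor (B := B).1 t.2)
  exact congrArg (TensorProduct.assoc k X.carrier B N.carrier)
    (LinearMap.rTensor_comp_apply N.carrier
      (cotensor X.rcoact (Coalgebra.comul (R := k) (A := B))).subtype
      (cotensorRid X.isRight).toLinearMap t.1).symm

lemma cotensorAssocComod_pentagon (X Y Z : HopfTrimodule k B) (N : LeftComod k B) :
    HopfTrimodule.cotensorComodMap (HopfTrimodule.assocIso X Y Z).hom (𝟙 N) ≫
        (cotensorAssocComod X (HopfTrimodule.cotensorObj Y Z) N).hom ≫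
        X.cotensorFunctor.map (cotensorAssocComod Y Z N).hom =
      (cotensorAssocComod (HopfTrimodule.cotensorObj X Y) Z N).hom ≫
        (cotensorAssocComod X Y (Z.cotensorComod N)).hom := by
  have e := pentagon_aux (W := X.carrier) (X := Y.carrier) (Y := Z.carrier) (Z := N.carrier)
        (i₁ := (cotensor X.rcoact Y.lcoact).subtype)
        (i₂ := (cotensor Y.rcoact Z.lcoact).subtype)
        (i₃ := (cotensor Z.rcoact N.coact).subtype)
        (iD := (cotensor (HopfTrimodule.cotensorObj X Y).rcoact Z.lcoact).subtype)
        (iE := (cotensor X.rcoact (HopfTrimodule.cotensorObj Y Z).lcoact).subtype)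
        (iF := (cotensor (HopfTrimodule.cotensorObj Y Z).rcoact N.coact).subtype)
        (iG := (cotensor Y.rcoact (Z.cotensorComod N).coact).subtype)
        (iT := (cotensor (HopfTrimodule.cotensorObj (HopfTrimodule.cotensorObj X Y) Z).rcoact
          N.coact).subtype)
        (iT₁ := (cotensor (HopfTrimodule.cotensorObj X (HopfTrimodule.cotensorObj Y Z)).rcoact
          N.coact).subtype)
        (iT₂ := (cotensor X.rcoact
          ((HopfTrimodule.cotensorObj Y Z).cotensorComod N).coact).subtype)
        (iT₃ := (cotensor X.rcoact (Y.cotensorComod (Z.cotensorComod N)).coact).subtype)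
        (iS := (cotensor (HopfTrimodule.cotensorObj X Y).rcoact
          (Z.cotensorComod N).coact).subtype)
        (Submodule.injective_subtype _) (Submodule.injective_subtype _)
        (Submodule.injective_subtype _)
        (a₁ := (HopfTrimodule.assocIso X Y Z).hom.lin)
        (a₂ := (cotensorAssocComod X (HopfTrimodule.cotensorObj Y Z) N).hom.lin)
        (a₃ := (cotensorAssocComod Y Z N).hom.lin)
        (a₄ := (cotensorAssocComod (HopfTrimodule.cotensorObj X Y) Z N).hom.lin)
        (a₅ := (cotensorAssocComod X Y (Z.cotensorComod N)).hom.lin)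
        (b := (HopfTrimodule.cotensorComodMap (HopfTrimodule.assocIso X Y Z).hom (𝟙 N)).lin)
        (c := (X.cotensorFunctor.map (cotensorAssocComod Y Z N).hom).lin)
        (LinearMap.ext (cotensorAssoc_spec X.rcoact Y.bicompatible Z.lcoact))
        (LinearMap.ext (cotensorAssoc_spec X.rcoact
          (HopfTrimodule.cotensorObj Y Z).bicompatible N.coact))
        (LinearMap.ext (cotensorAssoc_spec Y.rcoact Z.bicompatible N.coact))
        (LinearMap.ext (cotensorAssoc_spec (HopfTrimodule.cotensorObj X Y).rcoact Z.bicompatible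
          N.coact))
        (LinearMap.ext (cotensorAssoc_spec X.rcoact Y.bicompatible (Z.cotensorComod N).coact))
        rfl rfl
  exact LeftComod.hom_ext e

/-- `Σ` carries the cotensor product to composition. -/
def cotensorLaxCore : (cotensorLax k B).CoreMonoidal :=
  Functor.CoreMonoidal.mk' cotensorUnitIso (fun X Y => (cotensorCompIso X Y).symm)
    (fun {X X'} f Y => LaxModuleEnd.hom_ext <| NatTrans.ext <| funext fun N =>
      HopfTrimodule.cotensorComod_hom_ext fun t =>
        (LinearMap.congr_fun TensorProduct.map_id _).trans
          (cotensorAssoc_map Y.bicompatible Y.bicompatible f.lin LinearMap.id LinearMap.id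
            (HopfTrimodule.cotensorHom f (𝟙 Y)).lin (fun _ => rfl) LinearMap.id
            (fun _ => (LinearMap.congr_fun TensorProduct.map_id _).symm) rfl).symm)
    (fun {Y Y'} X f => LaxModuleEnd.hom_ext <| NatTrans.ext <| funext fun N =>
      HopfTrimodule.cotensorComod_hom_ext fun t =>
        (cotensorAssoc_map Y.bicompatible Y'.bicompatible LinearMap.id f.lin LinearMap.id
            (HopfTrimodule.cotensorHom (𝟙 X) f).lin (fun _ => rfl)
            (HopfTrimodule.cotensorComodMap f (𝟙 N)).lin (fun _ => rfl) rfl).symm)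
    (fun X Y Z => LaxModuleEnd.hom_ext <| NatTrans.ext <| funext fun N => by
        have e := cotensorAssocComod_pentagon X Y Z N
        have i : X.cotensorFunctor.map (Y.cotensorFunctor.map (𝟙 (Z.cotensorComod N))) =
            𝟙 (X.cotensorComod (Y.cotensorComod (Z.cotensorComod N))) :=
          (congrArg _ (Y.cotensorFunctor.map_id _)).trans (X.cotensorFunctor.map_id _)
        have h : ∀ j : X.cotensorComod (Y.cotensorComod (Z.cotensorComod N)) ⟶
            X.cotensorComod (Y.cotensorComod (Z.cotensorComod N)), j = 𝟙 _ →
            (cotensorAssocComod (HopfTrimodule.cotensorObj X Y) Z N).hom ≫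
              ((cotensorAssocComod X Y (Z.cotensorComod N)).hom ≫ j) ≫ 𝟙 _ =
            HopfTrimodule.cotensorComodMap (HopfTrimodule.assocIso X Y Z).hom (𝟙 N) ≫
              (cotensorAssocComod X (HopfTrimodule.cotensorObj Y Z) N).hom ≫
                𝟙 _ ≫ X.cotensorFunctor.map (cotensorAssocComod Y Z N).hom := by
          rintro _ rfl
          rw [Category.comp_id, Category.comp_id]
          exact e.symm
        exact h _ i)
    (fun X => LaxModuleEnd.hom_ext <| NatTrans.ext <| funext fun N =>
      HopfTrimodule.cotensorComod_hom_ext fun t => by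
        have e := (cotensorLid (X.cotensorComod N).isCoaction).symm_apply_eq.2
          (cotensorAssoc_leftUnitor X N t)
        exact congrArg Subtype.val e.symm)
    (fun X => LaxModuleEnd.hom_ext <| NatTrans.ext <| funext fun N =>
      HopfTrimodule.cotensorComod_hom_ext fun t => by
        have e := congrArg ((cotensorLid N.isCoaction).symm.toLinearMap.lTensor X.carrier)
          (cotensorAssoc_rightUnitor X N t)
        refine Eq.trans ?_ e.symm
        refine Eq.trans ?_ (LinearMap.lTensor_comp_apply X.carrier
          (cotensorLid N.isCoaction).symm.toLinearMap
          (cotensorLid N.isCoaction).toLinearMap t.1)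
        rw [LinearEquiv.symm_comp, LinearMap.lTensor_id]
        rfl)

/-- A monoidal functor with values in a monoidal full subcategory. -/
def _root_.CategoryTheory.Functor.CoreMonoidal.lift {C D : Type*} [Category* C] [Category* D]
    [MonoidalCategory C] [MonoidalCategory D] {P : ObjectProperty D} [P.IsMonoidal] {F : C ⥤ D}
    (h : F.CoreMonoidal) (hF : ∀ X, P (F.obj X)) : (P.lift F hF).CoreMonoidal where
  εIso := P.isoMk h.εIso
  μIso X Y := P.isoMk (h.μIso X Y)
  μIso_hom_natural_left f X := by ext; exact h.μIso_hom_natural_left f X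
  μIso_hom_natural_right X f := by ext; exact h.μIso_hom_natural_right X f
  associativity X Y Z := by ext; exact h.associativity X Y Z
  left_unitality X := by ext; exact h.left_unitality X
  right_unitality X := by ext; exact h.right_unitality X

end Monoidal

end

end HopfTrimod

namespace HopfTrimod

noncomputable section

section MonoidalFactorization

open Functor

variable {A C D E : Type*} [Category* A] [Category* C] [Category* D] [Category* E]
  [MonoidalCategory A] [MonoidalCategory C] [MonoidalCategory D] [MonoidalCategory E]

lemma isMonoidal_inverseMonoidal (e : A ≌ C) [e.functor.Monoidal] :
    letI := e.inverseMonoidal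
    e.IsMonoidal := by
  let _ := e.toAdjunction.rightAdjointLaxMonoidal
  have h : e.toAdjunction.IsMonoidal := inferInstance
  exact h

/-- If the square of functors formed by `F : A ⥤ D`, `I : C ⥤ E` and two monoidal equivalences
commutes and `I` is monoidal, then `F` carries a monoidal structure for which the square commutes up
to a monoidal isomorphism. -/
lemma exists_monoidal_factorization (e : A ≌ C) (s : D ≌ E) {F : A ⥤ D} {I : C ⥤ E}
    [e.functor.Monoidal] [e.inverse.Monoidal] [e.IsMonoidal]
    [s.functor.Monoidal] [s.inverse.Monoidal] [s.IsMonoidal] [I.Monoidal] (ψ : e.functor ⋙ I ≅ F ⋙ s.functor) :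
    ∃ (_ : F.Monoidal) (θ : I ≅ e.inverse ⋙ F ⋙ s.functor), NatTrans.IsMonoidal θ.hom := by
  let i : (e.functor ⋙ I) ⋙ s.inverse ≅ F := isoWhiskerRight ψ s.inverse ≪≫
    Functor.associator _ _ _ ≪≫ isoWhiskerLeft F s.unitIso.symm ≪≫ F.rightUnitor
  let _ : F.Monoidal := Functor.Monoidal.transport i
  have hi : NatTrans.IsMonoidal i.hom := Functor.Monoidal.natTransIsMonoidal_of_transport i
  have h₁ : NatTrans.IsMonoidal e.counitIso.hom := inferInstanceAs (NatTrans.IsMonoidal e.counit)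
  have h₂ : NatTrans.IsMonoidal s.counitIso.hom := inferInstanceAs (NatTrans.IsMonoidal s.counit)
  refine ⟨inferInstance, I.leftUnitor.symm ≪≫ isoWhiskerRight e.counitIso.symm I ≪≫
    Functor.associator _ _ _ ≪≫ isoWhiskerLeft e.inverse ((e.functor ⋙ I).rightUnitor.symm ≪≫
      isoWhiskerLeft (e.functor ⋙ I) s.counitIso.symm ≪≫ (Functor.associator _ _ _).symm ≪≫
      isoWhiskerRight i s.functor), ?_⟩
  dsimp only [Iso.trans_hom, Iso.symm_hom, isoWhiskerRight_hom, isoWhiskerLeft_hom]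
  infer_instance

end MonoidalFactorization

open LaxModuleEnd

variable (k : Type u) [Field k] (B : Type u) [Ring B] [Bialgebra k B]

/-- The isomorphism `- ⊗ V ≅ (B ⊗ V) □ -`, natural in `V`. -/
def tensorRightStrongIso :
    tensorRightStrong (LeftComod k B) ⋙ ObjectProperty.ιOfLE (isStrong_le_isLexFinitary k B) ≅
      (unmopFunctor (LeftComod k B) ⋙ freeFunctor k B) ⋙
        ObjectProperty.lift _ (cotensorLax k B) isLexFinitary_cotensorLax :=
  NatIso.ofComponents
    (fun V => ObjectProperty.isoMk _ (tensorRightEndFreeIso V.unmop)) fun {V W} f => by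
      ext N t
      refine Subtype.ext ?_
      exact toFreeTensor_naturality (c := N.coact) (d := N.coact) LinearMap.id
        (fun _ => by simp) f.unmop.lin t

lemma isEquivalence_iff_of_iso {A C D E : Type*} [Category* A] [Category* C] [Category* D]
    [Category* E] {F : A ⥤ C} {G : C ⥤ D} {H : D ⥤ E} {I : A ⥤ E} [F.IsEquivalence]
    [H.IsEquivalence] (θ : I ≅ F ⋙ G ⋙ H) : I.IsEquivalence ↔ G.IsEquivalence := by
  constructor
  · intro h
    have := Functor.isEquivalence_of_iso θ
    have := Functor.isEquivalence_of_comp_left F (G ⋙ H)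
    exact Functor.isEquivalence_of_comp_right G H
  · intro h
    exact Functor.isEquivalence_of_iso θ.symm

/-- The inclusion of strong into left exact finitary lax module endofunctors factors through the
free Hopf trimodule functor, up to monoidal equivalences. -/
theorem monoidal_factorization :
    ∃ (_ : (ObjectProperty.lift _ (cotensorLax k B) isLexFinitary_cotensorLax).Monoidal)
      (_ : (evalUnit (LeftComod k B)).Monoidal)
      (_ : (unmopFunctor (LeftComod k B) ⋙ freeFunctor k B).Monoidal)
      (θ : ObjectProperty.ιOfLE (isStrong_le_isLexFinitary k B) ≅ evalUnit (LeftComod k B) ⋙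
        (unmopFunctor (LeftComod k B) ⋙ freeFunctor k B) ⋙
        ObjectProperty.lift _ (cotensorLax k B) isLexFinitary_cotensorLax),
      (ObjectProperty.lift _ (cotensorLax k B) isLexFinitary_cotensorLax).IsEquivalence ∧
      (evalUnit (LeftComod k B)).IsEquivalence ∧ NatTrans.IsMonoidal θ.hom := by
  let h₁ : (tensorRightEquivalence (LeftComod k B)).functor.Monoidal :=
    tensorRightStrongCore.toMonoidal
  let h₂ : (tensorRightEquivalence (LeftComod k B)).inverse.Monoidal :=
    (tensorRightEquivalence (LeftComod k B)).inverseMonoidal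
  have h₃ := isMonoidal_inverseMonoidal (tensorRightEquivalence (LeftComod k B))
  let s := (ObjectProperty.lift _ (cotensorLax k B) isLexFinitary_cotensorLax).asEquivalence
  let h₄ : s.functor.Monoidal := (cotensorLaxCore.lift isLexFinitary_cotensorLax).toMonoidal
  let h₅ : s.inverse.Monoidal := s.inverseMonoidal
  have h₆ := isMonoidal_inverseMonoidal s
  obtain ⟨hF, θ, hθ⟩ := exists_monoidal_factorization (tensorRightEquivalence (LeftComod k B)) s
    (tensorRightStrongIso k B)
  exact ⟨h₄, h₂, hF, θ, inferInstance,
    (tensorRightEquivalence (LeftComod k B)).isEquivalence_inverse, hθ⟩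

/-- The inclusion of strong into left exact finitary lax module endofunctors is an equivalence if
and only if the free Hopf trimodule functor is. -/
theorem isEquivalence_ι_iff :
    (ObjectProperty.ιOfLE (isStrong_le_isLexFinitary k B)).IsEquivalence ↔
      (freeFunctor k B).IsEquivalence := by
  obtain ⟨_, _, _, θ, _, _, _⟩ := monoidal_factorization k B
  rw [isEquivalence_iff_of_iso θ]
  have : (unmopFunctor (LeftComod k B)).IsEquivalence :=
    (MonoidalOpposite.mopEquiv (LeftComod k B)).isEquivalence_inverse
  exact ⟨fun _ => Functor.isEquivalence_of_comp_left (unmopFunctor (LeftComod k B)) _,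
    fun _ => inferInstance⟩

end

end HopfTrimod

namespace HopfTrimod

noncomputable section

section CoactMatrix

variable {k : Type u} [Field k] {B : Type u} [Ring B] [Bialgebra k B]
variable {W : Type u} [AddCommGroup W] [Module k W] {ι : Type*}

/-- The `j`-th component of an element of `B ⊗ W` with respect to a basis of `W`. -/
def component (B : Type u) [Ring B] [Bialgebra k B] (b : Module.Basis ι k W) (j : ι) :
    B ⊗[k] W →ₗ[k] B :=
  (TensorProduct.rid k B).toLinearMap ∘ₗ (b.coord j).lTensor B

lemma component_tmul (b : Module.Basis ι k W) (j : ι) (x : B) (w : W) :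
    component B b j (x ⊗ₜ w) = b.coord j w • x := by
  simp [component]

variable [Fintype ι]

lemma component_sum (b : Module.Basis ι k W) (j : ι) (x : ι → B) :
    component B b j (∑ i, x i ⊗ₜ b i) = x j := by
  classical
  simp [component_tmul, Finsupp.single_apply]

lemma sum_component (b : Module.Basis ι k W) (t : B ⊗[k] W) :
    ∑ i, component B b i t ⊗ₜ b i = t := by
  induction t with
  | zero => simp
  | add x y hx hy => simp only [map_add, TensorProduct.add_tmul, Finset.sum_add_distrib, hx, hy]
  | tmul x w =>
    simp only [component_tmul, TensorProduct.smul_tmul, ← TensorProduct.tmul_sum]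
    rw [show ∑ i, b.coord i w • b i = w from b.sum_repr w]

/-- The matrix of a left coaction with respect to a basis. -/
def coactMatrix (b : Module.Basis ι k W) (c : W →ₗ[k] B ⊗[k] W) : Matrix ι ι B :=
  fun i j => component B b j (c (b i))

lemma coact_basis (b : Module.Basis ι k W) (c : W →ₗ[k] B ⊗[k] W) (i : ι) :
    c (b i) = ∑ j, coactMatrix b c i j ⊗ₜ b j :=
  (sum_component b _).symm

/-- The linear map `W → B ⊗ W` with a given matrix. -/
def matrixCoaction (b : Module.Basis ι k W) (D : Matrix ι ι B) : W →ₗ[k] B ⊗[k] W :=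
  b.constr k fun i => ∑ j, D i j ⊗ₜ b j

lemma matrixCoaction_basis (b : Module.Basis ι k W) (D : Matrix ι ι B) (i : ι) :
    matrixCoaction b D (b i) = ∑ j, D i j ⊗ₜ b j :=
  b.constr_basis k _ i

lemma comul_coactMatrix (b : Module.Basis ι k W) {c : W →ₗ[k] B ⊗[k] W} (hc : IsLeftCoaction c)
    (i j : ι) : Coalgebra.comul (R := k) (coactMatrix b c i j) =
      ∑ l, coactMatrix b c i l ⊗ₜ coactMatrix b c l j := by
  have e : ∀ t : B ⊗[k] W, (component B b j).lTensor B (TensorProduct.assoc k B B W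
      ((Coalgebra.comul (R := k) (A := B)).rTensor W t)) =
      Coalgebra.comul (R := k) (component B b j t) := by
    intro t
    induction t with
    | zero => simp
    | add x y hx hy => simp only [map_add, hx, hy]
    | tmul x w =>
      rw [LinearMap.rTensor_tmul, component_tmul, map_smul]
      generalize Coalgebra.comul (R := k) x = p
      induction p with
      | zero => simp
      | add x y hx hy => simp only [map_add, TensorProduct.add_tmul, smul_add, hx, hy]
      | tmul x y => simp [component_tmul]
  have h := congrArg ((component B b j).lTensor B) (hc.coassoc_apply (b i))
  rw [e, coact_basis b c i, component_sum] at h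
  rw [h]
  simp [coactMatrix]

lemma counit_coactMatrix [DecidableEq ι] (b : Module.Basis ι k W) {c : W →ₗ[k] B ⊗[k] W}
    (hc : IsLeftCoaction c) (i j : ι) :
    Coalgebra.counit (R := k) (coactMatrix b c i j) = if i = j then 1 else 0 := by
  have h := congrArg (b.coord j) (hc.counit_apply (b i))
  rw [coact_basis b c i] at h
  simpa [Finsupp.single_apply] using h

lemma isLeftCoaction_matrixCoaction [DecidableEq ι] (b : Module.Basis ι k W) {D : Matrix ι ι B}
    (h₁ : ∀ i j, Coalgebra.comul (R := k) (D i j) = ∑ l, D i l ⊗ₜ D l j)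
    (h₂ : ∀ i j, Coalgebra.counit (R := k) (D i j) = if i = j then 1 else 0) :
    IsLeftCoaction (matrixCoaction b D) where
  coassoc := by
    refine b.ext fun i => ?_
    simp only [LinearMap.comp_apply, matrixCoaction_basis, map_sum, LinearMap.rTensor_tmul, h₁,
      LinearMap.lTensor_tmul, TensorProduct.sum_tmul, LinearEquiv.coe_coe,
      TensorProduct.assoc_tmul, TensorProduct.tmul_sum]
    exact Finset.sum_comm
  counit := by
    refine b.ext fun i => ?_
    simp [LinearMap.comp_apply, matrixCoaction_basis, h₂]

variable {S : B →ₗ[k] B} [DecidableEq ι]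

lemma sum_antipode_mul (hS : IsTwistedAntipode k B S) {D : Matrix ι ι B}
    (h₁ : ∀ i j, Coalgebra.comul (R := k) (D i j) = ∑ l, D i l ⊗ₜ D l j)
    (h₂ : ∀ i j, Coalgebra.counit (R := k) (D i j) = if i = j then 1 else 0) (i j : ι) :
    ∑ l, S (D l j) * D i l = if i = j then 1 else 0 := by
  have := LinearMap.congr_fun hS.1 (D i j)
  simpa [h₁, h₂, apply_ite] using this

lemma sum_mul_antipode (hS : IsTwistedAntipode k B S) {D : Matrix ι ι B}
    (h₁ : ∀ i j, Coalgebra.comul (R := k) (D i j) = ∑ l, D i l ⊗ₜ D l j)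
    (h₂ : ∀ i j, Coalgebra.counit (R := k) (D i j) = if i = j then 1 else 0) (i j : ι) :
    ∑ l, D l j * S (D i l) = if i = j then 1 else 0 := by
  have := LinearMap.congr_fun hS.2 (D i j)
  simpa [h₁, h₂, apply_ite] using this

lemma counit_antipode (hS : IsTwistedAntipode k B S) {D : Matrix ι ι B}
    (h₁ : ∀ i j, Coalgebra.comul (R := k) (D i j) = ∑ l, D i l ⊗ₜ D l j)
    (h₂ : ∀ i j, Coalgebra.counit (R := k) (D i j) = if i = j then 1 else 0) (i j : ι) :
    Coalgebra.counit (R := k) (S (D i j)) = if i = j then 1 else 0 := by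
  have := congrArg (Coalgebra.counit (R := k)) (sum_antipode_mul hS h₁ h₂ i j)
  simpa [h₂, apply_ite] using this

lemma comul_antipode (hS : IsTwistedAntipode k B S) {D : Matrix ι ι B}
    (h₁ : ∀ i j, Coalgebra.comul (R := k) (D i j) = ∑ l, D i l ⊗ₜ D l j)
    (h₂ : ∀ i j, Coalgebra.counit (R := k) (D i j) = if i = j then 1 else 0) (i j : ι) :
    Coalgebra.comul (R := k) (S (D i j)) = ∑ l, S (D l j) ⊗ₜ S (D i l) := by
  let a : Matrix ι ι (B ⊗[k] B)ᵐᵒᵖ := .of fun i j => .op (Coalgebra.comul (R := k) (D i j))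
  let L : Matrix ι ι (B ⊗[k] B)ᵐᵒᵖ := .of fun i j => .op (Coalgebra.comul (R := k) (S (D i j)))
  let R : Matrix ι ι (B ⊗[k] B)ᵐᵒᵖ := .of fun i j => .op (∑ l, S (D l j) ⊗ₜ S (D i l))
  have hL : L * a = 1 := by
    ext i j : 2
    apply MulOpposite.unop_injective
    have := congrArg (Coalgebra.comul (R := k)) (sum_mul_antipode hS h₁ h₂ i j)
    rw [Matrix.mul_apply, Matrix.one_apply]
    simpa [L, a, apply_ite] using this
  have hR : a * R = 1 := by
    ext i j : 2
    apply MulOpposite.unop_injective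
    have e : ∀ n m, ∑ l, S (D l m) * D n l = if n = m then 1 else 0 := sum_antipode_mul hS h₁ h₂
    have : ∑ l, (∑ m, S (D m j) ⊗ₜ[k] S (D l m)) * (∑ n, D i n ⊗ₜ[k] D n l) =
        if i = j then 1 else 0 := by
      simp only [Finset.sum_mul_sum, Algebra.TensorProduct.tmul_mul_tmul]
      rw [Finset.sum_comm]
      simp only [Finset.sum_comm (s := Finset.univ (α := ι)) (t := Finset.univ (α := ι))
        (f := fun l n => _ ⊗ₜ[k] (S (D l _) * D n l)), ← TensorProduct.tmul_sum, e]
      simp only [TensorProduct.tmul_ite, Finset.sum_ite_eq', Finset.mem_univ, if_true,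
        ← TensorProduct.sum_tmul, e, TensorProduct.ite_tmul,
        Algebra.TensorProduct.one_def]
    rw [Matrix.mul_apply, Matrix.one_apply]
    simpa [R, a, apply_ite, h₁] using this
  exact congrArg (fun M : Matrix ι ι (B ⊗[k] B)ᵐᵒᵖ => (M i j).unop) (left_inv_eq_right_inv hL hR)

end CoactMatrix

end

end HopfTrimod

namespace HopfTrimod

noncomputable section

section LeftDual

variable {k : Type u} [Field k] {B : Type u} [Ring B] [Bialgebra k B]
variable {W : Type u} [AddCommGroup W] [Module k W]

/-- The coaction on the dual space of a finite-dimensional comodule determined by a twisted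
antipode. -/
def dualCoaction (S : B →ₗ[k] B) [FiniteDimensional k W] (c : W →ₗ[k] B ⊗[k] W) :
    Module.Dual k W →ₗ[k] B ⊗[k] Module.Dual k W :=
  open scoped Classical in
  matrixCoaction (Module.Basis.ofVectorSpace k W).dualBasis
    (.of fun j l => S (coactMatrix (Module.Basis.ofVectorSpace k W) c l j))

lemma diagCoaction_sum {V : Type u} [AddCommGroup V] [Module k V] {ι κ : Type*} [Fintype ι]
    [Fintype κ] {c : V →ₗ[k] B ⊗[k] V} {d : W →ₗ[k] B ⊗[k] W} {v : V} {w : W} {x : ι → B}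
    {y : κ → B} {v' : ι → V} {w' : κ → W} (hv : c v = ∑ i, x i ⊗ₜ v' i)
    (hw : d w = ∑ j, y j ⊗ₜ w' j) :
    diagCoaction c d (v ⊗ₜ w) = ∑ i, ∑ j, (x i * y j) ⊗ₜ (v' i ⊗ₜ w' j) := by
  simp only [diagCoaction, LinearMap.comp_apply, TensorProduct.map_tmul, hv, hw,
    TensorProduct.sum_tmul, TensorProduct.tmul_sum, map_sum, LinearEquiv.coe_coe,
    TensorProduct.tensorTensorTensorComm_tmul, LinearMap.rTensor_tmul, LinearMap.mul'_apply]
  exact Finset.sum_comm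

variable {S : B →ₗ[k] B} [FiniteDimensional k W] {c : W →ₗ[k] B ⊗[k] W}

lemma isLeftCoaction_dualCoaction (hS : IsTwistedAntipode k B S) (hc : IsLeftCoaction c) :
    IsLeftCoaction (dualCoaction S c) := by
  classical
  refine isLeftCoaction_matrixCoaction _ (fun i j => ?_) fun i j => ?_
  · exact comul_antipode hS (comul_coactMatrix _ hc) (counit_coactMatrix _ hc) j i
  · exact (counit_antipode hS (comul_coactMatrix _ hc) (counit_coactMatrix _ hc) j i).trans
      (if_congr eq_comm rfl rfl)

lemma dualCoaction_coord (S : B →ₗ[k] B) (c : W →ₗ[k] B ⊗[k] W)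
    (j : Module.Basis.ofVectorSpaceIndex k W) :
    dualCoaction S c ((Module.Basis.ofVectorSpace k W).coord j) =
      ∑ l, S (coactMatrix (Module.Basis.ofVectorSpace k W) c l j) ⊗ₜ
        (Module.Basis.ofVectorSpace k W).coord l := by
  classical
  have h := matrixCoaction_basis (Module.Basis.ofVectorSpace k W).dualBasis
    (.of fun j l => S (coactMatrix (Module.Basis.ofVectorSpace k W) c l j)) j
  simp only [Module.Basis.coe_dualBasis, Matrix.of_apply] at h
  exact h

lemma contractLeft_colinear (hS : IsTwistedAntipode k B S) (hc : IsLeftCoaction c) :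
    trivialCoaction k B k ∘ₗ contractLeft k W =
      (contractLeft k W).lTensor B ∘ₗ diagCoaction (dualCoaction S c) c := by
  classical
  refine TensorProduct.ext ((Module.Basis.ofVectorSpace k W).dualBasis.ext fun j =>
    (Module.Basis.ofVectorSpace k W).ext fun i => ?_)
  have h := sum_antipode_mul hS (comul_coactMatrix (Module.Basis.ofVectorSpace k W) hc)
    (counit_coactMatrix _ hc) i j
  rw [Module.Basis.coe_dualBasis]
  change 1 ⊗ₜ (Module.Basis.ofVectorSpace k W).coord j (Module.Basis.ofVectorSpace k W i) =
    (contractLeft k W).lTensor B (diagCoaction (dualCoaction S c) c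
      ((Module.Basis.ofVectorSpace k W).coord j ⊗ₜ Module.Basis.ofVectorSpace k W i))
  rw [diagCoaction_sum (dualCoaction_coord S c j) (coact_basis _ c i)]
  simp only [map_sum, LinearMap.lTensor_tmul, contractLeft_apply, Module.Basis.coord_apply,
    Module.Basis.repr_self, Finsupp.single_apply, TensorProduct.tmul_ite, Finset.sum_ite_eq',
    Finset.mem_univ, if_true, ← TensorProduct.sum_tmul, h]
  split_ifs <;> simp

lemma coevaluation_colinear (hS : IsTwistedAntipode k B S) (hc : IsLeftCoaction c) :
    diagCoaction c (dualCoaction S c) ∘ₗ coevaluation k W =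
      (coevaluation k W).lTensor B ∘ₗ trivialCoaction k B k := by
  classical
  refine LinearMap.ext_ring ?_
  have h := sum_mul_antipode hS (comul_coactMatrix (Module.Basis.ofVectorSpace k W) hc)
    (counit_coactMatrix _ hc)
  change diagCoaction c (dualCoaction S c) (coevaluation k W 1) = 1 ⊗ₜ coevaluation k W 1
  rw [coevaluation_apply_one]
  simp only [map_sum, diagCoaction_sum (coact_basis (Module.Basis.ofVectorSpace k W) c _)
    (dualCoaction_coord S c _)]
  rw [Finset.sum_comm, TensorProduct.tmul_sum]
  refine Finset.sum_congr rfl fun j _ => ?_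
  rw [Finset.sum_comm]
  simp only [← TensorProduct.sum_tmul, h, TensorProduct.ite_tmul, Finset.sum_ite_eq',
    Finset.mem_univ, if_true]

end LeftDual

variable {k : Type u} [Field k] {B : Type u} [Ring B] [Bialgebra k B]

/-- The left dual of a finite-dimensional comodule determined by a twisted antipode. -/
def leftDual {S : B →ₗ[k] B} (hS : IsTwistedAntipode k B S) (W : LeftComod k B)
    [FiniteDimensional k W.carrier] : LeftComod k B where
  carrier := Module.Dual k W.carrier
  coact := dualCoaction S W.coact
  isCoaction := isLeftCoaction_dualCoaction hS W.isCoaction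

lemma isLeftRigid_of_isTwistedAntipode {S : B →ₗ[k] B} (hS : IsTwistedAntipode k B S) :
    IsLeftRigid (FinComod k B) := by
  rintro ⟨W, hW⟩
  have : FiniteDimensional k W.carrier := hW
  refine ⟨⟨leftDual hS W, inferInstanceAs (FiniteDimensional k (Module.Dual k W.carrier))⟩, ⟨?_⟩⟩
  refine
    { coevaluation' := ObjectProperty.homMk
        ⟨coevaluation k W.carrier, coevaluation_colinear hS W.isCoaction⟩
      evaluation' := ObjectProperty.homMk
        ⟨contractLeft k W.carrier, contractLeft_colinear hS W.isCoaction⟩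
      coevaluation_evaluation' := ?_
      evaluation_coevaluation' := ?_ }
  · ext : 2
    exact contractLeft_assoc_coevaluation k W.carrier
  · ext : 2
    exact contractLeft_assoc_coevaluation' k W.carrier

end

end HopfTrimod

namespace HopfTrimod

noncomputable section

section LocallyFinite

variable {k : Type u} [Field k] {B : Type u} [Ring B] [Bialgebra k B]
variable {V : Type u} [AddCommGroup V] [Module k V]

/-- The smallest subspace `E` of `V` such that `t` lies in `B ⊗ E`. -/
def coefficientSpace (t : B ⊗[k] V) : Submodule k V :=
  LinearMap.range ((TensorProduct.lid k V).toLinearMap ∘ₗ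
    (LinearMap.rTensorHom (M := V) (N := B) (P := k)).flip t)

lemma mem_coefficientSpace (t : B ⊗[k] V) (f : Module.Dual k B) :
    TensorProduct.lid k V (f.rTensor V t) ∈ coefficientSpace t :=
  ⟨f, rfl⟩

lemma finiteDimensional_coefficientSpace (t : B ⊗[k] V) :
    FiniteDimensional k (coefficientSpace t) := by
  obtain ⟨N, hN, h⟩ :=
    TensorProduct.exists_finite_submodule_right_of_setFinite {t} (Set.finite_singleton t)
  obtain ⟨s, hs⟩ := h rfl
  refine Submodule.finiteDimensional_of_le (S₂ := N) ?_
  rintro _ ⟨f, rfl⟩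
  change TensorProduct.lid k V (f.rTensor V t) ∈ N
  rw [← hs]
  clear hs
  induction s with
  | zero => simp
  | add x y hx hy => simpa only [map_add] using add_mem hx hy
  | tmul b n => simpa using N.smul_mem _ n.2

lemma mem_range_lTensor_coefficientSpace (t : B ⊗[k] V) :
    t ∈ LinearMap.range ((coefficientSpace t).subtype.lTensor B) := by
  classical
  let b := Module.Basis.ofVectorSpace k B
  have h := (TensorProduct.equivFinsuppOfBasisLeft (N := V) b).symm_apply_apply t
  rw [TensorProduct.equivFinsuppOfBasisLeft_symm_apply] at h
  suffices Finsupp.sum _ _ ∈ LinearMap.range ((coefficientSpace t).subtype.lTensor B) from h ▸ this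
  refine Submodule.sum_mem _ fun i _ => ?_
  refine ⟨b i ⊗ₜ ⟨_, mem_coefficientSpace t (b.coord i)⟩, ?_⟩
  simp only [LinearMap.lTensor_tmul, Submodule.subtype_apply,
    TensorProduct.equivFinsuppOfBasisLeft_apply]

lemma range_lTensor_mono {E F : Submodule k V} (h : E ≤ F) :
    LinearMap.range (E.subtype.lTensor B) ≤ LinearMap.range (F.subtype.lTensor B) := by
  rintro _ ⟨t, rfl⟩
  exact ⟨(Submodule.inclusion h).lTensor B t, by rw [← LinearMap.lTensor_comp_apply]; rfl⟩

variable {c : V →ₗ[k] B ⊗[k] V} (hc : IsLeftCoaction c)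
include hc

lemma coact_coefficientSpace (v : V) {w : V} (hw : w ∈ coefficientSpace (c v)) :
    c w ∈ LinearMap.range ((coefficientSpace (c v)).subtype.lTensor B) := by
  obtain ⟨f, rfl⟩ := hw
  obtain ⟨s, hs⟩ := mem_range_lTensor_coefficientSpace (c v)
  have h := congrArg (TensorProduct.lid k (B ⊗[k] V) ∘ f.rTensor (B ⊗[k] V)) (hc.coassoc_apply v)
  have e : ∀ t : B ⊗[k] V, TensorProduct.lid k (B ⊗[k] V) (f.rTensor (B ⊗[k] V) (c.lTensor B t)) =
      c (TensorProduct.lid k V (f.rTensor V t)) := by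
    intro t
    induction t with
    | add x y hx hy => simp only [map_add, hx, hy]
    | _ => simp
  change c (TensorProduct.lid k V (f.rTensor V (c v))) ∈ _
  simp only [Function.comp_apply] at h
  rw [← e, ← h]
  generalize coefficientSpace (c v) = E at s hs
  rw [← hs]
  clear h hs
  induction s with
  | zero => simp
  | add x y hx hy => simpa only [map_add] using add_mem hx hy
  | tmul b w =>
    rw [LinearMap.lTensor_tmul, LinearMap.rTensor_tmul]
    generalize Coalgebra.comul (R := k) b = p
    induction p with
    | zero => simp
    | add x y hx hy => simpa only [map_add, TensorProduct.add_tmul] using add_mem hx hy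
    | tmul x y => exact ⟨(f x • y) ⊗ₜ w, by simp [TensorProduct.smul_tmul']⟩

lemma self_mem_coefficientSpace (v : V) : v ∈ coefficientSpace (c v) :=
  ⟨Coalgebra.counit, hc.counit_apply v⟩

/-- Every finite-dimensional subspace of a comodule is contained in a finite-dimensional
subcomodule. -/
lemma exists_finiteDimensional_subcomodule (U : Submodule k V) (hU : U.FG) :
    ∃ E : Submodule k V, FiniteDimensional k E ∧ U ≤ E ∧
      ∀ v ∈ E, c v ∈ LinearMap.range (E.subtype.lTensor B) := by
  induction U, hU using Submodule.fg_induction with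
  | singleton v =>
    exact ⟨_, finiteDimensional_coefficientSpace (c v),
      (Submodule.span_singleton_le_iff_mem _ _).2 (self_mem_coefficientSpace hc v),
      fun _ => coact_coefficientSpace hc v⟩
  | sup U₁ U₂ _ _ h₁ h₂ =>
    obtain ⟨E₁, _, hU₁, hE₁⟩ := h₁
    obtain ⟨E₂, _, hU₂, hE₂⟩ := h₂
    refine ⟨E₁ ⊔ E₂, inferInstance, sup_le_sup hU₁ hU₂, fun v hv => ?_⟩
    obtain ⟨x, hx, y, hy, rfl⟩ := Submodule.mem_sup.1 hv
    rw [map_add]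
    exact add_mem (range_lTensor_mono le_sup_left (hE₁ x hx))
      (range_lTensor_mono le_sup_right (hE₂ y hy))

end LocallyFinite

section Twist

variable {k : Type u} [Field k] {B : Type u} [Ring B] [Bialgebra k B]
variable {V W : Type u} [AddCommGroup V] [Module k V] [AddCommGroup W] [Module k W]

/-- The map `W ⊗ B → B ⊗ W`, `w ⊗ n ↦ w₍₋₁₎ n ⊗ w₍₀₎`. -/
def twist (c : W →ₗ[k] B ⊗[k] W) : W ⊗[k] B →ₗ[k] B ⊗[k] W :=
  (LinearMap.mul' k B).rTensor W ∘ₗ (TensorProduct.rightComm k B W B).toLinearMap ∘ₗ c.rTensor B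

lemma twist_tmul (c : W →ₗ[k] B ⊗[k] W) (w : W) (n : B) :
    twist c (w ⊗ₜ n) = (LinearMap.mulRight k n).rTensor W (c w) := by
  simp only [twist, LinearMap.comp_apply, LinearMap.rTensor_tmul]
  generalize c w = p
  induction p with
  | add x y hx hy => simp only [map_add, TensorProduct.add_tmul, hx, hy]
  | _ => simp

lemma twist_comul (t : B ⊗[k] B) : twist Coalgebra.comul t = galoisMap (regular k B) t := by
  induction t with
  | zero => simp
  | add x y hx hy => simp only [map_add, hx, hy]
  | tmul b n => rw [twist_tmul, galoisMap_tmul]; rfl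

lemma twist_rTensor {c : V →ₗ[k] B ⊗[k] V} {d : W →ₗ[k] B ⊗[k] W} (i : V →ₗ[k] W)
    (h : ∀ v, d (i v) = i.lTensor B (c v)) (t : V ⊗[k] B) :
    twist d (i.rTensor B t) = i.lTensor B (twist c t) := by
  induction t with
  | zero => simp
  | add x y hx hy => simp only [map_add, hx, hy]
  | tmul v n =>
    rw [LinearMap.rTensor_tmul, twist_tmul, twist_tmul, h]
    exact LinearMap.congr_fun ((LinearMap.rTensor_comp_lTensor ..).trans
      (LinearMap.lTensor_comp_rTensor ..).symm) _

/-- The map `(b ⊗ v) ⊗ (b' ⊗ w) ↦ ev(v ⊗ w) b b'`. -/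
def pairing (B : Type u) [Ring B] [Bialgebra k B] (ev : V ⊗[k] W →ₗ[k] k) :
    (B ⊗[k] V) ⊗[k] (B ⊗[k] W) →ₗ[k] B :=
  (TensorProduct.rid k B).toLinearMap ∘ₗ
    TensorProduct.map (LinearMap.mul' k B) ev ∘ₗ
      (TensorProduct.tensorTensorTensorComm k B V B W).toLinearMap

@[simp] lemma pairing_tmul (ev : V ⊗[k] W →ₗ[k] k) (b b' : B) (v : V) (w : W) :
    pairing B ev ((b ⊗ₜ v) ⊗ₜ (b' ⊗ₜ w)) = ev (v ⊗ₜ w) • (b * b') := by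
  simp [pairing]

variable {c : W →ₗ[k] B ⊗[k] W} {d : V →ₗ[k] B ⊗[k] V} {ev : V ⊗[k] W →ₗ[k] k} {t : W ⊗[k] V}
  (hs : ∀ w, ev.lTensor W (TensorProduct.assoc k W V W (t ⊗ₜ w)) = w ⊗ₜ 1)
include hs

lemma lTensor_eval (w : W) :
    (ev ∘ₗ (TensorProduct.mk k V W).flip w).lTensor W t = w ⊗ₜ 1 := by
  rw [← hs w]
  generalize t = p
  induction p with
  | add x y hx hy => simp only [map_add, TensorProduct.add_tmul, hx, hy]
  | _ => simp

lemma twist_injective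
    (hev : ∀ s, (1 : B) ⊗ₜ[k] ev s = ev.lTensor B (diagCoaction d c s)) :
    Function.Injective (twist c) := by
  let σ : B ⊗[k] W →ₗ[k] W ⊗[k] B := (LinearMap.lTensorHom W ∘ₗ LinearMap.lcomp k B d ∘ₗ
    (TensorProduct.mk k (B ⊗[k] V) (B ⊗[k] W)).flip.compr₂ (pairing B ev)).flip t
  have hσ : ∀ y, σ y = (pairing B ev ∘ₗ (TensorProduct.mk k _ _).flip y ∘ₗ d).lTensor W t :=
    fun _ => rfl
  refine Function.LeftInverse.injective (g := σ) fun x => ?_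
  induction x with
  | zero => simp
  | add x y hx hy => simp only [map_add, hx, hy]
  | tmul w n =>
    have e : pairing B ev ∘ₗ (TensorProduct.mk k _ _).flip (twist c (w ⊗ₜ n)) ∘ₗ d =
        LinearMap.toSpanSingleton k B n ∘ₗ ev ∘ₗ (TensorProduct.mk k V W).flip w := by
      ext v
      have e' : ∀ (p : B ⊗[k] V) (q : B ⊗[k] W),
          pairing B ev (p ⊗ₜ (LinearMap.mulRight k n).rTensor W q) =
          TensorProduct.rid k B ((LinearMap.mulRight k n).rTensor k (ev.lTensor B
            ((LinearMap.mul' k B).rTensor (V ⊗[k] W)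
              (TensorProduct.tensorTensorTensorComm k B V B W (p ⊗ₜ q))))) := by
        intro p q
        induction p with
        | zero => simp
        | add x y hx hy => simp only [map_add, TensorProduct.add_tmul, hx, hy]
        | tmul b v =>
          induction q with
          | add x y hx hy => simp only [map_add, TensorProduct.tmul_add, hx, hy]
          | _ => simp [mul_assoc]
      change pairing B ev (d v ⊗ₜ twist c (w ⊗ₜ n)) = ev (v ⊗ₜ w) • n
      rw [twist_tmul, e']
      refine (congrArg (fun z => TensorProduct.rid k B ((LinearMap.mulRight k n).rTensor k z))
        (hev (v ⊗ₜ w)).symm).trans ?_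
      simp
    rw [hσ, e, LinearMap.lTensor_comp_apply, lTensor_eval hs]
    simp

lemma twist_surjective (ht : diagCoaction c d t = 1 ⊗ₜ t) :
    Function.Surjective (twist c) := by
  rw [← LinearMap.range_eq_top, eq_top_iff, ← TensorProduct.span_tmul_eq_top, Submodule.span_le]
  rintro _ ⟨n, w, rfl⟩
  refine ⟨(pairing B ev ∘ₗ (TensorProduct.mk k _ _).flip (n ⊗ₜ w) ∘ₗ d).lTensor W t, ?_⟩
  have e : ∀ s : W ⊗[k] V,
      twist c ((pairing B ev ∘ₗ (TensorProduct.mk k _ _).flip (n ⊗ₜ w) ∘ₗ d).lTensor W s) =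
      TensorProduct.map (LinearMap.mulRight k n) ((TensorProduct.rid k W).toLinearMap ∘ₗ
        (ev ∘ₗ (TensorProduct.mk k V W).flip w).lTensor W) (diagCoaction c d s) := by
    intro s
    induction s with
    | zero => simp
    | add x y hx hy => simp only [map_add, hx, hy]
    | tmul w' v =>
      simp only [LinearMap.lTensor_tmul, twist_tmul, diagCoaction, LinearMap.comp_apply,
        TensorProduct.map_tmul, LinearMap.flip_apply, TensorProduct.mk_apply]
      generalize c w' = p
      generalize d v = q
      induction p with
      | zero => simp
      | add x y hx hy => simp only [map_add, TensorProduct.add_tmul, hx, hy]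
      | tmul b w' =>
        induction q with
        | zero => simp
        | add x y hx hy =>
          simp only [map_add, TensorProduct.tmul_add, TensorProduct.add_tmul, ← hx, ← hy]
          simp [mul_add, TensorProduct.add_tmul]
        | tmul b' v => simp [mul_assoc, TensorProduct.smul_tmul]
  rw [e, ht, TensorProduct.map_tmul, LinearMap.comp_apply, lTensor_eval hs]
  simp

end Twist

end

end HopfTrimod

namespace HopfTrimod

noncomputable section

section Rigid

variable {k : Type u} [Field k] {B : Type u} [Ring B] [Bialgebra k B]

lemma twist_bijective_of_exactPairing {W V : FinComod k B} (p : ExactPairing W V) :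
    Function.Bijective (twist W.obj.coact) := by
  let ev : V.obj.carrier ⊗[k] W.obj.carrier →ₗ[k] k := p.evaluation'.hom.lin
  let co : k →ₗ[k] W.obj.carrier ⊗[k] V.obj.carrier := p.coevaluation'.hom.lin
  have h : ev.lTensor W.obj.carrier ∘ₗ
      (TensorProduct.assoc k W.obj.carrier V.obj.carrier W.obj.carrier).toLinearMap ∘ₗ
        co.rTensor W.obj.carrier =
      (TensorProduct.rid k _).symm.toLinearMap ∘ₗ (TensorProduct.lid k _).toLinearMap :=
    congrArg (fun f => f.hom.lin) p.evaluation_coevaluation'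
  have hs : ∀ w, ev.lTensor W.obj.carrier
      (TensorProduct.assoc k W.obj.carrier V.obj.carrier W.obj.carrier (co 1 ⊗ₜ w)) = w ⊗ₜ 1 :=
    fun w => by simpa using LinearMap.congr_fun h (1 ⊗ₜ w)
  exact ⟨twist_injective hs p.evaluation'.hom.comm_apply,
    twist_surjective hs (p.coevaluation'.hom.comm_apply (1 : k))⟩

lemma twist_bijective_of_isLeftRigid (h : IsLeftRigid (FinComod k B)) (W : FinComod k B) :
    Function.Bijective (twist W.obj.coact) :=
  (h W).elim fun _ p => p.elim twist_bijective_of_exactPairing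

lemma hasTwistedAntipode_of_isLeftRigid (h : IsLeftRigid (FinComod k B)) :
    HasTwistedAntipode k B := by
  have key : ∀ U : Submodule k B, U.FG → ∃ (E : Submodule k B) (c : E →ₗ[k] B ⊗[k] E), U ≤ E ∧
      (∀ x, Coalgebra.comul (R := k) (E.subtype x) = E.subtype.lTensor B (c x)) ∧
        Function.Bijective (twist c) := by
    intro U hU
    obtain ⟨E, hE, hUE, hc⟩ :=
      exists_finiteDimensional_subcomodule (isLeftCoaction_comul k B) U hU
    exact ⟨E, restrictLeft E Coalgebra.comul hc, hUE,
      fun x => (restrictLeft_apply E Coalgebra.comul hc x).symm,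
      twist_bijective_of_isLeftRigid h ⟨⟨E, restrictLeft E Coalgebra.comul hc,
        (isLeftCoaction_comul k B).restrict E hc⟩, hE⟩⟩
  apply hasTwistedAntipode_of_galoisMap_bijective
  rw [show (galoisMap (regular k B) : B ⊗[k] B → B ⊗[k] B) = twist Coalgebra.comul from
    funext fun t => (twist_comul t).symm]
  constructor
  · rw [injective_iff_map_eq_zero]
    intro t ht
    obtain ⟨U, hU, hr⟩ :=
      TensorProduct.exists_finite_submodule_left_of_setFinite {t} (Set.finite_singleton t)
    obtain ⟨s, rfl⟩ := hr rfl
    obtain ⟨E, c, hUE, hc, hb⟩ := key U (Module.Finite.iff_fg.1 hU)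
    obtain ⟨s', hs'⟩ : ∃ s', E.subtype.rTensor B s' = U.subtype.rTensor B s :=
      ⟨(Submodule.inclusion hUE).rTensor B s, by rw [← LinearMap.rTensor_comp_apply]; rfl⟩
    rw [← hs', twist_rTensor E.subtype hc] at ht
    rw [← hs', hb.1 ((lTensor_inj B E.injective_subtype (ht.trans (map_zero _).symm)).trans
      (map_zero _).symm), map_zero]
  · intro t
    obtain ⟨U, hU, hr⟩ :=
      TensorProduct.exists_finite_submodule_right_of_setFinite {t} (Set.finite_singleton t)
    obtain ⟨E, c, hUE, hc, hb⟩ := key U (Module.Finite.iff_fg.1 hU)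
    obtain ⟨s, rfl⟩ := range_lTensor_mono hUE (hr rfl)
    obtain ⟨r, rfl⟩ := hb.2 s
    exact ⟨E.subtype.rTensor B r, twist_rTensor E.subtype hc r⟩

variable (k B) in
/-- Finite-dimensional comodules have left duals if and only if there is a twisted antipode. -/
theorem isLeftRigid_iff : IsLeftRigid (FinComod k B) ↔ HasTwistedAntipode k B :=
  ⟨hasTwistedAntipode_of_isLeftRigid, fun ⟨_, hS⟩ => isLeftRigid_of_isTwistedAntipode hS⟩

end Rigid

end

end HopfTrimod

theorem corollary9p9 {k : Type u} [Field k] (B : Type u) [Ring B] [Bialgebra k B] :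
    (HasTwistedAntipode k B ↔ (freeFunctor k B).IsEquivalence) ∧
    ∃ (hL : ∀ X, LaxModuleEnd.IsLexFinitary (LeftComod k B) ((cotensorLax k B).obj X))
      (hS : LaxModuleEnd.IsStrong (LeftComod k B) ≤ LaxModuleEnd.IsLexFinitary (LeftComod k B)),
      (∃ (_ : (ObjectProperty.lift _ (cotensorLax k B) hL).Monoidal)
          (_ : (evalUnit (LeftComod k B)).Monoidal)
          (_ : (unmopFunctor (LeftComod k B) ⋙ freeFunctor k B).Monoidal)
          (θ : ObjectProperty.ιOfLE hS ≅ evalUnit (LeftComod k B) ⋙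
            (unmopFunctor (LeftComod k B) ⋙ freeFunctor k B) ⋙
            ObjectProperty.lift _ (cotensorLax k B) hL),
        (ObjectProperty.lift _ (cotensorLax k B) hL).IsEquivalence ∧
        (evalUnit (LeftComod k B)).IsEquivalence ∧ NatTrans.IsMonoidal θ.hom) ∧
      ((ObjectProperty.ιOfLE hS).IsEquivalence ↔ IsLeftRigid (FinComod k B)) ∧
      (IsLeftRigid (FinComod k B) ↔ HasTwistedAntipode k B) := by
  refine ⟨hasTwistedAntipode_iff_isEquivalence k B, isLexFinitary_cotensorLax,
    isStrong_le_isLexFinitary k B, monoidal_factorization k B, ?_, isLeftRigid_iff k B⟩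
  rw [isEquivalence_ι_iff, ← hasTwistedAntipode_iff_isEquivalence]
  exact (isLeftRigid_iff k B).symm
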